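/- Let $\mathfrak g$ be a finite-dimensional semisimple complex Lie algebra of rank $r$. Choose a Cartan subalgebra $\mathfrak h$ (so $r=\dim\mathfrak h$), with root system $\Phi$, and a set $\Phi^+\subset\Phi$ of positive roots, and number the simple roots $\alpha_1,\dots,\alpha_r$ of $\Phi^+$. Let $n=|\Phi^+|$, let $\alpha^\vee$ be the coroot of $\alpha$, and let $\lambda_1,\dots,\lambda_r$ be the fundamental dominant weights, i.e. $(\lambda_i,\alpha_j^\vee)=\delta_{ij}$. For $\operatorname{Re}(s)>r$ and $x=(x_1,\dots,x_r)$ with $\operatorname{Re}(x_k)>0$ put $$\zeta_{\mathfrak g}(s,x)=\sum_{m\in\mathbb N_0^r}\ \prod_{\alpha\in\Phi^+}\Big(\sum_{k=1}^r(m_k+x_k)\lambda_k,\alpha^\vee\Big)^{-s},\qquad \mathcal Z_{\mathfrak g}(s,x)=\int_{(0,\infty)^r}\ \prod_{\alpha\in\Phi^+}\Big(\sum_{k=1}^r(t_k+x_k)\lambda_k,\alpha^\vee\Big)^{-s}dt,$$ with principal powers. The series and the integral converge absolutely there and are analytic functions of $(s,x)$. For every $x\in(0,\infty)^r$ both functions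 have meromorphic continuations in $s$ to $\mathbb C$, which are regular at $s=-\ell$ for every $\ell=0,1,2,\dots$. The special values $P_{\ell,\mathfrak g}(x)=\zeta_{\mathfrak g}(-\ell,x)$ and $Q_{\ell,\mathfrak g}(x)=\mathcal Z_{\mathfrak g}(-\ell,x)$ are polynomials in $x_1,\dots,x_r$ with rational coefficients and of total degree $n\ell+r$, $Q_{\ell,\mathfrak g}$ is homogeneous, and the following hold, where $B_m$ denotes the $m$-th Bernoulli polynomial. (0) If $\mathfrak g\cong\mathfrak{sl}_2$, then $r=1$, $P_{\ell,\mathfrak g}(x)=-B_{\ell+1}(x)/(\ell+1)$ and $Q_{\ell,\mathfrak g}(x)=-x^{\ell+1}/(\ell+1)$. (i) $P_{\ell,\mathfrak g}$ and $Q_{\ell,\mathfrak g}$ depend only on the isomorphism class of $\mathfrak g$, up to renumbering the variables: if $\mathfrak g'\cong\mathfrak g$, then, for all choices made for $\mathfrak g$ and for $\mathfrak g'$, both algebras have the same rank $r$ and there is a permutation $\rho$ of $\{1,\dots,r\}$ with $P_{\ell,\mathfrak g'}(x)=P_{\ell,\mathfrak g}(x^\rho)$ and $Q_{\ell,\mathfrak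 g'}(x)=Q_{\ell,\mathfrak g}(x^\rho)$, where $(x^\rho)_i=x_{\rho(i)}$. (ii) If $\mathfrak g_1,\mathfrak g_2$ are semisimple complex Lie algebras, then, after a suitable renumbering of the variables, $P_{\ell,\mathfrak g_1\times\mathfrak g_2}(x,y)=P_{\ell,\mathfrak g_1}(x)P_{\ell,\mathfrak g_2}(y)$ and $Q_{\ell,\mathfrak g_1\times\mathfrak g_2}(x,y)=Q_{\ell,\mathfrak g_1}(x)Q_{\ell,\mathfrak g_2}(y)$ (with the same renumbering). (iii) With $(\Delta_{e_k}P)(x)=P(x+e_k)-P(x)$, where $e_1,\dots,e_r$ is the standard basis of $\mathbb R^r$, $$\big(\Delta_{e_1}\circ\cdots\circ\Delta_{e_r}\big)(P_{\ell,\mathfrak g})(x)=\frac{\partial^r Q_{\ell,\mathfrak g}(x)}{\partial x_1\cdots\partial x_r}=(-1)^r\Big(\prod_{\alpha\in\Phi^+}\sum_{k=1}^r x_k(\lambda_k,\alpha^\vee)\Big)^{\ell}\in\mathbb Z[x].$$ (iv) $P_{\ell,\mathfrak g}(\mathbf 1-x)=(-1)^{n\ell+r}P_{\ell,\mathfrak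 g}(x)$, where $\mathbf 1=(1,\dots,1)$. (v) There are rational numbers $a_L$, for $L\in\mathbb N_0^r$ with $L_1+\cdots+L_r=n\ell+r$, such that $$Q_{\ell,\mathfrak g}(x)=\sum_L a_L\prod_{i=1}^r x_i^{L_i}\qquad\text{and}\qquad P_{\ell,\mathfrak g}(x)=\sum_L a_L\prod_{i=1}^r B_{L_i}(x_i).$$ (vi) $Q_{\ell,\mathfrak g}(x)=\int_{[0,1]^r}P_{\ell,\mathfrak g}(x+t)\,dt$. -/

import Mathlib

open scoped BigOperators
open MeasureTheory

namespace LieZeta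

noncomputable section

/-! ### Products of semisimple Lie algebras -/

/-- The product of two semisimple complex Lie algebras is semisimple. -/
instance instIsSemisimpleProd {g₁ g₂ : Type*}
    [LieRing g₁] [LieAlgebra ℂ g₁] [FiniteDimensional ℂ g₁] [LieAlgebra.IsSemisimple ℂ g₁]
    [LieRing g₂] [LieAlgebra ℂ g₂] [FiniteDimensional ℂ g₂] [LieAlgebra.IsSemisimple ℂ g₂] :
    LieAlgebra.IsSemisimple ℂ (g₁ × g₂) := by
  have key : LieAlgebra.HasTrivialRadical ℂ (g₁ × g₂) := by
    rw [LieAlgebra.hasTrivialRadical_iff_no_abelian_ideals]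
    intro I hI
    have h₁ : I.map (LieHom.fst ℂ g₁ g₂) = ⊥ := by
      refine (LieAlgebra.hasTrivialRadical_iff_no_abelian_ideals ℂ g₁).1 inferInstance _ ⟨?_⟩
      rintro ⟨x, hx⟩ ⟨y, hy⟩
      obtain ⟨⟨x', hx'⟩, rfl⟩ := LieIdeal.mem_map_of_surjective LieHom.fst_surjective hx
      obtain ⟨⟨y', hy'⟩, rfl⟩ := LieIdeal.mem_map_of_surjective LieHom.fst_surjective hy
      have h := congrArg (fun z : I => (z : g₁ × g₂).1) (hI.1 ⟨x', hx'⟩ ⟨y', hy'⟩)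
      exact Subtype.ext h
    have h₂ : I.map (LieHom.snd ℂ g₁ g₂) = ⊥ := by
      refine (LieAlgebra.hasTrivialRadical_iff_no_abelian_ideals ℂ g₂).1 inferInstance _ ⟨?_⟩
      rintro ⟨x, hx⟩ ⟨y, hy⟩
      obtain ⟨⟨x', hx'⟩, rfl⟩ := LieIdeal.mem_map_of_surjective LieHom.snd_surjective hx
      obtain ⟨⟨y', hy'⟩, rfl⟩ := LieIdeal.mem_map_of_surjective LieHom.snd_surjective hy
      have h := congrArg (fun z : I => (z : g₁ × g₂).2) (hI.1 ⟨x', hx'⟩ ⟨y', hy'⟩)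
      exact Subtype.ext h
    rw [LieSubmodule.eq_bot_iff]
    intro x hx
    have e₁ := LieIdeal.mem_map (f := LieHom.fst ℂ g₁ g₂) hx
    have e₂ := LieIdeal.mem_map (f := LieHom.snd ℂ g₁ g₂) hx
    rw [h₁, LieSubmodule.mem_bot] at e₁
    rw [h₂, LieSubmodule.mem_bot] at e₂
    exact Prod.ext e₁ e₂
  infer_instance

/-! ### Positive roots and fundamental dominant weights -/

/-- The choices that enter the definition of the zeta function of a semisimple complex Lie
algebra: a Cartan subalgebra, a base of the associated root system (equivalently a system of
positive roots), and a numbering of the `r` simple roots. -/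
structure NumberedBase (g : Type*) [LieRing g] [LieAlgebra ℂ g] [FiniteDimensional ℂ g]
    [LieAlgebra.IsSemisimple ℂ g] (r : ℕ) where
  cartan : LieSubalgebra ℂ g
  isCartan : cartan.IsCartanSubalgebra
  base : (LieAlgebra.IsKilling.rootSystem cartan).Base
  numbering : Fin r ≃ base.support

attribute [instance] NumberedBase.isCartan

section

variable {g : Type*} [LieRing g] [LieAlgebra ℂ g] [FiniteDimensional ℂ g]
  [LieAlgebra.IsSemisimple ℂ g] {r : ℕ} (D : NumberedBase g r)

/-- The choices exist: every semisimple complex Lie algebra has a numbered base. -/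
theorem NumberedBase.exists_nonempty (g : Type*) [LieRing g] [LieAlgebra ℂ g]
    [FiniteDimensional ℂ g] [LieAlgebra.IsSemisimple ℂ g] :
    ∃ r : ℕ, Nonempty (NumberedBase g r) := by
  obtain ⟨x, hx⟩ := LieAlgebra.exists_isCartanSubalgebra_engel ℂ g
  obtain ⟨b⟩ := (LieAlgebra.IsKilling.rootSystem (LieSubalgebra.engel ℂ x)).nonempty_base
  exact ⟨_, ⟨⟨_, hx, b, b.support.equivFin.symm⟩⟩⟩

open Classical in
/-- The set `Φ⁺` of positive roots. -/
def NumberedBase.positiveRoots : Finset D.cartan.root :=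
  Finset.univ.filter fun α => D.base.IsPos α

/-- The number `n` of positive roots. -/
def NumberedBase.numPos : ℕ := D.positiveRoots.card

/-- The fundamental dominant weight `λ_k`: these weights form the basis dual to the basis of
simple coroots. -/
def NumberedBase.fundamentalWeight (k : Fin r) : Module.Dual ℂ D.cartan :=
  D.base.toCoweightBasis.coord (D.numbering k)

/-- The linear form `x ↦ (x₁ λ₁ + ⋯ + x_r λ_r, α^∨)`. The coroot `α^∨` is an element of the Cartan
subalgebra, and the inner product of a weight with it is evaluation of the weight. -/
def NumberedBase.weightForm (x : Fin r → ℂ) (α : D.cartan.root) : ℂ :=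
  (∑ k, x k • D.fundamentalWeight k) ((LieAlgebra.IsKilling.rootSystem D.cartan).coroot α)

/-- `∏_{α ∈ Φ⁺} (x₁ λ₁ + ⋯ + x_r λ_r, α^∨)^{-s}`, with principal powers. -/
def NumberedBase.term (s : ℂ) (x : Fin r → ℂ) : ℂ :=
  ∏ α ∈ D.positiveRoots, D.weightForm x α ^ (-s)

/-! ### The zeta series and the zeta integral -/

/-- The Dirichlet series defining `ζ_g(s, x)`. -/
def NumberedBase.zetaSeries (s : ℂ) (x : Fin r → ℂ) : ℂ :=
  ∑' m : Fin r → ℕ, D.term s (fun k => (m k : ℂ) + x k)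

/-- The open orthant `(0, ∞)^r`. -/
def orthant (r : ℕ) : Set (Fin r → ℝ) := {t | ∀ k, 0 < t k}

/-- The integral defining `𝒵_g(s, x)`. -/
def NumberedBase.zetaIntegral (s : ℂ) (x : Fin r → ℂ) : ℂ :=
  ∫ t in orthant r, D.term s (fun k => (t k : ℂ) + x k)

/-- `F` is a meromorphic function on `ℂ`, normalized so that it is analytic at its removable
singularities and vanishes at its poles, which agrees with `f` on `Re s > σ`. -/
def IsMeromorphicContinuation (σ : ℝ) (f F : ℂ → ℂ) : Prop :=
  MeromorphicNFOn F Set.univ ∧ ∀ s : ℂ, σ < s.re → F s = f s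

/-- The meromorphic continuation is unique. -/
theorem IsMeromorphicContinuation.unique {σ : ℝ} {f F G : ℂ → ℂ}
    (hF : IsMeromorphicContinuation σ f F) (hG : IsMeromorphicContinuation σ f G) : F = G := by
  have hm : MeromorphicOn (F - G) Set.univ := hF.1.meromorphicOn.sub hG.1.meromorphicOn
  have h₀ : meromorphicOrderAt (F - G) ((σ + 1 : ℝ) : ℂ) = ⊤ := by
    rw [meromorphicOrderAt_eq_top_iff]
    refine Filter.Eventually.filter_mono nhdsWithin_le_nhds ?_
    have ho : IsOpen {s : ℂ | σ < s.re} := isOpen_lt continuous_const Complex.continuous_re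
    filter_upwards [ho.mem_nhds (show σ < (((σ + 1 : ℝ) : ℂ)).re by simp)] with s hs
    simp [hF.2 s hs, hG.2 s hs]
  funext s
  have h₁ : meromorphicOrderAt (F - G) s = ⊤ := by
    by_contra h
    exact hm.meromorphicOrderAt_ne_top_of_isPreconnected isPreconnected_univ (Set.mem_univ s)
      (Set.mem_univ _) h h₀
  rw [meromorphicOrderAt_eq_top_iff] at h₁
  have h₂ : F =ᶠ[nhdsWithin s {s}ᶜ] G := by
    filter_upwards [h₁] with z hz
    exact sub_eq_zero.1 hz
  exact (((hF.1 (Set.mem_univ s)).eventuallyEq_nhdsNE_iff_eventuallyEq_nhds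
    (hG.1 (Set.mem_univ s))).1 h₂).eq_of_nhds

open Classical in
/-- The meromorphic continuation to `ℂ` of `f`, given on `Re s > σ` (and `f` itself if there is no
continuation). -/
def meromorphicContinuation (σ : ℝ) (f : ℂ → ℂ) : ℂ → ℂ :=
  if h : ∃ F, IsMeromorphicContinuation σ f F then h.choose else f

/-- The meromorphically continued function `s ↦ ζ_g(s, x)`. -/
def NumberedBase.zeta (x : Fin r → ℝ) : ℂ → ℂ :=
  meromorphicContinuation r fun s => D.zetaSeries s (fun k => (x k : ℂ))

/-- The meromorphically continued function `s ↦ 𝒵_g(s, x)`. -/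
def NumberedBase.intZeta (x : Fin r → ℝ) : ℂ → ℂ :=
  meromorphicContinuation r fun s => D.zetaIntegral s (fun k => (x k : ℂ))

/-! ### The special values as polynomials -/

/-- The values of `f` on `(0, ∞)^r` are those of the polynomial `p` with rational coefficients. -/
def Represents (p : MvPolynomial (Fin r) ℚ) (f : (Fin r → ℝ) → ℂ) : Prop :=
  ∀ x ∈ orthant r, f x = MvPolynomial.aeval (fun k => (x k : ℂ)) p

/-- The representing polynomial is unique. -/
theorem Represents.unique {p q : MvPolynomial (Fin r) ℚ} {f : (Fin r → ℝ) → ℂ}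
    (hp : Represents p f) (hq : Represents q f) : p = q := by
  have h : ∀ x ∈ Set.pi Set.univ (fun _ : Fin r => Set.Ioi (0 : ℚ)),
      MvPolynomial.eval x p = MvPolynomial.eval x q := by
    intro x hx
    have hx' : (fun k => ((x k : ℚ) : ℝ)) ∈ orthant r := fun k => by
      have := hx k (Set.mem_univ k)
      simpa using this
    have e := (hp _ hx').symm.trans (hq _ hx')
    have c : ∀ u : MvPolynomial (Fin r) ℚ,
        MvPolynomial.aeval (fun k => (((x k : ℚ) : ℝ) : ℂ)) u =
          algebraMap ℚ ℂ (MvPolynomial.eval x u) := by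
      intro u
      have := MvPolynomial.aeval_algebraMap_apply ℂ x u
      simpa [Function.comp_def] using this
    rw [c, c] at e
    exact (algebraMap ℚ ℂ).injective e
  exact MvPolynomial.funext_set _ (fun _ => Set.Ioi_infinite 0) h

open Classical in
/-- The polynomial with rational coefficients whose values on `(0, ∞)^r` are those of `f`
(and `0` if there is none). -/
def polynomialOf (f : (Fin r → ℝ) → ℂ) : MvPolynomial (Fin r) ℚ :=
  if h : ∃ p, Represents p f then h.choose else 0

/-- `P_{ℓ,g}(x) = ζ_g(-ℓ, x)`, as a polynomial. -/
def NumberedBase.P (ℓ : ℕ) : MvPolynomial (Fin r) ℚ :=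
  polynomialOf fun x => D.zeta x (-ℓ)

/-- `Q_{ℓ,g}(x) = 𝒵_g(-ℓ, x)`, as a polynomial. -/
def NumberedBase.Q (ℓ : ℕ) : MvPolynomial (Fin r) ℚ :=
  polynomialOf fun x => D.intZeta x (-ℓ)

/-- The polynomial `(∏_{α ∈ Φ⁺} ∑_k x_k (λ_k, α^∨)) ^ ℓ`. -/
def NumberedBase.weylPower (ℓ : ℕ) : MvPolynomial (Fin r) ℂ :=
  (∏ α ∈ D.positiveRoots, ∑ k, MvPolynomial.X k * MvPolynomial.C
    (D.fundamentalWeight k ((LieAlgebra.IsKilling.rootSystem D.cartan).coroot α))) ^ ℓ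

end

/-- The difference operator `(Δ_{e_k} p)(x) = p(x + e_k) - p(x)`. -/
def diff {r : ℕ} (k : Fin r) (p : MvPolynomial (Fin r) ℚ) : MvPolynomial (Fin r) ℚ :=
  MvPolynomial.aeval (fun i => MvPolynomial.X i + MvPolynomial.C (Pi.single k (1 : ℚ) i)) p - p

/-- The composition `Δ_{e_1} ∘ ⋯ ∘ Δ_{e_r}`. -/
def diffAll {r : ℕ} (p : MvPolynomial (Fin r) ℚ) : MvPolynomial (Fin r) ℚ :=
  (List.finRange r).foldr diff p

/-- The composition `∂/∂x_1 ∘ ⋯ ∘ ∂/∂x_r`. -/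
def pderivAll {r : ℕ} (p : MvPolynomial (Fin r) ℚ) : MvPolynomial (Fin r) ℚ :=
  (List.finRange r).foldr (fun k q => MvPolynomial.pderiv k q) p

/-- The multi-indices `L ∈ ℕ₀^r` with `L_1 + ⋯ + L_r = d`. -/
def multiIndices (r d : ℕ) : Finset (Fin r → ℕ) := Finset.piAntidiag Finset.univ d

/-- `p(1 - x)`. -/
def reflect {r : ℕ} (p : MvPolynomial (Fin r) ℚ) : MvPolynomial (Fin r) ℚ :=
  MvPolynomial.aeval (fun i => 1 - MvPolynomial.X i) p

end

end LieZeta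

/-! Written in the basis of simple coroots, the positive coroots give `n` linear forms in `r`
variables with natural coefficients. None of them is zero, and all the coordinates occur among them
(`IsFormFamily`). The analysis uses only this. Lie theory enters in one other place: the matrix of
coefficients is an invariant of the algebra up to permutations of rows and columns.

The series and the integral are treated together. Each is an integral of the product of the forms
against a product measure whose one-dimensional Laplace transform, shifted by `x`, is `φ_x(T)/T`
with `φ_x` smooth and rapidly decreasing (`Kind`). For the sum `φ_x(T) = T e^{-xT}/(1 - e^{-T})`,
with `j`-th derivative `(-1)^j B_j(x)` at `0`. For the integral `φ_x(T) = e^{-xT}`, with `j`-th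
derivative `(-1)^j x^j`. The Gamma integral turns `Γ(s)^n ζ(s, x)` into the integral over `(0,∞)^n`
of `∏ t_i^{s-1} ∏_k φ_{x_k}(T_k)/T_k`, where `T_k = ∑_i c_{ik} t_i` (`Kind.gamma_mul_total`).

The poles `1/T_k` are resolved by cutting the orthant into the `n!` chambers given by an ordering of
the `t_i`. In the coordinates `t_i = u_0 ⋯ u_i` each `T_k` is a monomial times a polynomial that is
at least `1`. A chamber then contributes a Mellin integral over `(0,∞) × (0,1)^{n-1}` of a smooth
function that decreases rapidly in `u_0` (`Kind.gamma_mul_total_eq_sum`). Repeated integration by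
parts continues it (`mellinCube_continuation`). At `s = -ℓ` all `n` exponents reach nonpositive
integers together, so each variable gives one simple pole, and the zero of order `n` of `Γ(s)^{-n}`
cancels them. What is left is a partial derivative at `u = 0` of the smooth function.

That derivative is a rational combination of the products `∏_k φ_{x_k}^{(L_k)}(0)`. Homogeneity in
`u_0` leaves only the `L` with `|L| = nℓ + r` (`exists_rat_pds_chamberFun`). The rational
coefficients depend on the forms and not on `φ`. So `P` and `Q` have the same coefficients, on
products of Bernoulli polynomials and on monomials respectively. This is (v), and it yields
homogeneity, (iv), (vi) and the first equality of (iii) by the identities for a single Bernoulli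
polynomial. The second equality of (iii) holds because the iterated difference of the series
telescopes to `(-1)^r` times its term at `m = 0`, an entire function of `s` (`aeval_diffAll_eq`). As
its value is not zero, the degrees are exact.

For (i) and (ii), Cartan subalgebras are conjugate under automorphisms
(`exists_lieEquiv_map_cartan`), coroots are recognised by `sl₂`-triples (`mem_range_coroot_iff`) and
are thus carried along by isomorphisms, and simple systems are conjugate under reflections
(`exists_linearEquiv_map_simple`). For (0), dimension three forces one simple and one positive root,
and (iii) determines the only coefficient. -/

namespace LieZeta

set_option autoImplicit false

/-! ### Osgood's lemma for functions with values in a Banach space. -/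

section Osgood

open Complex Metric

variable {F : Type*} [NormedAddCommGroup F] [NormedSpace ℂ F] [CompleteSpace F]

/-- A continuous function with values in `C(K, F)` that is pointwise holomorphic is holomorphic. -/
theorem differentiableAt_continuousMap_of_eval {K : Type*} [TopologicalSpace K] [CompactSpace K]
    {g : ℂ → C(K, F)} {a : ℂ} {ρ : ℝ} (hρ : 0 < ρ) (hg : ContinuousOn g (closedBall a ρ))
    (hd : ∀ ζ : K, ∀ t ∈ ball a ρ, DifferentiableAt ℂ (fun t => g t ζ) t) :
    DifferentiableAt ℂ g a := by
  lift ρ to NNReal using hρ.le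
  have hint : CircleIntegrable g a ρ :=
    (hg.mono sphere_subset_closedBall).circleIntegrable ρ.2
  -- The Cauchy integral of a continuous function is analytic without further hypotheses. Evaluating
  -- at each point of `K` shows that here it reproduces `g`.
  have hps := hasFPowerSeriesOn_cauchy_integral hint (by exact_mod_cast hρ)
  have han : AnalyticAt ℂ _ a := hps.analyticAt
  refine (han.congr ?_).differentiableAt
  filter_upwards [ball_mem_nhds a hρ] with w hw
  ext ζ
  have hint2 : CircleIntegrable (fun z => (z - w)⁻¹ • g z) a ρ := by
    refine ContinuousOn.circleIntegrable ρ.2 ?_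
    refine ContinuousOn.smul (ContinuousOn.inv₀ (f := fun z => z - w) (by fun_prop) ?_)
      (hg.mono sphere_subset_closedBall)
    intro z hz h
    rw [sub_eq_zero] at h
    subst h
    rw [mem_ball] at hw
    rw [mem_sphere] at hz
    exact hw.ne hz
  have key := two_pi_I_inv_smul_circleIntegral_sub_inv_smul_of_differentiable_on_off_countable
    (f := fun t => g t ζ) (c := a) (R := ρ) Set.countable_empty hw
    ((ContinuousEvalConst.continuous_eval_const ζ).comp_continuousOn hg) (fun x hx => hd ζ x hx.1)
  simp only [ContinuousMap.smul_apply]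
  rw [← key]
  congr 1
  unfold circleIntegral
  have := (ContinuousMap.evalCLM ℂ ζ : C(K, F) →L[ℂ] F).intervalIntegral_comp_comm
    (hint2.out)
  simp only [ContinuousMap.evalCLM_apply, ContinuousMap.smul_apply] at this
  exact this.symm

variable {E : Type*} [NormedAddCommGroup E] [NormedSpace ℂ E]

/-- `f` is continuous on `U` and holomorphic along every complex line. -/
def LineHolomorphicOn (f : E → F) (U : Set E) : Prop :=
  ContinuousOn f U ∧ ∀ z ∈ U, ∀ v : E, DifferentiableAt ℂ (fun t : ℂ => f (z + t • v)) 0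

/-- Osgood's lemma holds for functions on `E`. -/
def Osgood (E : Type*) [NormedAddCommGroup E] [NormedSpace ℂ E] : Prop :=
  ∀ (F : Type) [NormedAddCommGroup F] [NormedSpace ℂ F] [CompleteSpace F] (f : E → F)
    (U : Set E), IsOpen U → LineHolomorphicOn f U → ∀ a ∈ U, AnalyticAt ℂ f a

theorem LineHolomorphicOn.differentiableAt {F : Type*} [NormedAddCommGroup F]
    [NormedSpace ℂ F] {f : E → F} {U : Set E} (hf : LineHolomorphicOn f U)
    {z v : E} {t : ℂ} (h : z + t • v ∈ U) :
    DifferentiableAt ℂ (fun t : ℂ => f (z + t • v)) t := by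
  have h1 := hf.2 _ h v
  have h2 : DifferentiableAt ℂ (fun u : ℂ => f (z + t • v + u • v)) (t - t) := by simpa using h1
  have h3 := DifferentiableAt.comp (f := fun u : ℂ => u - t) t h2 (by fun_prop)
  refine h3.congr_of_eventuallyEq (Filter.Eventually.of_forall fun u => ?_)
  simp only [Function.comp]
  congr 1
  rw [add_assoc, ← add_smul]
  congr 2
  ring

/-- The Cauchy kernel `(k, g) ↦ (2πi)⁻¹ ∮ k(ζ) g(ζ) dζ` as a continuous bilinear map. -/
theorem exists_cauchy_bilinear {F : Type*} [NormedAddCommGroup F] [NormedSpace ℂ F] (a : ℂ) {ρ : ℝ} (hρ : 0 < ρ) :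
    ∃ B : C(sphere a ρ, ℂ) →L[ℂ] C(sphere a ρ, F) →L[ℂ] F,
      ∀ (k : C(sphere a ρ, ℂ)) (g : C(sphere a ρ, F)) (k' : ℂ → ℂ) (g' : ℂ → F),
        (∀ ζ : sphere a ρ, k ζ = k' ζ) → (∀ ζ : sphere a ρ, g ζ = g' ζ) →
        B k g = (2 * Real.pi * I : ℂ)⁻¹ • ∮ z in C(a, ρ), k' z • g' z := by
  have : CompactSpace (sphere a ρ) := isCompact_iff_compactSpace.1 (isCompact_sphere a ρ)
  let γ : ℝ → sphere a ρ := fun θ => ⟨circleMap a ρ θ, circleMap_mem_sphere a hρ.le θ⟩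
  have hγ : Continuous γ := (continuous_circleMap a ρ).subtype_mk _
  have hdc : Continuous (fun θ => deriv (circleMap a ρ) θ) := by
    simp only [deriv_circleMap]; fun_prop
  have hcont : ∀ (k : C(sphere a ρ, ℂ)) (g : C(sphere a ρ, F)),
      Continuous (fun θ => deriv (circleMap a ρ) θ • (k (γ θ) • g (γ θ))) := by
    intro k g
    exact hdc.smul ((k.continuous.comp hγ).smul (g.continuous.comp hγ))
  refine ⟨LinearMap.mkContinuous₂ (LinearMap.mk₂ ℂ (fun k g => (2 * Real.pi * I : ℂ)⁻¹ •
    ∫ θ in (0:ℝ)..2 * Real.pi, deriv (circleMap a ρ) θ • (k (γ θ) • g (γ θ))) ?_ ?_ ?_ ?_)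
    (‖(2 * Real.pi * I : ℂ)⁻¹‖ * (|ρ| * (2 * Real.pi))) ?_, ?_⟩
  · intro k₁ k₂ g
    rw [← smul_add, ← intervalIntegral.integral_add ((hcont _ _).intervalIntegrable _ _)
      ((hcont _ _).intervalIntegrable _ _)]
    simp [add_smul, smul_add]
  · intro c k g
    rw [smul_comm c, ← intervalIntegral.integral_smul c]
    congr 1
    refine intervalIntegral.integral_congr fun θ _ => ?_
    simp only [ContinuousMap.smul_apply, smul_eq_mul, smul_smul]
    congr 1; ring
  · intro k g₁ g₂
    rw [← smul_add, ← intervalIntegral.integral_add ((hcont _ _).intervalIntegrable _ _)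
      ((hcont _ _).intervalIntegrable _ _)]
    simp [smul_add]
  · intro c k g
    rw [smul_comm c, ← intervalIntegral.integral_smul c]
    congr 1
    refine intervalIntegral.integral_congr fun θ _ => ?_
    simp only [ContinuousMap.smul_apply, smul_smul]
    congr 1; ring
  · intro k g
    simp only [LinearMap.mk₂_apply, norm_smul]
    rw [mul_assoc (_ * _), mul_assoc ‖_‖]
    refine mul_le_mul_of_nonneg_left ?_ (norm_nonneg _)
    have := intervalIntegral.norm_integral_le_of_norm_le_const (a := (0:ℝ)) (b := 2 * Real.pi)
      (f := fun θ => deriv (circleMap a ρ) θ • (k (γ θ) • g (γ θ))) (C := |ρ| * (‖k‖ * ‖g‖)) ?_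
    · refine this.trans (le_of_eq ?_)
      rw [sub_zero, abs_of_pos Real.two_pi_pos]; ring
    · intro θ _
      rw [norm_smul, norm_smul]
      have h1 : ‖deriv (circleMap a ρ) θ‖ = |ρ| := by simp [deriv_circleMap]
      rw [h1]
      gcongr
      · exact k.norm_coe_le_norm _
      · exact g.norm_coe_le_norm _
  · intro k g k' g' hk hg
    simp only [LinearMap.mkContinuous₂_apply, LinearMap.mk₂_apply, circleIntegral]
    congr 2; ext θ
    rw [hk, hg]

/-- Restricting the first variable to a circle turns `f` into a function of the second variable with
values in the continuous functions on that circle; the hypothesis on `E` applies to it, because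
`Osgood` ranges over all Banach targets. Cauchy's formula in the first variable recovers `f` as a
continuous bilinear expression in the Cauchy kernel and this function, both analytic. -/
theorem osgood_prod (h : Osgood E) : Osgood (ℂ × E) := by
  intro F _ _ _ f U hU hf p hp
  obtain ⟨a, b⟩ := p
  obtain ⟨ρ, hρ, hsub⟩ := Metric.nhds_basis_closedBall.mem_iff.1 (hU.mem_nhds hp)
  rw [← closedBall_prod_same] at hsub
  have : CompactSpace (sphere a ρ) := isCompact_iff_compactSpace.1 (isCompact_sphere a ρ)
  have hcont : ContinuousOn f (closedBall a ρ ×ˢ closedBall b ρ) := hf.1.mono hsub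
  classical
  let G : C(ball b ρ, C(sphere a ρ, F)) := ContinuousMap.curry
    ⟨fun q => f (q.2, q.1), by
      refine hcont.comp_continuous (by fun_prop) ?_
      intro q
      exact ⟨sphere_subset_closedBall q.2.2, ball_subset_closedBall q.1.2⟩⟩
  let Φ : E → C(sphere a ρ, F) := fun w => if hw : w ∈ ball b ρ then G ⟨w, hw⟩ else 0
  have hΦ : ∀ w ∈ ball b ρ, ∀ ζ, Φ w ζ = f (ζ, w) := by
    intro w hw ζ
    simp only [Φ, dif_pos hw]
    rfl
  have hΦc : ContinuousOn Φ (ball b ρ) := by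
    rw [continuousOn_iff_continuous_domRestrict]
    have : (ball b ρ).domRestrict Φ = G := by
      ext1 ⟨w, hw⟩
      exact dif_pos hw
    rw [this]
    exact G.continuous
  have hΦan : AnalyticAt ℂ Φ b := by
    refine h _ Φ (ball b ρ) isOpen_ball ⟨hΦc, ?_⟩ b (mem_ball_self hρ)
    intro z hz v
    have hopen : IsOpen {t : ℂ | z + t • v ∈ ball b ρ} :=
      isOpen_ball.preimage (by fun_prop)
    obtain ⟨δ, hδ, hδs⟩ := Metric.nhds_basis_closedBall.mem_iff.1
      (hopen.mem_nhds (x := 0) (by simpa using hz))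
    refine differentiableAt_continuousMap_of_eval hδ
      (hΦc.comp (by fun_prop) (fun t ht => hδs ht)) ?_
    intro ζ t ht
    have hmem : ∀ t ∈ ball (0:ℂ) δ, z + t • v ∈ ball b ρ := fun t ht =>
      hδs (ball_subset_closedBall ht)
    have h1 := hf.differentiableAt (z := ((ζ : ℂ), z)) (v := ((0 : ℂ), v)) (t := t)
      (hsub ⟨by simpa using ζ.2.le, by simpa using ball_subset_closedBall (hmem t ht)⟩)
    refine h1.congr_of_eventuallyEq ?_
    filter_upwards [isOpen_ball.mem_nhds ht] with u hu
    simp [hΦ _ (hmem u hu)]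
  obtain ⟨B, hB⟩ := exists_cauchy_bilinear (F := F) a hρ
  let idK : C(sphere a ρ, ℂ) := ⟨fun ζ => (ζ : ℂ), continuous_subtype_val⟩
  -- The Cauchy kernel as an inverse in the Banach algebra of functions on the circle, where
  -- inversion is analytic at units.
  let κ : ℂ → C(sphere a ρ, ℂ) := fun z => Ring.inverse (idK - algebraMap ℂ _ z)
  have hunit : ∀ z ∈ ball a ρ, ∃ u : (C(sphere a ρ, ℂ))ˣ, (u : C(sphere a ρ, ℂ)) =
      idK - algebraMap ℂ _ z ∧ ∀ ζ, (↑u⁻¹ : C(sphere a ρ, ℂ)) ζ = ((ζ : ℂ) - z)⁻¹ := by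
    intro z hz
    have hne : ∀ ζ : sphere a ρ, (ζ : ℂ) - z ≠ 0 := by
      intro ζ h0
      rw [sub_eq_zero] at h0
      have := ζ.2
      rw [mem_sphere, h0] at this
      exact (mem_ball.1 hz).ne this
    let v : C(sphere a ρ, ℂ) := ⟨fun ζ => ((ζ : ℂ) - z)⁻¹,
      Continuous.inv₀ (by fun_prop) hne⟩
    refine ⟨⟨idK - algebraMap ℂ _ z, v, ?_, ?_⟩, rfl, fun ζ => rfl⟩
    · ext ζ
      simp [idK, v, mul_inv_cancel₀ (hne ζ)]
    · ext ζ
      simp [idK, v, inv_mul_cancel₀ (hne ζ)]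
  have hκ : AnalyticAt ℂ κ a := by
    obtain ⟨u, hu, -⟩ := hunit a (mem_ball_self hρ)
    have h1 : AnalyticAt ℂ (fun z : ℂ => idK - algebraMap ℂ C(sphere a ρ, ℂ) z) a := by
      refine analyticAt_const.sub ?_
      exact (Algebra.linearMap ℂ C(sphere a ρ, ℂ)).toContinuousLinearMap.analyticAt a
    have h2 := analyticAt_inverse (𝕜 := ℂ) u
    rw [hu] at h2
    exact AnalyticAt.comp (f := fun z : ℂ => idK - algebraMap ℂ C(sphere a ρ, ℂ) z) h2 h1
  have hfin : AnalyticAt ℂ (fun p : ℂ × E => B (κ p.1) (Φ p.2)) (a, b) := by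
    have h1 := B.analyticAt_bilinear (κ a, Φ b)
    have h2 : AnalyticAt ℂ (fun p : ℂ × E => (κ p.1, Φ p.2)) (a, b) :=
      (hκ.fun_comp (x := (a, b)) analyticAt_fst).prod (hΦan.fun_comp (x := (a, b)) analyticAt_snd)
    exact AnalyticAt.fun_comp (g := fun p : C(sphere a ρ, ℂ) × C(sphere a ρ, F) => B p.1 p.2)
      (f := fun p : ℂ × E => (κ p.1, Φ p.2)) h1 h2
  refine hfin.congr ?_
  filter_upwards [(isOpen_ball.prod isOpen_ball).mem_nhds
    (show (a, b) ∈ ball a ρ ×ˢ ball b ρ from ⟨mem_ball_self hρ, mem_ball_self hρ⟩)] with q hq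
  obtain ⟨z, w⟩ := q
  obtain ⟨hz, hw⟩ := hq
  simp only at hz hw ⊢
  rw [hB (κ z) (Φ w) (fun ζ => (ζ - z)⁻¹) (fun ζ => f (ζ, w))]
  · refine two_pi_I_inv_smul_circleIntegral_sub_inv_smul_of_differentiable_on_off_countable
      (f := fun ζ => f (ζ, w)) Set.countable_empty hz ?_ ?_
    · exact hcont.comp (by fun_prop) (fun t ht => ⟨ht, ball_subset_closedBall hw⟩)
    · intro t ht
      have := hf.differentiableAt (z := ((0 : ℂ), w)) (v := ((1 : ℂ), (0 : E))) (t := t)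
        (hsub ⟨by simpa using ball_subset_closedBall ht.1, by simpa using ball_subset_closedBall hw⟩)
      simpa using this
  · intro ζ
    obtain ⟨u, hu, hu2⟩ := hunit z hz
    simp only [κ]
    rw [← hu, Ring.inverse_unit, hu2]
  · exact fun ζ => hΦ w hw ζ

theorem Osgood.of_equiv {E' : Type*} [NormedAddCommGroup E'] [NormedSpace ℂ E']
    (h : Osgood E) (e : E' ≃L[ℂ] E) : Osgood E' := by
  intro F _ _ _ f U hU hf a ha
  have h1 : AnalyticAt ℂ (f ∘ e.symm) (e a) := by
    refine h F _ (e.symm ⁻¹' U) (hU.preimage e.symm.continuous) ⟨?_, ?_⟩ _ (by simpa using ha)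
    · exact hf.1.comp e.symm.continuous.continuousOn (fun _ h => h)
    · intro z hz v
      simpa using hf.2 (e.symm z) hz (e.symm v)
  have h2 := h1.fun_comp ((e : E' →L[ℂ] E).analyticAt a)
  simpa [Function.comp_def] using h2

theorem osgood_pi (N : ℕ) : Osgood (Fin N → ℂ) := by
  induction N with
  | zero =>
    intro F _ _ _ f U _ _ a _
    have : f = fun _ => f a := by ext z; rw [Subsingleton.elim z a]
    rw [this]; exact analyticAt_const
  | succ N ih =>
    exact (osgood_prod ih).of_equiv (Fin.consEquivL ℂ (fun _ : Fin (N+1) => ℂ)).symm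

end Osgood

end LieZeta

namespace LieZeta

set_option autoImplicit false

/-! ### Holomorphic dependence of dominated integrals on parameters. -/

section ParametricIntegral

open Complex Metric Filter Topology

variable {τ : Type*} [MeasurableSpace τ] {μ : Measure τ}

/-- Integrals of dominated families of holomorphic functions are holomorphic. -/
theorem differentiableAt_integral_of_dominated {f : ℂ → τ → ℂ} {a : ℂ} {δ : ℝ} (hδ : 0 < δ)
    (hmeas : ∀ z ∈ ball a δ, AEStronglyMeasurable (f z) μ)
    (hd : ∀ᵐ t ∂μ, ∀ z ∈ ball a δ, DifferentiableAt ℂ (fun z => f z t) z)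
    {bound : τ → ℝ} (hb : Integrable bound μ)
    (hdom : ∀ᵐ t ∂μ, ∀ z ∈ ball a δ, ‖f z t‖ ≤ bound t) :
    DifferentiableAt ℂ (fun z => ∫ t, f z t ∂μ) a := by
  have hδ2 : 0 < δ / 2 := by linarith
  -- Since `1/2 + 1/3 < 1`, Cauchy's estimate on circles of radius `δ/3` bounds the derivative on
  -- the half ball by `bound / (δ/3)`.
  have hsub : ∀ z ∈ ball a (δ / 2), closedBall z (δ / 3) ⊆ ball a δ := by
    intro z hz w hw
    rw [mem_ball] at *
    rw [mem_closedBall] at hw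
    linarith [dist_triangle w z a]
  have hself : a ∈ ball a δ := mem_ball_self hδ
  refine (hasDerivAt_integral_of_dominated_loc_of_deriv_le (𝕜 := ℂ) (F := f) (μ := μ)
    (F' := fun z t => deriv (fun z => f z t) z) (x₀ := a) (s := ball a (δ / 2))
    (bound := fun t => bound t / (δ / 3)) (ball_mem_nhds a hδ2) ?_ ?_ ?_ ?_ ?_ ?_).2.differentiableAt
  · filter_upwards [ball_mem_nhds a hδ] with z hz using hmeas z hz
  · exact hb.mono' (hmeas a hself) (hdom.mono fun t ht => ht a hself)
  -- The derivative is measurable in the parameter as a limit of difference quotients along this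
  -- null sequence.
  · let u : ℕ → ℂ := fun n => ((δ / 2 / (n + 1) : ℝ) : ℂ)
    have hu0 : Tendsto u atTop (𝓝 0) := by
      have h1 : Tendsto (fun n : ℕ => δ / 2 / ((n : ℝ) + 1)) atTop (𝓝 0) :=
        tendsto_const_div_atTop_nhds_zero_nat (δ / 2) |>.comp (tendsto_add_atTop_nat 1) |>.congr
          (fun n => by simp)
      have := (continuous_ofReal.tendsto 0).comp h1
      simpa [u, Function.comp_def] using this
    have hune : ∀ n, u n ≠ 0 := by
      intro n
      have : (0 : ℝ) < δ / 2 / (n + 1) := by positivity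
      exact ofReal_ne_zero.2 this.ne'
    have hub : ∀ n, a + u n ∈ ball a δ := by
      intro n
      rw [mem_ball, dist_eq, add_sub_cancel_left]
      have h0 : (0 : ℝ) < δ / 2 / (n + 1) := by positivity
      have : ‖u n‖ = δ / 2 / (n + 1) := by
        simp only [u]; rw [norm_real, Real.norm_of_nonneg h0.le]
      rw [this]
      have h2 : δ / 2 / ((n : ℝ) + 1) ≤ δ / 2 := div_le_self hδ2.le (by linarith [n.cast_nonneg (α := ℝ)])
      linarith
    refine aestronglyMeasurable_of_tendsto_ae atTop
      (f := fun n t => (u n)⁻¹ • (f (a + u n) t - f a t)) ?_ ?_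
    · intro n
      exact ((hmeas _ (hub n)).sub (hmeas _ hself)).const_smul (u n)⁻¹
    · filter_upwards [hd] with t ht
      have h1 := (ht a hself).hasDerivAt.tendsto_slope_zero
      exact h1.comp (tendsto_nhdsWithin_iff.2 ⟨hu0, Eventually.of_forall hune⟩)
  · filter_upwards [hd, hdom] with t ht hbt z hz
    refine norm_deriv_le_of_forall_mem_sphere_norm_le (by positivity) ?_ ?_
    · refine DifferentiableOn.diffContOnCl ?_
      rw [closure_ball _ (by positivity)]
      exact fun w hw => (ht w (hsub z hz hw)).differentiableWithinAt
    · exact fun w hw => hbt w (hsub z hz (sphere_subset_closedBall hw))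
  · exact hb.div_const _
  · filter_upwards [hd] with t ht z hz
    exact (ht z (ball_subset_ball (by linarith) hz)).hasDerivAt

/-- Integrals of locally dominated families of functions analytic in several variables are
analytic. -/
theorem analyticAt_integral_of_dominated {r : ℕ} {f : ℂ × (Fin r → ℂ) → τ → ℂ}
    {U : Set (ℂ × (Fin r → ℂ))} (hU : IsOpen U)
    (hmeas : ∀ z ∈ U, AEStronglyMeasurable (f z) μ)
    (hd : ∀ t, ∀ z ∈ U, DifferentiableAt ℂ (fun z => f z t) z)
    (hdom : ∀ z₀ ∈ U, ∃ V ∈ 𝓝 z₀, ∃ bound : τ → ℝ, Integrable bound μ ∧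
      ∀ t, ∀ z ∈ V, ‖f z t‖ ≤ bound t) {z₀ : ℂ × (Fin r → ℂ)} (hz₀ : z₀ ∈ U) :
    AnalyticAt ℂ (fun z => ∫ t, f z t ∂μ) z₀ := by
  refine osgood_prod (osgood_pi r) ℂ _ U hU ⟨?_, ?_⟩ z₀ hz₀
  · intro z hz
    obtain ⟨V, hV, bound, hb, hbd⟩ := hdom z hz
    refine (continuousAt_of_dominated (bound := bound) ?_ ?_ hb ?_).continuousWithinAt
    · filter_upwards [hU.mem_nhds hz] with w hw using hmeas w hw
    · filter_upwards [hV] with w hw using Eventually.of_forall fun t => hbd t w hw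
    · exact Eventually.of_forall fun t => (hd t z hz).continuousAt
  · intro z hz v
    obtain ⟨V, hV, bound, hb, hbd⟩ := hdom z hz
    have hc : ContinuousAt (fun t : ℂ => z + t • v) 0 := by fun_prop
    have hmem : {t : ℂ | z + t • v ∈ V ∩ U} ∈ 𝓝 (0 : ℂ) := by
      refine hc.preimage_mem_nhds ?_
      simpa using Filter.inter_mem hV (hU.mem_nhds hz)
    obtain ⟨δ, hδ, hδs⟩ := Metric.mem_nhds_iff.1 hmem
    refine differentiableAt_integral_of_dominated (f := fun u t => f (z + u • v) t) hδ
      (fun w hw => hmeas _ (hδs hw).2) (Eventually.of_forall fun t w hw => ?_) hb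
      (Eventually.of_forall fun t w hw => hbd t _ (hδs hw).1)
    exact DifferentiableAt.comp (f := fun u : ℂ => z + u • v) (g := fun z => f z t) w
      (hd t _ (hδs hw).2) (by fun_prop)

end ParametricIntegral

/-! ### Products of powers of linear forms and their size. -/

section Forms

variable {n r : ℕ}

/-- The linear form with the coefficients `a`. -/
def linForm (a : Fin r → ℕ) (x : Fin r → ℂ) : ℂ := ∑ k, (a k : ℂ) * x k

/-- The product of the powers with exponent `-s` of the linear forms with coefficients `c i`. -/
noncomputable def formTerm (c : Fin n → Fin r → ℕ) (s : ℂ) (x : Fin r → ℂ) : ℂ :=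
  ∏ i, linForm (c i) x ^ (-s)

/-- A family of nonzero linear forms which contains the coordinate functions. -/
structure IsFormFamily (c : Fin n → Fin r → ℕ) : Prop where
  simple : ∀ k, ∃ i, c i = Pi.single k 1
  ne_zero : ∀ i, c i ≠ 0

theorem le_re_linForm {a : Fin r → ℕ} {k : Fin r} (hk : a k ≠ 0) {x : Fin r → ℂ}
    (hx : ∀ k, 0 ≤ (x k).re) : (x k).re ≤ (linForm a x).re := by
  have h1 : (linForm a x).re = ∑ k, (a k : ℝ) * (x k).re := by simp [linForm]
  rw [h1]
  have h2 : (a k : ℝ) * (x k).re ≤ ∑ k, (a k : ℝ) * (x k).re :=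
    Finset.single_le_sum (f := fun k => (a k : ℝ) * (x k).re)
      (fun j _ => mul_nonneg (Nat.cast_nonneg _) (hx j)) (Finset.mem_univ k)
  have h3 : (1 : ℝ) ≤ a k := by exact_mod_cast Nat.one_le_iff_ne_zero.2 hk
  nlinarith [hx k]

theorem linForm_single (k : Fin r) (x : Fin r → ℂ) : linForm (Pi.single k 1) x = x k := by
  unfold linForm
  rw [Finset.sum_eq_single k]
  · simp
  · intro j _ hj; simp [Pi.single_eq_of_ne hj]
  · simp

theorem IsFormFamily.exists_ne_zero {c : Fin n → Fin r → ℕ} (hc : IsFormFamily c) (i : Fin n) :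
    ∃ k, c i k ≠ 0 := Function.ne_iff.1 (hc.ne_zero i)

/-- The modulus is `|w|^{-Re s}` times the exponential of `arg w · Im s`, and the argument is at
most `π`. Since `ε ≤ 1 ≤ ρ`, each factor of `ερ` can be given its own worst exponent, which makes
the bound uniform in `s`. -/
theorem norm_cpow_neg_le {w s : ℂ} {ρ σ₁ σ₂ M ε : ℝ} (hε : 0 < ε) (hε1 : ε ≤ 1) (hρ : 1 ≤ ρ)
    (hw : ε * ρ ≤ w.re) (hσ₁ : 0 ≤ σ₁) (h₁ : σ₁ ≤ s.re) (h₂ : s.re ≤ σ₂) (hM : |s.im| ≤ M) :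
    ‖w ^ (-s)‖ ≤ ε ^ (-σ₂) * Real.exp (Real.pi * M) * ρ ^ (-σ₁) := by
  have hρ0 : 0 < ρ := by linarith
  have hwre : 0 < w.re := lt_of_lt_of_le (by positivity) hw
  have hw0 : w ≠ 0 := by intro h; simp [h] at hwre
  rw [Complex.norm_cpow_of_ne_zero hw0]
  have hn : ε * ρ ≤ ‖w‖ := hw.trans (Complex.re_le_norm w)
  have e1 : ‖w‖ ^ (-s).re ≤ ε ^ (-σ₂) * ρ ^ (-σ₁) := by
    rw [Complex.neg_re]
    calc ‖w‖ ^ (-s.re) ≤ (ε * ρ) ^ (-s.re) :=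
          Real.rpow_le_rpow_of_nonpos (by positivity) hn (by linarith)
      _ = ε ^ (-s.re) * ρ ^ (-s.re) := Real.mul_rpow hε.le hρ0.le
      _ ≤ ε ^ (-σ₂) * ρ ^ (-σ₁) := by
          gcongr ?_ * ?_
          · exact Real.rpow_le_rpow_of_exponent_ge hε hε1 (by linarith)
          · exact Real.rpow_le_rpow_of_exponent_le hρ (by linarith)
  have e2 : 1 / Real.exp (w.arg * (-s).im) ≤ Real.exp (Real.pi * M) := by
    rw [one_div, ← Real.exp_neg, Real.exp_le_exp, Complex.neg_im]
    have h3 : w.arg * s.im ≤ |w.arg| * |s.im| := by rw [← abs_mul]; exact le_abs_self _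
    have h4 : |w.arg| * |s.im| ≤ Real.pi * M :=
      mul_le_mul (Complex.abs_arg_le_pi w) hM (abs_nonneg _) Real.pi_pos.le
    linarith
  rw [div_eq_mul_one_div]
  calc ‖w‖ ^ (-s).re * (1 / Real.exp (w.arg * (-s).im))
      ≤ (ε ^ (-σ₂) * ρ ^ (-σ₁)) * Real.exp (Real.pi * M) := by gcongr
    _ = _ := by ring

/-- All the decay comes from the coordinate forms, one for each variable. The remaining forms are
only bounded below by `ε`. The bound is a product over the variables, hence integrable as soon as
the exponent exceeds `1`. -/
theorem norm_formTerm_le {c : Fin n → Fin r → ℕ} (hc : IsFormFamily c) {s : ℂ} {y : Fin r → ℝ}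
    {x : Fin r → ℂ} {σ₁ σ₂ M ε : ℝ} (hy : ∀ k, 0 ≤ y k) (hε : 0 < ε) (hε1 : ε ≤ 1)
    (hx : ∀ k, ε ≤ (x k).re) (hσ₁ : 0 ≤ σ₁) (h₁ : σ₁ ≤ s.re) (h₂ : s.re ≤ σ₂) (hM : |s.im| ≤ M) :
    ‖formTerm c s (fun k => (y k : ℂ) + x k)‖ ≤
      (ε ^ (-σ₂) * Real.exp (Real.pi * M)) ^ n * ∏ k, (1 + y k / ε) ^ (-σ₁) := by
  choose p hp using hc.simple
  have hpinj : Function.Injective p := by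
    intro k l hkl
    have h1 := hp k
    rw [hkl, hp l] at h1
    by_contra hne
    have := congrFun h1 k
    simp [Pi.single_eq_of_ne hne] at this
  have hre : ∀ k, ε * (1 + y k / ε) ≤ ((y k : ℂ) + x k).re := by
    intro k
    rw [mul_add, mul_div_cancel₀ _ hε.ne']
    simp
    linarith [hx k]
  have hre0 : ∀ k, 0 ≤ ((y k : ℂ) + x k).re := by
    intro k; simp; linarith [hx k, hy k]
  unfold formTerm
  rw [norm_prod]
  have h1 : ∀ i ∈ Finset.univ, ‖linForm (c i) (fun k => (y k : ℂ) + x k) ^ (-s)‖ ≤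
      (ε ^ (-σ₂) * Real.exp (Real.pi * M)) * ∏ k with p k = i, (1 + y k / ε) ^ (-σ₁) := by
    intro i _
    by_cases hi : ∃ k, p k = i
    · obtain ⟨k, rfl⟩ := hi
      have : (Finset.univ.filter fun k' => p k' = p k) = {k} := by
        ext k'; simp [hpinj.eq_iff]
      rw [this, Finset.prod_singleton, hp k, linForm_single]
      refine norm_cpow_neg_le hε hε1 ?_ (hre k) hσ₁ h₁ h₂ hM
      have := hy k
      have : 0 ≤ y k / ε := by positivity
      linarith
    · have : (Finset.univ.filter fun k' => p k' = i) = ∅ := by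
        ext k'; simp only [Finset.mem_filter, Finset.mem_univ, true_and, Finset.notMem_empty,
          iff_false]; exact fun h => hi ⟨k', h⟩
      rw [this, Finset.prod_empty]
      obtain ⟨k, hk⟩ := hc.exists_ne_zero i
      have h2 := norm_cpow_neg_le (w := linForm (c i) (fun k => (y k : ℂ) + x k)) (ρ := 1)
        hε hε1 le_rfl ?_ hσ₁ h₁ h₂ hM
      · simpa using h2
      · refine le_trans ?_ (le_re_linForm hk hre0)
        simp; linarith [hx k, hy k]
  refine (Finset.prod_le_prod (fun _ _ => norm_nonneg _) h1).trans (le_of_eq ?_)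
  rw [Finset.prod_mul_distrib, Finset.prod_const, Finset.card_univ, Fintype.card_fin,
    Finset.prod_fiberwise]

theorem differentiableAt_formTerm {c : Fin n → Fin r → ℕ} (hc : IsFormFamily c) (y : Fin r → ℝ)
    (hy : ∀ k, 0 ≤ y k) {z : ℂ × (Fin r → ℂ)} (hz : ∀ k, 0 < (z.2 k).re) :
    DifferentiableAt ℂ (fun z : ℂ × (Fin r → ℂ) =>
      formTerm c z.1 (fun k => (y k : ℂ) + z.2 k)) z := by
  unfold formTerm
  classical
  refine (HasFDerivAt.finsetProd fun i _ => DifferentiableAt.hasFDerivAt ?_).differentiableAt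
  refine DifferentiableAt.cpow ?_ (by fun_prop) ?_
  · unfold linForm
    fun_prop
  · left
    obtain ⟨k, hk⟩ := hc.exists_ne_zero i
    refine lt_of_lt_of_le ?_ (le_re_linForm hk ?_)
    · simp; linarith [hz k, hy k]
    · intro k; simp; linarith [hz k, hy k]

end Forms

end LieZeta

namespace LieZeta

set_option autoImplicit false

/-! ### Sum and integral as one object, and its Mellin transform. -/

section Kind

open Complex Metric Filter Topology
open scoped ContDiff

/-- A measure on the half-line, given through a parametrization, together with its Laplace
transform `φ(T)/T`; covers both summation over `ℕ` and integration over `(0, ∞)`. -/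
structure Kind (Y : Type) [MeasurableSpace Y] where
  ν : Measure Y
  sigmaFinite : SigmaFinite ν
  emb : Y → ℝ
  measurable_emb : Measurable emb
  emb_nonneg : ∀ y, 0 ≤ emb y
  integrable_rpow : ∀ ε : ℝ, 0 < ε → ∀ σ : ℝ, 1 < σ →
    Integrable (fun y => (1 + emb y / ε) ^ (-σ)) ν
  φ : ℝ → ℝ → ℝ
  laplace : ∀ x : ℝ, 0 < x → ∀ T : ℝ, 0 < T →
    ∫ y, Real.exp (-((emb y + x) * T)) ∂ν = φ x T / T
  contDiff : ∀ x : ℝ, 0 < x → ContDiff ℝ ∞ (φ x)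
  decay : ∀ x : ℝ, 0 < x → ∀ j M : ℕ, ∃ C : ℝ, ∀ T : ℝ, 0 ≤ T →
    (1 + T) ^ M * |iteratedDeriv j (φ x) T| ≤ C
  β : ℕ → Polynomial ℚ
  taylor : ∀ x : ℝ, 0 < x → ∀ j, iteratedDeriv j (φ x) 0 = Polynomial.aeval x (β j)

attribute [instance] Kind.sigmaFinite

variable {Y : Type} [MeasurableSpace Y] (κ : Kind Y) {n r : ℕ} {c : Fin n → Fin r → ℕ}

/-- The integral of `formTerm` over the shifted orthant with respect to the product measure. -/
noncomputable def Kind.total (c : Fin n → Fin r → ℕ) (s : ℂ) (x : Fin r → ℂ) : ℂ :=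
  ∫ y : Fin r → Y, formTerm c s (fun k => (κ.emb (y k) : ℂ) + x k) ∂Measure.pi fun _ => κ.ν

theorem Kind.measurable_formTerm (c : Fin n → Fin r → ℕ) (s : ℂ) (x : Fin r → ℂ) :
    Measurable fun y : Fin r → Y => formTerm c s (fun k => (κ.emb (y k) : ℂ) + x k) := by
  unfold formTerm linForm
  have h := κ.measurable_emb
  refine Finset.measurable_prod _ fun i _ => ?_
  refine Measurable.pow_const ?_ _
  refine Finset.measurable_sum _ fun k _ => ?_
  refine Measurable.const_mul (Measurable.add_const ?_ _) _
  exact measurable_ofReal.comp (h.comp (measurable_pi_apply k))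

theorem Kind.integrable_bound {ε σ : ℝ} (hε : 0 < ε) (hσ : 1 < σ) (C : ℝ) :
    Integrable (fun y : Fin r → Y => C * ∏ k, (1 + κ.emb (y k) / ε) ^ (-σ))
      (Measure.pi fun _ => κ.ν) := by
  refine Integrable.const_mul ?_ C
  exact Integrable.fintype_prod (f := fun _ y => (1 + κ.emb y / ε) ^ (-σ))
    fun _ => κ.integrable_rpow ε hε σ hσ

theorem exists_pos_le_re (x : Fin r → ℂ) (hx : ∀ k, 0 < (x k).re) :
    ∃ ε : ℝ, 0 < ε ∧ ε ≤ 1 ∧ ∀ k, ε ≤ (x k).re := by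
  have h : ∀ S : Finset (Fin r), ∃ ε : ℝ, 0 < ε ∧ ε ≤ 1 ∧ ∀ k ∈ S, ε ≤ (x k).re := by
    intro S
    induction S using Finset.induction_on with
    | empty => exact ⟨1, one_pos, le_rfl, by simp⟩
    | insert a S _ ih =>
      obtain ⟨ε, h0, h1, h2⟩ := ih
      refine ⟨min ε (x a).re, lt_min h0 (hx a), (min_le_left _ _).trans h1, ?_⟩
      intro k hk
      rcases Finset.mem_insert.1 hk with rfl | hk
      · exact min_le_right _ _
      · exact (min_le_left _ _).trans (h2 k hk)
  obtain ⟨ε, h0, h1, h2⟩ := h Finset.univ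
  exact ⟨ε, h0, h1, fun k => h2 k (Finset.mem_univ k)⟩

theorem Kind.integrable_formTerm (hc : IsFormFamily c) {s : ℂ} (hs : 1 < s.re) {x : Fin r → ℂ}
    (hx : ∀ k, 0 < (x k).re) :
    Integrable (fun y : Fin r → Y => formTerm c s (fun k => (κ.emb (y k) : ℂ) + x k))
      (Measure.pi fun _ => κ.ν) := by
  obtain ⟨ε, h0, h1, h2⟩ := exists_pos_le_re x hx
  refine (κ.integrable_bound (ε := ε) h0 hs ((ε ^ (-s.re) * Real.exp (Real.pi * |s.im|)) ^ n)).mono'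
    (κ.measurable_formTerm c s x).aestronglyMeasurable (Eventually.of_forall fun y => ?_)
  exact norm_formTerm_le hc (fun k => κ.emb_nonneg _) h0 h1 h2 (by linarith) le_rfl le_rfl le_rfl

theorem isOpen_convergence_region (r : ℕ) (σ : ℝ) :
    IsOpen {z : ℂ × (Fin r → ℂ) | σ < z.1.re ∧ ∀ k, 0 < (z.2 k).re} := by
  have h1 : IsOpen {z : ℂ × (Fin r → ℂ) | σ < z.1.re} :=
    isOpen_lt continuous_const (by fun_prop)
  have h2 : IsOpen {z : ℂ × (Fin r → ℂ) | ∀ k, 0 < (z.2 k).re} := by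
    rw [Set.ofPred_forall]
    exact isOpen_iInter_of_finite fun k => isOpen_lt continuous_const (by fun_prop)
  exact h1.inter h2

theorem Kind.exists_integrable_bound (hc : IsFormFamily c) {w : ℂ × (Fin r → ℂ)}
    (hw : 1 < w.1.re) (hw' : ∀ k, 0 < (w.2 k).re) :
    ∃ V ∈ 𝓝 w, ∃ bound : (Fin r → Y) → ℝ, Integrable bound (Measure.pi fun _ => κ.ν) ∧
      ∀ y, ∀ z ∈ V, ‖formTerm c z.1 (fun k => (κ.emb (y k) : ℂ) + z.2 k)‖ ≤ bound y := by
  obtain ⟨ε, h0, h1, h2⟩ := exists_pos_le_re w.2 hw'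
  obtain ⟨σ, hσ, hσ'⟩ := exists_between hw
  have e1 : ∀ᶠ z : ℂ × (Fin r → ℂ) in 𝓝 w, σ < z.1.re :=
    (isOpen_lt continuous_const (by fun_prop)).mem_nhds hσ'
  have e2 : ∀ᶠ z : ℂ × (Fin r → ℂ) in 𝓝 w, z.1.re < w.1.re + 1 :=
    (isOpen_lt (by fun_prop) continuous_const).mem_nhds (by simp)
  have e3 : ∀ᶠ z : ℂ × (Fin r → ℂ) in 𝓝 w, |z.1.im| < |w.1.im| + 1 :=
    (isOpen_lt (continuous_abs.comp (continuous_im.comp continuous_fst))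
      continuous_const).mem_nhds (by simp)
  have e4 : ∀ᶠ z : ℂ × (Fin r → ℂ) in 𝓝 w, ∀ k, ε / 2 < (z.2 k).re := by
    refine eventually_all.2 fun k => ?_
    exact (isOpen_lt continuous_const (by fun_prop)).mem_nhds
      (show ε / 2 < (w.2 k).re by linarith [h2 k])
  refine ⟨_, e1.and (e2.and (e3.and e4)), _, κ.integrable_bound (ε := ε / 2) (by linarith) hσ
    (((ε / 2) ^ (-(w.1.re + 1)) * Real.exp (Real.pi * (|w.1.im| + 1))) ^ n), ?_⟩
  rintro y z ⟨g1, g2, g3, g4⟩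
  exact norm_formTerm_le (y := fun k => κ.emb (y k)) hc (fun k => κ.emb_nonneg _) (by linarith)
    (by linarith) (fun k => (g4 k).le) (by linarith) g1.le g2.le g3.le

theorem Kind.analyticAt_total (hc : IsFormFamily c) {z : ℂ × (Fin r → ℂ)} (hz : 1 < z.1.re)
    (hz' : ∀ k, 0 < (z.2 k).re) :
    AnalyticAt ℂ (fun z : ℂ × (Fin r → ℂ) => κ.total c z.1 z.2) z := by
  have key : ∀ z₀ ∈ {z : ℂ × (Fin r → ℂ) | 1 < z.1.re ∧ ∀ k, 0 < (z.2 k).re},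
    ∃ V ∈ 𝓝 z₀, ∃ bound : (Fin r → Y) → ℝ, Integrable bound (Measure.pi fun _ => κ.ν) ∧
      ∀ y, ∀ z ∈ V, ‖formTerm c z.1 (fun k => (κ.emb (y k) : ℂ) + z.2 k)‖ ≤ bound y :=
    fun w hw => κ.exists_integrable_bound hc hw.1 hw.2
  have h := analyticAt_integral_of_dominated
    (f := fun (z : ℂ × (Fin r → ℂ)) (y : Fin r → Y) =>
      formTerm c z.1 (fun k => (κ.emb (y k) : ℂ) + z.2 k))
    (isOpen_convergence_region r 1)
    (fun z _ => (κ.measurable_formTerm c z.1 z.2).aestronglyMeasurable)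
    (fun y z hz => differentiableAt_formTerm hc (fun k => κ.emb (y k))
      (fun k => κ.emb_nonneg _) hz.2) key (z₀ := z) ⟨hz, hz'⟩
  exact h

/-- The linear form `T_k(t) = ∑ i, c i k * t i` dual to the forms `c i`. -/
def dualForm (c : Fin n → Fin r → ℕ) (k : Fin r) (t : Fin n → ℝ) : ℝ := ∑ i, (c i k : ℝ) * t i

/-- The Laplace side of the integral `Kind.total`. -/
noncomputable def Kind.mellinIntegrand (c : Fin n → Fin r → ℕ) (s : ℂ) (x : Fin r → ℝ)
    (t : Fin n → ℝ) : ℂ :=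
  (∏ i, (t i : ℂ) ^ (s - 1)) *
    ((∏ k, κ.φ (x k) (dualForm c k t) / dualForm c k t : ℝ) : ℂ)

/-- Lebesgue measure on `(0, ∞)^n`. -/
noncomputable def posMeasure (n : ℕ) : Measure (Fin n → ℝ) :=
  Measure.pi fun _ => volume.restrict (Set.Ioi 0)

instance (n : ℕ) : SigmaFinite (posMeasure n) := by
  unfold posMeasure; infer_instance

theorem ae_posMeasure_pos (n : ℕ) : ∀ᵐ t ∂posMeasure n, ∀ i, 0 < t i := by
  unfold posMeasure
  rw [ae_all_iff]
  intro i
  have h : ∀ᵐ u ∂(volume.restrict (Set.Ioi (0:ℝ))), 0 < u :=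
    ae_restrict_mem measurableSet_Ioi
  exact (Measure.quasiMeasurePreserving_eval (μ := fun _ : Fin n =>
    (volume.restrict (Set.Ioi (0:ℝ)))) i).ae h

theorem dualForm_pos (hc : IsFormFamily c) (k : Fin r) {t : Fin n → ℝ} (ht : ∀ i, 0 < t i) :
    0 < dualForm c k t := by
  obtain ⟨i, hi⟩ := hc.simple k
  refine Finset.sum_pos' (fun j _ => mul_nonneg (Nat.cast_nonneg _) (ht j).le) ⟨i, Finset.mem_univ i, ?_⟩
  simp [hi, ht i]

theorem sum_mul_linForm (c : Fin n → Fin r → ℕ) (t : Fin n → ℝ) (y : Fin r → ℝ) :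
    ∑ i, t i * (∑ k, (c i k : ℝ) * y k) = ∑ k, y k * dualForm c k t := by
  simp only [dualForm, Finset.mul_sum]
  rw [Finset.sum_comm]
  refine Finset.sum_congr rfl fun k _ => Finset.sum_congr rfl fun i _ => by ring

theorem linForm_ofReal (a : Fin r → ℕ) (y : Fin r → ℝ) :
    linForm a (fun k => (y k : ℂ)) = ((∑ k, (a k : ℝ) * y k : ℝ) : ℂ) := by
  simp [linForm]

theorem linForm_real_pos (hc : IsFormFamily c) (i : Fin n) {y : Fin r → ℝ} (hy : ∀ k, 0 < y k) :
    0 < ∑ k, (c i k : ℝ) * y k := by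
  obtain ⟨k, hk⟩ := hc.exists_ne_zero i
  refine Finset.sum_pos' (fun j _ => mul_nonneg (Nat.cast_nonneg _) (hy j).le) ⟨k, Finset.mem_univ k, ?_⟩
  have : 0 < (c i k : ℝ) := by exact_mod_cast Nat.pos_of_ne_zero hk
  exact mul_pos this (hy k)

theorem integral_gamma_prod (s : ℂ) (hs : 0 < s.re) (L : Fin n → ℝ) (hL : ∀ i, 0 < L i) :
    ∫ t : Fin n → ℝ, ∏ i, ((t i : ℂ) ^ (s - 1) * Complex.exp (-(L i * t i))) ∂posMeasure n =
      Complex.Gamma s ^ n * ∏ i, (L i : ℂ) ^ (-s) := by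
  unfold posMeasure
  rw [integral_fintype_prod_eq_prod (f := fun i (t : ℝ) => (t : ℂ) ^ (s - 1) *
    Complex.exp (-(L i * t)))]
  have h : ∀ i, ∫ t : ℝ in Set.Ioi 0, (t : ℂ) ^ (s - 1) * Complex.exp (-(L i * t)) =
      Complex.Gamma s * (L i : ℂ) ^ (-s) := by
    intro i
    rw [Complex.integral_cpow_mul_exp_neg_mul_Ioi hs (hL i), mul_comm]
    congr 1
    rw [one_div, Complex.inv_cpow, Complex.cpow_neg]
    rw [Complex.arg_ofReal_of_nonneg (hL i).le]
    exact Real.pi_pos.ne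
  simp_rw [h]
  rw [Finset.prod_mul_distrib, Finset.prod_const, Finset.card_univ, Fintype.card_fin]

theorem integrable_gamma_prod (s : ℂ) (hs : 0 < s.re) (L : Fin n → ℝ) (hL : ∀ i, 0 < L i) :
    Integrable (fun t : Fin n → ℝ => ∏ i, ((t i : ℂ) ^ (s - 1) * Complex.exp (-(L i * t i))))
      (posMeasure n) := by
  refine Integrable.fintype_prod (f := fun i (t : ℝ) => (t : ℂ) ^ (s - 1) *
    Complex.exp (-(L i * t))) fun i => ?_
  -- A function that is not integrable has integral `0` by convention, whereas the Gamma integral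
  -- does not vanish.
  by_contra h
  have h1 := Complex.integral_cpow_mul_exp_neg_mul_Ioi hs (r := L i) (hL i)
  rw [integral_undef h] at h1
  have h2 : (1 / (L i : ℂ)) ^ s ≠ 0 := by
    rw [Ne, Complex.cpow_eq_zero_iff]
    have : (L i : ℂ) ≠ 0 := by exact_mod_cast (hL i).ne'
    simp [this]
  exact (mul_ne_zero h2 (Complex.Gamma_ne_zero_of_re_pos hs)) h1.symm

theorem Kind.laplace_prod (hc : IsFormFamily c) {x : Fin r → ℝ} (hx : ∀ k, 0 < x k)
    {t : Fin n → ℝ} (ht : ∀ i, 0 < t i) :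
    ∫ y : Fin r → Y, Real.exp (-∑ k, (κ.emb (y k) + x k) * dualForm c k t)
      ∂(Measure.pi fun _ => κ.ν) = ∏ k, κ.φ (x k) (dualForm c k t) / dualForm c k t := by
  simp_rw [← Finset.sum_neg_distrib, Real.exp_sum]
  rw [integral_fintype_prod_eq_prod
    (f := fun k y => Real.exp (-((κ.emb y + x k) * dualForm c k t)))]
  exact Finset.prod_congr rfl fun k _ => κ.laplace _ (hx k) _ (dualForm_pos hc k ht)

/-- By Tonelli: integrating the norm over `t` is again a Gamma integral, at the real exponent `Re
s`, and what is left in `y` is the already integrable product of forms. -/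
theorem Kind.integrable_joint (hc : IsFormFamily c) {s : ℂ} (hs : 1 < s.re) {x : Fin r → ℝ}
    (hx : ∀ k, 0 < x k) :
    Integrable (fun p : (Fin r → Y) × (Fin n → ℝ) =>
      ∏ i, ((p.2 i : ℂ) ^ (s - 1) *
        Complex.exp (-((∑ k, (c i k : ℝ) * (κ.emb (p.1 k) + x k) : ℝ) * p.2 i))))
      ((Measure.pi fun _ => κ.ν).prod (posMeasure n)) := by
  have hpos : ∀ (y : Fin r → Y) (i : Fin n), 0 < ∑ k, (c i k : ℝ) * (κ.emb (y k) + x k) :=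
    fun y i => linForm_real_pos hc i fun k => by linarith [hx k, κ.emb_nonneg (y k)]
  have hs0 : 0 < s.re := by linarith
  have hmeas : Measurable (fun p : (Fin r → Y) × (Fin n → ℝ) =>
      ∏ i, ((p.2 i : ℂ) ^ (s - 1) *
        Complex.exp (-((∑ k, (c i k : ℝ) * (κ.emb (p.1 k) + x k) : ℝ) * p.2 i)))) := by
    have h1 := κ.measurable_emb
    have h2 : ∀ i : Fin n, Measurable (fun p : (Fin r → Y) × (Fin n → ℝ) => p.2 i) := fun i =>
      (measurable_pi_apply i).comp measurable_snd
    have h3 : ∀ k : Fin r, Measurable (fun p : (Fin r → Y) × (Fin n → ℝ) => κ.emb (p.1 k)) :=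
      fun k => h1.comp ((measurable_pi_apply k).comp measurable_fst)
    refine Finset.measurable_prod _ fun i _ => ?_
    refine Measurable.mul ((measurable_ofReal.comp (h2 i)).pow_const _) ?_
    refine measurable_exp.comp (Measurable.neg (Measurable.mul ?_ (measurable_ofReal.comp (h2 i))))
    refine measurable_ofReal.comp (Finset.measurable_sum _ fun k _ => ?_)
    exact ((h3 k).add_const _).const_mul _
  rw [integrable_prod_iff hmeas.aestronglyMeasurable]
  refine ⟨Eventually.of_forall fun y => integrable_gamma_prod s hs0
    (fun i => ∑ k, (c i k : ℝ) * (κ.emb (y k) + x k)) (hpos y), ?_⟩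
  have key : ∀ y : Fin r → Y, ∫ t : Fin n → ℝ, ‖∏ i, ((t i : ℂ) ^ (s - 1) *
        Complex.exp (-((∑ k, (c i k : ℝ) * (κ.emb (y k) + x k) : ℝ) * t i)))‖ ∂posMeasure n =
      ‖(Complex.Gamma s.re ^ n * formTerm c s.re (fun k => (κ.emb (y k) : ℂ) + x k))‖ := by
    intro y
    have e1 : formTerm c s.re (fun k => (κ.emb (y k) : ℂ) + x k) =
        ∏ i, ((∑ k, (c i k : ℝ) * (κ.emb (y k) + x k) : ℝ) : ℂ) ^ (-(s.re : ℂ)) := by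
      unfold formTerm
      refine Finset.prod_congr rfl fun i _ => ?_
      congr 1
      rw [← linForm_ofReal]
      congr 1; ext k; push_cast; rfl
    rw [e1, ← integral_gamma_prod (s.re : ℂ) (by simpa using hs0) _ (hpos y)]
    have e2 : ∀ᵐ t ∂posMeasure n, (∏ i, ((t i : ℂ) ^ ((s.re : ℂ) - 1) *
        Complex.exp (-((∑ k, (c i k : ℝ) * (κ.emb (y k) + x k) : ℝ) * t i)))) =
        ((‖∏ i, ((t i : ℂ) ^ (s - 1) *
        Complex.exp (-((∑ k, (c i k : ℝ) * (κ.emb (y k) + x k) : ℝ) * t i)))‖ : ℝ) : ℂ) := by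
      filter_upwards [ae_posMeasure_pos n] with t ht
      rw [norm_prod, ofReal_prod]
      refine Finset.prod_congr rfl fun i _ => ?_
      rw [norm_mul, norm_cpow_eq_rpow_re_of_pos (ht i), norm_exp, ofReal_mul, ofReal_exp,
        ofReal_cpow (ht i).le]
      congr 2
      · simp
      · rw [← ofReal_mul, ← ofReal_neg, ofReal_re]
    rw [integral_congr_ae e2, integral_complex_ofReal, norm_real, Real.norm_of_nonneg]
    exact integral_nonneg fun t => norm_nonneg _
  simp_rw [key]
  exact ((κ.integrable_formTerm hc (s := (s.re : ℂ)) (by simpa using hs) (x := fun k => (x k : ℂ))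
    (by simpa using hx)).const_mul _).norm

theorem Kind.joint_eq {s : ℂ} {x : Fin r → ℝ} (y : Fin r → Y)
    (t : Fin n → ℝ) :
    ∏ i, ((t i : ℂ) ^ (s - 1) *
        Complex.exp (-((∑ k, (c i k : ℝ) * (κ.emb (y k) + x k) : ℝ) * t i))) =
      (∏ i, (t i : ℂ) ^ (s - 1)) *
        (Real.exp (-∑ k, (κ.emb (y k) + x k) * dualForm c k t) : ℂ) := by
  rw [Finset.prod_mul_distrib, ← Complex.exp_sum, ← sum_mul_linForm c t (fun k => κ.emb (y k) + x k)]
  congr 2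
  push_cast
  rw [Finset.sum_neg_distrib]
  exact congrArg (fun w => cexp (-w)) (Finset.sum_congr rfl fun i _ => mul_comm _ _)

theorem Kind.integral_joint {s : ℂ} (hc : IsFormFamily c) {x : Fin r → ℝ}
    (hx : ∀ k, 0 < x k) {t : Fin n → ℝ} (ht : ∀ i, 0 < t i) :
    ∫ y : Fin r → Y, ∏ i, ((t i : ℂ) ^ (s - 1) *
        Complex.exp (-((∑ k, (c i k : ℝ) * (κ.emb (y k) + x k) : ℝ) * t i)))
        ∂(Measure.pi fun _ => κ.ν) = κ.mellinIntegrand c s x t := by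
  simp_rw [κ.joint_eq]
  rw [integral_const_mul, integral_complex_ofReal, κ.laplace_prod hc hx ht]
  rfl

theorem Kind.integrable_mellinIntegrand (hc : IsFormFamily c) {s : ℂ} (hs : 1 < s.re)
    {x : Fin r → ℝ} (hx : ∀ k, 0 < x k) :
    Integrable (κ.mellinIntegrand c s x) (posMeasure n) := by
  refine ((κ.integrable_joint hc hs hx).integral_prod_right).congr ?_
  filter_upwards [ae_posMeasure_pos n] with t ht
  exact κ.integral_joint hc hx ht

/-- The Mellin transform representation of `Kind.total`. -/
theorem Kind.gamma_mul_total (hc : IsFormFamily c) {s : ℂ} (hs : 1 < s.re)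
    {x : Fin r → ℝ} (hx : ∀ k, 0 < x k) :
    Complex.Gamma s ^ n * κ.total c s (fun k => (x k : ℂ)) =
      ∫ t, κ.mellinIntegrand c s x t ∂posMeasure n := by
  have hs0 : 0 < s.re := by linarith
  have h1 : κ.mellinIntegrand c s x =ᵐ[posMeasure n] fun t => ∫ y : Fin r → Y,
      ∏ i, ((t i : ℂ) ^ (s - 1) *
        Complex.exp (-((∑ k, (c i k : ℝ) * (κ.emb (y k) + x k) : ℝ) * t i)))
        ∂(Measure.pi fun _ => κ.ν) := by
    filter_upwards [ae_posMeasure_pos n] with t ht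
    exact (κ.integral_joint hc hx ht).symm
  rw [integral_congr_ae h1, ← integral_integral_swap (κ.integrable_joint hc hs hx),
    Kind.total, ← integral_const_mul]
  congr 1
  ext y
  rw [integral_gamma_prod s hs0]
  · congr 1
    unfold formTerm
    refine Finset.prod_congr rfl fun i _ => ?_
    congr 1
    rw [← linForm_ofReal]
    congr 1; ext k; push_cast; rfl
  · exact fun i => linForm_real_pos hc i fun k => by linarith [hx k, κ.emb_nonneg (y k)]

end Kind

end LieZeta

namespace LieZeta

set_option autoImplicit false

/-! ### Calculus of iterated partial derivatives and classes stable under them. -/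

section PartialDerivatives

open Filter Topology
open scoped ContDiff

variable {N : ℕ}

/-- The `i`-th partial derivative. -/
noncomputable def pd (i : Fin N) (ψ : (Fin N → ℝ) → ℝ) : (Fin N → ℝ) → ℝ :=
  fun u => fderiv ℝ ψ u (Pi.single i 1)

/-- Iterated partial derivatives along a list of indices. -/
noncomputable def pds : List (Fin N) → ((Fin N → ℝ) → ℝ) → (Fin N → ℝ) → ℝ
  | [], ψ => ψ
  | i :: l, ψ => pds l (pd i ψ)

theorem pds_append (l l' : List (Fin N)) (ψ : (Fin N → ℝ) → ℝ) :
    pds (l ++ l') ψ = pds l' (pds l ψ) := by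
  induction l generalizing ψ with
  | nil => rfl
  | cons i l ih => exact ih _

theorem pds_replicate (i : Fin N) (m : ℕ) (ψ : (Fin N → ℝ) → ℝ) :
    pds (List.replicate m i) ψ = (pd i)^[m] ψ := by
  induction m generalizing ψ with
  | zero => rfl
  | succ m ih => rw [List.replicate_succ, Function.iterate_succ_apply]; exact ih _

theorem contDiff_pd (i : Fin N) {ψ : (Fin N → ℝ) → ℝ} (h : ContDiff ℝ ∞ ψ) :
    ContDiff ℝ ∞ (pd i ψ) :=
  (h.fderiv_right (m := ∞) (by simp)).clm_apply contDiff_const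

theorem contDiff_pds (l : List (Fin N)) {ψ : (Fin N → ℝ) → ℝ} (h : ContDiff ℝ ∞ ψ) :
    ContDiff ℝ ∞ (pds l ψ) := by
  induction l generalizing ψ with
  | nil => exact h
  | cons i l ih => exact ih (contDiff_pd i h)

theorem differentiableAt_of_smooth {ψ : (Fin N → ℝ) → ℝ} (h : ContDiff ℝ ∞ ψ) (u : Fin N → ℝ) :
    DifferentiableAt ℝ ψ u := (h.differentiable (by simp)).differentiableAt

theorem contDiff_mul {f g : (Fin N → ℝ) → ℝ} (hf : ContDiff ℝ ∞ f) (hg : ContDiff ℝ ∞ g) :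
    ContDiff ℝ ∞ (f * g) := hf.mul hg

theorem pd_add (i : Fin N) {f g : (Fin N → ℝ) → ℝ} (hf : ContDiff ℝ ∞ f) (hg : ContDiff ℝ ∞ g) :
    pd i (f + g) = pd i f + pd i g := by
  ext u
  simp only [pd, Pi.add_apply]
  rw [fderiv_add (differentiableAt_of_smooth hf u) (differentiableAt_of_smooth hg u)]
  rfl

theorem pd_smul (i : Fin N) (a : ℝ) {f : (Fin N → ℝ) → ℝ} (hf : ContDiff ℝ ∞ f) :
    pd i (a • f) = a • pd i f := by
  ext u
  simp only [pd, Pi.smul_apply]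
  rw [fderiv_const_smul (differentiableAt_of_smooth hf u)]
  rfl

theorem pd_mul (i : Fin N) {f g : (Fin N → ℝ) → ℝ} (hf : ContDiff ℝ ∞ f) (hg : ContDiff ℝ ∞ g) :
    pd i (f * g) = pd i f * g + f * pd i g := by
  ext u
  simp only [pd, Pi.add_apply, Pi.mul_apply]
  rw [fderiv_mul (differentiableAt_of_smooth hf u) (differentiableAt_of_smooth hg u)]
  simp only [add_apply, smul_apply, smul_eq_mul]
  ring

theorem pd_const (i : Fin N) (a : ℝ) : pd i (fun _ => a) = 0 := by
  ext u; simp [pd]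

theorem pd_coord (i j : Fin N) : pd i (fun u => u j) = fun _ => (Pi.single i (1:ℝ) : Fin N → ℝ) j := by
  ext u
  simp only [pd]
  have : (fun u : Fin N → ℝ => u j) = (ContinuousLinearMap.proj j : (Fin N → ℝ) →L[ℝ] ℝ) := rfl
  rw [this, ContinuousLinearMap.fderiv]
  rfl

theorem pd_comp (i : Fin N) {f : ℝ → ℝ} {σ : (Fin N → ℝ) → ℝ} (hf : ContDiff ℝ ∞ f)
    (hσ : ContDiff ℝ ∞ σ) : pd i (f ∘ σ) = (deriv f ∘ σ) * pd i σ := by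
  ext u
  simp only [pd, Pi.mul_apply, Function.comp]
  have h1 : HasDerivAt f (deriv f (σ u)) (σ u) :=
    (hf.differentiable (by simp)).differentiableAt.hasDerivAt
  have h2 := h1.comp_hasFDerivAt u (differentiableAt_of_smooth hσ u).hasFDerivAt
  rw [h2.fderiv]
  simp

theorem pd_comm (i j : Fin N) {ψ : (Fin N → ℝ) → ℝ} (h : ContDiff ℝ ∞ ψ) :
    pd i (pd j ψ) = pd j (pd i ψ) := by
  ext u
  have hd : DifferentiableAt ℝ (fderiv ℝ ψ) u :=
    ((h.fderiv_right (m := ∞) (by simp)).differentiable (by simp)).differentiableAt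
  have key : ∀ a b : Fin N, pd a (pd b ψ) u = fderiv ℝ (fderiv ℝ ψ) u (Pi.single a 1) (Pi.single b 1) := by
    intro a b
    change fderiv ℝ (fun y => fderiv ℝ ψ y (Pi.single b 1)) u (Pi.single a 1) = _
    rw [fderiv_clm_apply hd (by fun_prop)]
    simp
  rw [key, key]
  have hs : IsSymmSndFDerivAt ℝ ψ u := (h.contDiffAt).isSymmSndFDerivAt (by
    simp only [minSmoothness_of_isRCLikeNormedField]; exact ENat.LEInfty.out)
  exact hs _ _

theorem pds_add (l : List (Fin N)) {f g : (Fin N → ℝ) → ℝ} (hf : ContDiff ℝ ∞ f)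
    (hg : ContDiff ℝ ∞ g) : pds l (f + g) = pds l f + pds l g := by
  induction l generalizing f g with
  | nil => rfl
  | cons i l ih =>
    change pds l (pd i (f + g)) = _
    rw [pd_add i hf hg, ih (contDiff_pd i hf) (contDiff_pd i hg)]
    rfl

theorem pds_smul (l : List (Fin N)) (a : ℝ) {f : (Fin N → ℝ) → ℝ} (hf : ContDiff ℝ ∞ f) :
    pds l (a • f) = a • pds l f := by
  induction l generalizing f with
  | nil => rfl
  | cons i l ih =>
    change pds l (pd i (a • f)) = _
    rw [pd_smul i a hf, ih (contDiff_pd i hf)]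
    rfl

theorem pds_sum (l : List (Fin N)) {ι : Type*} (s : Finset ι) {f : ι → (Fin N → ℝ) → ℝ}
    (hf : ∀ a ∈ s, ContDiff ℝ ∞ (f a)) : pds l (∑ a ∈ s, f a) = ∑ a ∈ s, pds l (f a) := by
  classical
  induction s using Finset.induction_on with
  | empty =>
    simp only [Finset.sum_empty]
    have := pds_smul l 0 (f := fun _ => (0:ℝ)) contDiff_const
    simpa using this
  | insert a s ha ih =>
    rw [Finset.sum_insert ha, Finset.sum_insert ha, pds_add l (hf a (by simp)) ?_,
      ih fun b hb => hf b (by simp [hb])]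
    have := ContDiff.sum (s := s) (f := f) (n := ∞) (𝕜 := ℝ) fun b hb => hf b (by simp [hb])
    convert this using 1
    ext u; simp

theorem pds_zero (l : List (Fin N)) : pds l (0 : (Fin N → ℝ) → ℝ) = 0 := by
  have := pds_smul l 0 (f := fun _ => (0:ℝ)) contDiff_const
  simpa using this

/-- Smooth functions all of whose iterated partial derivatives belong to `W`. -/
def SmoothClass (W : Set ((Fin N → ℝ) → ℝ)) (ψ : (Fin N → ℝ) → ℝ) : Prop :=
  ContDiff ℝ ∞ ψ ∧ ∀ l, pds l ψ ∈ W

theorem SmoothClass.pd {W : Set ((Fin N → ℝ) → ℝ)} {ψ : (Fin N → ℝ) → ℝ} (h : SmoothClass W ψ)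
    (i : Fin N) : SmoothClass W (pd i ψ) :=
  ⟨contDiff_pd i h.1, fun l => h.2 (i :: l)⟩

theorem SmoothClass.pds {W : Set ((Fin N → ℝ) → ℝ)} {ψ : (Fin N → ℝ) → ℝ} (h : SmoothClass W ψ)
    (l : List (Fin N)) : SmoothClass W (pds l ψ) :=
  ⟨contDiff_pds l h.1, fun l' => by rw [← pds_append]; exact h.2 _⟩

theorem SmoothClass.add {W : AddSubgroup ((Fin N → ℝ) → ℝ)} {f g : (Fin N → ℝ) → ℝ}
    (hf : SmoothClass W f) (hg : SmoothClass W g) : SmoothClass W (f + g) :=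
  ⟨hf.1.add hg.1, fun l => by rw [pds_add l hf.1 hg.1]; exact W.add_mem (hf.2 l) (hg.2 l)⟩

/-- Leibniz rule for membership of the iterated derivatives of a product, up to a given order. -/
theorem pds_mul_mem {W₁ W₂ : Set ((Fin N → ℝ) → ℝ)} {W₃ : AddSubgroup ((Fin N → ℝ) → ℝ)}
    (hW : ∀ f ∈ W₁, ∀ g ∈ W₂, f * g ∈ W₃) (l : List (Fin N)) {f g : (Fin N → ℝ) → ℝ}
    (hf : ContDiff ℝ ∞ f) (hg : ContDiff ℝ ∞ g) (hf' : ∀ l', l'.length ≤ l.length → pds l' f ∈ W₁)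
    (hg' : ∀ l', l'.length ≤ l.length → pds l' g ∈ W₂) : pds l (f * g) ∈ W₃ := by
  induction l generalizing f g with
  | nil => exact hW _ (hf' [] le_rfl) _ (hg' [] le_rfl)
  | cons i l ih =>
    change pds l (LieZeta.pd i (f * g)) ∈ W₃
    rw [pd_mul i hf hg, pds_add l (contDiff_mul (contDiff_pd i hf) hg)
      (contDiff_mul hf (contDiff_pd i hg))]
    refine W₃.add_mem (ih (contDiff_pd i hf) hg ?_ ?_) (ih hf (contDiff_pd i hg) ?_ ?_)
    · exact fun l' h => hf' (i :: l') (by simpa using h)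
    · exact fun l' h => hg' l' (by simp; omega)
    · exact fun l' h => hf' l' (by simp; omega)
    · exact fun l' h => hg' (i :: l') (by simpa using h)

theorem SmoothClass.mul {W₁ W₂ : Set ((Fin N → ℝ) → ℝ)} {W₃ : AddSubgroup ((Fin N → ℝ) → ℝ)}
    (hW : ∀ f ∈ W₁, ∀ g ∈ W₂, f * g ∈ W₃) {f g : (Fin N → ℝ) → ℝ}
    (hf : SmoothClass W₁ f) (hg : SmoothClass W₂ g) : SmoothClass W₃ (f * g) :=
  ⟨hf.1.mul hg.1, fun l => pds_mul_mem hW l hf.1 hg.1 (fun _ _ => hf.2 _) (fun _ _ => hg.2 _)⟩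

/-- Induction on the order of differentiation with `f` varying: the chain rule trades `f` for its
derivative times a derivative of `σ`, and the Leibniz rule handles the shorter list. The class `W₃`
need only absorb factors from `W₂`, so it may be a module and not a ring. -/
theorem SmoothClass.comp {W₂ : Set ((Fin N → ℝ) → ℝ)} {W₃ : AddSubgroup ((Fin N → ℝ) → ℝ)}
    (hW : ∀ f ∈ W₃, ∀ g ∈ W₂, f * g ∈ W₃) {f : ℝ → ℝ} {σ : (Fin N → ℝ) → ℝ}
    (hf : ContDiff ℝ ∞ f) (hf' : ∀ j, iteratedDeriv j f ∘ σ ∈ W₃) (hσ : SmoothClass W₂ σ) :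
    SmoothClass W₃ (f ∘ σ) := by
  refine ⟨hf.comp hσ.1, ?_⟩
  have key : ∀ m : ℕ, ∀ f : ℝ → ℝ, ContDiff ℝ ∞ f → (∀ j, iteratedDeriv j f ∘ σ ∈ W₃) →
      ∀ l : List (Fin N), l.length ≤ m → LieZeta.pds l (f ∘ σ) ∈ W₃ := by
    intro m
    induction m with
    | zero =>
      intro f _ hf' l hl
      rw [List.length_eq_zero_iff.1 (Nat.le_zero.1 hl)]
      exact hf' 0
    | succ m ih =>
      intro f hf hf' l hl
      cases l with
      | nil => exact hf' 0
      | cons i l =>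
        change LieZeta.pds l (LieZeta.pd i (f ∘ σ)) ∈ W₃
        rw [pd_comp i hf hσ.1]
        have hdf : ContDiff ℝ ∞ (deriv f) := by
          have := (contDiff_infty_iff_deriv.1 hf).2
          exact this
        have hlen : l.length ≤ m := by simpa using hl
        refine pds_mul_mem hW l (hdf.comp hσ.1) (contDiff_pd i hσ.1) ?_ ?_
        · intro l' hl'
          refine ih (deriv f) hdf (fun j => ?_) l' (hl'.trans hlen)
          rw [← iteratedDeriv_succ']
          exact hf' (j + 1)
        · exact fun l' _ => hσ.2 (i :: l')
  exact fun l => key l.length f hf hf' l le_rfl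

/-- If `f` vanishes to order `m` at `σ(0) = 0`, the partial derivatives of order less than `m` of
`(f ∘ σ) g` vanish at `0`. -/
theorem pds_comp_mul_zero {f : ℝ → ℝ} {σ g : (Fin N → ℝ) → ℝ} (hf : ContDiff ℝ ∞ f)
    (hσ : ContDiff ℝ ∞ σ) (hg : ContDiff ℝ ∞ g) (hσ0 : σ 0 = 0) (l : List (Fin N))
    (hf' : ∀ j, j ≤ l.length → iteratedDeriv j f 0 = 0) : pds l ((f ∘ σ) * g) 0 = 0 := by
  induction l generalizing f g with
  | nil =>
    have := hf' 0 le_rfl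
    simp only [iteratedDeriv_zero] at this
    simp [pds, hσ0, this]
  | cons i l ih =>
    change pds l (pd i ((f ∘ σ) * g)) 0 = 0
    have hdf : ContDiff ℝ ∞ (deriv f) := (contDiff_infty_iff_deriv.1 hf).2
    rw [pd_mul i (hf.comp hσ) hg, pd_comp i hf hσ, mul_assoc,
      pds_add l (contDiff_mul (hdf.comp hσ) (contDiff_mul (contDiff_pd i hσ) hg))
        (contDiff_mul (hf.comp hσ) (contDiff_pd i hg)), Pi.add_apply,
      ih hdf (contDiff_mul (contDiff_pd i hσ) hg) (fun j hj => ?_),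
      ih hf (contDiff_pd i hg) (fun j hj => hf' j (by simp; omega)), add_zero]
    rw [← iteratedDeriv_succ']
    exact hf' (j + 1) (by simpa using hj)

/-- A subring containing the natural numbers and the coordinates contains all derivatives of
coordinates. -/
theorem smoothClass_coord {W : Subring ((Fin N → ℝ) → ℝ)} {j : Fin N}
    (hj : (fun u : Fin N → ℝ => u j) ∈ W) : SmoothClass (W : Set ((Fin N → ℝ) → ℝ)) (fun u => u j) := by
  refine ⟨contDiff_apply ℝ ℝ j, fun l => ?_⟩
  cases l with
  | nil => exact hj
  | cons i l =>
    change pds l (pd i _) ∈ W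
    rw [pd_coord]
    cases l with
    | nil =>
      change (fun _ => (Pi.single i (1:ℝ) : Fin N → ℝ) j) ∈ W
      by_cases h : j = i
      · subst h; simp only [Pi.single_eq_same]; exact W.one_mem
      · simp only [Pi.single_eq_of_ne h]; exact W.zero_mem
    | cons i' l =>
      change pds l (pd i' _) ∈ W
      rw [pd_const, pds_zero]
      exact W.zero_mem

theorem smoothClass_const {W : AddSubgroup ((Fin N → ℝ) → ℝ)} {a : ℝ} (ha : (fun _ => a) ∈ W) :
    SmoothClass (W : Set ((Fin N → ℝ) → ℝ)) (fun _ => a) := by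
  refine ⟨contDiff_const, fun l => ?_⟩
  cases l with
  | nil => exact ha
  | cons i l =>
    change pds l (pd i _) ∈ W
    rw [pd_const, pds_zero]
    exact W.zero_mem

/-- The subring of functions with all derivatives in the subring `W`. -/
def smoothSubring (W : Subring ((Fin N → ℝ) → ℝ)) : Subring ((Fin N → ℝ) → ℝ) where
  carrier := {ψ | SmoothClass (W : Set ((Fin N → ℝ) → ℝ)) ψ}
  mul_mem' hf hg := SmoothClass.mul (W₃ := W.toAddSubgroup)
    (fun _ h₁ _ h₂ => W.mul_mem h₁ h₂) hf hg
  one_mem' := smoothClass_const (W := W.toAddSubgroup) W.one_mem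
  add_mem' hf hg := SmoothClass.add (W := W.toAddSubgroup) hf hg
  zero_mem' := smoothClass_const (W := W.toAddSubgroup) W.zero_mem
  neg_mem' {f} hf := by
    have h1 : SmoothClass (W : Set ((Fin N → ℝ) → ℝ)) (fun _ => (-1 : ℝ)) :=
      smoothClass_const (W := W.toAddSubgroup) (W.neg_mem W.one_mem)
    have := SmoothClass.mul (W₃ := W.toAddSubgroup) (fun _ h₁ _ h₂ => W.mul_mem h₁ h₂) h1 hf
    have e : (fun _ => (-1 : ℝ)) * f = -f := by ext; simp
    rw [e] at this
    exact this

end PartialDerivatives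

end LieZeta

namespace LieZeta

set_option autoImplicit false

/-! ### Decay and growth on the cube, and restriction to its faces with a weight of mass one in the
lost variable. -/

section Cube

open Filter Topology Set
open scoped ContDiff

variable {n : ℕ}

/-- The range of the `i`-th variable: `(0, ∞)` for `i = 0` and `(0, 1)` otherwise. -/
def dom (i : Fin (n + 1)) : Set ℝ := if i = 0 then Ioi 0 else Ioo 0 1

theorem dom_zero : dom (0 : Fin (n + 1)) = Ioi 0 := if_pos rfl

theorem dom_ne {i : Fin (n + 1)} (hi : i ≠ 0) : dom i = Ioo 0 1 := if_neg hi

theorem measurableSet_dom (i : Fin (n + 1)) : MeasurableSet (dom i) := by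
  unfold dom; split_ifs
  · exact measurableSet_Ioi
  · exact measurableSet_Ioo

theorem dom_pos {i : Fin (n + 1)} {t : ℝ} (h : t ∈ dom i) : 0 < t := by
  unfold dom at h; split_ifs at h
  · exact h
  · exact h.1

/-- Lebesgue measure on `(0, ∞) × (0, 1)^n`. -/
noncomputable def cubeMeasure (n : ℕ) : Measure (Fin (n + 1) → ℝ) :=
  Measure.pi fun i => volume.restrict (dom i)

/-- The set `[0, ∞) × [0, 1]^n`. -/
def closedCube (n : ℕ) : Set (Fin (n + 1) → ℝ) := {u | 0 ≤ u 0 ∧ ∀ i ≠ 0, 0 ≤ u i ∧ u i ≤ 1}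

theorem mem_closedCube_of_dom {u : Fin (n + 1) → ℝ} (h : ∀ i, u i ∈ dom i) : u ∈ closedCube n := by
  refine ⟨(dom_pos (h 0)).le, fun i hi => ?_⟩
  have := h i
  rw [dom_ne hi] at this
  exact ⟨this.1.le, this.2.le⟩

theorem ae_cubeMeasure_dom (n : ℕ) : ∀ᵐ u ∂cubeMeasure n, ∀ i, u i ∈ dom i := by
  unfold cubeMeasure
  rw [ae_all_iff]
  intro i
  have h : ∀ᵐ u ∂(volume.restrict (dom i)), u ∈ dom i := ae_restrict_mem (measurableSet_dom i)
  exact (Measure.quasiMeasurePreserving_eval (μ := fun i : Fin (n + 1) =>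
    (volume.restrict (dom i))) i).ae h

/-- Functions that decrease rapidly in the variable `u 0` on the closed cube. -/
def rapid (n : ℕ) : AddSubgroup ((Fin (n + 1) → ℝ) → ℝ) where
  carrier := {f | ∀ M : ℕ, ∃ C : ℝ, ∀ u ∈ closedCube n, (1 + u 0) ^ M * |f u| ≤ C}
  zero_mem' := fun M => ⟨0, fun u _ => by simp⟩
  add_mem' := by
    intro f g hf hg M
    obtain ⟨C, hC⟩ := hf M
    obtain ⟨C', hC'⟩ := hg M
    refine ⟨C + C', fun u hu => ?_⟩
    have h0 : 0 ≤ (1 + u 0) ^ M := pow_nonneg (by linarith [hu.1]) M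
    calc (1 + u 0) ^ M * |f u + g u| ≤ (1 + u 0) ^ M * (|f u| + |g u|) := by
          gcongr; exact abs_add_le _ _
      _ ≤ C + C' := by rw [mul_add]; exact add_le_add (hC u hu) (hC' u hu)
  neg_mem' := by
    intro f hf M
    obtain ⟨C, hC⟩ := hf M
    exact ⟨C, fun u hu => by simpa using hC u hu⟩

/-- Functions of polynomial growth in the variable `u 0` on the closed cube. -/
def growth (n : ℕ) : Subring ((Fin (n + 1) → ℝ) → ℝ) where
  carrier := {f | ∃ M : ℕ, ∃ C : ℝ, ∀ u ∈ closedCube n, |f u| ≤ C * (1 + u 0) ^ M}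
  zero_mem' := ⟨0, 0, fun u _ => by simp⟩
  one_mem' := ⟨0, 1, fun u _ => by simp⟩
  add_mem' := by
    rintro f g ⟨M, C, hC⟩ ⟨M', C', hC'⟩
    refine ⟨M + M', |C| + |C'|, fun u hu => ?_⟩
    have h1 : 1 ≤ 1 + u 0 := by linarith [hu.1]
    have hp : ∀ a : ℕ, 0 ≤ (1 + u 0) ^ a := fun a => pow_nonneg (by linarith) a
    calc |f u + g u| ≤ |f u| + |g u| := abs_add_le _ _
      _ ≤ |C| * (1 + u 0) ^ (M + M') + |C'| * (1 + u 0) ^ (M + M') := by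
          refine add_le_add ((hC u hu).trans ?_) ((hC' u hu).trans ?_)
          · exact mul_le_mul (le_abs_self _) (pow_le_pow_right₀ h1 (by omega)) (hp _) (abs_nonneg _)
          · exact mul_le_mul (le_abs_self _) (pow_le_pow_right₀ h1 (by omega)) (hp _) (abs_nonneg _)
      _ = _ := by ring
  mul_mem' := by
    rintro f g ⟨M, C, hC⟩ ⟨M', C', hC'⟩
    refine ⟨M + M', C * C', fun u hu => ?_⟩
    have h1 : 1 ≤ 1 + u 0 := by linarith [hu.1]
    rw [Pi.mul_apply, abs_mul]
    calc |f u| * |g u| ≤ (C * (1 + u 0) ^ M) * (C' * (1 + u 0) ^ M') :=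
          mul_le_mul (hC u hu) (hC' u hu) (abs_nonneg _) ((abs_nonneg _).trans (hC u hu))
      _ = _ := by ring
  neg_mem' := by
    rintro f ⟨M, C, hC⟩
    exact ⟨M, C, fun u hu => by simpa using hC u hu⟩

/-- The rapidly decreasing functions form a module over those of polynomial growth, so one rapidly
decreasing factor is enough in a product. -/
theorem rapid_mul_growth {f g : (Fin (n + 1) → ℝ) → ℝ} (hf : f ∈ rapid n) (hg : g ∈ growth n) :
    f * g ∈ rapid n := by
  intro M
  obtain ⟨M', C', hC'⟩ := hg
  obtain ⟨C, hC⟩ := hf (M + M')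
  refine ⟨C * |C'|, fun u hu => ?_⟩
  have h1 : 0 ≤ 1 + u 0 := by linarith [hu.1]
  have hp : ∀ a : ℕ, 0 ≤ (1 + u 0) ^ a := fun a => pow_nonneg h1 a
  rw [Pi.mul_apply, abs_mul]
  calc (1 + u 0) ^ M * (|f u| * |g u|)
      ≤ (1 + u 0) ^ M * (|f u| * (|C'| * (1 + u 0) ^ M')) := by
        refine mul_le_mul_of_nonneg_left (mul_le_mul_of_nonneg_left ?_ (abs_nonneg _)) (hp M)
        exact (hC' u hu).trans (mul_le_mul_of_nonneg_right (le_abs_self _) (hp _))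
    _ = ((1 + u 0) ^ (M + M') * |f u|) * |C'| := by rw [pow_add]; ring
    _ ≤ C * |C'| := mul_le_mul_of_nonneg_right (hC u hu) (abs_nonneg _)

theorem coord_mem_growth (i : Fin (n + 1)) : (fun u : Fin (n + 1) → ℝ => u i) ∈ growth n := by
  refine ⟨1, 1, fun u hu => ?_⟩
  have h0 := hu.1
  by_cases hi : i = 0
  · subst hi
    change |u 0| ≤ _
    rw [abs_of_nonneg h0]; linarith
  · have := hu.2 i hi
    change |u i| ≤ _
    rw [abs_of_nonneg this.1]; linarith

/-- The weight of total mass one on the range of the `i`-th variable. -/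
noncomputable def wt (i : Fin (n + 1)) (t : ℝ) : ℝ := if i = 0 then Real.exp (-t) else 1

/-- Restriction to `u i = a`, multiplied by the weight in the variable `u i`. -/
noncomputable def ev (i : Fin (n + 1)) (a : ℝ) (ψ : (Fin (n + 1) → ℝ) → ℝ) :
    (Fin (n + 1) → ℝ) → ℝ := fun u => wt i (u i) * ψ (Function.update u i a)

theorem contDiff_wt (i : Fin (n + 1)) : ContDiff ℝ ∞ (wt i) := by
  unfold wt
  split_ifs
  · exact Real.contDiff_exp.comp contDiff_neg
  · exact contDiff_const

theorem contDiff_update_const {N : ℕ} (i : Fin N) (a : ℝ) :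
    ContDiff ℝ ∞ (fun u : Fin N → ℝ => Function.update u i a) := by
  rw [contDiff_pi]
  intro j
  by_cases h : j = i
  · subst h; simp only [Function.update_self]; exact contDiff_const
  · simp only [Function.update_of_ne h]; exact contDiff_apply ℝ ℝ j

theorem contDiff_ev (i : Fin (n + 1)) (a : ℝ) {ψ : (Fin (n + 1) → ℝ) → ℝ} (h : ContDiff ℝ ∞ ψ) :
    ContDiff ℝ ∞ (ev i a ψ) :=
  ((contDiff_wt i).comp (contDiff_apply ℝ ℝ i)).mul (h.comp (contDiff_update_const i a))

theorem pd_update {N : ℕ} (i j : Fin N) (a : ℝ) {ψ : (Fin N → ℝ) → ℝ} (h : ContDiff ℝ ∞ ψ)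
    (u : Fin N → ℝ) : pd j (fun u => ψ (Function.update u i a)) u =
      if j = i then 0 else pd j ψ (Function.update u i a) := by
  have h1 : HasFDerivAt (fun u : Fin N → ℝ => Function.update u i a)
      (ContinuousLinearMap.pi fun k => if k = i then 0 else
        ContinuousLinearMap.proj (R := ℝ) (φ := fun _ : Fin N => ℝ) k) u := by
    rw [hasFDerivAt_pi]
    intro k
    by_cases hk : k = i
    · subst hk
      simp only [Function.update_self, if_true]
      exact hasFDerivAt_const _ _
    · simp only [Function.update_of_ne hk, hk, if_false]
      exact (ContinuousLinearMap.proj (R := ℝ) (φ := fun _ : Fin N => ℝ) k).hasFDerivAt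
  have h2 := (differentiableAt_of_smooth h (Function.update u i a)).hasFDerivAt.comp u h1
  unfold pd
  change fderiv ℝ (ψ ∘ fun u => Function.update u i a) u _ = _
  rw [h2.fderiv, ContinuousLinearMap.comp_apply]
  split_ifs with hj
  · subst hj
    refine (congrArg _ ?_).trans (map_zero (fderiv ℝ ψ (Function.update u j a)))
    ext k
    simp only [ContinuousLinearMap.pi_apply, Pi.zero_apply]
    split_ifs with hk
    · rfl
    · simp [Pi.single_eq_of_ne hk]
  · congr 1
    ext k
    simp only [ContinuousLinearMap.pi_apply]
    split_ifs with hk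
    · subst hk; simp [Pi.single_eq_of_ne (Ne.symm hj)]
    · rfl

theorem pd_wt (i j : Fin (n + 1)) (u : Fin (n + 1) → ℝ) : pd j (fun u => wt i (u i)) u =
      if j = i ∧ i = 0 then -wt i (u i) else 0 := by
  by_cases hi : i = 0
  · subst hi
    have h1 : (fun u : Fin (n + 1) → ℝ => wt (0 : Fin (n + 1)) (u 0)) =
        (fun t => Real.exp (-t)) ∘ (fun u : Fin (n + 1) → ℝ => u 0) := by
      ext u; simp [wt]
    have h2 : deriv (fun t : ℝ => Real.exp (-t)) = fun t => -Real.exp (-t) := by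
      ext t
      have := ((Real.hasDerivAt_exp (-t)).comp t (hasDerivAt_neg t)).deriv
      simpa [Function.comp_def] using this
    have h3 : ContDiff ℝ ∞ (fun t : ℝ => Real.exp (-t)) := Real.contDiff_exp.comp contDiff_neg
    have h4 : ContDiff ℝ ∞ (fun u : Fin (n + 1) → ℝ => u 0) := contDiff_apply ℝ ℝ 0
    rw [h1, pd_comp j h3 h4, pd_coord, h2]
    by_cases hj : j = 0
    · subst hj; simp [wt]
    · simp [hj]
  · simp only [wt, hi, if_false, and_false]
    rw [pd_const]; rfl

theorem pd_ev (i j : Fin (n + 1)) (a : ℝ) {ψ : (Fin (n + 1) → ℝ) → ℝ} (h : ContDiff ℝ ∞ ψ) :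
    pd j (ev i a ψ) = if j = i then (if i = 0 then (-1 : ℝ) else 0) • ev i a ψ
      else ev i a (pd j ψ) := by
  have e : ev i a ψ = (fun u => wt i (u i)) * (fun u => ψ (Function.update u i a)) := rfl
  have h1 : ContDiff ℝ ∞ (fun u : Fin (n + 1) → ℝ => wt i (u i)) :=
    (contDiff_wt i).comp (contDiff_apply ℝ ℝ i)
  have h2 : ContDiff ℝ ∞ (fun u : Fin (n + 1) → ℝ => ψ (Function.update u i a)) :=
    h.comp (contDiff_update_const i a)
  ext u
  rw [e, pd_mul j h1 h2, Pi.add_apply, Pi.mul_apply, Pi.mul_apply, pd_update i j a h, pd_wt]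
  by_cases hj : j = i
  · subst hj
    by_cases h0 : j = 0
    · simp [h0]
    · simp [h0]
  · simp [hj, ev]

theorem ev_comm {i j : Fin (n + 1)} (hij : i ≠ j) (a b : ℝ) (ψ : (Fin (n + 1) → ℝ) → ℝ) :
    ev i a (ev j b ψ) = ev j b (ev i a ψ) := by
  ext u
  simp only [ev, Function.update_of_ne hij, Function.update_of_ne hij.symm]
  rw [Function.update_comm hij]
  ring

theorem smul_mem_rapid (a : ℝ) {f : (Fin (n + 1) → ℝ) → ℝ} (hf : f ∈ rapid n) :
    a • f ∈ rapid n := by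
  have : f * (fun _ => a) ∈ rapid n :=
    rapid_mul_growth hf ⟨0, |a|, fun u _ => by simp⟩
  convert this using 1
  ext u; simp [mul_comm]

theorem pow_mul_exp_neg_bounded (M : ℕ) : ∃ C : ℝ, ∀ t : ℝ, 0 ≤ t →
    (1 + t) ^ M * Real.exp (-t) ≤ C := by
  refine ⟨(M.factorial : ℝ) * Real.exp 1, fun t ht => ?_⟩
  have h1 : (1 + t) ^ M / (M.factorial : ℝ) ≤ Real.exp (1 + t) :=
    Real.pow_div_factorial_le_exp (1 + t) (by linarith) M
  have h2 : (0 : ℝ) < M.factorial := by exact_mod_cast M.factorial_pos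
  rw [div_le_iff₀ h2, Real.exp_add] at h1
  calc (1 + t) ^ M * Real.exp (-t) ≤ (Real.exp 1 * Real.exp t * M.factorial) * Real.exp (-t) := by
        gcongr
    _ = (M.factorial : ℝ) * Real.exp 1 * (Real.exp t * Real.exp (-t)) := by ring
    _ = _ := by rw [← Real.exp_add]; simp

theorem ev_mem_rapid (i : Fin (n + 1)) {a : ℝ} (ha : 0 ≤ a) (ha' : a ≤ 1)
    {f : (Fin (n + 1) → ℝ) → ℝ} (hf : f ∈ rapid n) : ev i a f ∈ rapid n := by
  intro M
  have hmem : ∀ u ∈ closedCube n, Function.update u i a ∈ closedCube n := by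
    intro u hu
    constructor
    · by_cases h : i = 0
      · subst h; simpa using ha
      · rw [Function.update_of_ne (Ne.symm h)]; exact hu.1
    · intro j hj
      by_cases h : j = i
      · subst h; simp [ha, ha']
      · rw [Function.update_of_ne h]; exact hu.2 j hj
  by_cases h : i = 0
  · subst h
    obtain ⟨C, hC⟩ := hf 0
    obtain ⟨C', hC'⟩ := pow_mul_exp_neg_bounded M
    refine ⟨C' * C, fun u hu => ?_⟩
    have h1 := hC _ (hmem u hu)
    have h2 := hC' (u 0) hu.1
    have h0 : 0 ≤ (1 + u 0) ^ M * Real.exp (-u 0) := by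
      have := hu.1; positivity
    simp only [pow_zero, one_mul] at h1
    simp only [ev, wt, if_true, abs_mul, Real.abs_exp]
    rw [← mul_assoc]
    exact mul_le_mul h2 h1 (abs_nonneg _) (h0.trans h2)
  · obtain ⟨C, hC⟩ := hf M
    refine ⟨C, fun u hu => ?_⟩
    have h1 := hC _ (hmem u hu)
    rw [Function.update_of_ne (Ne.symm h)] at h1
    simpa [ev, wt, h] using h1

/-- A derivative in `u i` meets only the weight, which it kills or changes by a sign. A derivative
in any other variable passes to `ψ`. -/
theorem SmoothClass.ev {ψ : (Fin (n + 1) → ℝ) → ℝ} (h : SmoothClass (rapid n) ψ)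
    (i : Fin (n + 1)) {a : ℝ} (ha : 0 ≤ a) (ha' : a ≤ 1) :
    SmoothClass (rapid n : Set ((Fin (n + 1) → ℝ) → ℝ)) (ev i a ψ) := by
  refine ⟨contDiff_ev i a h.1, fun l => ?_⟩
  induction l generalizing ψ with
  | nil => exact ev_mem_rapid i ha ha' (h.2 [])
  | cons j l ih =>
    change LieZeta.pds l (LieZeta.pd j (LieZeta.ev i a ψ)) ∈ rapid n
    rw [pd_ev i j a h.1]
    split_ifs
    · rw [pds_smul l _ (contDiff_ev i a h.1)]
      exact smul_mem_rapid _ (ih h)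
    · rw [pds_smul l _ (contDiff_ev i a h.1)]
      exact smul_mem_rapid _ (ih h)
    · exact ih (h.pd j)

end Cube

end LieZeta

namespace LieZeta

set_option autoImplicit false

/-! ### Mellin integrals on the cube and one-variable integration by parts. -/

section Mellin

open Filter Topology Set
open scoped ContDiff

variable {n : ℕ}

/-- The multiplicative kernel of the Mellin integral. -/
noncomputable def mellinKernel (z : Fin (n + 1) → ℂ) (u : Fin (n + 1) → ℝ) : ℂ :=
  ∏ i, (u i : ℂ) ^ (z i - 1)

/-- The Mellin integral over `(0, ∞) × (0, 1)^n`. -/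
noncomputable def mellinCube (z : Fin (n + 1) → ℂ) (ψ : (Fin (n + 1) → ℝ) → ℝ) : ℂ :=
  ∫ u, mellinKernel z u * (ψ u : ℂ) ∂cubeMeasure n

theorem integrableOn_rpow_Ioo {σ : ℝ} (hσ : 0 < σ) :
    IntegrableOn (fun t : ℝ => t ^ (σ - 1)) (Ioo 0 1) := by
  have h := intervalIntegral.intervalIntegrable_rpow' (a := 0) (b := 1) (r := σ - 1) (by linarith)
  rw [intervalIntegrable_iff_integrableOn_Ioo_of_le zero_le_one] at h
  exact h

theorem integrableOn_rpow_mul_Ioi {σ : ℝ} (hσ : 0 < σ) {M : ℕ} (hM : σ + 1 ≤ M) :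
    IntegrableOn (fun t : ℝ => t ^ (σ - 1) * ((1 + t) ^ M)⁻¹) (Ioi 0) := by
  have hmeas : Measurable (fun t : ℝ => t ^ (σ - 1) * ((1 + t) ^ M)⁻¹) := by
    fun_prop
  rw [← Ioc_union_Ioi_eq_Ioi (zero_le_one (α := ℝ))]
  refine IntegrableOn.union ?_ ?_
  · have h := intervalIntegral.intervalIntegrable_rpow' (a := 0) (b := 1) (r := σ - 1) (by linarith)
    rw [intervalIntegrable_iff_integrableOn_Ioc_of_le zero_le_one] at h
    refine Integrable.mono' h hmeas.aestronglyMeasurable ?_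
    filter_upwards [ae_restrict_mem measurableSet_Ioc] with t ht
    have h0 : 0 ≤ t ^ (σ - 1) := Real.rpow_nonneg ht.1.le _
    have h1 : 1 ≤ (1 + t) ^ M := one_le_pow₀ (by linarith [ht.1])
    rw [Real.norm_of_nonneg (by positivity)]
    exact mul_le_of_le_one_right h0 (inv_le_one_of_one_le₀ h1)
  -- The condition on `M` makes the exponent `σ - 1 - M` at most `-2`.
  · have h := integrableOn_Ioi_rpow_of_lt (a := -2) (c := 1) (by norm_num) one_pos
    refine Integrable.mono' h hmeas.aestronglyMeasurable ?_
    filter_upwards [ae_restrict_mem measurableSet_Ioi] with t ht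
    have ht1 : (1 : ℝ) < t := ht
    have ht0 : 0 < t := by linarith
    rw [Real.norm_of_nonneg (by positivity)]
    have h1 : t ^ M ≤ (1 + t) ^ M := pow_le_pow_left₀ ht0.le (by linarith) M
    calc t ^ (σ - 1) * ((1 + t) ^ M)⁻¹ ≤ t ^ (σ - 1) * (t ^ M)⁻¹ := by gcongr
      _ = t ^ (σ - 1 - M) := by
          rw [Real.rpow_sub ht0 (σ - 1), Real.rpow_natCast, div_eq_mul_inv]
      _ ≤ t ^ (-2 : ℝ) := Real.rpow_le_rpow_of_exponent_le ht1.le (by linarith)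

/-- The one-variable factor of the dominating function. -/
noncomputable def domBound (σ₁ σ₂ : ℝ) (M : ℕ) (i : Fin (n + 1)) (t : ℝ) : ℝ :=
  (t ^ (σ₁ - 1) + t ^ (σ₂ - 1)) * (if i = 0 then ((1 + t) ^ M)⁻¹ else 1)

theorem integrable_domBound {σ₁ σ₂ : Fin (n + 1) → ℝ} (h₁ : ∀ i, 0 < σ₁ i)
    (h₂ : ∀ i, 0 < σ₂ i) {M : ℕ} (hM₁ : σ₁ 0 + 1 ≤ M) (hM₂ : σ₂ 0 + 1 ≤ M) (C : ℝ) :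
    Integrable (fun u => C * ∏ i, domBound (σ₁ i) (σ₂ i) M i (u i)) (cubeMeasure n) := by
  refine Integrable.const_mul ?_ C
  unfold cubeMeasure
  refine Integrable.fintype_prod (f := fun i => domBound (σ₁ i) (σ₂ i) M i) fun i => ?_
  by_cases hi : i = 0
  · subst hi
    rw [dom_zero]
    have := (integrableOn_rpow_mul_Ioi (h₁ 0) hM₁).add (integrableOn_rpow_mul_Ioi (h₂ 0) hM₂)
    refine this.congr (Eventually.of_forall fun t => ?_)
    simp [domBound, add_mul]
  · rw [dom_ne hi]
    have := (integrableOn_rpow_Ioo (h₁ i)).add (integrableOn_rpow_Ioo (h₂ i))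
    refine this.congr (Eventually.of_forall fun t => ?_)
    simp [domBound, hi]

/-- The smaller exponent dominates on `t ≤ 1` and the larger one on `t ≥ 1`, so a single function
dominates a whole strip of exponents. -/
theorem rpow_le_add {t σ σ₁ σ₂ : ℝ} (ht : 0 < t) (h₁ : σ₁ ≤ σ) (h₂ : σ ≤ σ₂) :
    t ^ (σ - 1) ≤ t ^ (σ₁ - 1) + t ^ (σ₂ - 1) := by
  rcases le_total t 1 with h | h
  · have := Real.rpow_le_rpow_of_exponent_ge ht h (show σ₁ - 1 ≤ σ - 1 by linarith)
    have h0 : 0 ≤ t ^ (σ₂ - 1) := Real.rpow_nonneg ht.le _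
    linarith
  · have := Real.rpow_le_rpow_of_exponent_le h (show σ - 1 ≤ σ₂ - 1 by linarith)
    have h0 : 0 ≤ t ^ (σ₁ - 1) := Real.rpow_nonneg ht.le _
    linarith

theorem norm_mellinKernel_mul_le {ψ : (Fin (n + 1) → ℝ) → ℝ} {M : ℕ} {C : ℝ}
    (hC : ∀ u ∈ closedCube n, (1 + u 0) ^ M * |ψ u| ≤ C) {σ₁ σ₂ : Fin (n + 1) → ℝ}
    {z : Fin (n + 1) → ℂ} (h₁ : ∀ i, σ₁ i ≤ (z i).re) (h₂ : ∀ i, (z i).re ≤ σ₂ i)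
    {u : Fin (n + 1) → ℝ} (hu : ∀ i, u i ∈ dom i) :
    ‖mellinKernel z u * (ψ u : ℂ)‖ ≤ C * ∏ i, domBound (σ₁ i) (σ₂ i) M i (u i) := by
  have hu0 : 0 < u 0 := dom_pos (hu 0)
  have hpow : 0 < (1 + u 0) ^ M := by positivity
  have hC' := hC u (mem_closedCube_of_dom hu)
  have hC0 : 0 ≤ C := le_trans (by positivity) hC'
  have e1 : ‖mellinKernel z u‖ ≤ ∏ i, ((u i) ^ (σ₁ i - 1) + (u i) ^ (σ₂ i - 1)) := by
    unfold mellinKernel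
    rw [norm_prod]
    refine Finset.prod_le_prod (fun _ _ => norm_nonneg _) fun i _ => ?_
    rw [Complex.norm_cpow_eq_rpow_re_of_pos (dom_pos (hu i)), Complex.sub_re, Complex.one_re]
    exact rpow_le_add (dom_pos (hu i)) (h₁ i) (h₂ i)
  have e2 : |ψ u| ≤ C * ((1 + u 0) ^ M)⁻¹ := by
    rw [← div_eq_mul_inv, le_div_iff₀ hpow, mul_comm]; exact hC'
  have e3 : (∏ i : Fin (n + 1), (if i = 0 then ((1 + u i) ^ M)⁻¹ else 1)) = ((1 + u 0) ^ M)⁻¹ := by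
    rw [Finset.prod_ite_eq' Finset.univ (0 : Fin (n + 1))]; simp
  simp only [domBound]
  rw [Finset.prod_mul_distrib, e3, norm_mul, Complex.norm_real, Real.norm_eq_abs]
  calc ‖mellinKernel z u‖ * |ψ u| ≤ (∏ i, ((u i) ^ (σ₁ i - 1) + (u i) ^ (σ₂ i - 1))) *
        (C * ((1 + u 0) ^ M)⁻¹) := by
        refine mul_le_mul e1 e2 (abs_nonneg _) ((norm_nonneg _).trans e1)
    _ = _ := by ring

theorem measurable_mellinKernel (z : Fin (n + 1) → ℂ) : Measurable (mellinKernel z) := by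
  unfold mellinKernel
  refine Finset.measurable_prod _ fun i _ => ?_
  exact (Complex.measurable_ofReal.comp (measurable_pi_apply i)).pow_const _

theorem measurable_mellin_integrand (z : Fin (n + 1) → ℂ) {ψ : (Fin (n + 1) → ℝ) → ℝ}
    (hψ : Continuous ψ) : Measurable fun u => mellinKernel z u * (ψ u : ℂ) :=
  (measurable_mellinKernel z).mul (Complex.measurable_ofReal.comp hψ.measurable)

theorem integrable_mellin {ψ : (Fin (n + 1) → ℝ) → ℝ} (hψ : SmoothClass (rapid n) ψ)
    {z : Fin (n + 1) → ℂ} (hz : ∀ i, 0 < (z i).re) :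
    Integrable (fun u => mellinKernel z u * (ψ u : ℂ)) (cubeMeasure n) := by
  obtain ⟨M, hM⟩ := exists_nat_ge ((z 0).re + 1)
  obtain ⟨C, hC⟩ := hψ.2 [] M
  refine (integrable_domBound hz hz hM hM C).mono'
    (measurable_mellin_integrand z hψ.1.continuous).aestronglyMeasurable ?_
  filter_upwards [ae_cubeMeasure_dom n] with u hu
  exact norm_mellinKernel_mul_le hC (fun _ => le_rfl) (fun _ => le_rfl) hu

theorem differentiableAt_mellinCube {ψ : (Fin (n + 1) → ℝ) → ℝ} (hψ : SmoothClass (rapid n) ψ)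
    {e : Fin (n + 1) → ℂ → ℂ} (he : ∀ i, Differentiable ℂ (e i)) {s : ℂ}
    (hs : ∀ i, 0 < (e i s).re) :
    DifferentiableAt ℂ (fun s => mellinCube (fun i => e i s) ψ) s := by
  have h1 : ∀ᶠ w in 𝓝 s, ∀ i, (e i s).re / 2 ≤ (e i w).re ∧ (e i w).re ≤ (e i s).re + 1 := by
    refine eventually_all.2 fun i => ?_
    have hc : ContinuousAt (fun w => (e i w).re) s :=
      Complex.continuous_re.continuousAt.comp (he i).continuous.continuousAt
    have a1 := hc.eventually (lt_mem_nhds (show (e i s).re / 2 < (e i s).re by linarith [hs i]))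
    have a2 := hc.eventually (gt_mem_nhds (show (e i s).re < (e i s).re + 1 by linarith))
    filter_upwards [a1, a2] with w b1 b2 using ⟨b1.le, b2.le⟩
  obtain ⟨δ, hδ, hδs⟩ := Metric.mem_nhds_iff.1 h1
  obtain ⟨M, hM⟩ := exists_nat_ge ((e 0 s).re + 2)
  obtain ⟨C, hC⟩ := hψ.2 [] M
  refine differentiableAt_integral_of_dominated
    (f := fun s u => mellinKernel (fun i => e i s) u * (ψ u : ℂ)) hδ
    (fun w _ => (measurable_mellin_integrand _ hψ.1.continuous).aestronglyMeasurable) ?_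
    (integrable_domBound (σ₁ := fun i => (e i s).re / 2) (σ₂ := fun i => (e i s).re + 1)
      (M := M) (fun i => by have := hs i; positivity) (fun i => by have := hs i; positivity)
      (by linarith [hs 0]) (by linarith) C) ?_
  · filter_upwards [ae_cubeMeasure_dom n] with u hu w hw
    unfold mellinKernel
    refine DifferentiableAt.mul ?_ (by fun_prop)
    refine DifferentiableAt.fun_finsetProd fun i _ => ?_
    refine DifferentiableAt.const_cpow ?_ (Or.inl ?_)
    · exact ((he i).sub_const 1).differentiableAt
    · exact_mod_cast (dom_pos (hu i)).ne'
  · filter_upwards [ae_cubeMeasure_dom n] with u hu w hw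
    exact norm_mellinKernel_mul_le hC (fun i => (hδs hw i).1) (fun i => (hδs hw i).2) hu

theorem mellinKernel_insertNth (z : Fin (n + 1) → ℂ) (i : Fin (n + 1)) (t : ℝ) (w : Fin n → ℝ) :
    mellinKernel z (i.insertNth t w) =
      (t : ℂ) ^ (z i - 1) * ∏ j, (w j : ℂ) ^ (z (i.succAbove j) - 1) := by
  unfold mellinKernel
  rw [Fin.prod_univ_succAbove _ i]
  simp

/-- A function all of whose integrals in the `i`-th variable vanish has vanishing integral. -/
theorem integral_eq_zero_of_slices (i : Fin (n + 1)) {G : (Fin (n + 1) → ℝ) → ℂ}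
    (hG : Integrable G (cubeMeasure n))
    (h : ∀ w : Fin n → ℝ, (∀ j, w j ∈ dom (i.succAbove j)) →
      ∫ t in dom i, G (i.insertNth t w) = 0) : ∫ u, G u ∂cubeMeasure n = 0 := by
  unfold cubeMeasure at *
  have mp := (measurePreserving_piFinSuccAbove (fun j : Fin (n + 1) => volume.restrict (dom j)) i).symm
  rw [← mp.integral_comp', integral_prod_symm]
  · refine integral_eq_zero_of_ae ?_
    have hae : ∀ᵐ w ∂(Measure.pi fun j : Fin n => volume.restrict (dom (i.succAbove j))),
        ∀ j, w j ∈ dom (i.succAbove j) := by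
      rw [ae_all_iff]
      intro j
      have h : ∀ᵐ u ∂(volume.restrict (dom (i.succAbove j))), u ∈ dom (i.succAbove j) :=
        ae_restrict_mem (measurableSet_dom _)
      exact (Measure.quasiMeasurePreserving_eval (μ := fun j : Fin n =>
        (volume.restrict (dom (i.succAbove j)))) j).ae h
    filter_upwards [hae] with w hw
    exact h w hw
  · exact (mp.integrable_comp_emb (MeasurableEquiv.measurableEmbedding _)).2 hG

theorem hasDerivAt_insertNth {ψ : (Fin (n + 1) → ℝ) → ℝ} (hψ : ContDiff ℝ ∞ ψ) (i : Fin (n + 1))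
    (w : Fin n → ℝ) (t : ℝ) :
    HasDerivAt (fun t => ψ (i.insertNth t w)) (pd i ψ (i.insertNth t w)) t := by
  have h1 : HasDerivAt (fun t : ℝ => (i.insertNth t w : Fin (n + 1) → ℝ)) (Pi.single i 1) t := by
    rw [hasDerivAt_pi]
    intro j
    refine Fin.succAboveCases i ?_ (fun k => ?_) j
    · simpa using hasDerivAt_id' t
    · simpa using hasDerivAt_const t (w k)
  exact (differentiableAt_of_smooth hψ _).hasFDerivAt.comp_hasDerivAt t h1

theorem continuous_insertNth_left (i : Fin (n + 1)) (w : Fin n → ℝ) :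
    Continuous (fun t : ℝ => (i.insertNth t w : Fin (n + 1) → ℝ)) := by
  refine continuous_pi fun j => ?_
  refine Fin.succAboveCases i ?_ (fun k => ?_) j
  · simpa using continuous_id'
  · simpa using continuous_const

theorem hasDerivAt_cpow_mul {f : ℝ → ℝ} {f' t : ℝ} (ht : 0 < t) (hf : HasDerivAt f f' t) (z : ℂ) :
    HasDerivAt (fun t : ℝ => (t : ℂ) ^ z * (f t : ℂ))
      (z * (t : ℂ) ^ (z - 1) * f t + (t : ℂ) ^ z * f') t := by
  have h1 : HasDerivAt (fun t : ℝ => (t : ℂ) ^ z) (z * (t : ℂ) ^ (z - 1)) t := by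
    by_cases hz : z = 0
    · subst hz; simpa using hasDerivAt_const t (1 : ℂ)
    · have h2 := (hasDerivAt_id (t : ℂ)).cpow_const (c := z)
        (Or.inl (by simpa using ht))
      simpa using h2.comp_ofReal
  exact h1.mul hf.ofReal_comp

/-- The integrand is the derivative of `t^z f(t)`, which vanishes at `0` because `Re z > 0`. On the
half-line rapid decay also removes the boundary term at infinity. -/
theorem integral_Ioo_cpow_deriv {f f' : ℝ → ℝ} (hf : ∀ t, HasDerivAt f (f' t) t)
    (hf' : Continuous f') {z : ℂ} (hz : 0 < z.re) :
    IntegrableOn (fun t : ℝ => z * (t : ℂ) ^ (z - 1) * f t + (t : ℂ) ^ z * f' t) (Ioo 0 1) ∧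
    ∫ t in Ioo (0:ℝ) 1, (z * (t : ℂ) ^ (z - 1) * f t + (t : ℂ) ^ z * f' t) = f 1 := by
  have hfc : Continuous f := continuous_iff_continuousAt.2 fun t => (hf t).continuousAt
  have hcont : ContinuousOn (fun t : ℝ => (t : ℂ) ^ z * (f t : ℂ)) (Icc 0 1) := by
    refine Continuous.continuousOn ?_
    refine Continuous.mul ?_ (Complex.continuous_ofReal.comp hfc)
    exact Complex.continuous_ofReal_cpow_const hz
  have hint : IntervalIntegrable
      (fun t : ℝ => z * (t : ℂ) ^ (z - 1) * f t + (t : ℂ) ^ z * f' t) volume 0 1 := by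
    refine IntervalIntegrable.add ?_ ?_
    · have h1 := intervalIntegral.intervalIntegrable_cpow' (a := 0) (b := 1) (r := z - 1) (by
        simp; exact hz)
      exact (h1.const_mul z).mul_continuousOn (Complex.continuous_ofReal.comp hfc).continuousOn
    · exact ((Complex.continuous_ofReal_cpow_const hz).mul
        (Complex.continuous_ofReal.comp hf')).intervalIntegrable _ _
  have key := intervalIntegral.integral_eq_sub_of_hasDerivAt_of_le zero_le_one hcont
    (fun t ht => hasDerivAt_cpow_mul ht.1 (hf t) z) hint
  have hz0 : z ≠ 0 := by rintro rfl; simp at hz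
  rw [intervalIntegral.integral_of_le zero_le_one, integral_Ioc_eq_integral_Ioo] at key
  refine ⟨?_, ?_⟩
  · rwa [intervalIntegrable_iff_integrableOn_Ioo_of_le zero_le_one] at hint
  · rw [key]; simp [Complex.zero_cpow hz0]

theorem integral_Ioi_cpow_deriv {f f' : ℝ → ℝ} (hf : ∀ t, HasDerivAt f (f' t) t)
    (hf' : Continuous f') (hd : ∀ M : ℕ, ∃ C : ℝ, ∀ t, 0 ≤ t → (1 + t) ^ M * |f t| ≤ C)
    (hd' : ∀ M : ℕ, ∃ C : ℝ, ∀ t, 0 ≤ t → (1 + t) ^ M * |f' t| ≤ C) {z : ℂ} (hz : 0 < z.re) :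
    IntegrableOn (fun t : ℝ => z * (t : ℂ) ^ (z - 1) * f t + (t : ℂ) ^ z * f' t) (Ioi 0) ∧
    ∫ t in Ioi (0:ℝ), (z * (t : ℂ) ^ (z - 1) * f t + (t : ℂ) ^ z * f' t) = 0 := by
  have hfc : Continuous f := continuous_iff_continuousAt.2 fun t => (hf t).continuousAt
  have hz0 : z ≠ 0 := by rintro rfl; simp at hz
  have hgen : ∀ (g : ℝ → ℝ), Continuous g →
      (∀ M : ℕ, ∃ C : ℝ, ∀ t, 0 ≤ t → (1 + t) ^ M * |g t| ≤ C) → ∀ w : ℂ, 0 < w.re →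
      IntegrableOn (fun t : ℝ => (t : ℂ) ^ (w - 1) * g t) (Ioi 0) := by
    intro g hg hgd w hw
    obtain ⟨M, hM⟩ := exists_nat_ge (w.re + 1)
    obtain ⟨C, hC⟩ := hgd M
    refine Integrable.mono' ((integrableOn_rpow_mul_Ioi hw hM).const_mul C) ?_ ?_
    · exact ((Complex.measurable_ofReal.pow_const _).mul
        (Complex.measurable_ofReal.comp hg.measurable)).aestronglyMeasurable
    · filter_upwards [ae_restrict_mem measurableSet_Ioi] with t ht
      have ht0 : (0:ℝ) < t := ht
      have hp : 0 < (1 + t) ^ M := by positivity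
      rw [norm_mul, Complex.norm_cpow_eq_rpow_re_of_pos ht0, Complex.norm_real, Real.norm_eq_abs,
        Complex.sub_re, Complex.one_re]
      have h1 : |g t| ≤ C * ((1 + t) ^ M)⁻¹ := by
        rw [← div_eq_mul_inv, le_div_iff₀ hp, mul_comm]; exact hC t ht0.le
      calc t ^ (w.re - 1) * |g t| ≤ t ^ (w.re - 1) * (C * ((1 + t) ^ M)⁻¹) := by gcongr
        _ = _ := by ring
  have hint : IntegrableOn
      (fun t : ℝ => z * (t : ℂ) ^ (z - 1) * f t + (t : ℂ) ^ z * f' t) (Ioi 0) := by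
    refine Integrable.add ?_ ?_
    · refine ((hgen f hfc hd z hz).const_mul z).congr (Eventually.of_forall fun t => ?_)
      simp only []; ring
    · have := hgen f' hf' hd' (z + 1) (by simp; linarith)
      simp only [add_sub_cancel_right] at this
      exact this
  refine ⟨hint, ?_⟩
  have hcont : ContinuousWithinAt (fun t : ℝ => (t : ℂ) ^ z * (f t : ℂ)) (Ici 0) 0 := by
    refine Continuous.continuousWithinAt ?_
    exact (Complex.continuous_ofReal_cpow_const hz).mul (Complex.continuous_ofReal.comp hfc)
  have hlim : Tendsto (fun t : ℝ => (t : ℂ) ^ z * (f t : ℂ)) atTop (𝓝 0) := by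
    obtain ⟨M, hM⟩ := exists_nat_ge (z.re + 1)
    obtain ⟨C, hC⟩ := hd M
    rw [tendsto_zero_iff_norm_tendsto_zero]
    have hb : Tendsto (fun t : ℝ => |C| * t⁻¹) atTop (𝓝 0) := by
      simpa using (tendsto_inv_atTop_zero (𝕜 := ℝ)).const_mul |C|
    refine squeeze_zero' (Eventually.of_forall fun _ => norm_nonneg _) ?_ hb
    filter_upwards [eventually_gt_atTop 1] with t ht
    have ht0 : 0 < t := by linarith
    have hp : 0 < (1 + t) ^ M := by positivity
    rw [norm_mul, Complex.norm_cpow_eq_rpow_re_of_pos ht0, Complex.norm_real, Real.norm_eq_abs]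
    have h1 : |f t| ≤ |C| * (t ^ M)⁻¹ := by
      have : |f t| ≤ C * ((1 + t) ^ M)⁻¹ := by
        rw [← div_eq_mul_inv, le_div_iff₀ hp, mul_comm]; exact hC t ht0.le
      refine this.trans ?_
      have h2 : t ^ M ≤ (1 + t) ^ M := pow_le_pow_left₀ ht0.le (by linarith) M
      have h3 : ((1 + t) ^ M)⁻¹ ≤ (t ^ M)⁻¹ := by gcongr
      exact mul_le_mul (le_abs_self _) h3 (by positivity) (abs_nonneg _)
    calc t ^ z.re * |f t| ≤ t ^ z.re * (|C| * (t ^ M)⁻¹) := by gcongr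
      _ = |C| * t ^ (z.re - M) := by
          rw [Real.rpow_sub ht0, Real.rpow_natCast, div_eq_mul_inv]; ring
      _ ≤ |C| * t ^ (-1 : ℝ) := by
          gcongr
          · exact ht.le
          · linarith
      _ = |C| * t⁻¹ := by rw [Real.rpow_neg_one]
  have := integral_Ioi_of_hasDerivAt_of_tendsto hcont
    (fun t ht => hasDerivAt_cpow_mul ht (hf t) z) hint hlim
  rw [this]
  simp [Complex.zero_cpow hz0]

end Mellin

end LieZeta

namespace LieZeta

set_option autoImplicit false

/-! ### Integration by parts in one variable of the cube. -/

section Continuation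

open Filter Topology Set
open scoped ContDiff

variable {n : ℕ}

/-- The coefficient of the boundary term at `u i = 1`. -/
noncomputable def bdCoeff (i : Fin (n + 1)) : ℝ := if i = 0 then 0 else 1

theorem ev_insertNth (i : Fin (n + 1)) (a : ℝ) (ψ : (Fin (n + 1) → ℝ) → ℝ) (t : ℝ)
    (w : Fin n → ℝ) : ev i a ψ (i.insertNth t w) = wt i t * ψ (i.insertNth a w) := by
  simp [ev, Fin.update_insertNth]

theorem slice_mem_closedCube {w : Fin n → ℝ}
    (hw : ∀ j, w j ∈ dom ((0 : Fin (n + 1)).succAbove j)) {t : ℝ} (ht : 0 ≤ t) :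
    ((0 : Fin (n + 1)).insertNth t w : Fin (n + 1) → ℝ) ∈ closedCube n := by
  constructor
  · simpa using ht
  · intro i
    refine Fin.succAboveCases 0 ?_ (fun k => ?_) i
    · simp
    · intro hk
      have := hw k
      rw [dom_ne (by simp)] at this
      rw [Fin.insertNth_apply_succAbove]
      exact ⟨this.1.le, this.2.le⟩

theorem slice_decay {ψ : (Fin (n + 1) → ℝ) → ℝ} (hψ : ψ ∈ rapid n) {w : Fin n → ℝ}
    (hw : ∀ j, w j ∈ dom ((0 : Fin (n + 1)).succAbove j)) (M : ℕ) :
    ∃ C : ℝ, ∀ t, 0 ≤ t → (1 + t) ^ M * |ψ ((0 : Fin (n + 1)).insertNth t w)| ≤ C := by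
  obtain ⟨C, hC⟩ := hψ M
  exact ⟨C, fun t ht => by simpa using hC _ (slice_mem_closedCube hw ht)⟩

theorem integrableOn_wt (i : Fin (n + 1)) : IntegrableOn (fun t => (wt i t : ℂ)) (dom i) := by
  have h : IntegrableOn (fun t => wt i t) (dom i) := by
    by_cases hi : i = 0
    · subst hi
      have h0 : (fun t => wt (0 : Fin (n + 1)) t) = fun t => Real.exp (-t) := by
        funext t; simp [wt]
      rw [dom_zero, h0]
      simpa using exp_neg_integrableOn_Ioi 0 one_pos
    · have h0 : (fun t => wt i t) = fun _ => (1 : ℝ) := by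
        funext t; simp [wt, hi]
      rw [dom_ne hi, h0]
      exact (continuous_const.integrableOn_Icc).mono_set Ioo_subset_Icc_self
  exact h.ofReal

theorem integral_wt (i : Fin (n + 1)) : ∫ t in dom i, (wt i t : ℂ) = 1 := by
  rw [integral_complex_ofReal]
  by_cases hi : i = 0
  · subst hi
    rw [dom_zero]
    simp only [wt, if_true, integral_exp_neg_Ioi_zero, Complex.ofReal_one]
  · rw [dom_ne hi]
    simp [wt, hi]

theorem slice_integral_deriv {ψ : (Fin (n + 1) → ℝ) → ℝ} (hψ : SmoothClass (rapid n) ψ)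
    (i : Fin (n + 1)) {w : Fin n → ℝ} (hw : ∀ j, w j ∈ dom (i.succAbove j)) {z : ℂ}
    (hz : 0 < z.re) :
    IntegrableOn (fun t : ℝ => z * (t : ℂ) ^ (z - 1) * ψ (i.insertNth t w) +
      (t : ℂ) ^ z * pd i ψ (i.insertNth t w)) (dom i) ∧
    ∫ t in dom i, (z * (t : ℂ) ^ (z - 1) * ψ (i.insertNth t w) +
      (t : ℂ) ^ z * pd i ψ (i.insertNth t w)) = bdCoeff i * ψ (i.insertNth 1 w) := by
  have h1 := fun t => hasDerivAt_insertNth hψ.1 i w t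
  have h2 : Continuous fun t => pd i ψ (i.insertNth t w) :=
    (contDiff_pd i hψ.1).continuous.comp (continuous_insertNth_left i w)
  by_cases hi : i = 0
  · subst hi
    rw [dom_zero]
    have := integral_Ioi_cpow_deriv h1 h2 (slice_decay (hψ.2 []) hw) (slice_decay (hψ.2 [0]) hw) hz
    refine ⟨this.1, this.2.trans ?_⟩
    simp [bdCoeff]
  · rw [dom_ne hi]
    have := integral_Ioo_cpow_deriv h1 h2 hz
    refine ⟨this.1, this.2.trans ?_⟩
    simp [bdCoeff, hi]

theorem slice_integral_pd {ψ : (Fin (n + 1) → ℝ) → ℝ} (hψ : SmoothClass (rapid n) ψ)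
    (i : Fin (n + 1)) {w : Fin n → ℝ} (hw : ∀ j, w j ∈ dom (i.succAbove j)) :
    IntegrableOn (fun t : ℝ => (pd i ψ (i.insertNth t w) : ℂ)) (dom i) ∧
    ∫ t in dom i, (pd i ψ (i.insertNth t w) : ℂ) =
      bdCoeff i * ψ (i.insertNth 1 w) - ψ (i.insertNth 0 w) := by
  have h1 := fun t => hasDerivAt_insertNth hψ.1 i w t
  have h2 : Continuous fun t => pd i ψ (i.insertNth t w) :=
    (contDiff_pd i hψ.1).continuous.comp (continuous_insertNth_left i w)
  have h3 : Continuous fun t => ψ (i.insertNth t w) :=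
    hψ.1.continuous.comp (continuous_insertNth_left i w)
  rw [integral_complex_ofReal]
  by_cases hi : i = 0
  · subst hi
    rw [dom_zero]
    have hint : IntegrableOn (fun t : ℝ => pd 0 ψ ((0 : Fin (n + 1)).insertNth t w)) (Ioi 0) := by
      obtain ⟨C, hC⟩ := slice_decay (hψ.2 [0]) hw 2
      refine Integrable.mono' ((integrableOn_rpow_mul_Ioi (σ := 1) one_pos (M := 2)
        (by norm_num)).const_mul C) h2.aestronglyMeasurable ?_
      filter_upwards [ae_restrict_mem measurableSet_Ioi] with t ht
      have ht0 : (0:ℝ) < t := ht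
      have hp : 0 < (1 + t) ^ 2 := by positivity
      simp only [sub_self, Real.rpow_zero, one_mul]
      rw [← div_eq_mul_inv, le_div_iff₀ hp, mul_comm]
      exact hC t ht0.le
    refine ⟨hint.ofReal, ?_⟩
    have hlim : Tendsto (fun t : ℝ => ψ ((0 : Fin (n + 1)).insertNth t w)) atTop (𝓝 0) := by
      obtain ⟨C, hC⟩ := slice_decay (hψ.2 []) hw 1
      rw [tendsto_zero_iff_norm_tendsto_zero]
      have hb : Tendsto (fun t : ℝ => C * t⁻¹) atTop (𝓝 0) := by
        simpa using (tendsto_inv_atTop_zero (𝕜 := ℝ)).const_mul C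
      refine squeeze_zero' (Eventually.of_forall fun _ => norm_nonneg _) ?_ hb
      filter_upwards [eventually_gt_atTop 0] with t ht
      rw [← div_eq_mul_inv, le_div_iff₀ ht, mul_comm, Real.norm_eq_abs]
      have := hC t ht.le
      rw [pow_one] at this
      refine le_trans ?_ this
      have : 0 ≤ |ψ ((0 : Fin (n + 1)).insertNth t w)| := abs_nonneg _
      change t * |ψ ((0 : Fin (n + 1)).insertNth t w)| ≤
        (1 + t) * |ψ ((0 : Fin (n + 1)).insertNth t w)|
      nlinarith
    rw [integral_Ioi_of_hasDerivAt_of_tendsto h3.continuousWithinAt (fun t _ => h1 t) hint hlim]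
    simp [bdCoeff]
  · rw [dom_ne hi]
    have hint : IntegrableOn (fun t : ℝ => pd i ψ (i.insertNth t w)) (Ioo 0 1) :=
      (h2.integrableOn_Icc).mono_set Ioo_subset_Icc_self
    refine ⟨hint.ofReal, ?_⟩
    rw [← integral_Ioc_eq_integral_Ioo, ← intervalIntegral.integral_of_le zero_le_one,
      intervalIntegral.integral_eq_sub_of_hasDerivAt (fun t _ => h1 t) (h2.intervalIntegrable _ _)]
    simp [bdCoeff, hi]

theorem update_re_pos {z : Fin (n + 1) → ℂ} (hz : ∀ i, 0 < (z i).re) (i : Fin (n + 1)) {a : ℂ}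
    (ha : 0 < a.re) : ∀ j, 0 < (Function.update z i a j).re := by
  intro j
  by_cases h : j = i
  · subst h; simpa using ha
  · rw [Function.update_of_ne h]; exact hz j

/-- Integration by parts in the `i`-th variable. -/
theorem mellinCube_ibp {ψ : (Fin (n + 1) → ℝ) → ℝ} (hψ : SmoothClass (rapid n) ψ)
    {z : Fin (n + 1) → ℂ} (hz : ∀ i, 0 < (z i).re) (i : Fin (n + 1)) :
    z i * mellinCube z ψ = bdCoeff i * mellinCube (Function.update z i 1) (ev i 1 ψ) -
      mellinCube (Function.update z i (z i + 1)) (pd i ψ) := by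
  have i1 := (integrable_mellin hψ hz).const_mul (z i)
  have i2 := integrable_mellin (hψ.pd i) (update_re_pos hz i (a := z i + 1)
    (by simp; linarith [hz i]))
  have i3 := (integrable_mellin (hψ.ev i zero_le_one le_rfl) (update_re_pos hz i (a := 1)
    (by simp))).const_mul (bdCoeff i : ℂ)
  -- The weight spreads the boundary term over the variable `u i`, so that all three terms are
  -- integrals over the same cube and can be compared slice by slice.
  have key := integral_eq_zero_of_slices i ((i1.add i2).sub i3) ?_
  · rw [integral_sub' (i1.add i2) i3, integral_add' i1 i2, integral_const_mul, integral_const_mul]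
      at key
    unfold mellinCube
    linear_combination key
  · intro w hw
    obtain ⟨s1, s2⟩ := slice_integral_deriv hψ i hw (hz i)
    have s3 := (integrableOn_wt i).const_mul (bdCoeff i * ψ (i.insertNth 1 w) : ℂ)
    simp only [Pi.sub_apply, Pi.add_apply, mellinKernel_insertNth, Function.update_self,
      Function.update_of_ne (Fin.succAbove_ne i _), sub_self, Complex.cpow_zero, ev_insertNth,
      add_sub_cancel_right, one_mul]
    set P : ℂ := ∏ j, (w j : ℂ) ^ (z (i.succAbove j) - 1)
    have e : ∀ t : ℝ, z i * ((t : ℂ) ^ (z i - 1) * P * ψ (i.insertNth t w)) +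
        (t : ℂ) ^ z i * P * pd i ψ (i.insertNth t w) -
        bdCoeff i * (P * ((wt i t * ψ (i.insertNth 1 w) : ℝ) : ℂ)) =
        P * ((z i * (t : ℂ) ^ (z i - 1) * ψ (i.insertNth t w) +
          (t : ℂ) ^ z i * pd i ψ (i.insertNth t w)) -
          (bdCoeff i * ψ (i.insertNth 1 w) : ℂ) * wt i t) := by
      intro t; push_cast; ring
    simp_rw [e]
    rw [integral_const_mul, integral_sub s1 s3, s2, integral_const_mul, integral_wt]
    ring

/-- The fundamental theorem of calculus in the `i`-th variable. -/
theorem mellinCube_ftc {ψ : (Fin (n + 1) → ℝ) → ℝ} (hψ : SmoothClass (rapid n) ψ)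
    {z : Fin (n + 1) → ℂ} (hz : ∀ i, 0 < (z i).re) (i : Fin (n + 1)) (hzi : z i = 1) :
    bdCoeff i * mellinCube z (ev i 1 ψ) - mellinCube z (pd i ψ) = mellinCube z (ev i 0 ψ) := by
  have i1 := (integrable_mellin (hψ.ev i zero_le_one le_rfl) hz).const_mul (bdCoeff i : ℂ)
  have i2 := integrable_mellin (hψ.pd i) hz
  have i3 := integrable_mellin (hψ.ev i le_rfl zero_le_one) hz
  have key := integral_eq_zero_of_slices i ((i1.sub i2).sub i3) ?_
  · rw [integral_sub' (i1.sub i2) i3, integral_sub' i1 i2, integral_const_mul] at key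
    unfold mellinCube
    linear_combination key
  · intro w hw
    obtain ⟨s1, s2⟩ := slice_integral_pd hψ i hw
    have s3 := (integrableOn_wt i).const_mul
      (bdCoeff i * ψ (i.insertNth 1 w) - ψ (i.insertNth 0 w) : ℂ)
    simp only [Pi.sub_apply, mellinKernel_insertNth, hzi, sub_self, Complex.cpow_zero,
      ev_insertNth, one_mul]
    set P : ℂ := ∏ j, (w j : ℂ) ^ (z (i.succAbove j) - 1)
    have e : ∀ t : ℝ, bdCoeff i * (P * ((wt i t * ψ (i.insertNth 1 w) : ℝ) : ℂ)) -
        P * pd i ψ (i.insertNth t w) - P * ((wt i t * ψ (i.insertNth 0 w) : ℝ) : ℂ) =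
        P * ((bdCoeff i * ψ (i.insertNth 1 w) - ψ (i.insertNth 0 w) : ℂ) * wt i t -
          pd i ψ (i.insertNth t w)) := by
      intro t; push_cast; ring
    simp_rw [e]
    rw [integral_const_mul, integral_sub s3 s1, s2, integral_const_mul, integral_wt]
    ring

theorem SmoothClass.iterate_pd {W : Set ((Fin (n + 1) → ℝ) → ℝ)} {ψ : (Fin (n + 1) → ℝ) → ℝ}
    (h : SmoothClass W ψ) (i : Fin (n + 1)) (m : ℕ) : SmoothClass W ((LieZeta.pd i)^[m] ψ) := by
  rw [← pds_replicate]; exact h.pds _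

/-- Iterated integration by parts in the `i`-th variable. -/
theorem mellinCube_ibp_iterate {ψ : (Fin (n + 1) → ℝ) → ℝ} (hψ : SmoothClass (rapid n) ψ)
    {z : Fin (n + 1) → ℂ} (hz : ∀ i, 0 < (z i).re) (i : Fin (n + 1)) (J : ℕ) :
    (∏ j ∈ Finset.range J, (z i + j)) * mellinCube z ψ =
      ∑ j ∈ Finset.range J, (-1) ^ j * (∏ k ∈ Finset.Ico (j + 1) J, (z i + k)) *
        (bdCoeff i * mellinCube (Function.update z i 1) (ev i 1 ((pd i)^[j] ψ))) +
      (-1) ^ J * mellinCube (Function.update z i (z i + J)) ((pd i)^[J] ψ) := by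
  induction J with
  | zero => simp
  | succ J ih =>
    rw [Finset.prod_range_succ, Finset.sum_range_succ]
    have hzJ : ∀ k, 0 < (Function.update z i (z i + J) k).re :=
      update_re_pos hz i (by simp; linarith [hz i, J.cast_nonneg (α := ℝ)])
    have h1 := mellinCube_ibp (hψ.iterate_pd i J) hzJ i
    simp only [Function.update_self, Function.update_idem] at h1
    rw [← Function.iterate_succ_apply' (pd i) J ψ] at h1
    have h2 : ∑ j ∈ Finset.range J, (-1 : ℂ) ^ j * (∏ k ∈ Finset.Ico (j + 1) (J + 1), (z i + k)) *
        (bdCoeff i * mellinCube (Function.update z i 1) (ev i 1 ((pd i)^[j] ψ))) =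
        (z i + J) * ∑ j ∈ Finset.range J, (-1) ^ j * (∏ k ∈ Finset.Ico (j + 1) J, (z i + k)) *
        (bdCoeff i * mellinCube (Function.update z i 1) (ev i 1 ((pd i)^[j] ψ))) := by
      rw [Finset.mul_sum]
      refine Finset.sum_congr rfl fun j hj => ?_
      rw [Finset.prod_Ico_succ_top (by have := Finset.mem_range.1 hj; omega)]
      ring
    rw [h2, Finset.Ico_self, Finset.prod_empty]
    have h3 : Function.update z i (z i + (J : ℂ) + 1) = Function.update z i (z i + ((J + 1 : ℕ) : ℂ)) := by
      push_cast; ring_nf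
    rw [h3] at h1
    linear_combination (z i + J) * ih + (-1) ^ J * h1

end Continuation

end LieZeta

namespace LieZeta

set_option autoImplicit false

/-! ### Continuation of the Mellin integral to nonpositive integral exponents. -/

section MellinContinuation

open Filter Topology Set
open scoped ContDiff

variable {n : ℕ}

/-- For every variable `i` in the list, differentiate `J i` times and restrict to `u i = 0`. -/
noncomputable def evZeros (J : Fin (n + 1) → ℕ) :
    List (Fin (n + 1)) → ((Fin (n + 1) → ℝ) → ℝ) → (Fin (n + 1) → ℝ) → ℝ
  | [], ψ => ψ
  | i :: S, ψ => evZeros J S (ev i 0 ((pd i)^[J i] ψ))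

theorem SmoothClass.evZeros (J : Fin (n + 1) → ℕ) (S : List (Fin (n + 1)))
    {ψ : (Fin (n + 1) → ℝ) → ℝ} (h : SmoothClass (rapid n) ψ) :
    SmoothClass (rapid n : Set ((Fin (n + 1) → ℝ) → ℝ)) (evZeros J S ψ) := by
  induction S generalizing ψ with
  | nil => exact h
  | cons i S ih => exact ih ((h.iterate_pd i (J i)).ev i le_rfl zero_le_one)

theorem iterate_pd_comm (i j : Fin (n + 1)) (m : ℕ) {ψ : (Fin (n + 1) → ℝ) → ℝ}
    (h : ContDiff ℝ ∞ ψ) : (pd j)^[m] (pd i ψ) = pd i ((pd j)^[m] ψ) := by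
  induction m generalizing ψ with
  | zero => rfl
  | succ m ih =>
    rw [Function.iterate_succ_apply, Function.iterate_succ_apply, pd_comm j i h,
      ih (contDiff_pd j h)]

theorem iterate_pd_ev {i j : Fin (n + 1)} (hij : j ≠ i) (a : ℝ) (m : ℕ)
    {ψ : (Fin (n + 1) → ℝ) → ℝ} (h : ContDiff ℝ ∞ ψ) :
    (pd j)^[m] (ev i a ψ) = ev i a ((pd j)^[m] ψ) := by
  induction m generalizing ψ with
  | zero => rfl
  | succ m ih =>
    rw [Function.iterate_succ_apply, Function.iterate_succ_apply, pd_ev i j a h, if_neg hij,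
      ih (contDiff_pd j h)]

theorem contDiff_iterate_pd (i : Fin (n + 1)) (m : ℕ) {ψ : (Fin (n + 1) → ℝ) → ℝ}
    (h : ContDiff ℝ ∞ ψ) : ContDiff ℝ ∞ ((pd i)^[m] ψ) := by
  rw [← pds_replicate]; exact contDiff_pds _ h

theorem evZeros_ev (J : Fin (n + 1) → ℕ) (S : List (Fin (n + 1))) {i : Fin (n + 1)} (hi : i ∉ S)
    (a : ℝ) {ψ : (Fin (n + 1) → ℝ) → ℝ} (h : ContDiff ℝ ∞ ψ) :
    evZeros J S (ev i a ψ) = ev i a (evZeros J S ψ) := by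
  induction S generalizing ψ with
  | nil => rfl
  | cons j S ih =>
    have hij : j ≠ i := fun e => hi (by simp [e])
    have hc := contDiff_iterate_pd j (J j) h
    simp only [evZeros]
    rw [iterate_pd_ev hij a _ h, ev_comm hij, ih (fun h' => hi (List.mem_cons_of_mem _ h'))
      (contDiff_ev j 0 hc)]

theorem evZeros_pd (J : Fin (n + 1) → ℕ) (S : List (Fin (n + 1))) {i : Fin (n + 1)} (hi : i ∉ S)
    {ψ : (Fin (n + 1) → ℝ) → ℝ} (h : ContDiff ℝ ∞ ψ) :
    evZeros J S (pd i ψ) = pd i (evZeros J S ψ) := by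
  induction S generalizing ψ with
  | nil => rfl
  | cons j S ih =>
    have hij : i ≠ j := fun e => hi (by simp [e])
    have hc := contDiff_iterate_pd j (J j) h
    simp only [evZeros]
    rw [← ih (fun h' => hi (List.mem_cons_of_mem _ h')) (contDiff_ev j 0 hc), pd_ev j i 0 hc,
      if_neg hij, iterate_pd_comm i j _ h]

/-- Because the list has no repetitions, each restriction commutes with all later derivatives and
restrictions. The operations therefore collect into one iterated partial derivative, evaluated on a
face. -/
theorem evZeros_apply (J : Fin (n + 1) → ℕ) (S : List (Fin (n + 1))) (hS : S.Nodup)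
    {ψ : (Fin (n + 1) → ℝ) → ℝ} (h : ContDiff ℝ ∞ ψ) (u : Fin (n + 1) → ℝ) :
    evZeros J S ψ u = (S.map fun i => wt i (u i)).prod *
      pds (S.flatMap fun i => List.replicate (J i) i) ψ (fun j => if j ∈ S then 0 else u j) := by
  induction S generalizing ψ u with
  | nil => simp [evZeros, pds]
  | cons i S ih =>
    rw [List.nodup_cons] at hS
    have hc := contDiff_iterate_pd i (J i) h
    simp only [evZeros]
    rw [evZeros_ev J S hS.1 0 hc]
    simp only [ev]
    rw [ih hS.2 hc, List.flatMap_cons, pds_append, pds_replicate]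
    have e1 : (S.map fun j => wt j (Function.update u i 0 j)) = S.map fun j => wt j (u j) := by
      refine List.map_congr_left fun j hj => ?_
      rw [Function.update_of_ne]
      rintro rfl; exact hS.1 hj
    have e2 : (fun j => if j ∈ S then 0 else Function.update u i 0 j) =
        fun j => if j ∈ i :: S then 0 else u j := by
      funext j
      by_cases hji : j = i
      · subst hji; simp
      · simp [hji]
    rw [e1, e2, List.map_cons, List.prod_cons, mul_assoc]

/-- Induction on the list of variables whose exponents may be nonpositive. Integrating by parts `J i
+ 1` times raises the exponent of `u i` into the domain of convergence, at the cost of the factor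
`∏_{j ≤ J i} (e i s + j)` and of boundary terms whose exponent in `u i` is `1`. At `p` the factor
with `j = J i` vanishes. Only the last boundary term and the remaining integral survive, and the
fundamental theorem of calculus joins them into the restriction to `u i = 0`. -/
theorem mellinCube_continuation_of_forall (J : Fin (n + 1) → ℕ) {U : Set ℂ} {p : ℂ}
    (hp : p ∈ U) (S : List (Fin (n + 1))) (hS : S.Nodup) (e : Fin (n + 1) → ℂ → ℂ)
    (he : ∀ i, Differentiable ℂ (e i)) (hpos : ∀ i ∉ S, ∀ s ∈ U, 0 < (e i s).re)
    (hS' : ∀ i ∈ S, ∀ s ∈ U, 0 < (e i s).re + J i + 1) (hSp : ∀ i ∈ S, e i p = -J i)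
    {ψ : (Fin (n + 1) → ℝ) → ℝ} (hψ : SmoothClass (rapid n) ψ) :
    ∃ H : ℂ → ℂ, (∀ s ∈ U, DifferentiableAt ℂ H s) ∧
      (∀ s ∈ U, (∀ i, 0 < (e i s).re) →
        H s = (S.map fun i => ∏ j ∈ Finset.range (J i + 1), (e i s + j)).prod *
          mellinCube (fun i => e i s) ψ) ∧
      H p = (S.map fun i => (-1 : ℂ) ^ J i).prod *
        mellinCube (fun i => if i ∈ S then 1 else e i p) (evZeros J S ψ) := by
  induction S generalizing e ψ with
  | nil =>
    refine ⟨fun s => mellinCube (fun i => e i s) ψ, fun s hs =>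
      differentiableAt_mellinCube hψ he fun i => hpos i (by simp) s hs, fun s _ _ => by simp, ?_⟩
    simp [evZeros]
  | cons i S ih =>
    rw [List.nodup_cons] at hS
    -- The induction hypothesis after the exponent of `u i` has been replaced by a function `f` with
    -- positive real part. It is used with `f = 1` for the boundary terms and with the raised
    -- exponent for the remaining integral.
    have hex : ∀ (f : ℂ → ℂ) (φ : (Fin (n + 1) → ℝ) → ℝ), Differentiable ℂ f →
        (∀ s ∈ U, 0 < (f s).re) → SmoothClass (rapid n) φ →
        ∃ H : ℂ → ℂ, (∀ s ∈ U, DifferentiableAt ℂ H s) ∧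
        (∀ s ∈ U, (∀ k, 0 < (e k s).re) →
          H s = (S.map fun i => ∏ j ∈ Finset.range (J i + 1), (e i s + j)).prod *
            mellinCube (Function.update (fun k => e k s) i (f s)) φ) ∧
        H p = (S.map fun i => (-1 : ℂ) ^ J i).prod *
          mellinCube (fun k => if k ∈ S then 1 else if k = i then f p else e k p)
            (evZeros J S φ) := by
      intro f φ hf hfpos hφ
      have hne : ∀ k ∈ S, k ≠ i := by rintro k hk rfl; exact hS.1 hk
      obtain ⟨H, h1, h2, h3⟩ := ih hS.2 (Function.update e i f)
        (fun k => by
          by_cases hk : k = i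
          · subst hk; simpa using hf
          · simpa [hk] using he k)
        (fun k hk s hs => by
          by_cases hki : k = i
          · subst hki; simpa using hfpos s hs
          · simpa [hki] using hpos k (by simp [hki, hk]) s hs)
        (fun k hk s hs => by simpa [hne k hk] using hS' k (by simp [hk]) s hs)
        (fun k hk => by simpa [hne k hk] using hSp k (by simp [hk])) hφ
      refine ⟨H, h1, fun s hs hs' => ?_, ?_⟩
      · rw [h2 s hs]
        · congr 2
          · refine List.map_congr_left fun k hk => ?_
            simp [hne k hk]
          · funext k
            by_cases hki : k = i
            · subst hki; simp
            · simp [hki]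
        · intro k
          by_cases hki : k = i
          · subst hki; simpa using hfpos s hs
          · simpa [hki] using hs' k
      · rw [h3]
        congr 2
        funext k
        by_cases hki : k = i
        · subst hki; simp
        · simp [hki]
    have hi := hS' i (by simp)
    choose A hA1 hA2 hA3 using fun j : ℕ => hex (fun _ => 1) (ev i 1 ((pd i)^[j] ψ))
      (differentiable_const _) (fun _ _ => by simp)
      ((hψ.iterate_pd i j).ev i zero_le_one le_rfl)
    obtain ⟨B, hB1, hB2, hB3⟩ := hex (fun s => e i s + ((J i + 1 : ℕ) : ℂ)) ((pd i)^[J i + 1] ψ)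
      ((he i).add_const _) (fun s hs => by
        have := hi s hs
        simp only [Complex.add_re, Complex.natCast_re]
        push_cast
        linarith) (hψ.iterate_pd i _)
    refine ⟨fun s => ∑ j ∈ Finset.range (J i + 1), (-1) ^ j *
      (∏ k ∈ Finset.Ico (j + 1) (J i + 1), (e i s + k)) * (bdCoeff i * A j s) +
      (-1) ^ (J i + 1) * B s, ?_, ?_, ?_⟩
    · intro s hs
      refine DifferentiableAt.add (DifferentiableAt.fun_sum fun j _ => ?_)
        ((hB1 s hs).const_mul _)
      refine DifferentiableAt.mul (DifferentiableAt.const_mul ?_ _) ((hA1 j s hs).const_mul _)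
      exact DifferentiableAt.fun_finsetProd fun k _ => (he i s).add_const _
    · intro s hs hs'
      have key := mellinCube_ibp_iterate hψ hs' i (J i + 1)
      simp only [hA2 _ s hs hs', hB2 s hs hs']
      rw [List.map_cons, List.prod_cons, mul_right_comm, key, add_mul, Finset.sum_mul]
      congr 1
      · refine Finset.sum_congr rfl fun j _ => ?_
        ring
      · ring
    -- For `j < J i` the product contains the factor with `k = J i`, which is zero at `p`.
    · have hz : ∀ j ∈ Finset.range (J i), (-1) ^ j *
          (∏ k ∈ Finset.Ico (j + 1) (J i + 1), (e i p + k)) * (bdCoeff i * A j p) = 0 := by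
        intro j hj
        rw [Finset.prod_eq_zero (i := J i) (by simp at hj ⊢; omega)
          (by rw [hSp i (by simp)]; ring)]
        ring
      beta_reduce
      rw [Finset.sum_range_succ, Finset.sum_eq_zero hz, Finset.Ico_self, Finset.prod_empty,
        hA3, hB3]
      have ez : (fun k => if k ∈ S then 1 else if k = i then e i p + ((J i + 1 : ℕ) : ℂ)
          else e k p) = fun k => if k ∈ i :: S then 1 else e k p := by
        funext k
        by_cases hki : k = i
        · subst hki; simp [hSp k, hS.1]
        · simp [hki]
      have ez' : (fun k => if k ∈ S then 1 else if k = i then 1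
          else e k p) = fun k => if k ∈ i :: S then 1 else e k p := by
        funext k
        by_cases hki : k = i
        · subst hki; simp
        · simp [hki]
      rw [ez, ez']
      have hc := hψ.iterate_pd i (J i)
      have hf := mellinCube_ftc (hc.evZeros J S)
        (z := fun k => if k ∈ i :: S then 1 else e k p) (fun k => by
          by_cases hk : k ∈ i :: S
          · simp only [if_pos hk]; simp
          · simp only [if_neg hk]; exact hpos k hk p hp) i (by simp)
      rw [evZeros_ev J S hS.1 1 hc.1, Function.iterate_succ_apply', evZeros_pd J S hS.1 hc.1]
      change _ = _ * mellinCube _ (evZeros J S (ev i 0 ((pd i)^[J i] ψ)))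
      rw [evZeros_ev J S hS.1 0 hc.1, ← hf, List.map_cons, List.prod_cons]
      ring

theorem integral_prod_wt (n : ℕ) : ∫ u, ∏ i, (wt i (u i) : ℂ) ∂cubeMeasure n = 1 := by
  unfold cubeMeasure
  rw [integral_fintype_prod_eq_prod (fun (i : Fin (n + 1)) t => (wt i t : ℂ))]
  simp [integral_wt]

/-- The list in which every index `i` is repeated `J i` times. -/
def indexList (J : Fin (n + 1) → ℕ) : List (Fin (n + 1)) :=
  (List.finRange (n + 1)).flatMap fun i => List.replicate (J i) i

/-- Continuation of a Mellin integral over `(0, ∞) × (0, 1)^n` to a point where all the exponents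
are nonpositive integers. -/
theorem mellinCube_continuation (J : Fin (n + 1) → ℕ) {U : Set ℂ} {p : ℂ} (hp : p ∈ U)
    (e : Fin (n + 1) → ℂ → ℂ) (he : ∀ i, Differentiable ℂ (e i))
    (hU : ∀ i, ∀ s ∈ U, 0 < (e i s).re + J i + 1) (hep : ∀ i, e i p = -J i)
    {ψ : (Fin (n + 1) → ℝ) → ℝ} (hψ : SmoothClass (rapid n) ψ) :
    ∃ H : ℂ → ℂ, (∀ s ∈ U, DifferentiableAt ℂ H s) ∧
      (∀ s ∈ U, (∀ i, 0 < (e i s).re) →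
        H s = (∏ i, ∏ j ∈ Finset.range (J i + 1), (e i s + j)) *
          mellinCube (fun i => e i s) ψ) ∧
      H p = (∏ i, (-1 : ℂ) ^ J i) * pds (indexList J) ψ 0 := by
  obtain ⟨H, h1, h2, h3⟩ := mellinCube_continuation_of_forall J hp (List.finRange (n + 1))
    (List.nodup_finRange _) e he (fun i hi => absurd (List.mem_finRange i) hi)
    (fun i _ => hU i) (fun i _ => hep i) hψ
  refine ⟨H, h1, fun s hs hs' => ?_, ?_⟩
  · rw [h2 s hs hs', ← Fin.prod_univ_def]
  · rw [h3, ← Fin.prod_univ_def]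
    congr 1
    -- All exponents are now `1`, so the kernel is trivial and the integrand is a constant times the
    -- product of the weights.
    simp only [List.mem_finRange, if_true, mellinCube, mellinKernel, sub_self, Complex.cpow_zero,
      Finset.prod_const_one, one_mul, evZeros_apply J _ (List.nodup_finRange (n + 1)) hψ.1,
      ← Fin.prod_univ_def]
    push_cast
    rw [integral_mul_const, integral_prod_wt, one_mul]
    rfl

end MellinContinuation

end LieZeta

namespace LieZeta

set_option autoImplicit false

/-! ### Decomposition of the orthant into chambers and their coordinates. -/

section Chambers

open Filter Topology Set

variable {n : ℕ}

/-- The coordinates `t i = u 0 ⋯ u i` on the chamber `t 0 > t 1 > ⋯ > t n > 0`. -/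
noncomputable def chart (u : Fin (n + 1) → ℝ) : Fin (n + 1) → ℝ :=
  fun i => ∏ j ∈ Finset.Iic i, u j

theorem chart_zero (u : Fin (n + 1) → ℝ) : chart u 0 = u 0 := by
  have : Finset.Iic (0 : Fin (n + 1)) = {0} := by ext j; simp
  simp [chart, this]

theorem chart_succ (u : Fin (n + 1) → ℝ) (i : Fin n) :
    chart u i.succ = chart u i.castSucc * u i.succ := by
  have : Finset.Iic i.succ = insert i.succ (Finset.Iic i.castSucc) := by
    ext j
    simp only [Finset.mem_Iic, Finset.mem_insert, Fin.le_def, Fin.ext_iff, Fin.val_succ,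
      Fin.val_castSucc]
    omega
  rw [chart, this, Finset.prod_insert (by simp [Fin.le_def]), mul_comm]
  rfl

theorem chart_pos {u : Fin (n + 1) → ℝ} (hu : ∀ i, u i ∈ dom i) (i : Fin (n + 1)) :
    0 < chart u i := Finset.prod_pos fun j _ => dom_pos (hu j)

/-- The set of points with positive and strictly decreasing coordinates. -/
def chamber (n : ℕ) : Set (Fin (n + 1) → ℝ) := {t | (∀ i, 0 < t i) ∧ StrictAnti t}

theorem image_chart : chart '' {u : Fin (n + 1) → ℝ | ∀ i, u i ∈ dom i} = chamber n := by
  ext t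
  constructor
  · rintro ⟨u, hu, rfl⟩
    refine ⟨chart_pos hu, Fin.strictAnti_iff_succ_lt.2 fun i => ?_⟩
    rw [chart_succ]
    have := hu i.succ
    rw [dom_ne (Fin.succ_ne_zero i)] at this
    exact mul_lt_of_lt_one_right (chart_pos hu _) this.2
  · rintro ⟨h0, h1⟩
    refine ⟨Fin.cons (t 0) fun i => t i.succ / t i.castSucc, ?_, ?_⟩
    · intro i
      refine Fin.cases ?_ (fun i => ?_) i
      · simpa [dom_zero] using h0 0
      · rw [dom_ne (Fin.succ_ne_zero i), Fin.cons_succ]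
        refine ⟨div_pos (h0 _) (h0 _), (div_lt_one (h0 _)).2 (h1 ?_)⟩
        exact Fin.castSucc_lt_succ
    · funext i
      induction i using Fin.induction with
      | zero => rw [chart_zero]; rfl
      | succ i ih => rw [chart_succ, ih, Fin.cons_succ, mul_div_cancel₀ _ (h0 _).ne']

theorem injOn_chart : InjOn chart {u : Fin (n + 1) → ℝ | ∀ i, u i ∈ dom i} := by
  intro u hu v hv h
  funext i
  refine Fin.cases ?_ (fun i => ?_) i
  · rw [← chart_zero u, ← chart_zero v, h]
  · have h1 := congrFun h i.succ
    rw [chart_succ, chart_succ, ← h] at h1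
    exact mul_left_cancel₀ (ne_of_gt (chart_pos hu _)) h1

/-- The derivative of `chart`. -/
noncomputable def chartDeriv (u : Fin (n + 1) → ℝ) :
    (Fin (n + 1) → ℝ) →L[ℝ] (Fin (n + 1) → ℝ) :=
  ContinuousLinearMap.pi fun i => ∑ j ∈ Finset.Iic i, (∏ k ∈ (Finset.Iic i).erase j, u k) •
    (ContinuousLinearMap.proj j : (Fin (n + 1) → ℝ) →L[ℝ] ℝ)

theorem hasFDerivAt_chart (u : Fin (n + 1) → ℝ) : HasFDerivAt chart (chartDeriv u) u := by
  rw [hasFDerivAt_pi']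
  intro i
  have := HasFDerivAt.finsetProd (u := Finset.Iic i) (g := fun j (u : Fin (n + 1) → ℝ) => u j)
    (x := u) (g' := fun j => (ContinuousLinearMap.proj j : (Fin (n + 1) → ℝ) →L[ℝ] ℝ))
    fun j _ => (ContinuousLinearMap.proj j : (Fin (n + 1) → ℝ) →L[ℝ] ℝ).hasFDerivAt
  refine this.congr_fderiv ?_
  ext v; simp [chartDeriv]

/-- The Jacobian matrix is lower triangular with diagonal entries `∏_{k < i} u k`, and `u k` appears
once for each of the `n - k` indices above `k`. -/
theorem det_chartDeriv (u : Fin (n + 1) → ℝ) :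
    (chartDeriv u).det = ∏ i, u i ^ (n - (i : ℕ)) := by
  have hentry : ∀ i j, LinearMap.toMatrix' (chartDeriv u : (Fin (n + 1) → ℝ) →ₗ[ℝ] _) i j =
      if j ≤ i then ∏ k ∈ (Finset.Iic i).erase j, u k else 0 := by
    intro i j
    rw [LinearMap.toMatrix'_apply]
    simp [chartDeriv, Pi.single_apply]
  rw [ContinuousLinearMap.det, ← LinearMap.det_toMatrix', Matrix.det_of_isLowerTriangular]
  · have h1 : ∀ i, LinearMap.toMatrix' (chartDeriv u : (Fin (n + 1) → ℝ) →ₗ[ℝ] _) i i =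
        ∏ k, if k < i then u k else 1 := by
      intro i
      rw [hentry, if_pos le_rfl, ← Finset.prod_filter]
      congr 1
      ext k
      simp [lt_iff_le_and_ne, and_comm]
    simp_rw [h1]
    rw [Finset.prod_comm]
    refine Finset.prod_congr rfl fun k _ => ?_
    rw [← Finset.prod_filter, Finset.prod_const]
    congr 1
    have : Finset.univ.filter (fun i => k < i) = Finset.Ioi k := by ext; simp
    rw [this, Fin.card_Ioi]
    omega
  · intro i j hij
    rw [hentry, if_neg]
    exact not_le.2 (by simpa using hij)

theorem cubeMeasure_eq (n : ℕ) :
    cubeMeasure n = volume.restrict {u : Fin (n + 1) → ℝ | ∀ i, u i ∈ dom i} := by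
  unfold cubeMeasure
  rw [← Measure.restrict_pi_pi, volume_pi]
  congr 1
  ext u; simp

theorem posMeasure_eq (n : ℕ) :
    posMeasure n = volume.restrict {t : Fin n → ℝ | ∀ i, 0 < t i} := by
  unfold posMeasure
  rw [← Measure.restrict_pi_pi, volume_pi]
  congr 1
  ext u; simp

theorem measurableSet_domCube :
    MeasurableSet {u : Fin (n + 1) → ℝ | ∀ i, u i ∈ dom i} := by
  rw [Set.ofPred_forall]
  exact MeasurableSet.iInter fun i => measurable_pi_apply i (measurableSet_dom i)

theorem integral_chamber (g : (Fin (n + 1) → ℝ) → ℂ) :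
    ∫ t in chamber n, g t =
      ∫ u, (∏ i, (u i : ℂ) ^ (n - (i : ℕ))) * g (chart u) ∂cubeMeasure n := by
  rw [← image_chart, integral_image_eq_integral_abs_det_fderiv_smul volume measurableSet_domCube
    (fun u _ => (hasFDerivAt_chart u).hasFDerivWithinAt) injOn_chart, cubeMeasure_eq]
  refine setIntegral_congr_fun measurableSet_domCube fun u hu => ?_
  simp only [det_chartDeriv]
  rw [abs_of_pos (Finset.prod_pos fun i _ => pow_pos (dom_pos (hu i)) _), Complex.real_smul]
  push_cast
  rfl

theorem measurableSet_chamber : MeasurableSet (chamber n) := by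
  have : chamber n = {t : Fin (n + 1) → ℝ | ∀ i, 0 < t i} ∩
      {t : Fin (n + 1) → ℝ | ∀ i : Fin n, t i.succ < t i.castSucc} := by
    ext t; simp only [chamber, Fin.strictAnti_iff_succ_lt]; rfl
  rw [this]
  refine MeasurableSet.inter ?_ ?_
  · rw [Set.ofPred_forall]
    exact MeasurableSet.iInter fun i => measurableSet_lt measurable_const (measurable_pi_apply i)
  · rw [Set.ofPred_forall]
    exact MeasurableSet.iInter fun i =>
      measurableSet_lt (measurable_pi_apply _) (measurable_pi_apply _)

/-- Ties between coordinates lie in finitely many hyperplanes, which are null sets. Hence the open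
chambers exhaust the orthant almost everywhere. -/
theorem ae_injective (n : ℕ) : ∀ᵐ t : Fin n → ℝ, Function.Injective t := by
  have h : ∀ i j : Fin n, i ≠ j → ∀ᵐ t : Fin n → ℝ, t i ≠ t j := by
    intro i j hij
    let f : (Fin n → ℝ) →ₗ[ℝ] ℝ := LinearMap.proj (R := ℝ) (φ := fun _ : Fin n => ℝ) i - LinearMap.proj j
    have h1 : LinearMap.ker f ≠ ⊤ := by
      intro h
      have : Pi.single i (1:ℝ) ∈ LinearMap.ker f := by rw [h]; trivial
      simp [f, hij.symm] at this
    have h2 := Measure.addHaar_submodule volume (LinearMap.ker f) h1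
    rw [ae_iff]
    convert h2 using 2
    ext t
    simp [f, sub_eq_zero]
  have h' : ∀ᵐ t : Fin n → ℝ, ∀ i j : Fin n, i ≠ j → t i ≠ t j := by
    rw [ae_all_iff]; intro i
    rw [ae_all_iff]; intro j
    by_cases hij : i = j
    · exact Eventually.of_forall fun t h => absurd hij h
    · filter_upwards [h i j hij] with t ht _ using ht
  filter_upwards [h'] with t ht i j hij
  by_contra hne
  exact ht i j hne hij

theorem exists_strictAnti_comp {t : Fin n → ℝ} (ht : Function.Injective t) :
    ∃ π : Equiv.Perm (Fin n), StrictAnti (t ∘ π) := by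
  refine ⟨Tuple.sort (-t), ?_⟩
  have h := Tuple.monotone_sort (-t)
  have h1 : Antitone (t ∘ Tuple.sort (-t)) := fun i j hij => by
    have := h hij
    simpa using this
  exact h1.strictAnti_of_injective (ht.comp (Equiv.injective _))

theorem eq_of_strictAnti_comp {t : Fin n → ℝ} {π π' : Equiv.Perm (Fin n)}
    (h : StrictAnti (t ∘ π)) (h' : StrictAnti (t ∘ π')) : π = π' := by
  have hr : t ∘ π = t ∘ π' := (h.range_inj h').1 (by simp [EquivLike.range_comp])
  have ht : Function.Injective t := by
    have := h.injective.comp π.symm.injective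
    simpa [Function.comp_def] using this
  ext i
  exact congrArg Fin.val (ht (congrFun hr i))

/-- Decomposition of an integral over the open orthant into integrals over chambers. -/
theorem integral_posMeasure_eq_sum {f : (Fin (n + 1) → ℝ) → ℂ}
    (hf : Integrable f (posMeasure (n + 1))) :
    ∫ t, f t ∂posMeasure (n + 1) = ∑ π : Equiv.Perm (Fin (n + 1)),
      ∫ u, (∏ i, (u i : ℂ) ^ (n - (i : ℕ))) * f (chart u ∘ π.symm) ∂cubeMeasure n := by
  have mp : ∀ π : Equiv.Perm (Fin (n + 1)), MeasurePreserving
      (fun t : Fin (n + 1) → ℝ => t ∘ π) volume volume := by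
    intro π
    have h := volume_measurePreserving_piCongrLeft (fun _ : Fin (n + 1) => ℝ) π.symm
    convert h using 1
    funext t i
    have := MeasurableEquiv.piCongrLeft_apply_apply (β := fun _ => ℝ) π.symm t (π i)
    simpa using this.symm
  have hms : ∀ π : Equiv.Perm (Fin (n + 1)), MeasurableSet {t : Fin (n + 1) → ℝ | t ∘ π ∈ chamber n} :=
    fun π => (mp π).measurable measurableSet_chamber
  have hsub : ∀ π : Equiv.Perm (Fin (n + 1)),
      {t : Fin (n + 1) → ℝ | t ∘ π ∈ chamber n} ⊆ {t | ∀ i, 0 < t i} := by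
    intro π t ht i
    have := ht.1 (π.symm i)
    simpa using this
  rw [posMeasure_eq] at hf ⊢
  have hU : ({t : Fin (n + 1) → ℝ | ∀ i, 0 < t i} : Set _) =ᵐ[volume]
      ⋃ π : Equiv.Perm (Fin (n + 1)), {t | t ∘ π ∈ chamber n} := by
    filter_upwards [ae_injective (n + 1)] with t ht
    refine propext ⟨fun h => ?_, fun h => ?_⟩
    · obtain ⟨π, hπ⟩ := exists_strictAnti_comp ht
      exact mem_iUnion.2 ⟨π, fun i => h _, hπ⟩
    · obtain ⟨π, hπ⟩ := mem_iUnion.1 h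
      exact hsub π hπ
  rw [setIntegral_congr_set hU, integral_iUnion_fintype hms]
  · refine Finset.sum_congr rfl fun π _ => ?_
    rw [← integral_chamber fun t => f (t ∘ π.symm)]
    have me : MeasurableEmbedding (fun t : Fin (n + 1) → ℝ => t ∘ π) := by
      have := (MeasurableEquiv.piCongrLeft (fun _ : Fin (n + 1) => ℝ) π.symm).measurableEmbedding
      convert this using 1
      funext t i
      have := MeasurableEquiv.piCongrLeft_apply_apply (β := fun _ => ℝ) π.symm t (π i)
      simpa using this.symm
    have := (mp π).setIntegral_preimage_emb me (fun t => f (t ∘ π.symm)) (chamber n)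
    rw [← this]
    refine setIntegral_congr_fun (hms π) fun t _ => ?_
    simp [Function.comp_def]
  · intro π π' hne
    refine Set.disjoint_left.2 fun t h h' => hne (eq_of_strictAnti_comp h.2 h'.2)
  · exact fun π => IntegrableOn.mono_set hf (hsub π)

end Chambers

end LieZeta

namespace LieZeta

set_option autoImplicit false

/-! ### The integrand in the coordinates of a chamber. -/

section ChamberIntegrand

open Filter Topology Set
open scoped ContDiff

/-- A smooth function on `ℝ` which is `1/y` for `y ≥ 1/2`. -/
noncomputable def smoothInv (y : ℝ) : ℝ := Real.smoothTransition (4 * y - 1) * y⁻¹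

/-- The cofactors are at least `1` on the closed cube but may vanish elsewhere. Cutting off the
inverse keeps all functions smooth on the whole space without changing them on the cube. -/
theorem contDiff_smoothInv : ContDiff ℝ ∞ smoothInv := by
  rw [contDiff_iff_contDiffAt]
  intro y
  by_cases hy : y < 1 / 4
  · have : smoothInv =ᶠ[𝓝 y] fun _ => 0 := by
      filter_upwards [gt_mem_nhds hy] with z hz
      simp [smoothInv, Real.smoothTransition.zero_of_nonpos (show 4 * z - 1 ≤ 0 by linarith)]
    exact contDiffAt_const.congr_of_eventuallyEq this
  · have h1 : ContDiffAt ℝ ∞ (fun y : ℝ => Real.smoothTransition (4 * y - 1)) y :=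
      (Real.smoothTransition.contDiff.comp (by fun_prop)).contDiffAt
    exact h1.mul (contDiffAt_inv ℝ (by rintro rfl; norm_num at hy))

theorem smoothInv_eventuallyEq {y : ℝ} (hy : 1 ≤ y) : smoothInv =ᶠ[𝓝 y] Inv.inv := by
  filter_upwards [lt_mem_nhds (show (1:ℝ) / 2 < y by linarith)] with z hz
  simp [smoothInv, Real.smoothTransition.one_of_one_le (show 1 ≤ 4 * z - 1 by linarith)]

theorem smoothInv_eq {y : ℝ} (hy : 1 ≤ y) : smoothInv y = y⁻¹ := (smoothInv_eventuallyEq hy).eq_of_nhds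

theorem iteratedDeriv_smoothInv {y : ℝ} (hy : 1 ≤ y) (j : ℕ) :
    iteratedDeriv j smoothInv y = (-1) ^ j * j.factorial * y ^ (-1 - (j : ℤ)) := by
  rw [(smoothInv_eventuallyEq hy).iteratedDeriv_eq, iteratedDeriv_eq_iterate, iter_deriv_inv']

theorem abs_iteratedDeriv_smoothInv_le {y : ℝ} (hy : 1 ≤ y) (j : ℕ) :
    |iteratedDeriv j smoothInv y| ≤ j.factorial := by
  rw [iteratedDeriv_smoothInv hy, abs_mul, abs_mul, abs_pow, abs_neg, abs_one, one_pow, one_mul,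
    Nat.abs_cast]
  refine mul_le_of_le_one_right (by positivity) ?_
  rw [abs_of_pos (zpow_pos (by linarith) _)]
  exact zpow_le_one_of_nonpos₀ hy (by omega)

variable {n r : ℕ}

/-- `j k` is the first row whose `k`-th entry does not vanish. -/
def IsLeading (c : Fin (n + 1) → Fin r → ℕ) (j : Fin r → Fin (n + 1)) : Prop :=
  ∀ k, c (j k) k ≠ 0 ∧ ∀ i < j k, c i k = 0

theorem IsFormFamily.exists_isLeading {c : Fin (n + 1) → Fin r → ℕ} (hc : IsFormFamily c) :
    ∃ j, IsLeading c j := by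
  have : ∀ k, ∃ j : Fin (n + 1), c j k ≠ 0 ∧ ∀ i < j, c i k = 0 := by
    intro k
    obtain ⟨i, hi⟩ := hc.simple k
    have hne : {i | c i k ≠ 0}.Nonempty := ⟨i, by simp [hi]⟩
    refine ⟨wellFounded_lt.min _ hne, wellFounded_lt.min_mem _ hne, fun i hi => ?_⟩
    by_contra h
    exact wellFounded_lt.not_lt_min _ h hi
  choose j hj using this
  exact ⟨j, hj⟩

/-- The value of the `k`-th dual form on the chamber, divided by its leading monomial. -/
noncomputable def cofactor (c : Fin (n + 1) → Fin r → ℕ) (j : Fin r → Fin (n + 1)) (k : Fin r)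
    (u : Fin (n + 1) → ℝ) : ℝ := ∑ i, (c i k : ℝ) * ∏ m ∈ Finset.Ioc (j k) i, u m

/-- The `k`-th dual form in the coordinates of the chamber. -/
noncomputable def chartForm (c : Fin (n + 1) → Fin r → ℕ) (k : Fin r) (u : Fin (n + 1) → ℝ) : ℝ :=
  dualForm c k (chart u)

variable {c : Fin (n + 1) → Fin r → ℕ} {j : Fin r → Fin (n + 1)}

/-- Rows before `j k` do not contribute to the `k`-th dual form, and every later coordinate `t_i` is
a multiple of `t_{j k}`. -/
theorem chartForm_eq (hj : IsLeading c j) (k : Fin r) (u : Fin (n + 1) → ℝ) :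
    chartForm c k u = (∏ m ∈ Finset.Iic (j k), u m) * cofactor c j k u := by
  unfold chartForm dualForm cofactor chart
  rw [Finset.mul_sum]
  refine Finset.sum_congr rfl fun i _ => ?_
  by_cases hi : i < j k
  · simp [(hj k).2 i hi]
  · have h1 : Finset.Iic i = Finset.Iic (j k) ∪ Finset.Ioc (j k) i := by
      ext m; simp only [Finset.mem_union, Finset.mem_Iic, Finset.mem_Ioc]
      rw [not_lt] at hi
      constructor
      · intro h
        rcases le_or_gt m (j k) with h' | h'
        · exact Or.inl h'
        · exact Or.inr ⟨h', h⟩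
      · rintro (h | h)
        · exact h.trans hi
        · exact h.2
    rw [h1, Finset.prod_union]
    · ring
    · rw [Finset.disjoint_left]
      intro m h1 h2
      simp only [Finset.mem_Iic, Finset.mem_Ioc] at h1 h2
      exact absurd h1 (not_le.2 h2.1)

theorem closedCube_nonneg {u : Fin (n + 1) → ℝ} (hu : u ∈ closedCube n) (i : Fin (n + 1)) :
    0 ≤ u i := by
  by_cases hi : i = 0
  · subst hi; exact hu.1
  · exact (hu.2 i hi).1

/-- The leading term is a nonzero natural number with an empty product, and on the cube the other
terms are nonnegative. This is where the ordering of the chamber resolves the pole along `T_k = 0`.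
-/
theorem one_le_cofactor (hj : IsLeading c j) (k : Fin r) {u : Fin (n + 1) → ℝ}
    (hu : u ∈ closedCube n) : 1 ≤ cofactor c j k u := by
  unfold cofactor
  have h1 : (1 : ℝ) ≤ (c (j k) k : ℝ) * ∏ m ∈ Finset.Ioc (j k) (j k), u m := by
    simp only [Finset.Ioc_self, Finset.prod_empty, mul_one]
    exact_mod_cast Nat.one_le_iff_ne_zero.2 (hj k).1
  refine h1.trans (Finset.single_le_sum (f := fun i => (c i k : ℝ) * ∏ m ∈ Finset.Ioc (j k) i, u m)
    (fun i _ => ?_) (Finset.mem_univ (j k)))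
  exact mul_nonneg (Nat.cast_nonneg _) (Finset.prod_nonneg fun m _ => closedCube_nonneg hu m)

/-- The cofactor is a polynomial in the coordinates with natural coefficients. The general subring
serves both the growth estimates and the rationality of the derivatives at `0`. -/
theorem cofactor_mem (W : Subring ((Fin (n + 1) → ℝ) → ℝ)) (hW : ∀ i, (fun u => u i) ∈ W)
    (k : Fin r) : cofactor c j k ∈ W := by
  have : cofactor c j k = ∑ i, (c i k : (Fin (n + 1) → ℝ) → ℝ) * ∏ m ∈ Finset.Ioc (j k) i,
      (fun u : Fin (n + 1) → ℝ => u m) := by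
    ext u; simp [cofactor]
  rw [this]
  exact W.sum_mem fun i _ => W.mul_mem (natCast_mem W _) (W.prod_mem fun m _ => hW m)

theorem chartForm_mem (W : Subring ((Fin (n + 1) → ℝ) → ℝ)) (hW : ∀ i, (fun u => u i) ∈ W)
    (k : Fin r) : chartForm c k ∈ W := by
  have : chartForm c k = ∑ i, (c i k : (Fin (n + 1) → ℝ) → ℝ) * ∏ m ∈ Finset.Iic i,
      (fun u : Fin (n + 1) → ℝ => u m) := by
    ext u; simp [chartForm, dualForm, chart]
  rw [this]
  exact W.sum_mem fun i _ => W.mul_mem (natCast_mem W _) (W.prod_mem fun m _ => hW m)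

theorem chartForm_nonneg (k : Fin r) {u : Fin (n + 1) → ℝ} (hu : u ∈ closedCube n) :
    0 ≤ chartForm c k u := by
  unfold chartForm dualForm chart
  exact Finset.sum_nonneg fun _ _ => mul_nonneg (Nat.cast_nonneg _)
    (Finset.prod_nonneg fun m _ => closedCube_nonneg hu m)

theorem mem_smoothSubring {W : Subring ((Fin (n + 1) → ℝ) → ℝ)} {ψ : (Fin (n + 1) → ℝ) → ℝ} :
    ψ ∈ smoothSubring W ↔ SmoothClass (W : Set ((Fin (n + 1) → ℝ) → ℝ)) ψ := Iff.rfl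

theorem comp_mem_smoothSubring {W : Subring ((Fin (n + 1) → ℝ) → ℝ)} {f : ℝ → ℝ}
    {σ : (Fin (n + 1) → ℝ) → ℝ} (hf : ContDiff ℝ ∞ f) (hf' : ∀ j, iteratedDeriv j f ∘ σ ∈ W)
    (hσ : σ ∈ smoothSubring W) : f ∘ σ ∈ smoothSubring W :=
  SmoothClass.comp (W₂ := (W : Set ((Fin (n + 1) → ℝ) → ℝ))) (W₃ := W.toAddSubgroup)
    (fun _ hf _ hg => W.mul_mem hf hg) hf hf' (mem_smoothSubring.1 hσ)

/-- The smooth factor of the integrand on a chamber. -/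
noncomputable def chamberFun (c : Fin (n + 1) → Fin r → ℕ) (j : Fin r → Fin (n + 1))
    (f : Fin r → ℝ → ℝ) : (Fin (n + 1) → ℝ) → ℝ :=
  (∏ k, smoothInv ∘ cofactor c j k) * ∏ k, f k ∘ chartForm c k

theorem smoothClass_smoothInv_cofactor (hj : IsLeading c j) (k : Fin r) :
    smoothInv ∘ cofactor c j k ∈ smoothSubring (growth n) := by
  refine comp_mem_smoothSubring contDiff_smoothInv ?_
    (cofactor_mem (smoothSubring (growth n)) (fun i => smoothClass_coord (coord_mem_growth i)) k)
  intro l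
  refine ⟨0, l.factorial, fun u hu => ?_⟩
  simpa using abs_iteratedDeriv_smoothInv_le (one_le_cofactor hj k hu) l

/-- The first row of `c` is not zero, so some dual form `T_k` is at least `u 0` on the cube, and the
single factor `f k (T_k)` provides the rapid decay. Everything else has polynomial growth. -/
theorem smoothClass_chamberFun (hc : IsFormFamily c) (hj : IsLeading c j) {f : Fin r → ℝ → ℝ}
    (hf : ∀ k, ContDiff ℝ ∞ (f k))
    (hd : ∀ k, ∀ l M : ℕ, ∃ C : ℝ, ∀ T : ℝ, 0 ≤ T → (1 + T) ^ M * |iteratedDeriv l (f k) T| ≤ C) :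
    SmoothClass (rapid n : Set ((Fin (n + 1) → ℝ) → ℝ)) (chamberFun c j f) := by
  obtain ⟨k₀, hk₀⟩ : ∃ k, c 0 k ≠ 0 := by
    by_contra h
    push Not at h
    exact hc.ne_zero 0 (funext h)
  have hT : ∀ k, chartForm c k ∈ smoothSubring (growth n) := fun k =>
    chartForm_mem _ (fun i => smoothClass_coord (coord_mem_growth i)) k
  have h1 : ∀ k, f k ∘ chartForm c k ∈ smoothSubring (growth n) := by
    intro k
    refine comp_mem_smoothSubring (hf k) ?_ (hT k)
    intro l
    obtain ⟨C, hC⟩ := hd k l 0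
    exact ⟨0, C, fun u hu => by simpa using hC _ (chartForm_nonneg k hu)⟩
  have h2 : SmoothClass (rapid n : Set ((Fin (n + 1) → ℝ) → ℝ)) (f k₀ ∘ chartForm c k₀) := by
    refine SmoothClass.comp (W₂ := (growth n : Set ((Fin (n + 1) → ℝ) → ℝ))) (W₃ := rapid n)
      (fun f hf g hg => rapid_mul_growth hf hg) (hf k₀) ?_ (mem_smoothSubring.1 (hT k₀))
    intro l M
    obtain ⟨C, hC⟩ := hd k₀ l M
    refine ⟨C, fun u hu => le_trans ?_ (hC _ (chartForm_nonneg (c := c) k₀ hu))⟩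
    have h3 : u 0 ≤ chartForm c k₀ u := by
      have h4 : u 0 ≤ (c 0 k₀ : ℝ) * chart u 0 := by
        rw [chart_zero]
        exact le_mul_of_one_le_left hu.1 (by exact_mod_cast Nat.one_le_iff_ne_zero.2 hk₀)
      refine h4.trans (Finset.single_le_sum (f := fun i => (c i k₀ : ℝ) * chart u i)
        (fun i _ => ?_) (Finset.mem_univ 0))
      exact mul_nonneg (Nat.cast_nonneg _) (Finset.prod_nonneg fun m _ => closedCube_nonneg hu m)
    have h5 := hu.1
    simp only [Function.comp_apply]
    gcongr
  have h6 : (∏ k, smoothInv ∘ cofactor c j k) * ∏ k ∈ Finset.univ.erase k₀, f k ∘ chartForm c k ∈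
      smoothSubring (growth n) :=
    Subring.mul_mem _ (Subring.prod_mem _ fun k _ => smoothClass_smoothInv_cofactor hj k)
      (Subring.prod_mem _ fun k _ => h1 k)
  have h7 : chamberFun c j f = (f k₀ ∘ chartForm c k₀) *
      ((∏ k, smoothInv ∘ cofactor c j k) * ∏ k ∈ Finset.univ.erase k₀, f k ∘ chartForm c k) := by
    rw [chamberFun, ← Finset.mul_prod_erase Finset.univ (fun k => f k ∘ chartForm c k)
      (Finset.mem_univ k₀)]
    ring
  rw [h7]
  exact SmoothClass.mul (W₃ := rapid n) (fun f hf g hg => rapid_mul_growth hf hg) h2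
    (mem_smoothSubring.1 h6)

/-- The number of variables divisible by the `i`-th coordinate of the chamber. -/
def poleOrder (j : Fin r → Fin (n + 1)) (i : Fin (n + 1)) : ℕ :=
  (Finset.univ.filter fun k => i ≤ j k).card

theorem prod_leading (j : Fin r → Fin (n + 1)) (u : Fin (n + 1) → ℝ) :
    ∏ k, ∏ m ∈ Finset.Iic (j k), u m = ∏ i, u i ^ poleOrder j i := by
  have h : ∀ k, ∏ m ∈ Finset.Iic (j k), u m = ∏ m, if m ≤ j k then u m else 1 := by
    intro k
    rw [← Finset.prod_filter]
    congr 1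
    ext; simp
  simp_rw [h]
  rw [Finset.prod_comm]
  refine Finset.prod_congr rfl fun m _ => ?_
  rw [← Finset.prod_filter, Finset.prod_const]
  rfl

theorem prod_chart_cpow {u : Fin (n + 1) → ℝ} (hu : ∀ i, 0 ≤ u i) (s : ℂ) :
    ∏ i, ((chart u i : ℝ) : ℂ) ^ s = ∏ i, ((u i : ℂ) ^ s) ^ (n + 1 - (i : ℕ)) := by
  have h1 : ∀ i, ((chart u i : ℝ) : ℂ) ^ s = ∏ m, if m ≤ i then (u m : ℂ) ^ s else 1 := by
    intro i
    rw [← Finset.prod_filter]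
    have : Finset.univ.filter (fun m => m ≤ i) = Finset.Iic i := by ext; simp
    rw [this, chart]
    induction Finset.Iic i using Finset.induction_on with
    | empty => simp
    | insert a S ha ih =>
      rw [Finset.prod_insert ha, Finset.prod_insert ha, Complex.ofReal_mul,
        Complex.mul_cpow_ofReal_nonneg (hu a) (Finset.prod_nonneg fun m _ => hu m), ih]
  simp_rw [h1]
  rw [Finset.prod_comm]
  refine Finset.prod_congr rfl fun m _ => ?_
  rw [← Finset.prod_filter, Finset.prod_const]
  congr 1
  have : Finset.univ.filter (fun i => m ≤ i) = Finset.Ici m := by ext; simp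
  rw [this, Fin.card_Ici]

/-- The exponents of the Mellin integral on a chamber. -/
noncomputable def chamberExp (j : Fin r → Fin (n + 1)) (i : Fin (n + 1)) (s : ℂ) : ℂ :=
  ((n + 1 - (i : ℕ) : ℕ) : ℂ) * s - poleOrder j i

theorem cpow_chamberExp {t : ℝ} (ht : 0 < t) (s : ℂ) (m a : ℕ) (hm : 1 ≤ m) :
    (t : ℂ) ^ (m - 1) * ((t : ℂ) ^ (s - 1)) ^ m * ((t : ℂ) ^ a)⁻¹ =
      (t : ℂ) ^ ((m : ℂ) * s - a - 1) := by
  have ht' : (t : ℂ) ≠ 0 := by exact_mod_cast ht.ne'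
  rw [← Complex.cpow_nat_mul, ← Complex.cpow_natCast, ← Complex.cpow_natCast, ← Complex.cpow_neg,
    ← Complex.cpow_add _ _ ht', ← Complex.cpow_add _ _ ht']
  congr 1
  push_cast [Nat.cast_sub hm]
  ring

variable {Y : Type} [MeasurableSpace Y] (κ : Kind Y)

/-- The Jacobian contributes `n - i` to the exponent of `u i`, the powers of the `t`'s contribute
`(n + 1 - i)(s - 1)`, and the leading monomials of the denominators contribute minus `poleOrder j
i`. The sum is `chamberExp j i s - 1`. -/
theorem Kind.mellinIntegrand_chart (hj : IsLeading c j) (s : ℂ) (x : Fin r → ℝ)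
    {u : Fin (n + 1) → ℝ} (hu : ∀ i, u i ∈ dom i) :
    (∏ i, (u i : ℂ) ^ (n - (i : ℕ))) * κ.mellinIntegrand c s x (chart u) =
      mellinKernel (fun i => chamberExp j i s) u * (chamberFun c j (fun k => κ.φ (x k)) u : ℂ) := by
  have hcube := mem_closedCube_of_dom hu
  have h1 : ∏ k, κ.φ (x k) (dualForm c k (chart u)) / dualForm c k (chart u) =
      (∏ i, u i ^ poleOrder j i)⁻¹ * chamberFun c j (fun k => κ.φ (x k)) u := by
    rw [← prod_leading, ← Finset.prod_inv_distrib]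
    simp only [chamberFun, Pi.mul_apply, Finset.prod_apply, Function.comp_apply]
    rw [← Finset.prod_mul_distrib, ← Finset.prod_mul_distrib]
    refine Finset.prod_congr rfl fun k _ => ?_
    rw [smoothInv_eq (one_le_cofactor hj k hcube)]
    change κ.φ (x k) (chartForm c k u) / chartForm c k u = _
    conv_lhs => rw [div_eq_mul_inv]; rhs; rw [chartForm_eq hj]
    rw [mul_inv]
    ring
  unfold Kind.mellinIntegrand mellinKernel
  rw [h1, prod_chart_cpow (fun i => (dom_pos (hu i)).le)]
  push_cast
  rw [← Finset.prod_inv_distrib, ← mul_assoc, ← mul_assoc, ← Finset.prod_mul_distrib,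
    ← Finset.prod_mul_distrib]
  congr 1
  refine Finset.prod_congr rfl fun i _ => ?_
  rw [chamberExp, ← cpow_chamberExp (dom_pos (hu i)) s _ _ (by omega)]
  congr 3
  omega

theorem IsFormFamily.comp_perm {n : ℕ} {c : Fin n → Fin r → ℕ} (hc : IsFormFamily c)
    (π : Equiv.Perm (Fin n)) : IsFormFamily (c ∘ π) where
  simple k := by
    obtain ⟨i, hi⟩ := hc.simple k
    exact ⟨π.symm i, by simpa using hi⟩
  ne_zero i := hc.ne_zero _

/-- A permutation of the integration variables can be moved to the rows of `c`, so only the standard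
chamber has to be studied, for all reorderings of the family. -/
theorem Kind.mellinIntegrand_comp_perm {n : ℕ} (c : Fin n → Fin r → ℕ) (s : ℂ) (x : Fin r → ℝ)
    (π : Equiv.Perm (Fin n)) (t : Fin n → ℝ) :
    κ.mellinIntegrand c s x (t ∘ π.symm) = κ.mellinIntegrand (c ∘ π) s x t := by
  have h : ∀ k, dualForm c k (t ∘ π.symm) = dualForm (c ∘ π) k t := by
    intro k
    unfold dualForm
    rw [← Equiv.sum_comp π]
    simp
  unfold Kind.mellinIntegrand
  simp_rw [h]
  congr 1
  exact Equiv.prod_comp π.symm fun i => (t i : ℂ) ^ (s - 1)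

/-- The continued function times a power of the Gamma function, as a sum over chambers. -/
theorem Kind.gamma_mul_total_eq_sum (hc : IsFormFamily c)
    {j : Equiv.Perm (Fin (n + 1)) → Fin r → Fin (n + 1)} (hj : ∀ π : Equiv.Perm (Fin (n + 1)), IsLeading (c ∘ π) (j π))
    {s : ℂ} (hs : 1 < s.re) {x : Fin r → ℝ} (hx : ∀ k, 0 < x k) :
    Complex.Gamma s ^ (n + 1) * κ.total c s (fun k => (x k : ℂ)) =
      ∑ π : Equiv.Perm (Fin (n + 1)), mellinCube (fun i => chamberExp (j π) i s)
        (chamberFun (c ∘ π) (j π) fun k => κ.φ (x k)) := by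
  rw [κ.gamma_mul_total hc hs hx, integral_posMeasure_eq_sum (κ.integrable_mellinIntegrand hc hs hx)]
  refine Finset.sum_congr rfl fun π _ => ?_
  refine integral_congr_ae ?_
  filter_upwards [ae_cubeMeasure_dom n] with u hu
  rw [κ.mellinIntegrand_comp_perm, κ.mellinIntegrand_chart (hj π) s x hu]

end ChamberIntegrand

end LieZeta

namespace LieZeta

set_option autoImplicit false

/-! ### Derivatives at the origin of the smooth factor on a chamber. -/

section ChamberValue

open Filter Topology Set
open scoped ContDiff

variable {n r : ℕ} {c : Fin (n + 1) → Fin r → ℕ} {j : Fin r → Fin (n + 1)}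

/-- The functions with a rational value at the origin. -/
noncomputable def rationalAtZero (N : ℕ) : Subring ((Fin N → ℝ) → ℝ) :=
  ((Rat.castHom ℝ).range).comap (Pi.evalRingHom (fun _ : Fin N → ℝ => ℝ) 0)

theorem mem_rationalAtZero {N : ℕ} {f : (Fin N → ℝ) → ℝ} :
    f ∈ rationalAtZero N ↔ ∃ q : ℚ, (q : ℝ) = f 0 := Iff.rfl

theorem coord_mem_rationalAtZero {N : ℕ} (i : Fin N) :
    (fun u : Fin N → ℝ => u i) ∈ rationalAtZero N := ⟨0, by simp⟩

theorem zero_mem_closedCube : (0 : Fin (n + 1) → ℝ) ∈ closedCube n :=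
  ⟨le_rfl, fun _ _ => ⟨le_rfl, zero_le_one⟩⟩

/-- Only the inverses of the cofactors need an argument: a cofactor has a rational value at the
origin, at least `1`, and all derivatives of `1/y` are rational at such a point. -/
theorem chamberFun_pow_mem (hj : IsLeading c j) (L : Fin r → ℕ) :
    chamberFun c j (fun k y => y ^ L k) ∈ smoothSubring (rationalAtZero (n + 1)) := by
  have hcoord : ∀ i, (fun u : Fin (n + 1) → ℝ => u i) ∈ smoothSubring (rationalAtZero (n + 1)) :=
    fun i => smoothClass_coord (coord_mem_rationalAtZero i)
  refine Subring.mul_mem _ (Subring.prod_mem _ fun k _ => ?_) (Subring.prod_mem _ fun k _ => ?_)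
  · refine comp_mem_smoothSubring contDiff_smoothInv (fun m => ?_) (cofactor_mem _ hcoord k)
    obtain ⟨q, hq⟩ := mem_rationalAtZero.1
      (cofactor_mem (c := c) (j := j) _ coord_mem_rationalAtZero k)
    refine ⟨(-1) ^ m * m.factorial * q ^ (-1 - (m : ℤ)), ?_⟩
    change _ = iteratedDeriv m smoothInv (cofactor c j k 0)
    rw [iteratedDeriv_smoothInv (one_le_cofactor hj k zero_mem_closedCube), ← hq]
    simp
  · exact Subring.pow_mem _ (chartForm_mem _ hcoord k) (L k)

/-- Multiplication of the zeroth coordinate by `t`. -/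
noncomputable def scaleZero (t : ℝ) : (Fin (n + 1) → ℝ) →L[ℝ] (Fin (n + 1) → ℝ) :=
  ContinuousLinearMap.pi fun i => (if i = 0 then t else 1) •
    (ContinuousLinearMap.proj i : (Fin (n + 1) → ℝ) →L[ℝ] ℝ)

theorem scaleZero_apply (t : ℝ) (u : Fin (n + 1) → ℝ) (i : Fin (n + 1)) :
    scaleZero t u i = (if i = 0 then t else 1) * u i := rfl

theorem pds_comp_scaleZero (t : ℝ) (l : List (Fin (n + 1))) {F : (Fin (n + 1) → ℝ) → ℝ}
    (hF : ContDiff ℝ ∞ F) :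
    pds l (F ∘ scaleZero t) = t ^ (l.count 0) • (pds l F ∘ scaleZero t) := by
  induction l generalizing F with
  | nil => simp [pds]
  | cons i l ih =>
    have h1 : pd i (F ∘ scaleZero t) = (if i = 0 then t else 1) • (pd i F ∘ scaleZero t) := by
      ext u
      have h2 := (differentiableAt_of_smooth hF (scaleZero t u)).hasFDerivAt.comp u
        (scaleZero t).hasFDerivAt
      simp only [pd, Pi.smul_apply, Function.comp_apply]
      rw [h2.fderiv]
      have h3 : scaleZero t (Pi.single i 1) = (if i = 0 then t else 1) • Pi.single i (1:ℝ) := by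
        ext m
        rw [scaleZero_apply]
        by_cases hm : m = i
        · subst hm; simp
        · simp [hm]
      rw [ContinuousLinearMap.comp_apply, h3, map_smul]
    have hc : ContDiff ℝ ∞ (pd i F ∘ scaleZero t) := (contDiff_pd i hF).comp (scaleZero t).contDiff
    change pds l (pd i (F ∘ scaleZero t)) = _
    rw [h1, pds_smul l _ hc, ih (contDiff_pd i hF), smul_smul, List.count_cons]
    by_cases hi : i = 0
    · subst hi; simp [pow_succ', pds]
    · simp [hi, pds]

/-- The cofactors do not involve `u 0`, and each dual form contains it exactly once as a factor. -/
theorem chamberFun_pow_scaleZero (L : Fin r → ℕ) (t : ℝ) :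
    chamberFun c j (fun k y => y ^ L k) ∘ scaleZero t =
      t ^ (∑ k, L k) • chamberFun c j (fun k y => y ^ L k) := by
  have h1 : ∀ k u, cofactor c j k (scaleZero t u) = cofactor c j k u := by
    intro k u
    refine Finset.sum_congr rfl fun i _ => ?_
    congr 1
    refine Finset.prod_congr rfl fun m hm => ?_
    rw [scaleZero_apply, if_neg, one_mul]
    rintro rfl
    simp at hm
  have h2 : ∀ k u, chartForm c k (scaleZero t u) = t * chartForm c k u := by
    intro k u
    simp only [chartForm, dualForm, Finset.mul_sum, chart]
    refine Finset.sum_congr rfl fun i _ => ?_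
    have h0 : (0 : Fin (n + 1)) ∈ Finset.Iic i := by simp
    rw [← Finset.mul_prod_erase _ _ h0, ← Finset.mul_prod_erase _ _ h0, scaleZero_apply, if_pos rfl]
    have : ∏ m ∈ (Finset.Iic i).erase 0, scaleZero t u m = ∏ m ∈ (Finset.Iic i).erase 0, u m := by
      refine Finset.prod_congr rfl fun m hm => ?_
      rw [scaleZero_apply, if_neg (Finset.ne_of_mem_erase hm), one_mul]
    rw [this]
    ring
  ext u
  simp only [chamberFun, Function.comp_apply, Pi.mul_apply, Finset.prod_apply, Pi.smul_apply,
    smul_eq_mul, h1, h2, mul_pow, Finset.prod_mul_distrib, Finset.prod_pow_eq_pow_sum]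
  ring

theorem contDiff_chamberFun {f : Fin r → ℝ → ℝ} (hj : IsLeading c j)
    (hf : ∀ k, ContDiff ℝ ∞ (f k)) : ContDiff ℝ ∞ (chamberFun c j f) := by
  have h1 : ContDiff ℝ ∞ (chamberFun c j fun _ _ => 1) := by
    have := (chamberFun_pow_mem hj 0).1
    simpa using this
  have h2 : ∀ S : Finset (Fin r), ContDiff ℝ ∞ (∏ k ∈ S, f k ∘ chartForm c k) := by
    intro S
    have e : (∏ k ∈ S, f k ∘ chartForm c k) = fun u => ∏ k ∈ S, f k (chartForm c k u) := by
      ext u; simp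
    rw [e]
    exact contDiff_prod fun k _ => (hf k).comp (chartForm_mem (smoothSubring (growth n))
      (fun i => smoothClass_coord (coord_mem_growth i)) k).1
  have e : chamberFun c j f = (chamberFun c j fun _ _ => 1) * ∏ k, f k ∘ chartForm c k := by
    ext u; simp [chamberFun]
  rw [e]
  exact h1.mul (h2 _)

/-- Scaling `u 0` by `2` multiplies the derivative at the origin by `2` to the number of
differentiations in `u 0`, and by homogeneity also by `2` to the power `∑ L k`. The two factors
agree only for equal exponents. -/
theorem pds_chamberFun_pow (hj : IsLeading c j) (L : Fin r → ℕ) {l : List (Fin (n + 1))}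
    (hl : l.count 0 ≠ ∑ k, L k) : pds l (chamberFun c j (fun k y => y ^ L k)) 0 = 0 := by
  have hc := (chamberFun_pow_mem hj L).1
  have h := pds_comp_scaleZero 2 l hc
  rw [chamberFun_pow_scaleZero, pds_smul l _ hc] at h
  have h' := congrFun h 0
  simp only [Pi.smul_apply, Function.comp_apply, map_zero, smul_eq_mul] at h'
  have h2 : ((2:ℝ) ^ (∑ k, L k) - 2 ^ (l.count 0)) *
      pds l (chamberFun c j (fun k y => y ^ L k)) 0 = 0 := by linarith
  rcases mul_eq_zero.1 h2 with h3 | h3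
  · exact absurd (pow_right_injective₀ (by norm_num) (by norm_num) (sub_eq_zero.1 h3)).symm hl
  · exact h3

theorem chartForm_zero (k : Fin r) : chartForm c k 0 = 0 := by
  unfold chartForm dualForm
  refine Finset.sum_eq_zero fun i _ => ?_
  rw [chart, Finset.prod_eq_zero (i := i) (by simp) rfl, mul_zero]

/-- The functions are exchanged one index at a time. Each exchange alters the product by a term
containing `(f a - g a) ∘ T_a`, where `T_a` vanishes at the origin and `f a - g a` vanishes to
higher order than the number of differentiations. -/
theorem pds_chamberFun_congr (hj : IsLeading c j) {f g : Fin r → ℝ → ℝ}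
    (hf : ∀ k, ContDiff ℝ ∞ (f k)) (hg : ∀ k, ContDiff ℝ ∞ (g k)) (l : List (Fin (n + 1)))
    (h : ∀ k, ∀ m ≤ l.length, iteratedDeriv m (f k) 0 = iteratedDeriv m (g k) 0) :
    pds l (chamberFun c j f) 0 = pds l (chamberFun c j g) 0 := by
  have step : ∀ (f : Fin r → ℝ → ℝ) (hf : ∀ k, ContDiff ℝ ∞ (f k)) (a : Fin r)
      (_ : ∀ m ≤ l.length, iteratedDeriv m (f a) 0 = iteratedDeriv m (g a) 0),
      pds l (chamberFun c j f) 0 = pds l (chamberFun c j (Function.update f a (g a))) 0 := by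
    intro f hf a ha
    have e : ∀ f : Fin r → ℝ → ℝ, chamberFun c j f =
        (f a ∘ chartForm c a) * chamberFun c j (Function.update f a fun _ => 1) := by
      intro f
      have e1 : (∏ k, Function.update f a (fun _ => 1) k ∘ chartForm c k) =
          ∏ k ∈ Finset.univ.erase a, f k ∘ chartForm c k := by
        rw [← Finset.mul_prod_erase Finset.univ _ (Finset.mem_univ a)]
        have : Function.update f a (fun _ => 1) a ∘ chartForm c a = 1 := by
          ext u; simp
        rw [this, one_mul]
        refine Finset.prod_congr rfl fun k hk => ?_
        rw [Function.update_of_ne (Finset.ne_of_mem_erase hk)]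
      rw [chamberFun, chamberFun, e1, ← Finset.mul_prod_erase Finset.univ
        (fun k => f k ∘ chartForm c k) (Finset.mem_univ a)]
      ring
    have hG : ContDiff ℝ ∞ (chamberFun c j (Function.update f a fun _ => 1)) := by
      refine contDiff_chamberFun hj fun k => ?_
      by_cases hk : k = a
      · subst hk; simpa using contDiff_const
      · simpa [hk] using hf k
    have hU : ∀ k, ContDiff ℝ ∞ (Function.update f a (g a) k) := by
      intro k
      by_cases hk : k = a
      · subst hk; simpa using hg k
      · simpa [hk] using hf k
    have hT : ContDiff ℝ ∞ (chartForm c a) := (chartForm_mem (smoothSubring (growth n))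
      (fun i => smoothClass_coord (coord_mem_growth i)) a).1
    have e2 : chamberFun c j f = (((f a - g a) ∘ chartForm c a) *
        chamberFun c j (Function.update f a fun _ => 1)) +
        chamberFun c j (Function.update f a (g a)) := by
      rw [e f, e (Function.update f a (g a))]
      simp only [Function.update_self, Function.update_idem]
      ext u; simp; ring
    have hfg : ContDiff ℝ ∞ (f a - g a) := (hf a).sub (hg a)
    rw [e2, pds_add l (contDiff_mul (hfg.comp hT) hG) (contDiff_chamberFun hj hU),
      Pi.add_apply, pds_comp_mul_zero hfg hT hG (chartForm_zero a), zero_add]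
    intro m hm
    rw [iteratedDeriv_sub ((hf a).contDiffAt.of_le (by exact_mod_cast le_top))
      ((hg a).contDiffAt.of_le (by exact_mod_cast le_top)), ha m hm, sub_self]
  have key : ∀ S : Finset (Fin r), pds l (chamberFun c j f) 0 =
      pds l (chamberFun c j fun k => if k ∈ S then g k else f k) 0 := by
    intro S
    induction S using Finset.induction_on with
    | empty => simp
    | insert a S ha ih =>
      rw [ih, step _ (fun k => by split_ifs; exacts [hg k, hf k]) a (by simpa [ha] using h a)]
      congr 2
      funext k
      by_cases hk : k = a
      · subst hk; simp
      · simp [hk]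
  simpa using key Finset.univ

theorem iteratedDeriv_sum_pow (a : ℕ → ℝ) (D m : ℕ) (hm : m ≤ D) :
    iteratedDeriv m (fun y : ℝ => ∑ i ∈ Finset.range (D + 1), a i * y ^ i) 0 =
      m.factorial * a m := by
  rw [iteratedDeriv_fun_sum fun i _ => by fun_prop]
  simp_rw [iteratedDeriv_const_mul_field, iteratedDeriv_fun_pow_zero]
  rw [Finset.sum_eq_single m]
  · simp [mul_comm]
  · intro b _ hb; simp [hb.symm]
  · intro h; simp at h; omega

/-- Replace every `f k` by a Taylor polynomial of sufficient degree and expand the product.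
Homogeneity in `u 0` discards all multi-indices except those of the right total degree. -/
theorem pds_chamberFun_taylor (hj : IsLeading c j) {f : Fin r → ℝ → ℝ}
    (hf : ∀ k, ContDiff ℝ ∞ (f k)) (l : List (Fin (n + 1))) :
    pds l (chamberFun c j f) 0 = ∑ L ∈ multiIndices r (l.count 0),
      ((∏ k, iteratedDeriv (L k) (f k) 0 / (L k).factorial) *
        pds l (chamberFun c j (fun k y => y ^ L k)) 0) := by
  set D := l.length with hD
  set a : Fin r → ℕ → ℝ := fun k m => iteratedDeriv m (f k) 0 / m.factorial with ha
  have h1 : pds l (chamberFun c j f) 0 = pds l (chamberFun c j fun k y =>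
      ∑ m ∈ Finset.range (D + 1), a k m * y ^ m) 0 := by
    refine pds_chamberFun_congr hj hf (fun k => by fun_prop) l fun k m hm => ?_
    rw [iteratedDeriv_sum_pow _ _ _ hm]
    have : (m.factorial : ℝ) ≠ 0 := by exact_mod_cast m.factorial_ne_zero
    simp only [ha]; field_simp
  have h2 : (chamberFun c j fun k y => ∑ m ∈ Finset.range (D + 1), a k m * y ^ m) =
      ∑ L ∈ Fintype.piFinset (fun _ : Fin r => Finset.range (D + 1)),
        (∏ k, a k (L k)) • chamberFun c j (fun k y => y ^ L k) := by
    ext u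
    simp only [chamberFun, Pi.mul_apply, Finset.prod_apply, Function.comp_apply, Finset.sum_apply,
      Pi.smul_apply, smul_eq_mul]
    rw [Finset.prod_univ_sum, Finset.mul_sum]
    refine Finset.sum_congr rfl fun L _ => ?_
    rw [Finset.prod_mul_distrib]
    ring
  have h3 : ∀ L ∈ Fintype.piFinset (fun _ : Fin r => Finset.range (D + 1)),
      ContDiff ℝ ∞ ((∏ k, a k (L k)) • chamberFun c j (fun k y => y ^ L k)) :=
    fun L _ => ContDiff.const_smul (∏ k, a k (L k)) (chamberFun_pow_mem hj L).1
  rw [h1, h2, pds_sum _ _ h3, Finset.sum_apply]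
  simp_rw [pds_smul l _ (chamberFun_pow_mem hj _).1, Pi.smul_apply, smul_eq_mul]
  symm
  refine Finset.sum_subset ?_ ?_
  · intro L hL
    rw [multiIndices, Finset.mem_piAntidiag] at hL
    rw [Fintype.mem_piFinset]
    intro k
    have h3 : L k ≤ ∑ k, L k := Finset.single_le_sum (fun _ _ => Nat.zero_le _) (Finset.mem_univ k)
    have h4 : l.count 0 ≤ D := List.count_le_length
    rw [Finset.mem_range]
    have : ∑ k, L k = l.count 0 := hL.1
    omega
  · intro L _ hL
    rw [multiIndices, Finset.mem_piAntidiag] at hL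
    rw [pds_chamberFun_pow hj L, mul_zero]
    intro h
    exact hL ⟨h.symm, by simp⟩

/-- The weights come from the derivatives for monomial `f`, so they depend only on the forms, their
leading rows and the list of differentiations. Their independence of `f` is the reason why `P` and
`Q` share their coefficients. -/
theorem exists_rat_pds_chamberFun (hj : IsLeading c j) (l : List (Fin (n + 1))) :
    ∃ w : (Fin r → ℕ) → ℚ, ∀ f : Fin r → ℝ → ℝ, (∀ k, ContDiff ℝ ∞ (f k)) →
      pds l (chamberFun c j f) 0 = ∑ L ∈ multiIndices r (l.count 0),
        (w L : ℝ) * ∏ k, iteratedDeriv (L k) (f k) 0 := by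
  choose q hq using fun L : Fin r → ℕ => mem_rationalAtZero.1
    ((mem_smoothSubring.1 (chamberFun_pow_mem hj L)).2 l)
  refine ⟨fun L => (∏ k, ((L k).factorial : ℚ)⁻¹) * q L, fun f hf => ?_⟩
  rw [pds_chamberFun_taylor hj hf]
  refine Finset.sum_congr rfl fun L _ => ?_
  rw [← hq]
  push_cast
  simp_rw [div_eq_mul_inv]
  rw [Finset.prod_mul_distrib]
  ring

theorem count_indexList (J : Fin (n + 1) → ℕ) : (indexList J).count 0 = J 0 := by
  unfold indexList
  rw [List.count_flatMap]
  have : (List.finRange (n + 1)).map (fun i => List.count 0 (List.replicate (J i) i)) =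
      (List.finRange (n + 1)).map (fun i => if i = 0 then J i else 0) := by
    refine List.map_congr_left fun i _ => ?_
    rw [List.count_replicate]
    simp
  simp only [Function.comp_def]
  rw [this, ← Fin.sum_univ_def]
  simp

end ChamberValue

end LieZeta

namespace LieZeta

set_option autoImplicit false

/-! ### Continuation past `s = -ℓ`, with its value there. -/

section LocalContinuation

open Filter Topology Set
open scoped ContDiff

variable {n r : ℕ} {c : Fin (n + 1) → Fin r → ℕ}

theorem poleOrder_le (j : Fin r → Fin (n + 1)) (i : Fin (n + 1)) : poleOrder j i ≤ r := by
  unfold poleOrder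
  exact (Finset.card_filter_le _ _).trans (by simp)

theorem poleOrder_zero (j : Fin r → Fin (n + 1)) : poleOrder j 0 = r := by
  simp [poleOrder]

/-- Minus the exponent of the `i`-th variable of a chamber at `s = -ℓ`. -/
def jetOrder (ℓ : ℕ) (j : Fin r → Fin (n + 1)) (i : Fin (n + 1)) : ℕ :=
  (n + 1 - (i : ℕ)) * ℓ + poleOrder j i

theorem chamberExp_eq (ℓ : ℕ) (j : Fin r → Fin (n + 1)) (i : Fin (n + 1)) (s : ℂ) :
    chamberExp j i s + jetOrder ℓ j i = ((n + 1 - (i : ℕ) : ℕ) : ℂ) * (s + ℓ) := by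
  unfold chamberExp jetOrder
  push_cast
  ring

theorem chamberExp_re (j : Fin r → Fin (n + 1)) (i : Fin (n + 1)) (s : ℂ) :
    (chamberExp j i s).re = ((n + 1 - (i : ℕ) : ℕ) : ℝ) * s.re - poleOrder j i := by
  simp [chamberExp]

theorem chamberExp_re_pos (j : Fin r → Fin (n + 1)) (i : Fin (n + 1)) {s : ℂ} (hs : r < s.re) :
    0 < (chamberExp j i s).re := by
  rw [chamberExp_re]
  have h1 : (poleOrder j i : ℝ) ≤ r := by exact_mod_cast poleOrder_le j i
  have h2 : (1 : ℝ) ≤ ((n + 1 - (i : ℕ) : ℕ) : ℝ) := by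
    exact_mod_cast (by omega : 1 ≤ n + 1 - (i : ℕ))
  have h3 : (0 : ℝ) ≤ r := Nat.cast_nonneg r
  nlinarith

/-- The shifted exponent is `(n + 1 - i)(s + ℓ)` with a factor of at most `n + 1`, so a margin of
`1/(n + 1)` to the left of `-ℓ` costs less than `1`. -/
theorem chamberExp_re_add_pos (ℓ : ℕ) (j : Fin r → Fin (n + 1)) (i : Fin (n + 1)) {s : ℂ}
    (hs : -(ℓ : ℝ) - 1 / (n + 1) < s.re) : 0 < (chamberExp j i s).re + jetOrder ℓ j i + 1 := by
  have h0 := congrArg Complex.re (chamberExp_eq ℓ j i s)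
  simp only [Complex.add_re, Complex.natCast_re, Complex.mul_re, Complex.natCast_im, zero_mul,
    sub_zero] at h0
  rw [h0]
  have h1 : (1 : ℝ) ≤ ((n + 1 - (i : ℕ) : ℕ) : ℝ) := by
    exact_mod_cast (by omega : 1 ≤ n + 1 - (i : ℕ))
  have h2 : ((n + 1 - (i : ℕ) : ℕ) : ℝ) ≤ n + 1 := by
    exact_mod_cast (by omega : n + 1 - (i : ℕ) ≤ n + 1)
  have h3 : (-1 : ℝ) < (n + 1) * (s.re + ℓ) := by
    have h4 : (0 : ℝ) < n + 1 := by positivity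
    have h5 : -(1 / ((n : ℝ) + 1)) < s.re + ℓ := by linarith
    have h6 := mul_lt_mul_of_pos_left h5 h4
    have h7 : ((n : ℝ) + 1) * -(1 / (n + 1)) = -1 := by field_simp
    linarith
  rcases le_or_gt 0 (s.re + ℓ) with h | h
  · have := mul_nonneg (zero_le_one.trans h1) h
    linarith
  · nlinarith

theorem prod_range_sub_eq (J : ℕ) :
    ∏ m ∈ Finset.range J, (-(J : ℂ) + m) = (-1) ^ J * J.factorial := by
  have h : ∏ m ∈ Finset.range J, (-(J : ℂ) + m) = ∏ m ∈ Finset.range J, (-1 * ((m : ℂ) + 1)) := by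
    rw [← Finset.prod_range_reflect]
    refine Finset.prod_congr rfl fun m hm => ?_
    have : m + 1 ≤ J := Finset.mem_range.1 hm
    have e : J - 1 - m = J - (m + 1) := by omega
    rw [e, Nat.cast_sub this]
    push_cast
    ring
  rw [h, Finset.prod_mul_distrib]
  simp only [Finset.prod_const, Finset.card_range]
  congr 1
  rw [← Finset.prod_range_add_one_eq_factorial]
  push_cast
  rfl

theorem inv_Gamma_eq (s : ℂ) (ℓ : ℕ) :
    (Complex.Gamma s)⁻¹ =
      (∏ m ∈ Finset.range (ℓ + 1), (s + m)) * (Complex.Gamma (s + ℓ + 1))⁻¹ := by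
  induction ℓ with
  | zero => simpa using Complex.one_div_Gamma_eq_self_mul_one_div_Gamma_add_one s
  | succ ℓ ih =>
    rw [ih, Finset.prod_range_succ _ (ℓ + 1)]
    have h := Complex.one_div_Gamma_eq_self_mul_one_div_Gamma_add_one (s + ℓ + 1)
    push_cast
    rw [h, mul_assoc, add_assoc s (ℓ : ℂ) 1]

/-- The regular part of the denominator of the contribution of a chamber. -/
noncomputable def chamberDenom (ℓ : ℕ) (j : Fin r → Fin (n + 1)) (s : ℂ) : ℂ :=
  ∏ i : Fin (n + 1), (((n + 1 - (i : ℕ) : ℕ) : ℂ) *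
    ∏ m ∈ Finset.range (jetOrder ℓ j i), (chamberExp j i s + m))

/-- For each of the `n + 1` variables exactly one factor vanishes at `-ℓ`, the one with `m =
jetOrder ℓ j i`. Collecting these gives the power of `s + ℓ` that the zero of `Γ^{-(n+1)}` cancels.
-/
theorem prod_chamberExp (ℓ : ℕ) (j : Fin r → Fin (n + 1)) (s : ℂ) :
    ∏ i, ∏ m ∈ Finset.range (jetOrder ℓ j i + 1), (chamberExp j i s + m) =
      (s + ℓ) ^ (n + 1) * chamberDenom ℓ j s := by
  have : (s + ℓ) ^ (n + 1) = ∏ _i : Fin (n + 1), (s + ℓ) := by simp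
  rw [this, chamberDenom, ← Finset.prod_mul_distrib]
  refine Finset.prod_congr rfl fun i _ => ?_
  rw [Finset.prod_range_succ, chamberExp_eq]
  ring

theorem differentiable_chamberExp (j : Fin r → Fin (n + 1)) (i : Fin (n + 1)) :
    Differentiable ℂ (chamberExp j i) := by
  unfold chamberExp; fun_prop

theorem differentiable_chamberDenom (ℓ : ℕ) (j : Fin r → Fin (n + 1)) :
    Differentiable ℂ (chamberDenom ℓ j) := by
  unfold chamberDenom
  refine Differentiable.fun_finsetProd fun i _ => Differentiable.const_mul ?_ _
  exact Differentiable.fun_finsetProd fun m _ => (differentiable_chamberExp j i).add_const _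

theorem chamberExp_neg (ℓ : ℕ) (j : Fin r → Fin (n + 1)) (i : Fin (n + 1)) :
    chamberExp j i (-ℓ) = -(jetOrder ℓ j i : ℂ) := by
  have := chamberExp_eq ℓ j i (-ℓ)
  simp only [neg_add_cancel, mul_zero] at this
  exact eq_neg_of_add_eq_zero_left this

/-- The value of `chamberDenom` at `-ℓ`. -/
def denomValue (ℓ : ℕ) (j : Fin r → Fin (n + 1)) : ℚ :=
  ∏ i : Fin (n + 1), (((n + 1 - (i : ℕ) : ℕ) : ℚ) *
    ((-1) ^ jetOrder ℓ j i * (jetOrder ℓ j i).factorial))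

theorem chamberDenom_neg (ℓ : ℕ) (j : Fin r → Fin (n + 1)) :
    chamberDenom ℓ j (-ℓ) = (denomValue ℓ j : ℂ) := by
  unfold chamberDenom denomValue
  simp_rw [chamberExp_neg ℓ j, prod_range_sub_eq]
  push_cast
  rfl

theorem denomValue_ne_zero (ℓ : ℕ) (j : Fin r → Fin (n + 1)) : denomValue ℓ j ≠ 0 := by
  unfold denomValue
  refine Finset.prod_ne_zero_iff.2 fun i _ => mul_ne_zero ?_ (mul_ne_zero (by simp) ?_)
  · exact_mod_cast (by omega : n + 1 - (i : ℕ) ≠ 0)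
  · exact_mod_cast Nat.factorial_ne_zero _

theorem chamberExp_prod_ne_zero (ℓ : ℕ) (j : Fin r → Fin (n + 1)) {s : ℂ} (hs : r < s.re) :
    ∏ i, ∏ m ∈ Finset.range (jetOrder ℓ j i + 1), (chamberExp j i s + m) ≠ 0 := by
  refine Finset.prod_ne_zero_iff.2 fun i _ => Finset.prod_ne_zero_iff.2 fun m _ h => ?_
  have h1 := congrArg Complex.re h
  simp only [Complex.add_re, Complex.natCast_re, Complex.zero_re] at h1
  have := chamberExp_re_pos j i hs
  have h2 : (0:ℝ) ≤ m := Nat.cast_nonneg m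
  linarith

theorem IsFormFamily.one_le (hc : IsFormFamily c) : 1 ≤ r := by
  by_contra h
  have hr : r = 0 := by omega
  subst hr
  exact hc.ne_zero 0 (Subsingleton.elim _ _)

/-- Continuation to the half plane `Re s > -ℓ - 1/(n+1)`, regular at `-ℓ`, and the value there. -/
theorem exists_local_continuation (hc : IsFormFamily c) (ℓ : ℕ) :
    ∃ w : (Fin r → ℕ) → ℚ, ∀ {Y : Type} [MeasurableSpace Y] (κ : Kind Y) (x : Fin r → ℝ),
      (∀ k, 0 < x k) → ∃ G : ℂ → ℂ,
        (∀ s : ℂ, -(ℓ : ℝ) - 1 / (n + 1) < s.re → MeromorphicAt G s) ∧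
        AnalyticAt ℂ G (-ℓ) ∧
        (∀ s : ℂ, r < s.re → G s = κ.total c s fun k => (x k : ℂ)) ∧
        G (-ℓ) = ∑ L ∈ multiIndices r ((n + 1) * ℓ + r),
          (w L : ℂ) * ∏ k, ((Polynomial.aeval (x k) (κ.β (L k)) : ℝ) : ℂ) := by
  choose j hj using fun π : Equiv.Perm (Fin (n + 1)) => (hc.comp_perm π).exists_isLeading
  choose v hv using fun π => exists_rat_pds_chamberFun (hj π) (indexList (jetOrder ℓ (j π)))
  have hcount : ∀ π, (indexList (jetOrder ℓ (j π))).count 0 = (n + 1) * ℓ + r := by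
    intro π
    rw [count_indexList, jetOrder, poleOrder_zero]
    simp
  -- The weights are fixed before the kind and the point `x` appear. The first factor is the value
  -- at `-ℓ` of the function `A` below; each chamber then contributes its sign, its denominator and
  -- its jet weights.
  refine ⟨fun L => ((-1) ^ ℓ * ℓ.factorial) ^ (n + 1) * ∑ π,
    (∏ i, (-1 : ℚ) ^ jetOrder ℓ (j π) i) * (denomValue ℓ (j π))⁻¹ * v π L, ?_⟩
  intro Y _ κ x hx
  set U : Set ℂ := {s | -(ℓ : ℝ) - 1 / (n + 1) < s.re} with hU
  have hUo : IsOpen U := isOpen_lt continuous_const Complex.continuous_re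
  have hpU : (-ℓ : ℂ) ∈ U := by
    have : (0:ℝ) < 1 / (n + 1) := by positivity
    simp only [hU, Set.mem_ofPred_eq, Complex.neg_re, Complex.natCast_re]
    linarith
  choose H hH1 hH2 hH3 using fun π => mellinCube_continuation (jetOrder ℓ (j π)) hpU
    (chamberExp (j π)) (differentiable_chamberExp (j π))
    (fun i s hs => chamberExp_re_add_pos ℓ (j π) i hs) (chamberExp_neg ℓ (j π))
    (smoothClass_chamberFun (hc.comp_perm π) (hj π) (f := fun k => κ.φ (x k))
      (fun k => κ.contDiff _ (hx k)) (fun k => κ.decay _ (hx k)))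
  have hHan : ∀ π, ∀ s ∈ U, AnalyticAt ℂ (H π) s := fun π s hs =>
    DifferentiableOn.analyticAt (s := U) (fun z hz => (hH1 π z hz).differentiableWithinAt)
      (hUo.mem_nhds hs)
  -- This is `Γ(s)^{-(n+1)}` with the factor `(s + ℓ)^{n+1}` removed.
  set A : ℂ → ℂ := fun s => ((∏ m ∈ Finset.range ℓ, (s + m)) *
    (Complex.Gamma (s + ℓ + 1))⁻¹) ^ (n + 1) with hA
  have hAd : Differentiable ℂ A := by
    refine Differentiable.pow (Differentiable.mul ?_ ?_) _
    · exact Differentiable.fun_finsetProd fun m _ => by fun_prop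
    · exact Complex.differentiable_one_div_Gamma.comp (by fun_prop)
  have hDan : ∀ π s, AnalyticAt ℂ (chamberDenom ℓ (j π)) s := fun π s =>
    (differentiable_chamberDenom ℓ (j π)).analyticAt s
  set G : ℂ → ℂ := fun s => A s * ∑ π, H π s / chamberDenom ℓ (j π) s with hG
  have hr := hc.one_le
  refine ⟨G, fun s hs => ?_, ?_, fun s hs => ?_, ?_⟩
  · refine (hAd.analyticAt s).meromorphicAt.mul (MeromorphicAt.fun_sum fun π _ => ?_)
    exact (hHan π s hs).meromorphicAt.div (hDan π s).meromorphicAt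
  · refine (hAd.analyticAt _).mul (Finset.analyticAt_fun_sum _ fun π _ => ?_)
    refine (hHan π _ hpU).div (hDan π _) ?_
    rw [chamberDenom_neg]
    exact_mod_cast denomValue_ne_zero ℓ (j π)
  · have hs1 : 1 < s.re := by
      have : (1:ℝ) ≤ r := by exact_mod_cast hr
      linarith
    have hs0 : -(ℓ : ℝ) - 1 / (n + 1) < s.re := by
      have : (0:ℝ) < 1 / (n + 1) := by positivity
      have h2 : (0:ℝ) ≤ ℓ := Nat.cast_nonneg ℓ
      linarith
    have hΓ : Complex.Gamma s ≠ 0 := Complex.Gamma_ne_zero_of_re_pos (by linarith)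
    have hsl : s + ℓ ≠ 0 := by
      intro h
      have h1 := congrArg Complex.re h
      simp only [Complex.add_re, Complex.natCast_re, Complex.zero_re] at h1
      have h2 : (0:ℝ) ≤ ℓ := Nat.cast_nonneg ℓ
      linarith
    have key := κ.gamma_mul_total_eq_sum hc hj hs1 hx
    have h1 : ∀ π, H π s / chamberDenom ℓ (j π) s = (s + ℓ) ^ (n + 1) *
        mellinCube (fun i => chamberExp (j π) i s)
          (chamberFun (c ∘ π) (j π) fun k => κ.φ (x k)) := by
      intro π
      have h2 := chamberExp_prod_ne_zero ℓ (j π) hs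
      rw [hH2 π s hs0 fun i => chamberExp_re_pos (j π) i hs, prod_chamberExp]
      rw [prod_chamberExp] at h2
      have h3 := right_ne_zero_of_mul h2
      field_simp
    simp only [hG, h1]
    rw [← Finset.mul_sum, ← key, ← mul_assoc, ← mul_assoc]
    have h4 : A s * (s + ℓ) ^ (n + 1) * Complex.Gamma s ^ (n + 1) = 1 := by
      rw [hA, ← mul_pow, ← mul_pow]
      have h5 : (∏ m ∈ Finset.range ℓ, (s + m)) * (Complex.Gamma (s + ℓ + 1))⁻¹ * (s + ℓ) =
          (Complex.Gamma s)⁻¹ := by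
        rw [inv_Gamma_eq s ℓ, Finset.prod_range_succ]
        ring
      rw [h5, inv_mul_cancel₀ hΓ, one_pow]
    rw [h4, one_mul]
  · have hA0 : A (-ℓ) = ((-1) ^ ℓ * ℓ.factorial) ^ (n + 1) := by
      simp only [hA]
      rw [prod_range_sub_eq]
      simp
    have hval : ∀ π, H π (-ℓ) = (∏ i, (-1 : ℂ) ^ jetOrder ℓ (j π) i) *
        ∑ L ∈ multiIndices r ((n + 1) * ℓ + r),
          (v π L : ℂ) * ∏ k, ((Polynomial.aeval (x k) (κ.β (L k)) : ℝ) : ℂ) := by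
      intro π
      rw [hH3, hv π _ fun k => κ.contDiff _ (hx k), hcount]
      congr 1
      push_cast
      refine Finset.sum_congr rfl fun L _ => ?_
      simp_rw [κ.taylor _ (hx _)]
    simp only [hG, hA0, hval, chamberDenom_neg, div_eq_mul_inv, Finset.mul_sum, Finset.sum_mul]
    rw [Finset.sum_comm]
    refine Finset.sum_congr rfl fun L _ => ?_
    push_cast
    rw [Finset.sum_mul]
    refine Finset.sum_congr rfl fun π _ => ?_
    ring

end LocalContinuation

end LieZeta

namespace LieZeta

set_option autoImplicit false

/-! ### Gluing the continuations to half planes. -/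

section Gluing

open Filter Topology Set

theorem toMeromorphicNFAt_self_congr {f g : ℂ → ℂ} {s : ℂ} (hf : MeromorphicAt f s)
    (hg : MeromorphicAt g s) (h : f =ᶠ[𝓝[≠] s] g) :
    toMeromorphicNFAt f s s = toMeromorphicNFAt g s s := by
  have h1 := hf.eq_nhdsNE_toMeromorphicNFAt
  have h2 := hg.eq_nhdsNE_toMeromorphicNFAt
  exact ((meromorphicNFAt_toMeromorphicNFAt.eventuallyEq_nhdsNE_iff_eventuallyEq_nhds
    meromorphicNFAt_toMeromorphicNFAt).1 (h1.symm.trans (h.trans h2))).eq_of_nhds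

theorem toMeromorphicNFAt_self_of_analyticAt {f : ℂ → ℂ} {s : ℂ} (hf : AnalyticAt ℂ f s) :
    toMeromorphicNFAt f s s = f s := by
  rw [toMeromorphicNFAt_eq_self.2 hf.meromorphicNFAt]

theorem isPreconnected_halfPlane (a : ℝ) : IsPreconnected {s : ℂ | a < s.re} :=
  (convex_halfSpace_re_gt a).isPreconnected

/-- The identity theorem: the difference has infinite order at a point far to the right, hence
everywhere on the connected half plane. -/
theorem eventuallyEq_of_eq_on_halfPlane {f g : ℂ → ℂ} {a b : ℝ}
    (hf : ∀ s : ℂ, a < s.re → MeromorphicAt f s) (hg : ∀ s : ℂ, a < s.re → MeromorphicAt g s)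
    (h : ∀ s : ℂ, b < s.re → f s = g s) {s : ℂ} (hs : a < s.re) : f =ᶠ[𝓝[≠] s] g := by
  have hm : MeromorphicOn (f - g) {s : ℂ | a < s.re} := fun s hs => (hf s hs).sub (hg s hs)
  set p : ℂ := ((max a b + 1 : ℝ) : ℂ)
  have hpa : a < p.re := by
    simp only [p, Complex.ofReal_re]; linarith [le_max_left a b]
  have hpb : b < p.re := by
    simp only [p, Complex.ofReal_re]; linarith [le_max_right a b]
  have h₀ : meromorphicOrderAt (f - g) p = ⊤ := by
    rw [meromorphicOrderAt_eq_top_iff]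
    refine Filter.Eventually.filter_mono nhdsWithin_le_nhds ?_
    have ho : IsOpen {s : ℂ | b < s.re} := isOpen_lt continuous_const Complex.continuous_re
    filter_upwards [ho.mem_nhds hpb] with z hz
    simp [h z hz]
  have h₁ : meromorphicOrderAt (f - g) s = ⊤ := by
    by_contra h
    exact hm.meromorphicOrderAt_ne_top_of_isPreconnected (isPreconnected_halfPlane a) hs hpa h h₀
  rw [meromorphicOrderAt_eq_top_iff] at h₁
  filter_upwards [h₁] with z hz
  exact sub_eq_zero.1 hz

/-- Meromorphic continuations to a sequence of half planes which exhaust `ℂ` glue. -/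
theorem exists_isMeromorphicContinuation {f : ℂ → ℂ} {σ : ℝ} {G : ℕ → ℂ → ℂ} {a : ℕ → ℝ}
    (ha : ∀ ℓ : ℕ, a ℓ < -ℓ)
    (hG : ∀ ℓ : ℕ, ∀ s : ℂ, a ℓ < s.re → MeromorphicAt (G ℓ) s)
    (hf : ∀ s : ℂ, σ < s.re → AnalyticAt ℂ f s)
    (hGf : ∀ ℓ : ℕ, ∀ s : ℂ, σ < s.re → G ℓ s = f s) :
    ∃ F, IsMeromorphicContinuation σ f F ∧
      ∀ ℓ s, a ℓ < s.re → AnalyticAt ℂ (G ℓ) s → AnalyticAt ℂ F s ∧ F s = G ℓ s := by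
  have hex : ∀ s : ℂ, ∃ ℓ : ℕ, a ℓ < s.re := fun s => by
    obtain ⟨ℓ, hℓ⟩ := exists_nat_gt (-s.re)
    exact ⟨ℓ, by linarith [ha ℓ]⟩
  choose lev hlev using hex
  have hagree : ∀ ℓ ℓ' : ℕ, ∀ s : ℂ, a ℓ < s.re → a ℓ' < s.re → G ℓ =ᶠ[𝓝[≠] s] G ℓ' := by
    intro ℓ ℓ' s h h'
    refine eventuallyEq_of_eq_on_halfPlane (a := max (a ℓ) (a ℓ')) (b := σ)
      (fun s hs => hG ℓ s ((le_max_left _ _).trans_lt hs))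
      (fun s hs => hG ℓ' s ((le_max_right _ _).trans_lt hs))
      (fun s hs => (hGf ℓ s hs).trans (hGf ℓ' s hs).symm) (max_lt h h')
  -- The value of the normal form at `s` depends only on the punctured germ, on which all available
  -- levels agree. The arbitrary choice of a level is therefore harmless.
  set F : ℂ → ℂ := fun s => toMeromorphicNFAt (G (lev s)) s s with hF
  have hFval : ∀ ℓ s, a ℓ < s.re → F s = toMeromorphicNFAt (G ℓ) s s := fun ℓ s hs =>
    toMeromorphicNFAt_self_congr (hG _ s (hlev s)) (hG ℓ s hs) (hagree _ _ s (hlev s) hs)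
  have hFan : ∀ ℓ s, a ℓ < s.re → AnalyticAt ℂ (G ℓ) s → F s = G ℓ s := fun ℓ s hs hs' => by
    rw [hFval ℓ s hs, toMeromorphicNFAt_self_of_analyticAt hs']
  have hopen : ∀ ℓ : ℕ, IsOpen {s : ℂ | a ℓ < s.re} := fun ℓ =>
    isOpen_lt continuous_const Complex.continuous_re
  have hFne : ∀ ℓ s, a ℓ < s.re → F =ᶠ[𝓝[≠] s] G ℓ := by
    intro ℓ s hs
    have h1 := (hG ℓ s hs).eventually_analyticAt
    have h2 : ∀ᶠ z in 𝓝[≠] s, a ℓ < z.re := nhdsWithin_le_nhds ((hopen ℓ).mem_nhds hs)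
    filter_upwards [h1, h2] with z hz hz'
    exact hFan ℓ z hz' hz
  have hFnhds : ∀ ℓ s, a ℓ < s.re → F =ᶠ[𝓝 s] toMeromorphicNFAt (G ℓ) s := by
    intro ℓ s hs
    have h1 := (hFne ℓ s hs).trans (hG ℓ s hs).eq_nhdsNE_toMeromorphicNFAt
    exact eventuallyEq_nhds_of_eventuallyEq_nhdsNE h1 (hFval ℓ s hs)
  have hGan : ∀ ℓ : ℕ, ∀ s : ℂ, σ < s.re → AnalyticAt ℂ (G ℓ) s := by
    intro ℓ s hs
    refine (hf s hs).congr ?_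
    have ho : IsOpen {s : ℂ | σ < s.re} := isOpen_lt continuous_const Complex.continuous_re
    filter_upwards [ho.mem_nhds hs] with z hz
    exact (hGf ℓ z hz).symm
  refine ⟨F, ⟨fun s _ => ?_, fun s hs => ?_⟩, fun ℓ s hs hs' => ⟨?_, hFan ℓ s hs hs'⟩⟩
  · exact (meromorphicNFAt_congr (hFnhds _ s (hlev s))).2 meromorphicNFAt_toMeromorphicNFAt
  · rw [hFan _ s (hlev s) (hGan _ s hs), hGf _ s hs]
  · refine hs'.congr ?_
    have h1 := hFnhds ℓ s hs
    rw [toMeromorphicNFAt_eq_self.2 hs'.meromorphicNFAt] at h1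
    exact h1.symm

variable {n r : ℕ} {c : Fin n → Fin r → ℕ}

/-- The meromorphic continuation of the zeta function attached to a family of forms, its
regularity at the nonpositive integers, and its values there. -/
theorem exists_continuation (hc : IsFormFamily c) :
    ∃ w : ℕ → (Fin r → ℕ) → ℚ, ∀ {Y : Type} [MeasurableSpace Y] (κ : Kind Y) (x : Fin r → ℝ),
      (∀ k, 0 < x k) → ∃ F : ℂ → ℂ,
        IsMeromorphicContinuation r (fun s => κ.total c s fun k => (x k : ℂ)) F ∧
        ∀ ℓ : ℕ, AnalyticAt ℂ F (-ℓ) ∧ F (-ℓ) = ∑ L ∈ multiIndices r (n * ℓ + r),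
          (w ℓ L : ℂ) * ∏ k, ((Polynomial.aeval (x k) (κ.β (L k)) : ℝ) : ℂ) := by
  cases n with
  | zero =>
    -- Without forms there are no coordinates either, and the function is the constant `1`.
    have hr : r = 0 := by
      by_contra h
      obtain ⟨i, _⟩ := hc.simple ⟨0, by omega⟩
      exact i.elim0
    subst hr
    refine ⟨fun _ _ => 1, fun κ x hx => ⟨fun _ => 1, ⟨fun s _ => analyticAt_const.meromorphicNFAt,
      fun s _ => ?_⟩, fun ℓ => ⟨analyticAt_const, ?_⟩⟩⟩
    · simp [Kind.total, formTerm, Measure.real]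
    · simp [multiIndices]
  | succ n =>
    choose w hw using exists_local_continuation hc
    refine ⟨w, fun {Y} _ κ x hx => ?_⟩
    choose G h1 h2 h3 h4 using fun ℓ => hw ℓ κ x hx
    have hr := hc.one_le
    have hpos : (0:ℝ) < 1 / (n + 1) := by positivity
    obtain ⟨F, hF1, hF2⟩ := exists_isMeromorphicContinuation (σ := r)
      (f := fun s => κ.total c s fun k => (x k : ℂ)) (G := G)
      (a := fun ℓ => -(ℓ : ℝ) - 1 / (n + 1)) (fun ℓ => by linarith) h1
      (fun s hs => by
        have h5 : 1 < s.re := by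
          have : (1:ℝ) ≤ r := by exact_mod_cast hr
          linarith
        exact (κ.analyticAt_total (z := (s, fun k => (x k : ℂ))) hc h5
          (by simpa using hx)).comp_of_eq (g := fun z : ℂ × (Fin r → ℂ) => κ.total c z.1 z.2)
          (f := fun s => (s, fun k => (x k : ℂ)))
          (analyticAt_id.prod analyticAt_const) rfl) h3
    refine ⟨F, hF1, fun ℓ => ?_⟩
    have h6 := hF2 ℓ (-ℓ) (by simp only [Complex.neg_re, Complex.natCast_re]; linarith) (h2 ℓ)
    exact ⟨h6.1, h6.2.trans (h4 ℓ)⟩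

end Gluing

end LieZeta

namespace LieZeta

set_option autoImplicit false

/-! ### The two kinds: the Bernoulli generating function and the exponential. -/

section Kinds

open Filter Topology Set
open scoped ContDiff

theorem exists_pow_mul_exp_le (x : ℝ) (hx : 0 < x) (M : ℕ) : ∃ C : ℝ, ∀ T : ℝ, 0 ≤ T →
    (1 + T) ^ M * Real.exp (-x * T) ≤ C := by
  obtain ⟨C, hC⟩ := pow_mul_exp_neg_bounded M
  refine ⟨(1 + x⁻¹) ^ M * C, fun T hT => ?_⟩
  have h1 : 1 + T ≤ (1 + x⁻¹) * (1 + x * T) := by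
    have : (1 + x⁻¹) * (1 + x * T) = 1 + T + (x⁻¹ + x * T) := by field_simp; ring
    rw [this]
    have : 0 ≤ x⁻¹ + x * T := by positivity
    linarith
  have h2 := hC (x * T) (by positivity)
  calc (1 + T) ^ M * Real.exp (-x * T) ≤ ((1 + x⁻¹) * (1 + x * T)) ^ M * Real.exp (-x * T) := by
        gcongr
    _ = (1 + x⁻¹) ^ M * ((1 + x * T) ^ M * Real.exp (-(x * T))) := by
        rw [mul_pow, neg_mul]; ring
    _ ≤ _ := by gcongr

theorem iteratedDeriv_mul_exp (x : ℝ) (j : ℕ) :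
    iteratedDeriv j (fun T : ℝ => T * Real.exp (-x * T)) =
      fun T => (j * (-x) ^ (j - 1) + (-x) ^ j * T) * Real.exp (-x * T) := by
  induction j with
  | zero => simp
  | succ j ih =>
    rw [iteratedDeriv_succ, ih]
    funext T
    have h1 : HasDerivAt (fun T : ℝ => Real.exp (-x * T)) (Real.exp (-x * T) * (-x)) T := by
      simpa using ((hasDerivAt_id T).const_mul (-x)).exp
    have h2 : HasDerivAt (fun T : ℝ => (j * (-x) ^ (j - 1) + (-x) ^ j * T)) ((-x) ^ j) T := by
      simpa using ((hasDerivAt_id T).const_mul ((-x) ^ j)).const_add (j * (-x) ^ (j - 1))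
    rw [(h2.fun_mul h1).deriv]
    -- For `j = 0` the exponent `j - 1` is truncated, which is harmless because of the factor `j`.
    cases j with
    | zero => simp; ring
    | succ j => simp only [Nat.add_sub_cancel]; push_cast; ring

/-- Smooth functions with rapidly decreasing derivatives. -/
def RapidDerivs (f : ℝ → ℝ) : Prop :=
  ∀ j M : ℕ, ∃ C : ℝ, ∀ T : ℝ, 0 ≤ T → (1 + T) ^ M * |iteratedDeriv j f T| ≤ C

theorem rapidDerivs_exp {x : ℝ} (hx : 0 < x) : RapidDerivs fun T => Real.exp (-x * T) := by
  intro j M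
  obtain ⟨C, hC⟩ := exists_pow_mul_exp_le x hx M
  refine ⟨|(-x) ^ j| * C, fun T hT => ?_⟩
  rw [iteratedDeriv_exp_const_mul, abs_mul, abs_of_pos (Real.exp_pos _), mul_left_comm]
  exact mul_le_mul_of_nonneg_left (hC T hT) (abs_nonneg _)

theorem rapidDerivs_mul_exp {x : ℝ} (hx : 0 < x) : RapidDerivs fun T => T * Real.exp (-x * T) := by
  intro j M
  obtain ⟨C, hC⟩ := exists_pow_mul_exp_le x hx (M + 1)
  refine ⟨(|(j * (-x) ^ (j - 1) : ℝ)| + |(-x) ^ j|) * C, fun T hT => ?_⟩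
  rw [iteratedDeriv_mul_exp, abs_mul, abs_of_pos (Real.exp_pos _)]
  have h1 : |(j * (-x) ^ (j - 1) + (-x) ^ j * T : ℝ)| ≤
      (|(j * (-x) ^ (j - 1) : ℝ)| + |(-x) ^ j|) * (1 + T) := by
    refine (abs_add_le _ _).trans ?_
    rw [abs_mul _ T, abs_of_nonneg hT]
    have a1 := abs_nonneg (j * (-x) ^ (j - 1) : ℝ)
    have a2 := abs_nonneg ((-x) ^ j)
    nlinarith
  calc _ ≤ (1 + T) ^ M * ((|(j * (-x) ^ (j - 1) : ℝ)| + |(-x) ^ j|) * (1 + T) *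
        Real.exp (-x * T)) := by gcongr
    _ = (|(j * (-x) ^ (j - 1) : ℝ)| + |(-x) ^ j|) * ((1 + T) ^ (M + 1) * Real.exp (-x * T)) := by
        ring
    _ ≤ _ := by
        gcongr
        exact hC T hT

theorem iteratedDeriv_one_sub_exp {m : ℕ} (hm : m ≠ 0) (T : ℝ) :
    iteratedDeriv m (fun T : ℝ => 1 - Real.exp (-1 * T)) T = -((-1) ^ m * Real.exp (-1 * T)) := by
  have h := iteratedDeriv_fun_sub (n := m) (x := T) (f := fun _ : ℝ => (1:ℝ))
    (g := fun T : ℝ => Real.exp (-1 * T)) contDiffAt_const (by fun_prop)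
  rw [h, iteratedDeriv_exp_const_mul, iteratedDeriv_const, if_neg hm, zero_sub]

theorem leibniz_one_sub_exp {f : ℝ → ℝ} (hf : ContDiff ℝ ∞ f) (j : ℕ) (T : ℝ) :
    iteratedDeriv j (fun T => f T * (1 - Real.exp (-1 * T))) T =
      iteratedDeriv j f T * (1 - Real.exp (-1 * T)) - ∑ i ∈ Finset.range j,
        (j.choose i : ℝ) * iteratedDeriv i f T * ((-1) ^ (j - i) * Real.exp (-1 * T)) := by
  rw [iteratedDeriv_fun_mul (hf.contDiffAt.of_le (by exact_mod_cast le_top)) (by fun_prop),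
    Finset.sum_range_succ, ← sub_eq_zero]
  simp only [Nat.choose_self, Nat.cast_one, one_mul, Nat.sub_self, iteratedDeriv_zero]
  have : ∑ i ∈ Finset.range j, (j.choose i : ℝ) * iteratedDeriv i f T *
      iteratedDeriv (j - i) (fun T : ℝ => 1 - Real.exp (-1 * T)) T =
      -∑ i ∈ Finset.range j, (j.choose i : ℝ) * iteratedDeriv i f T *
        ((-1) ^ (j - i) * Real.exp (-1 * T)) := by
    rw [← Finset.sum_neg_distrib]
    refine Finset.sum_congr rfl fun i hi => ?_
    rw [iteratedDeriv_one_sub_exp (by have := Finset.mem_range.1 hi; omega)]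
    ring
  rw [this]
  ring

/-- Induction on the order by the Leibniz rule, without differentiating a quotient: the product's
derivative is the wanted derivative times `1 - e^{-T}` plus lower derivatives of `f` with bounded
coefficients. For `T ≥ 1` the factor is at least `1 - e^{-1}`, and `T ≤ 1` is handled by
compactness. -/
theorem RapidDerivs.of_mul_one_sub_exp {f : ℝ → ℝ} (hf : ContDiff ℝ ∞ f)
    (h : RapidDerivs fun T => f T * (1 - Real.exp (-1 * T))) : RapidDerivs f := by
  intro j M
  induction j using Nat.strong_induction_on with
  | _ j ih =>
    choose! C hC using ih
    obtain ⟨K, hK⟩ := h j M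
    have hcont : Continuous (fun T => (1 + T) ^ M * |iteratedDeriv j f T|) :=
      (by fun_prop : Continuous fun T : ℝ => (1 + T) ^ M).mul
        (hf.continuous_iteratedDeriv j (by exact_mod_cast le_top)).abs
    obtain ⟨B, hB⟩ := (isCompact_Icc (a := (0:ℝ)) (b := 1)).exists_bound_of_continuousOn
      hcont.continuousOn
    set e := 1 - Real.exp (-1) with he
    have he0 : 0 < e := by
      have : Real.exp (-1) < 1 := Real.exp_lt_one_iff.2 (by norm_num)
      linarith
    refine ⟨max B ((K + ∑ i ∈ Finset.range j, (j.choose i : ℝ) * C i) / e), fun T hT => ?_⟩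
    rcases le_total T 1 with h1 | h1
    · refine le_max_of_le_left ((le_abs_self _).trans (hB T ⟨hT, h1⟩))
    · refine le_max_of_le_right ?_
      rw [le_div_iff₀ he0]
      have h2 := leibniz_one_sub_exp hf j T
      have h3 : e ≤ 1 - Real.exp (-1 * T) := by
        have : Real.exp (-1 * T) ≤ Real.exp (-1) := Real.exp_le_exp.2 (by linarith)
        linarith
      have hE : Real.exp (-1 * T) ≤ 1 := Real.exp_le_one_iff.2 (by linarith)
      have hE0 := Real.exp_pos (-1 * T)
      have hp : 0 ≤ (1 + T) ^ M := by positivity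
      have h4 : |iteratedDeriv j f T| * (1 - Real.exp (-1 * T)) ≤
          |iteratedDeriv j (fun T => f T * (1 - Real.exp (-1 * T))) T| +
          ∑ i ∈ Finset.range j, (j.choose i : ℝ) * |iteratedDeriv i f T| := by
        have h5 : iteratedDeriv j f T * (1 - Real.exp (-1 * T)) =
          iteratedDeriv j (fun T => f T * (1 - Real.exp (-1 * T))) T + ∑ i ∈ Finset.range j,
            (j.choose i : ℝ) * iteratedDeriv i f T * ((-1) ^ (j - i) * Real.exp (-1 * T)) := by
          rw [h2]; ring
        have h6 : |iteratedDeriv j f T| * (1 - Real.exp (-1 * T)) =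
            |iteratedDeriv j f T * (1 - Real.exp (-1 * T))| := by
          rw [abs_mul, abs_of_nonneg (he0.le.trans h3)]
        rw [h6, h5]
        refine (abs_add_le _ _).trans (add_le_add le_rfl ?_)
        refine (Finset.abs_sum_le_sum_abs _ _).trans (Finset.sum_le_sum fun i _ => ?_)
        rw [abs_mul, abs_mul, Nat.abs_cast, abs_mul, abs_pow, abs_neg, abs_one, one_pow, one_mul,
          abs_of_pos hE0]
        exact mul_le_of_le_one_right (by positivity) hE
      calc (1 + T) ^ M * |iteratedDeriv j f T| * e
          ≤ (1 + T) ^ M * (|iteratedDeriv j f T| * (1 - Real.exp (-1 * T))) := by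
            rw [mul_assoc]; gcongr
        _ ≤ (1 + T) ^ M * (|iteratedDeriv j (fun T => f T * (1 - Real.exp (-1 * T))) T| +
            ∑ i ∈ Finset.range j, (j.choose i : ℝ) * |iteratedDeriv i f T|) := by gcongr
        _ = (1 + T) ^ M * |iteratedDeriv j (fun T => f T * (1 - Real.exp (-1 * T))) T| +
            ∑ i ∈ Finset.range j, (j.choose i : ℝ) * ((1 + T) ^ M * |iteratedDeriv i f T|) := by
            rw [mul_add, Finset.mul_sum]
            congr 1
            refine Finset.sum_congr rfl fun i _ => ?_
            ring
        _ ≤ _ := by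
            refine add_le_add (hK T hT) (Finset.sum_le_sum fun i hi => ?_)
            exact mul_le_mul_of_nonneg_left (hC i (Finset.mem_range.1 hi) T hT) (Nat.cast_nonneg _)

/-- The smooth function `(1 - exp (-T)) / T`. -/
noncomputable def expQuot (T : ℝ) : ℝ :=
  (dslope (fun z : ℂ => 1 - Complex.exp (-1 * z)) 0 (T : ℂ)).re

/-- The singularity at `0` is removable over `ℂ`: the difference quotient of an entire function is
entire, and its restriction to the real line is smooth. -/
theorem contDiff_expQuot : ContDiff ℝ ∞ expQuot := by
  have h1 : Differentiable ℂ (dslope (fun z : ℂ => 1 - Complex.exp (-1 * z)) 0) := by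
    rw [← differentiableOn_univ, Complex.differentiableOn_dslope univ_mem]
    exact Differentiable.differentiableOn (by fun_prop)
  have h2 : ContDiff ℝ ∞ (dslope (fun z : ℂ => 1 - Complex.exp (-1 * z)) 0) :=
    (h1.contDiff (n := ∞)).restrict_scalars ℝ
  exact Complex.reCLM.contDiff.comp (h2.comp Complex.ofRealCLM.contDiff)

theorem mul_expQuot (T : ℝ) : T * expQuot T = 1 - Real.exp (-1 * T) := by
  have h := sub_smul_dslope (fun z : ℂ => 1 - Complex.exp (-1 * z)) 0 (T : ℂ)
  have h' := congrArg Complex.re h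
  simp only [sub_zero, smul_eq_mul, Complex.re_ofReal_mul] at h'
  rw [expQuot, h']
  have : Complex.exp (-1 * (T : ℂ)) = ((Real.exp (-1 * T) : ℝ) : ℂ) := by push_cast; rfl
  rw [this, mul_zero, Complex.exp_zero, sub_self, sub_zero, ← Complex.ofReal_one,
    ← Complex.ofReal_sub, Complex.ofReal_re]

theorem expQuot_pos (T : ℝ) : 0 < expQuot T := by
  have h := mul_expQuot T
  rcases lt_trichotomy T 0 with hT | hT | hT
  · have h1 : 1 < Real.exp (-1 * T) := Real.one_lt_exp_iff.2 (by linarith)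
    by_contra hn
    push Not at hn
    nlinarith
  · subst hT
    have : HasDerivAt (fun z : ℂ => 1 - Complex.exp (-1 * z)) 1 0 := by
      have := (((hasDerivAt_id (0:ℂ)).const_mul (-1)).cexp).const_sub 1
      simpa using this
    rw [expQuot, Complex.ofReal_zero, dslope_same, this.deriv]
    simp
  · have h1 : Real.exp (-1 * T) < 1 := Real.exp_lt_one_iff.2 (by linarith)
    by_contra hn
    push Not at hn
    nlinarith

/-- The smooth function `T exp (-x T) / (1 - exp (-T))`. -/
noncomputable def bernoulliGen (x T : ℝ) : ℝ := Real.exp (-x * T) * (expQuot T)⁻¹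

theorem contDiff_bernoulliGen (x : ℝ) : ContDiff ℝ ∞ (bernoulliGen x) := by
  refine ContDiff.mul (by fun_prop) (contDiff_expQuot.inv fun T => (expQuot_pos T).ne')

theorem bernoulliGen_mul (x T : ℝ) :
    bernoulliGen x T * (1 - Real.exp (-1 * T)) = T * Real.exp (-x * T) := by
  rw [← mul_expQuot, bernoulliGen]
  have := (expQuot_pos T).ne'
  field_simp

theorem rapidDerivs_bernoulliGen {x : ℝ} (hx : 0 < x) : RapidDerivs (bernoulliGen x) := by
  refine RapidDerivs.of_mul_one_sub_exp (contDiff_bernoulliGen x) ?_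
  simp_rw [bernoulliGen_mul]
  exact rapidDerivs_mul_exp hx

theorem sum_aeval_bernoulli (x : ℝ) (j : ℕ) :
    ∑ i ∈ Finset.range (j + 1), ((j + 1).choose i : ℝ) *
      Polynomial.aeval x (Polynomial.bernoulli i) = (j + 1) * x ^ j := by
  have h := congrArg (Polynomial.aeval x) (Polynomial.sum_bernoulli j)
  simp only [map_sum, map_smul, Polynomial.aeval_monomial, map_add, map_natCast, map_one] at h
  rw [add_mul, ← h]
  refine Finset.sum_congr rfl fun i _ => ?_
  rw [Algebra.smul_def, map_natCast]

/-- Differentiating `φ(T)(1 - e^{-T}) = T e^{-xT}` at `0` to order `j + 1` gives a recursion which,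
up to the signs `(-1)^i`, is `∑_{i ≤ j} C(j+1, i) B_i(x) = (j+1) x^j`. -/
theorem iteratedDeriv_bernoulliGen (x : ℝ) (j : ℕ) : iteratedDeriv j (bernoulliGen x) 0 =
    Polynomial.aeval x ((-1) ^ j * Polynomial.bernoulli j) := by
  induction j using Nat.strong_induction_on with
  | _ j ih =>
    have h := leibniz_one_sub_exp (contDiff_bernoulliGen x) (j + 1) 0
    simp_rw [bernoulliGen_mul] at h
    rw [iteratedDeriv_mul_exp] at h
    simp only [mul_zero, Real.exp_zero, sub_self, mul_one, add_zero, zero_sub,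
      Nat.add_sub_cancel] at h
    have hb := sum_aeval_bernoulli x j
    rw [Finset.sum_range_succ] at h hb
    have e : ∑ i ∈ Finset.range j, ((j + 1).choose i : ℝ) * iteratedDeriv i (bernoulliGen x) 0 *
        (-1) ^ (j + 1 - i) = (-1) ^ (j + 1) * ∑ i ∈ Finset.range j, ((j + 1).choose i : ℝ) *
          Polynomial.aeval x (Polynomial.bernoulli i) := by
      rw [Finset.mul_sum]
      refine Finset.sum_congr rfl fun i hi => ?_
      have hij := Finset.mem_range.1 hi
      rw [ih i hij]
      have e1 : j + 1 = (j + 1 - i) + i := by omega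
      have e2 : (-1 : ℝ) ^ (j + 1) = (-1) ^ (j + 1 - i) * (-1) ^ i := by
        rw [← pow_add]; congr 1
      rw [e2]
      simp only [map_mul, map_pow, map_neg, map_one]
      ring
    rw [e] at h
    simp only [Nat.choose_succ_self_right, Nat.add_sub_cancel_left, pow_one] at h hb
    have hj : ((j : ℝ) + 1) ≠ 0 := by positivity
    have hxj : (-x) ^ j = (-1) ^ j * x ^ j := by rw [← mul_pow]; simp
    have hs : (-1 : ℝ) ^ (j + 1) = -(-1) ^ j := by ring
    rw [hxj, hs] at h
    push_cast at h hb
    simp only [map_mul, map_pow, map_neg, map_one]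
    apply mul_left_cancel₀ hj
    linear_combination -h - (-1) ^ j * hb

/-- Summation over `ℕ`. -/
noncomputable def sumKind : Kind ℕ where
  ν := Measure.count
  sigmaFinite := inferInstance
  emb := fun m => m
  measurable_emb := measurable_from_top
  emb_nonneg := fun m => Nat.cast_nonneg m
  integrable_rpow := by
    intro ε hε σ hσ
    rw [integrable_count_iff]
    have h := ((Real.summable_one_div_nat_add_rpow ε σ).2 hσ).mul_left (ε ^ σ)
    refine h.congr fun m => ?_
    have h1 : 0 ≤ 1 + (m : ℝ) / ε := by positivity
    have h2 : 0 < (m : ℝ) + ε := by positivity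
    rw [Real.norm_of_nonneg (Real.rpow_nonneg h1 _), abs_of_pos h2, Real.rpow_neg h1]
    have h3 : 1 + (m : ℝ) / ε = (m + ε) / ε := by field_simp; ring
    rw [h3, Real.div_rpow h2.le hε.le]
    field_simp
  φ := bernoulliGen
  laplace := by
    intro x hx T hT
    have hq : Real.exp (-1 * T) < 1 := Real.exp_lt_one_iff.2 (by linarith)
    have e : ∀ m : ℕ, Real.exp (-((m + x) * T)) = Real.exp (-x * T) * Real.exp (-1 * T) ^ m := by
      intro m
      rw [← Real.exp_nat_mul, ← Real.exp_add]
      congr 1; ring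
    simp_rw [e]
    have hs : Summable fun m : ℕ => Real.exp (-x * T) * Real.exp (-1 * T) ^ m :=
      (summable_geometric_of_lt_one (Real.exp_pos _).le hq).mul_left _
    rw [integral_countable (integrable_count_iff.2 hs.norm)]
    simp only [Measure.real, Measure.count_singleton, ENNReal.toReal_one, one_smul]
    rw [tsum_mul_left, tsum_geometric_of_lt_one (Real.exp_pos _).le hq, eq_div_iff hT.ne',
      ← div_eq_mul_inv, div_mul_eq_mul_div, div_eq_iff (by linarith), bernoulliGen_mul, mul_comm]
  contDiff := fun x _ => contDiff_bernoulliGen x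
  decay := fun x hx => rapidDerivs_bernoulliGen hx
  β := fun j => (-1) ^ j * Polynomial.bernoulli j
  taylor := fun x _ j => iteratedDeriv_bernoulliGen x j

/-- Integration over `(0, ∞)`. -/
noncomputable def intKind : Kind ℝ where
  ν := volume.restrict (Ioi 0)
  sigmaFinite := inferInstance
  -- The absolute value makes the embedding nonnegative at every point; on the support `(0, ∞)` of
  -- the measure it is the identity.
  emb := fun y => |y|
  measurable_emb := measurable_id.abs
  emb_nonneg := fun y => abs_nonneg y
  integrable_rpow := by
    intro ε hε σ hσ
    have h := (integrableOn_add_rpow_Ioi_of_lt (a := -σ) (c := 0) (m := ε) (by linarith)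
      (by linarith)).const_mul (ε ^ σ)
    refine h.congr ?_
    filter_upwards [ae_restrict_mem measurableSet_Ioi] with y hy
    have hy0 : 0 < y := hy
    have h3 : 1 + y / ε = (y + ε) / ε := by field_simp; ring
    rw [abs_of_pos hy0, h3, Real.div_rpow (by positivity) hε.le, Real.rpow_neg hε.le σ]
    field_simp
  φ := fun x T => Real.exp (-x * T)
  laplace := by
    intro x hx T hT
    have e : ∀ y ∈ Ioi (0:ℝ), Real.exp (-((|y| + x) * T)) =
        Real.exp (-x * T) * Real.exp (-T * y) := by
      intro y hy
      rw [abs_of_pos hy, ← Real.exp_add]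
      congr 1; ring
    rw [setIntegral_congr_fun measurableSet_Ioi e, integral_const_mul,
      integral_exp_mul_Ioi (by linarith)]
    simp
    ring
  contDiff := fun x _ => by fun_prop
  decay := fun x hx => rapidDerivs_exp hx
  β := fun j => (-Polynomial.X) ^ j
  taylor := fun x _ j => by
    rw [iteratedDeriv_exp_const_mul]
    simp

end Kinds

end LieZeta

namespace LieZeta

set_option autoImplicit false

/-! ### Combinations of products of one-variable polynomials. -/

section Separable

open MvPolynomial

variable {r : ℕ}

/-- The product of polynomials in the separate variables. -/
noncomputable def sepProd (f : Fin r → Polynomial ℚ) : MvPolynomial (Fin r) ℚ :=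
  ∏ i, Polynomial.aeval (X i) (f i)

theorem sepProd_eq_mul_erase (f : Fin r → Polynomial ℚ) (k : Fin r) :
    sepProd f = Polynomial.aeval (X k) (f k) *
      ∏ i ∈ Finset.univ.erase k, Polynomial.aeval (X i) (f i) :=
  (Finset.mul_prod_erase Finset.univ _ (Finset.mem_univ k)).symm

theorem sepProd_update (f : Fin r → Polynomial ℚ) (k : Fin r) (p : Polynomial ℚ) :
    sepProd (Function.update f k p) = Polynomial.aeval (X k) p *
      ∏ i ∈ Finset.univ.erase k, Polynomial.aeval (X i) (f i) := by
  rw [sepProd_eq_mul_erase _ k, Function.update_self]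
  congr 1
  refine Finset.prod_congr rfl fun i hi => ?_
  rw [Function.update_of_ne (Finset.ne_of_mem_erase hi)]

/-- The forward difference of a polynomial. -/
noncomputable def fwdDiff (p : Polynomial ℚ) : Polynomial ℚ := p.comp (1 + Polynomial.X) - p

theorem diff_sepProd (k : Fin r) (f : Fin r → Polynomial ℚ) :
    diff k (sepProd f) = sepProd (Function.update f k (fwdDiff (f k))) := by
  rw [sepProd_update, diff]
  have h : aeval (fun i => X i + C (Pi.single k (1 : ℚ) i)) (sepProd f) =
      Polynomial.aeval (X k) ((f k).comp (1 + Polynomial.X)) *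
        ∏ i ∈ Finset.univ.erase k, Polynomial.aeval (X i) (f i) := by
    rw [sepProd_eq_mul_erase f k, map_mul, map_prod]
    congr 1
    · rw [← Polynomial.aeval_algHom_apply, aeval_X, Polynomial.aeval_comp]
      simp [add_comm]
    · refine Finset.prod_congr rfl fun i hi => ?_
      rw [← Polynomial.aeval_algHom_apply, aeval_X,
        Pi.single_eq_of_ne (Finset.ne_of_mem_erase hi), map_zero, add_zero]
  rw [h, sepProd_eq_mul_erase f k, fwdDiff, map_sub, sub_mul]

theorem pderiv_sepProd (k : Fin r) (f : Fin r → Polynomial ℚ) :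
    pderiv k (sepProd f) = sepProd (Function.update f k (Polynomial.derivative (f k))) := by
  have h0 : ∀ S : Finset (Fin r), k ∉ S →
      pderiv k (∏ i ∈ S, Polynomial.aeval (X i : MvPolynomial (Fin r) ℚ) (f i)) = 0 := by
    intro S hS
    induction S using Finset.induction_on with
    | empty => simp
    | insert a S ha ih =>
      rw [Finset.prod_insert ha, Derivation.leibniz, ih fun h => hS (Finset.mem_insert_of_mem h),
        Derivation.map_aeval, pderiv_X_of_ne fun h => hS (by simp [h])]
      simp
  rw [sepProd_update, sepProd_eq_mul_erase f k, Derivation.leibniz, h0 _ (by simp),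
    Derivation.map_aeval, pderiv_X_self]
  simp [mul_comm]

theorem foldr_sepProd (T : Fin r → MvPolynomial (Fin r) ℚ → MvPolynomial (Fin r) ℚ)
    (D : Polynomial ℚ → Polynomial ℚ)
    (hT : ∀ k f, T k (sepProd f) = sepProd (Function.update f k (D (f k)))) (l : List (Fin r))
    (hl : l.Nodup) (f : Fin r → Polynomial ℚ) :
    l.foldr T (sepProd f) = sepProd fun i => if i ∈ l then D (f i) else f i := by
  induction l with
  | nil => simp
  | cons k l ih =>
    rw [List.nodup_cons] at hl
    rw [List.foldr_cons, ih hl.2, hT]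
    congr 1
    funext i
    by_cases hi : i = k
    · subst hi; simp [hl.1]
    · simp [hi]

theorem foldr_linear (T : Fin r → MvPolynomial (Fin r) ℚ → MvPolynomial (Fin r) ℚ)
    (hadd : ∀ k p q, T k (p + q) = T k p + T k q) (hzero : ∀ k, T k 0 = 0)
    (hmul : ∀ k a p, T k (C a * p) = C a * T k p) (l : List (Fin r)) {ι : Type*} (s : Finset ι)
    (a : ι → ℚ) (p : ι → MvPolynomial (Fin r) ℚ) :
    l.foldr T (∑ L ∈ s, C (a L) * p L) = ∑ L ∈ s, C (a L) * l.foldr T (p L) := by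
  classical
  have hs : ∀ k (q : ι → MvPolynomial (Fin r) ℚ), T k (∑ L ∈ s, q L) = ∑ L ∈ s, T k (q L) := by
    intro k q
    induction s using Finset.induction_on with
    | empty => simpa using hzero k
    | insert b s hb ih => rw [Finset.sum_insert hb, Finset.sum_insert hb, hadd, ih]
  induction l with
  | nil => rfl
  | cons k l ih =>
    rw [List.foldr_cons, ih, hs]
    refine Finset.sum_congr rfl fun L _ => ?_
    rw [hmul, List.foldr_cons]

theorem diffAll_sum {ι : Type*} (s : Finset ι) (a : ι → ℚ) (f : ι → Fin r → Polynomial ℚ) :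
    diffAll (∑ L ∈ s, C (a L) * sepProd (f L)) =
      ∑ L ∈ s, C (a L) * sepProd fun i => fwdDiff (f L i) := by
  unfold diffAll
  rw [foldr_linear diff]
  · refine Finset.sum_congr rfl fun L _ => ?_
    rw [foldr_sepProd diff fwdDiff diff_sepProd _ (List.nodup_finRange r)]
    simp
  · intro k p q; simp only [diff, map_add]; ring
  · intro k; simp [diff]
  · intro k a p; simp only [diff, map_mul, algHom_C, algebraMap_eq]; ring

theorem pderivAll_sum {ι : Type*} (s : Finset ι) (a : ι → ℚ) (f : ι → Fin r → Polynomial ℚ) :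
    pderivAll (∑ L ∈ s, C (a L) * sepProd (f L)) =
      ∑ L ∈ s, C (a L) * sepProd fun i => Polynomial.derivative (f L i) := by
  unfold pderivAll
  rw [foldr_linear (fun k q => pderiv k q)]
  · refine Finset.sum_congr rfl fun L _ => ?_
    rw [foldr_sepProd _ (fun p => Polynomial.derivative p) pderiv_sepProd _ (List.nodup_finRange r)]
    simp
  · intro k p q; simp
  · intro k; simp
  · intro k a p; simp

/-- The combination of products of Bernoulli polynomials with coefficients `a`. -/
noncomputable def bernoulliSum (N : ℕ) (a : (Fin r → ℕ) → ℚ) : MvPolynomial (Fin r) ℚ :=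
  ∑ L ∈ multiIndices r N, C (a L) * sepProd fun i => Polynomial.bernoulli (L i)

/-- The combination of monomials with coefficients `a`. -/
noncomputable def powerSum (N : ℕ) (a : (Fin r → ℕ) → ℚ) : MvPolynomial (Fin r) ℚ :=
  ∑ L ∈ multiIndices r N, C (a L) * sepProd fun i => Polynomial.X ^ L i

/-- Both operators act on each variable separately, and `B_m(x+1) - B_m(x) = m x^{m-1}` is the
derivative of `x^m`. -/
theorem diffAll_bernoulliSum (N : ℕ) (a : (Fin r → ℕ) → ℚ) :
    diffAll (bernoulliSum N a) = pderivAll (powerSum N a) := by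
  unfold bernoulliSum powerSum
  rw [diffAll_sum, pderivAll_sum]
  refine Finset.sum_congr rfl fun L _ => ?_
  congr 2
  funext i
  rw [fwdDiff, Polynomial.bernoulli_comp_one_add_X, Polynomial.derivative_X_pow]
  simp

/-- Since `B_m(1 - x) = (-1)^m B_m(x)`, the term of `L` acquires the sign `(-1)^{|L|}`, which is the
same for all `L` in the sum. -/
theorem reflect_bernoulliSum (N : ℕ) (a : (Fin r → ℕ) → ℚ) :
    reflect (bernoulliSum N a) = (-1) ^ N * bernoulliSum N a := by
  unfold bernoulliSum reflect
  rw [map_sum, Finset.mul_sum]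
  refine Finset.sum_congr rfl fun L hL => ?_
  rw [map_mul, algHom_C, sepProd, map_prod]
  have h : ∀ i, aeval (fun i => 1 - X i) (Polynomial.aeval (X i : MvPolynomial (Fin r) ℚ)
      (Polynomial.bernoulli (L i))) = (-1) ^ L i *
        Polynomial.aeval (X i : MvPolynomial (Fin r) ℚ) (Polynomial.bernoulli (L i)) := by
    intro i
    have := congrArg (Polynomial.aeval (X i : MvPolynomial (Fin r) ℚ))
      (Polynomial.bernoulli_comp_one_sub_X (L i))
    rw [Polynomial.aeval_comp] at this
    rw [← Polynomial.aeval_algHom_apply, aeval_X]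
    simpa using this
  simp_rw [h]
  rw [Finset.prod_mul_distrib, Finset.prod_pow_eq_pow_sum]
  rw [multiIndices, Finset.mem_piAntidiag] at hL
  have hsum : ∑ i, L i = N := hL.1
  rw [hsum, algebraMap_eq]
  ring

theorem coeff_sepProd (f : Fin r → Polynomial ℚ) (d : Fin r →₀ ℕ) :
    coeff d (sepProd f) = ∏ i, (f i).coeff (d i) := by
  classical
  have h1 : ∀ i, Polynomial.aeval (X i : MvPolynomial (Fin r) ℚ) (f i) =
      -- A range common to all factors, long enough to contain every degree and every exponent of
      -- `d`.
      ∑ m ∈ Finset.range ((∑ i, (f i).natDegree) + (∑ i, d i) + 1), C ((f i).coeff m) * X i ^ m := by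
    intro i
    rw [Polynomial.aeval_eq_sum_range' (n := (∑ i, (f i).natDegree) + (∑ i, d i) + 1)]
    · simp [smul_eq_C_mul]
    · have : (f i).natDegree ≤ ∑ i, (f i).natDegree :=
        Finset.single_le_sum (f := fun i => (f i).natDegree) (fun _ _ => Nat.zero_le _)
          (Finset.mem_univ i)
      omega
  rw [sepProd]
  simp_rw [h1]
  rw [Finset.prod_univ_sum, coeff_sum]
  have h2 : ∀ L : Fin r → ℕ, ∏ i, (C ((f i).coeff (L i)) * X i ^ L i : MvPolynomial (Fin r) ℚ) =
      monomial (Finsupp.equivFunOnFinite.symm L) (∏ i, (f i).coeff (L i)) := by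
    intro L
    rw [Finset.prod_mul_distrib, ← map_prod, MvPolynomial.monomial_eq]
    congr 1
    rw [Finsupp.prod_fintype _ _ (by simp)]
    rfl
  simp_rw [h2, coeff_monomial]
  rw [Finset.sum_eq_single (fun i => d i)]
  · rw [if_pos (by ext; rfl)]
  · intro L _ hL
    rw [if_neg]
    rintro rfl
    exact hL (by funext i; rfl)
  · intro h
    exfalso
    apply h
    rw [Fintype.mem_piFinset]
    intro i
    have : d i ≤ ∑ i, d i :=
      Finset.single_le_sum (f := fun i => d i) (fun _ _ => Nat.zero_le _) (Finset.mem_univ i)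
    rw [Finset.mem_range]
    omega

theorem mem_multiIndices {N : ℕ} {L : Fin r → ℕ} : L ∈ multiIndices r N ↔ ∑ i, L i = N := by
  rw [multiIndices, Finset.mem_piAntidiag]
  exact ⟨fun h => h.1, fun h => ⟨h, by simp⟩⟩

theorem coeff_powerSum (N : ℕ) (a : (Fin r → ℕ) → ℚ) (d : Fin r →₀ ℕ) :
    coeff d (powerSum N a) = if ∑ i, d i = N then a d else 0 := by
  unfold powerSum
  simp only [coeff_sum, coeff_C_mul, coeff_sepProd, Polynomial.coeff_X_pow]
  have h : ∀ L : Fin r → ℕ, (∏ i, if d i = L i then (1:ℚ) else 0) = if L = d then 1 else 0 := by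
    intro L
    by_cases hL : L = d
    · subst hL; simp
    · rw [if_neg hL]
      obtain ⟨i, hi⟩ := Function.ne_iff.1 hL
      exact Finset.prod_eq_zero (Finset.mem_univ i) (if_neg fun h => hi h.symm)
  simp_rw [h]
  by_cases hd : ∑ i, d i = N
  · rw [if_pos hd, Finset.sum_eq_single (d : Fin r → ℕ)]
    · simp
    · intro L _ hL; simp [hL]
    · intro hn; exact absurd (mem_multiIndices.2 hd) hn
  · rw [if_neg hd]
    refine Finset.sum_eq_zero fun L hL => ?_
    rw [if_neg, mul_zero]
    rintro rfl
    exact hd (mem_multiIndices.1 hL)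

/-- `B_m` is monic of degree `m`, so in total degree at least `N` the product for `L` can contribute
only its leading monomial. Hence the degree can be read off from the combination of monomials. -/
theorem coeff_bernoulliSum {N : ℕ} (a : (Fin r → ℕ) → ℚ) {d : Fin r →₀ ℕ}
    (hd : N ≤ ∑ i, d i) : coeff d (bernoulliSum N a) = coeff d (powerSum N a) := by
  unfold bernoulliSum powerSum
  simp only [coeff_sum, coeff_C_mul, coeff_sepProd, Polynomial.coeff_X_pow,
    Polynomial.coeff_bernoulli]
  refine Finset.sum_congr rfl fun L hL => ?_
  rw [mem_multiIndices] at hL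
  congr 1
  by_cases h : ∀ i, d i = L i
  · refine Finset.prod_congr rfl fun i _ => ?_
    simp [h i]
  · push Not at h
    obtain ⟨i, hi⟩ := h
    have : ∃ k, L k < d k := by
      by_contra hn
      push Not at hn
      have := Finset.sum_lt_sum (fun k _ => hn k) ⟨i, Finset.mem_univ i, lt_of_le_of_ne (hn i) hi⟩
      omega
    obtain ⟨k, hk⟩ := this
    rw [Finset.prod_eq_zero (Finset.mem_univ k) (if_neg (not_le.2 hk)),
      Finset.prod_eq_zero (Finset.mem_univ i) (if_neg hi)]

theorem isHomogeneous_powerSum (N : ℕ) (a : (Fin r → ℕ) → ℚ) : (powerSum N a).IsHomogeneous N := by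
  intro d hd
  rw [coeff_powerSum] at hd
  have : ∑ i, d i = N := by
    by_contra h
    rw [if_neg h] at hd
    exact hd rfl
  rw [Finsupp.weight_apply, Finsupp.sum_fintype _ _ (by simp)]
  simpa using this

theorem totalDegree_powerSum {N : ℕ} {a : (Fin r → ℕ) → ℚ} (h : powerSum N a ≠ 0) :
    (powerSum N a).totalDegree = N := (isHomogeneous_powerSum N a).totalDegree h

theorem totalDegree_bernoulliSum {N : ℕ} {a : (Fin r → ℕ) → ℚ} (h : powerSum N a ≠ 0) :
    (bernoulliSum N a).totalDegree = N := by
  apply le_antisymm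
  · refine Finset.sup_le fun d hd => ?_
    rw [Finsupp.sum_fintype _ _ (by simp)]
    by_contra hn
    push Not at hn
    rw [mem_support_iff, coeff_bernoulliSum a hn.le, coeff_powerSum, if_neg hn.ne'] at hd
    exact hd rfl
  · obtain ⟨d, hd⟩ := ne_zero_iff.1 h
    have hN : ∑ i, d i = N := by
      by_contra hn
      rw [coeff_powerSum, if_neg hn] at hd
      exact hd rfl
    have hmem : d ∈ (bernoulliSum N a).support := by
      rw [mem_support_iff, coeff_bernoulliSum a hN.ge]
      exact hd
    have := le_totalDegree hmem
    rw [Finsupp.sum_fintype _ _ (by simp)] at this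
    omega

/-- An antiderivative is `B_{m+1}/(m+1)`, whose increment over a unit interval is `x^m`. -/
theorem integral_bernoulli_add (m : ℕ) (x : ℝ) :
    ∫ t in Set.Icc (0:ℝ) 1, Polynomial.aeval (x + t) (Polynomial.bernoulli m) = x ^ m := by
  rw [integral_Icc_eq_integral_Ioc, ← intervalIntegral.integral_of_le zero_le_one]
  have hm : ((m : ℝ) + 1) ≠ 0 := by positivity
  have hd : ∀ t : ℝ, HasDerivAt (fun t : ℝ => ((m : ℝ) + 1)⁻¹ *
      Polynomial.aeval (x + t) (Polynomial.bernoulli (m + 1)))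
      (Polynomial.aeval (x + t) (Polynomial.bernoulli m)) t := by
    intro t
    have h1 := (Polynomial.bernoulli (m + 1)).hasDerivAt_aeval (x + t)
    have h2 := (h1.comp_const_add x t).const_mul (((m : ℝ) + 1)⁻¹)
    rw [Polynomial.derivative_bernoulli_add_one] at h2
    simp only [map_mul, map_add, map_natCast, map_one] at h2
    rwa [inv_mul_cancel_left₀ hm] at h2
  have hc : Continuous fun t : ℝ => Polynomial.aeval (x + t) (Polynomial.bernoulli m) :=
    (Polynomial.continuous_aeval _).comp (by fun_prop)
  rw [intervalIntegral.integral_eq_sub_of_hasDerivAt (fun t _ => hd t) (hc.intervalIntegrable _ _)]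
  have h3 := congrArg (Polynomial.aeval x) (Polynomial.bernoulli_comp_one_add_X (m + 1))
  rw [Polynomial.aeval_comp] at h3
  simp only [map_add, map_one, Polynomial.aeval_X, map_nsmul, map_pow, Nat.add_sub_cancel] at h3
  rw [add_zero, add_comm x 1, h3, nsmul_eq_mul]
  push_cast
  field_simp
  ring

theorem aeval_sepProd {A : Type*} [CommRing A] [Algebra ℚ A] (f : Fin r → Polynomial ℚ)
    (x : Fin r → A) : aeval x (sepProd f) = ∏ i, Polynomial.aeval (x i) (f i) := by
  rw [sepProd, map_prod]
  refine Finset.prod_congr rfl fun i _ => ?_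
  rw [← Polynomial.aeval_algHom_apply, aeval_X]

theorem aeval_bernoulliSum {A : Type*} [CommRing A] [Algebra ℚ A] (N : ℕ) (a : (Fin r → ℕ) → ℚ)
    (x : Fin r → A) : aeval x (bernoulliSum N a) = ∑ L ∈ multiIndices r N,
      algebraMap ℚ A (a L) * ∏ i, Polynomial.aeval (x i) (Polynomial.bernoulli (L i)) := by
  simp only [bernoulliSum, map_sum, map_mul, algHom_C, aeval_sepProd]

theorem aeval_powerSum {A : Type*} [CommRing A] [Algebra ℚ A] (N : ℕ) (a : (Fin r → ℕ) → ℚ)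
    (x : Fin r → A) : aeval x (powerSum N a) = ∑ L ∈ multiIndices r N,
      algebraMap ℚ A (a L) * ∏ i, x i ^ L i := by
  simp only [powerSum, map_sum, map_mul, algHom_C, aeval_sepProd, map_pow, Polynomial.aeval_X]

theorem integral_bernoulliSum (N : ℕ) (a : (Fin r → ℕ) → ℚ) (x : Fin r → ℝ) :
    aeval x (powerSum N a) = ∫ t in Set.Icc (0 : Fin r → ℝ) 1, aeval (x + t) (bernoulliSum N a) := by
  simp only [aeval_powerSum, aeval_bernoulliSum, Pi.add_apply]
  have hc : ∀ L : Fin r → ℕ, Continuous fun t : Fin r → ℝ =>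
      ∏ i, Polynomial.aeval (x i + t i) (Polynomial.bernoulli (L i)) := fun L =>
    continuous_finsetProd _ fun i _ => (Polynomial.continuous_aeval _).comp (by fun_prop)
  rw [integral_finsetSum]
  · refine Finset.sum_congr rfl fun L _ => ?_
    rw [integral_const_mul]
    congr 1
    have h1 : (volume : Measure (Fin r → ℝ)).restrict (Set.Icc 0 1) =
        Measure.pi fun _ : Fin r => volume.restrict (Set.Icc (0:ℝ) 1) := by
      rw [← Measure.restrict_pi_pi, volume_pi, Set.pi_univ_Icc]
      rfl
    rw [h1, integral_fintype_prod_eq_prod (f := fun i (t : ℝ) =>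
      Polynomial.aeval (x i + t) (Polynomial.bernoulli (L i)))]
    simp_rw [integral_bernoulli_add]
  · intro L _
    exact ((hc L).const_mul _).integrableOn_Icc

end Separable

end LieZeta

namespace LieZeta

set_option autoImplicit false

/-! ### Zeta functions of families of linear forms and their differences. -/

section FormZeta

open Filter Topology

variable {n r : ℕ} {c : Fin n → Fin r → ℕ}

/-- The zeta series of a family of linear forms. -/
noncomputable def formSum (c : Fin n → Fin r → ℕ) (s : ℂ) (x : Fin r → ℂ) : ℂ :=
  ∑' m : Fin r → ℕ, formTerm c s fun k => (m k : ℂ) + x k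

/-- The zeta integral of a family of linear forms. -/
noncomputable def formInt (c : Fin n → Fin r → ℕ) (s : ℂ) (x : Fin r → ℂ) : ℂ :=
  ∫ t in orthant r, formTerm c s fun k => (t k : ℂ) + x k

theorem pi_count (r : ℕ) :
    (Measure.pi fun _ : Fin r => (Measure.count : Measure ℕ)) = Measure.count := by
  refine Measure.ext_of_singleton fun m => ?_
  rw [Measure.pi_singleton]
  simp

theorem restrict_orthant (r : ℕ) : (volume : Measure (Fin r → ℝ)).restrict (orthant r) =
    Measure.pi fun _ : Fin r => volume.restrict (Set.Ioi (0:ℝ)) := by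
  rw [← Measure.restrict_pi_pi, volume_pi]
  congr 1
  ext t; simp [orthant]

theorem measurableSet_orthant (r : ℕ) : MeasurableSet (orthant r) := by
  have : orthant r = Set.pi Set.univ fun _ => Set.Ioi 0 := by ext t; simp [orthant]
  rw [this]
  exact MeasurableSet.univ_pi fun _ => measurableSet_Ioi

theorem IsFormFamily.eq_zero_of_rank {c : Fin n → Fin 0 → ℕ} (hc : IsFormFamily c) : n = 0 := by
  by_contra h
  exact hc.ne_zero ⟨0, by omega⟩ (Subsingleton.elim _ _)

theorem summable_formTerm (hc : IsFormFamily c) {s : ℂ} (hs : (r : ℝ) < s.re) {x : Fin r → ℂ}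
    (hx : ∀ k, 0 < (x k).re) :
    Summable fun m : Fin r → ℕ => formTerm c s fun k => (m k : ℂ) + x k := by
  -- For `r ≥ 1` the hypothesis gives the bound `Re s > 1` used in the estimates. In rank zero it
  -- does not, but there is only one term.
  rcases Nat.eq_zero_or_pos r with hr | hr
  · subst hr; exact Summable.of_finite
  · have hs1 : 1 < s.re := lt_of_le_of_lt (by exact_mod_cast hr) hs
    have h := sumKind.integrable_formTerm hc hs1 hx
    change Integrable (fun m : Fin r → ℕ => formTerm c s fun k => (((m k : ℝ)) : ℂ) + x k)
      (Measure.pi fun _ => Measure.count) at h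
    rw [pi_count, integrable_count_iff] at h
    simpa using h.of_norm

theorem formSum_eq_total (hc : IsFormFamily c) {s : ℂ} (hs : (r : ℝ) < s.re) {x : Fin r → ℂ}
    (hx : ∀ k, 0 < (x k).re) : formSum c s x = sumKind.total c s x := by
  change _ = ∫ m : Fin r → ℕ, formTerm c s (fun k => (((m k : ℝ)) : ℂ) + x k)
    ∂(Measure.pi fun _ => Measure.count)
  rw [pi_count, integral_countable]
  · simp [formSum, Measure.real]
  · rw [integrable_count_iff]
    simpa using (summable_formTerm hc hs hx).norm

theorem formInt_integrand_ae (c : Fin n → Fin r → ℕ) (s : ℂ) (x : Fin r → ℂ) :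
    (fun t : Fin r → ℝ => formTerm c s fun k => (t k : ℂ) + x k) =ᵐ[volume.restrict (orthant r)]
      fun t => formTerm c s fun k => ((intKind.emb (t k) : ℝ) : ℂ) + x k := by
  filter_upwards [ae_restrict_mem (measurableSet_orthant r)] with t ht
  congr 1
  funext k
  rw [show intKind.emb (t k) = t k from abs_of_pos (ht k)]

theorem formInt_eq_total (c : Fin n → Fin r → ℕ) (s : ℂ) (x : Fin r → ℂ) :
    formInt c s x = intKind.total c s x := by
  rw [formInt, integral_congr_ae (formInt_integrand_ae c s x), restrict_orthant]
  rfl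

theorem integrableOn_formTerm (hc : IsFormFamily c) {s : ℂ} (hs : (r : ℝ) < s.re) {x : Fin r → ℂ}
    (hx : ∀ k, 0 < (x k).re) :
    IntegrableOn (fun t : Fin r → ℝ => formTerm c s fun k => (t k : ℂ) + x k) (orthant r) := by
  rcases Nat.eq_zero_or_pos r with hr | hr
  · subst hr
    have h0 := hc.eq_zero_of_rank
    subst h0
    have : (fun t : Fin 0 → ℝ => formTerm c s fun k => (t k : ℂ) + x k) = fun _ => 1 := by
      funext t; simp [formTerm]
    rw [this]
    refine integrableOn_const ?_
    rw [volume_pi, Measure.pi_of_empty]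
    exact measure_ne_top _ _
  · have hs1 : 1 < s.re := lt_of_le_of_lt (by exact_mod_cast hr) hs
    rw [IntegrableOn, integrable_congr (formInt_integrand_ae c s x), restrict_orthant]
    exact intKind.integrable_formTerm hc hs1 hx

theorem Kind.analyticOnNhd_total {Y : Type} [MeasurableSpace Y] (κ : Kind Y)
    (hc : IsFormFamily c) : AnalyticOnNhd ℂ (fun z : ℂ × (Fin r → ℂ) => κ.total c z.1 z.2)
      {z | (r : ℝ) < z.1.re ∧ ∀ k, 0 < (z.2 k).re} := by
  intro z hz
  rcases Nat.eq_zero_or_pos r with hr | hr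
  · subst hr
    have h0 := hc.eq_zero_of_rank
    subst h0
    have : (fun z : ℂ × (Fin 0 → ℂ) => κ.total c z.1 z.2) = fun _ =>
        κ.total c 1 (fun _ => 0) := by
      funext z; simp [Kind.total, formTerm]
    rw [this]
    exact analyticAt_const
  · exact κ.analyticAt_total hc (lt_of_le_of_lt (by exact_mod_cast hr) hz.1) hz.2

theorem analyticOnNhd_formSum (hc : IsFormFamily c) :
    AnalyticOnNhd ℂ (fun z : ℂ × (Fin r → ℂ) => formSum c z.1 z.2)
      {z | (r : ℝ) < z.1.re ∧ ∀ k, 0 < (z.2 k).re} := by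
  intro z hz
  refine (sumKind.analyticOnNhd_total hc z hz).congr ?_
  filter_upwards [(isOpen_convergence_region r r).mem_nhds hz] with w hw
  exact (formSum_eq_total hc hw.1 hw.2).symm

theorem analyticOnNhd_formInt (hc : IsFormFamily c) :
    AnalyticOnNhd ℂ (fun z : ℂ × (Fin r → ℂ) => formInt c z.1 z.2)
      {z | (r : ℝ) < z.1.re ∧ ∀ k, 0 < (z.2 k).re} := by
  simp_rw [formInt_eq_total]
  exact intKind.analyticOnNhd_total hc

theorem sum_neg_one_pow {A : Type*} [CommRing A] (N : ℕ) (w : (Fin r → ℕ) → A)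
    (f : (Fin r → ℕ) → Fin r → A) :
    ∑ L ∈ multiIndices r N, w L * ∏ k, ((-1) ^ L k * f L k) =
      ∑ L ∈ multiIndices r N, ((-1) ^ N * w L) * ∏ k, f L k := by
  refine Finset.sum_congr rfl fun L hL => ?_
  rw [Finset.prod_mul_distrib, Finset.prod_pow_eq_pow_sum, mem_multiIndices.1 hL]
  ring

/-- The continuations of the zeta series and of the zeta integral, and their special values. -/
theorem exists_form_continuation (hc : IsFormFamily c) :
    ∃ a : ℕ → (Fin r → ℕ) → ℚ, ∀ x ∈ orthant r,
      (∃ F, IsMeromorphicContinuation r (fun s => formSum c s fun k => (x k : ℂ)) F ∧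
        ∀ ℓ : ℕ, AnalyticAt ℂ F (-ℓ) ∧
          F (-ℓ) = MvPolynomial.aeval (fun k => (x k : ℂ)) (bernoulliSum (n * ℓ + r) (a ℓ))) ∧
      (∃ F, IsMeromorphicContinuation r (fun s => formInt c s fun k => (x k : ℂ)) F ∧
        ∀ ℓ : ℕ, AnalyticAt ℂ F (-ℓ) ∧
          F (-ℓ) = MvPolynomial.aeval (fun k => (x k : ℂ)) (powerSum (n * ℓ + r) (a ℓ))) := by
  obtain ⟨w, hw⟩ := exists_continuation hc
  -- Both kinds have derivatives with the sign `(-1)^j` at order `j`. These signs multiply to a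
  -- common one, which is absorbed into the coefficients.
  refine ⟨fun ℓ L => (-1) ^ (n * ℓ + r) * w ℓ L, fun x hx => ⟨?_, ?_⟩⟩
  · obtain ⟨F, h1, h2⟩ := hw sumKind x hx
    refine ⟨F, ⟨h1.1, fun s hs => ?_⟩, fun ℓ => ⟨(h2 ℓ).1, (h2 ℓ).2.trans ?_⟩⟩
    · exact (h1.2 s hs).trans (formSum_eq_total hc hs fun k => by simpa using hx k).symm
    · rw [aeval_bernoulliSum]
      have e : ∀ L : Fin r → ℕ, ∀ k, ((Polynomial.aeval (x k) (sumKind.β (L k)) : ℝ) : ℂ) =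
          (-1) ^ L k * Polynomial.aeval (x k : ℂ) (Polynomial.bernoulli (L k)) := by
        intro L k
        change ((Polynomial.aeval (x k) ((-1) ^ L k * Polynomial.bernoulli (L k)) : ℝ) : ℂ) = _
        have := Polynomial.aeval_algebraMap_apply ℂ (x k) (Polynomial.bernoulli (L k))
        simp only [Complex.coe_algebraMap] at this
        rw [this]
        simp
      simp_rw [e]
      rw [sum_neg_one_pow]
      refine Finset.sum_congr rfl fun L _ => ?_
      simp
  · obtain ⟨F, h1, h2⟩ := hw intKind x hx
    refine ⟨F, ⟨h1.1, fun s hs => ?_⟩, fun ℓ => ⟨(h2 ℓ).1, (h2 ℓ).2.trans ?_⟩⟩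
    · exact (h1.2 s hs).trans (formInt_eq_total c s _).symm
    · rw [aeval_powerSum]
      have e : ∀ L : Fin r → ℕ, ∀ k, ((Polynomial.aeval (x k) (intKind.β (L k)) : ℝ) : ℂ) =
          (-1) ^ L k * (x k : ℂ) ^ L k := by
        intro L k
        change ((Polynomial.aeval (x k) ((-Polynomial.X) ^ L k) : ℝ) : ℂ) = _
        rw [← mul_pow]
        simp
      simp_rw [e]
      rw [sum_neg_one_pow]
      refine Finset.sum_congr rfl fun L _ => ?_
      simp

/-- The difference operator in the direction of the `k`-th coordinate on functions. -/
def diffOp (k : Fin r) (f : (Fin r → ℝ) → ℂ) : (Fin r → ℝ) → ℂ :=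
  fun x => f (x + Pi.single k 1) - f x

theorem add_single_mem_orthant {x : Fin r → ℝ} (hx : x ∈ orthant r) (k : Fin r) :
    x + Pi.single k 1 ∈ orthant r := by
  intro i
  by_cases h : i = k
  · subst h; have := hx i; simp; linarith
  · simpa [h] using hx i

/-- Shifting `x` by the `k`-th unit vector amounts to summing only over `m k ≠ 0`. Each difference
thus leaves minus the part of the series with `m k = 0`. -/
theorem foldr_diffOp_tsum {h : (Fin r → ℝ) → ℂ}
    (hsum : ∀ x ∈ orthant r, Summable fun m : Fin r → ℕ => h fun k => (m k : ℝ) + x k)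
    (l : List (Fin r)) (hl : l.Nodup) {x : Fin r → ℝ} (hx : x ∈ orthant r) :
    l.foldr diffOp (fun x => ∑' m : Fin r → ℕ, h fun k => (m k : ℝ) + x k) x =
      (-1) ^ l.length * ∑' m : Fin r → ℕ,
        {m : Fin r → ℕ | ∀ k ∈ l, m k = 0}.indicator (fun m => h fun k => (m k : ℝ) + x k) m := by
  induction l generalizing x with
  | nil => simp
  | cons k l ih =>
    rw [List.nodup_cons] at hl
    rw [List.foldr_cons, diffOp, ih hl.2 (add_single_mem_orthant hx k), ih hl.2 hx]
    set f : (Fin r → ℕ) → ℂ := fun m => h fun k => (m k : ℝ) + x k with hf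
    set A : Set (Fin r → ℕ) := {m | ∀ k ∈ l, m k = 0} with hA
    have e1 : ∑' m : Fin r → ℕ, A.indicator
        (fun m => h fun i => (m i : ℝ) + (x + Pi.single k 1 : Fin r → ℝ) i) m =
        ∑' m : Fin r → ℕ, (A ∩ {m | m k ≠ 0}).indicator f m := by
      have hinj : Function.Injective fun m : Fin r → ℕ => m + Pi.single k 1 :=
        fun a b hab => add_right_cancel hab
      rw [← hinj.tsum_eq (f := (A ∩ {m | m k ≠ 0}).indicator f)]
      · refine tsum_congr fun m => ?_
        have hmem : (m + Pi.single k 1 ∈ A ∩ {m | m k ≠ 0}) ↔ m ∈ A := by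
          constructor
          · rintro ⟨h1, _⟩ i hi
            have := h1 i hi
            have hik : i ≠ k := fun e => hl.1 (e ▸ hi)
            simpa [hik] using this
          · intro h1
            refine ⟨fun i hi => ?_, by simp⟩
            have hik : i ≠ k := fun e => hl.1 (e ▸ hi)
            simpa [hik] using h1 i hi
        by_cases hm : m ∈ A
        · rw [Set.indicator_of_mem hm, Set.indicator_of_mem (hmem.2 hm)]
          simp only [hf]
          congr 1
          funext i
          by_cases hi : i = k
          · subst hi; simp; ring
          · simp [hi]
        · rw [Set.indicator_of_notMem hm, Set.indicator_of_notMem fun h' => hm (hmem.1 h')]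
      · intro m hm
        have hm' : m ∈ A ∩ {m | m k ≠ 0} := by
          by_contra hn
          exact hm (Set.indicator_of_notMem hn _)
        refine ⟨m - Pi.single k 1, ?_⟩
        funext i
        by_cases hi : i = k
        · subst hi
          have := hm'.2
          simp only [Set.mem_ofPred_eq] at this
          simp; omega
        · simp [hi]
    have e2 : A.indicator f = fun m => (A ∩ {m | m k ≠ 0}).indicator f m +
        {m : Fin r → ℕ | ∀ i ∈ k :: l, m i = 0}.indicator f m := by
      funext m
      by_cases hm : m ∈ A
      · by_cases hk : m k = 0
        · have h1 : m ∈ {m : Fin r → ℕ | ∀ i ∈ k :: l, m i = 0} := by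
            intro i hi
            rcases List.mem_cons.1 hi with rfl | hi
            · exact hk
            · exact hm i hi
          rw [Set.indicator_of_mem hm, Set.indicator_of_mem h1, Set.indicator_of_notMem, zero_add]
          exact fun h' => h'.2 hk
        · rw [Set.indicator_of_mem hm, Set.indicator_of_mem (show m ∈ A ∩ {m | m k ≠ 0} from ⟨hm, hk⟩), Set.indicator_of_notMem,
            add_zero]
          exact fun h' => hk (h' k (by simp))
      · rw [Set.indicator_of_notMem hm, Set.indicator_of_notMem fun h' => hm h'.1,
          Set.indicator_of_notMem, add_zero]
        exact fun h' => hm fun i hi => h' i (by simp [hi])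
    have hs := hsum x hx
    have hs1 : Summable ((A ∩ {m | m k ≠ 0}).indicator f) := hs.indicator _
    have hs2 : Summable ({m : Fin r → ℕ | ∀ i ∈ k :: l, m i = 0}.indicator f) := hs.indicator _
    rw [e1, e2, hs1.tsum_add hs2, List.length_cons]
    ring

theorem foldr_diffOp_tsum_all {h : (Fin r → ℝ) → ℂ}
    (hsum : ∀ x ∈ orthant r, Summable fun m : Fin r → ℕ => h fun k => (m k : ℝ) + x k)
    {x : Fin r → ℝ} (hx : x ∈ orthant r) :
    (List.finRange r).foldr diffOp (fun x => ∑' m : Fin r → ℕ, h fun k => (m k : ℝ) + x k) x =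
      (-1) ^ r * h x := by
  rw [foldr_diffOp_tsum hsum _ (List.nodup_finRange r) hx, List.length_finRange,
    tsum_eq_single 0]
  · rw [Set.indicator_of_mem (by simp)]
    simp
  · intro m hm
    rw [Set.indicator_of_notMem]
    intro h'
    exact hm (funext fun k => h' k (List.mem_finRange k))

theorem foldr_diffOp_congr {f g : (Fin r → ℝ) → ℂ} (h : ∀ x ∈ orthant r, f x = g x)
    (l : List (Fin r)) {x : Fin r → ℝ} (hx : x ∈ orthant r) :
    l.foldr diffOp f x = l.foldr diffOp g x := by
  induction l generalizing x with
  | nil => exact h x hx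
  | cons k l ih => simp only [List.foldr_cons, diffOp, ih (add_single_mem_orthant hx k), ih hx]

/-- Differences in `x` of a family of functions of `s` stay within any class closed under
subtraction. This is used for meromorphy on `ℂ` and for analyticity at `-ℓ`. -/
theorem foldr_diffOp_induction {p : (ℂ → ℂ) → Prop} (hp : ∀ f g, p f → p g → p fun s => f s - g s)
    {F : (Fin r → ℝ) → ℂ → ℂ} (hF : ∀ x ∈ orthant r, p (F x)) (l : List (Fin r)) {x : Fin r → ℝ}
    (hx : x ∈ orthant r) : p fun s => l.foldr diffOp (fun x => F x s) x := by
  induction l generalizing x with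
  | nil => exact hF x hx
  | cons k l ih => exact hp _ _ (ih (add_single_mem_orthant hx k)) (ih hx)

theorem foldr_diffOp_aeval (p : MvPolynomial (Fin r) ℚ) (l : List (Fin r)) (x : Fin r → ℝ) :
    l.foldr diffOp (fun x => MvPolynomial.aeval (fun k => (x k : ℂ)) p) x =
      MvPolynomial.aeval (fun k => (x k : ℂ)) (l.foldr diff p) := by
  induction l generalizing x with
  | nil => rfl
  | cons k l ih =>
    simp only [List.foldr_cons, diffOp, diff, map_sub, ih]
    congr 1
    have h := MvPolynomial.comp_aeval_apply (R := ℚ)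
      (f := fun i => MvPolynomial.X i + MvPolynomial.C (Pi.single k (1 : ℚ) i))
      (φ := MvPolynomial.aeval (fun k => (x k : ℂ))) (l.foldr diff p)
    rw [h]
    congr 2
    funext i
    by_cases hi : i = k
    · subst hi; simp
    · simp [hi]

/-- If two meromorphic functions agree on a half plane, they agree where both are analytic. -/
theorem eq_of_eq_on_halfPlane {f g : ℂ → ℂ} {b : ℝ} (hf : ∀ s, MeromorphicAt f s)
    (hg : ∀ s, MeromorphicAt g s) (h : ∀ s : ℂ, b < s.re → f s = g s) {s : ℂ}
    (hfs : AnalyticAt ℂ f s) (hgs : AnalyticAt ℂ g s) : f s = g s := by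
  have h1 := eventuallyEq_of_eq_on_halfPlane (a := s.re - 1) (fun s _ => hf s) (fun s _ => hg s) h
    (s := s) (by linarith)
  exact ((hfs.meromorphicNFAt.eventuallyEq_nhdsNE_iff_eventuallyEq_nhds
    hgs.meromorphicNFAt).1 h1).eq_of_nhds

/-- In the half plane of convergence the iterated difference of the series telescopes to `(-1)^r`
times the term at `m = 0`, which is entire in `s`. Both sides are meromorphic on `ℂ` and analytic at
`-ℓ`, so they agree there. -/
theorem aeval_diffAll_eq (hc : IsFormFamily c) {P : MvPolynomial (Fin r) ℚ} {ℓ : ℕ}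
    {F : (Fin r → ℝ) → ℂ → ℂ} (hF : ∀ x ∈ orthant r,
      IsMeromorphicContinuation r (fun s => formSum c s fun k => (x k : ℂ)) (F x) ∧
      AnalyticAt ℂ (F x) (-ℓ) ∧ F x (-ℓ) = MvPolynomial.aeval (fun k => (x k : ℂ)) P)
    {x : Fin r → ℝ} (hx : x ∈ orthant r) :
    MvPolynomial.aeval (fun k => (x k : ℂ)) (diffAll P) =
      (-1) ^ r * ∏ i, linForm (c i) (fun k => (x k : ℂ)) ^ ℓ := by
  have hL : ∀ i, linForm (c i) (fun k => (x k : ℂ)) ≠ 0 := by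
    intro i
    rw [linForm_ofReal]
    exact_mod_cast (linForm_real_pos hc i hx).ne'
  have hpow : ∀ s, DifferentiableAt ℂ (fun s => (-1) ^ r * formTerm c s fun k => (x k : ℂ)) s := by
    intro s
    refine DifferentiableAt.const_mul (DifferentiableAt.fun_finsetProd fun i _ => ?_) _
    exact differentiableAt_id.neg.const_cpow (Or.inl (hL i))
  have hpowA : ∀ s, AnalyticAt ℂ (fun s => (-1) ^ r * formTerm c s fun k => (x k : ℂ)) s :=
    fun s => Differentiable.analyticAt hpow s
  have key := eq_of_eq_on_halfPlane (b := r) (s := -ℓ)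
    (f := fun s => (List.finRange r).foldr diffOp (fun x => F x s) x)
    (g := fun s => (-1) ^ r * formTerm c s fun k => (x k : ℂ)) ?_
    (fun s => (hpowA s).meromorphicAt) ?_ ?_ (hpowA _)
  · rw [diffAll, ← foldr_diffOp_aeval, foldr_diffOp_congr (g := fun x => F x (-ℓ))
      (fun x hx => ((hF x hx).2.2).symm) _ hx, key]
    simp [formTerm]
  · intro s
    exact foldr_diffOp_induction (p := fun f => MeromorphicAt f s) (fun f g hf hg => hf.fun_sub hg)
      (fun x hx => ((hF x hx).1.1 (Set.mem_univ s)).meromorphicAt) _ hx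
  · intro s hs
    have h1 := foldr_diffOp_tsum_all (h := fun y : Fin r → ℝ => formTerm c s fun k => (y k : ℂ))
      (fun x hx => by
        simpa using summable_formTerm hc hs (x := fun k => (x k : ℂ)) (fun k => by simpa using hx k)) hx
    rw [← h1]
    refine foldr_diffOp_congr (fun x hx => ?_) _ hx
    refine ((hF x hx).1.2 s hs).trans ?_
    simp [formSum]
  · exact foldr_diffOp_induction (p := fun f => AnalyticAt ℂ f (-ℓ))
      (fun f g hf hg => hf.fun_sub hg) (fun x hx => (hF x hx).2.1) _ hx

/-- The product of the linear forms of the family, as a polynomial. -/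
noncomputable def formPoly (R : Type*) [CommRing R] (c : Fin n → Fin r → ℕ) :
    MvPolynomial (Fin r) R :=
  ∏ i, ∑ k, MvPolynomial.X k * MvPolynomial.C (c i k : R)

theorem map_formPoly {R S : Type*} [CommRing R] [CommRing S] (f : R →+* S)
    (c : Fin n → Fin r → ℕ) : MvPolynomial.map f (formPoly R c) = formPoly S c := by
  simp [formPoly]

theorem formPoly_ne_zero (hc : IsFormFamily c) : formPoly ℚ c ≠ 0 := by
  refine Finset.prod_ne_zero_iff.2 fun i _ h => hc.ne_zero i ?_
  funext k
  have h1 := congrArg (MvPolynomial.aeval (Pi.single k (1:ℚ))) h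
  simp [Pi.single_apply] at h1
  exact h1

theorem diffAll_eq (hc : IsFormFamily c) {P : MvPolynomial (Fin r) ℚ} {ℓ : ℕ}
    {F : (Fin r → ℝ) → ℂ → ℂ} (hF : ∀ x ∈ orthant r,
      IsMeromorphicContinuation r (fun s => formSum c s fun k => (x k : ℂ)) (F x) ∧
      AnalyticAt ℂ (F x) (-ℓ) ∧ F x (-ℓ) = MvPolynomial.aeval (fun k => (x k : ℂ)) P) :
    diffAll P = (-1) ^ r * formPoly ℚ c ^ ℓ := by
  refine Represents.unique (f := fun x => MvPolynomial.aeval (fun k => (x k : ℂ)) (diffAll P))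
    (fun x _ => rfl) fun x hx => ?_
  refine (aeval_diffAll_eq hc hF hx).trans ?_
  simp [formPoly, linForm, Finset.prod_pow, mul_comm]

end FormZeta

end LieZeta

namespace LieZeta

set_option autoImplicit false

/-! ### Positive coroots as a family of linear forms. -/

section Coroots

namespace RootPairingBase

variable {ι R M N : Type*} [CommRing R] [AddCommGroup M] [Module R M] [AddCommGroup N] [Module R N]
  {P : RootPairing ι R M N} [CharZero R] [Finite ι] [IsDomain R] [P.IsCrystallographic]
  [P.IsReduced] [Module.IsTorsionFree R M]
  [Module.IsTorsionFree R N]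

/-- Positivity with respect to a base is the same for roots and for coroots. -/
theorem isPos_flip_iff (b : P.Base) (i : ι) : b.flip.IsPos i ↔ b.IsPos i := by
  let := P.indexNeg
  have hneg : ∀ i, b.flip.IsPos (-i) ↔ ¬ b.flip.IsPos i := fun i =>
    RootPairing.Base.IsPos.neg_iff_not b.flip i
  -- Every root arises from simple roots by negations and simple reflections, so it suffices that
  -- the two notions of positivity behave alike under these.
  refine b.induction_reflect (p := fun i => b.flip.IsPos i ↔ b.IsPos i) i ?_ ?_ ?_
  · intro i hi
    have h1 := hneg i
    have h2 := RootPairing.Base.IsPos.neg_iff_not b i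
    exact h1.trans ((not_congr hi).trans h2.symm)
  · intro i hi
    exact iff_of_true (RootPairing.Base.isPos_of_mem_support (b := b.flip) hi)
      (RootPairing.Base.isPos_of_mem_support hi)
  -- A simple reflection keeps every positive root positive except the simple root itself, for roots
  -- and for coroots alike.
  · have key : ∀ i j, b.flip.IsPos i → b.IsPos i → j ∈ b.support →
        (b.flip.IsPos (P.reflectionPerm j i) ↔ b.IsPos (P.reflectionPerm j i)) := by
      intro i j h1 h2 hj
      by_cases hij : i = j
      · subst hij
        have e1 := hneg i
        have e2 := RootPairing.Base.IsPos.neg_iff_not b i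
        exact e1.trans ((not_congr (iff_of_true h1 h2)).trans e2.symm)
      · exact iff_of_true (RootPairing.Base.IsPos.reflectionPerm (b := b.flip) h1 hj hij)
          (h2.reflectionPerm hj hij)
    intro i j hi hj
    by_cases h : b.IsPos i
    · exact key i j (hi.2 h) h hj
    · have h1 : b.IsPos (-i) := (RootPairing.Base.IsPos.neg_iff_not b i).2 h
      have h2 : b.flip.IsPos (-i) := (hneg i).2 fun h' => h (hi.1 h')
      have e := key (-i) j h2 h1 hj
      have hr : P.reflectionPerm j (-i) = -(P.reflectionPerm j i) := by
        apply P.root.injective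
        have hn : ∀ m : ι, P.root (-m) = -P.root m := fun m => by simp
        rw [hn, P.root_reflectionPerm, hn, P.root_reflectionPerm, map_neg]
      rw [hr, hneg, RootPairing.Base.IsPos.neg_iff_not b] at e
      exact not_iff_not.1 e

/-- The coroot of a positive root is a combination of simple coroots with natural coefficients. -/
theorem coroot_mem_closure_iff (b : P.Base) (i : ι) :
    P.coroot i ∈ AddSubmonoid.closure (P.coroot '' b.support) ↔ b.IsPos i := by
  have key : ∀ i, b.IsPos i → P.coroot i ∈ AddSubmonoid.closure (P.coroot '' b.support) := by
    intro i hi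
    rw [← isPos_flip_iff b] at hi
    obtain ⟨f, -, h | h⟩ := b.flip.exists_root_eq_sum_nat_or_neg i
    · have h' : P.coroot i = ∑ j ∈ b.support, f j • P.coroot j := h
      rw [h']
      exact sum_mem fun j hj => nsmul_mem (AddSubmonoid.subset_closure (Set.mem_image_of_mem _ hj)) _
    · exfalso
      have := RootPairing.Base.height_eq_sum (b := b.flip) (i := i) (f := fun j => -(f j : ℤ))
        (by rw [h]; simp)
      rw [RootPairing.Base.isPos_iff, this] at hi
      have h0 : (∑ j ∈ b.flip.support, -(f j : ℤ)) ≤ 0 :=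
        Finset.sum_nonpos fun j _ => by simp
      omega
  refine ⟨fun h => ?_, key i⟩
  by_contra hn
  let := P.indexNeg
  have h2 := key (-i) ((RootPairing.Base.IsPos.neg_iff_not b i).2 hn)
  have h3 : ∀ v ∈ AddSubmonoid.closure (P.coroot '' b.support),
      ∃ f : ι → ℕ, v = ∑ j ∈ b.support, f j • P.coroot j := by
    classical
    intro v hv
    refine AddSubmonoid.closure_induction ?_ ⟨0, by simp⟩ ?_ hv
    · rintro - ⟨j, hj, rfl⟩
      refine ⟨Pi.single j 1, ?_⟩
      rw [Finset.sum_eq_single_of_mem j hj fun k _ hk => by simp [hk]]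
      simp
    · rintro _ _ - - ⟨f, rfl⟩ ⟨g, rfl⟩
      exact ⟨f + g, by simp [add_smul, Finset.sum_add_distrib]⟩
  obtain ⟨f, hf⟩ := h3 _ h
  have hp := (not_congr (isPos_flip_iff b i)).2 hn
  have := RootPairing.Base.height_eq_sum (b := b.flip) (i := i) (f := fun j => (f j : ℤ))
    (by simpa using hf)
  rw [RootPairing.Base.isPos_iff', this] at hp
  exact hp (Finset.sum_nonneg fun j _ => by simp)

end RootPairingBase

variable {g : Type*} [LieRing g] [LieAlgebra ℂ g] [FiniteDimensional ℂ g]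
  [LieAlgebra.IsSemisimple ℂ g] {r : ℕ} (D : NumberedBase g r)

/-- The coroot of a root, as an element of the Cartan subalgebra. -/
noncomputable abbrev NumberedBase.coroot (α : D.cartan.root) : D.cartan :=
  (LieAlgebra.IsKilling.rootSystem D.cartan).coroot α

/-- The basis of simple coroots. -/
noncomputable def NumberedBase.corootBasis : Module.Basis (Fin r) ℂ D.cartan :=
  D.base.toCoweightBasis.reindex D.numbering.symm

theorem NumberedBase.corootBasis_apply (k : Fin r) :
    D.corootBasis k = D.coroot (D.numbering k) := by
  simp [NumberedBase.corootBasis]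

theorem NumberedBase.fundamentalWeight_eq (k : Fin r) (v : D.cartan) :
    D.fundamentalWeight k v = D.corootBasis.repr v k := by
  simp [NumberedBase.fundamentalWeight, NumberedBase.corootBasis]

theorem NumberedBase.finrank_cartan : Module.finrank ℂ D.cartan = r := by
  rw [Module.finrank_eq_card_basis D.corootBasis, Fintype.card_fin]

theorem NumberedBase.range_corootBasis :
    Set.range D.corootBasis
      = (LieAlgebra.IsKilling.rootSystem D.cartan).coroot '' D.base.support := by
  ext v
  constructor
  · rintro ⟨k, rfl⟩
    exact ⟨_, (D.numbering k).2, (D.corootBasis_apply k).symm⟩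
  · rintro ⟨α, hα, rfl⟩
    exact ⟨D.numbering.symm ⟨α, hα⟩, by simp [D.corootBasis_apply]⟩

/-- Positivity is defined through roots, whereas the numbers `(λ_k, α^∨)` are coordinates of
coroots. This description moves it to the coroots, where isomorphisms can transport it. -/
theorem NumberedBase.mem_positiveRoots {α : D.cartan.root} :
    α ∈ D.positiveRoots ↔ D.coroot α ∈ AddSubmonoid.closure (Set.range D.corootBasis) := by
  rw [D.range_corootBasis, RootPairingBase.coroot_mem_closure_iff]
  simp [NumberedBase.positiveRoots]

theorem exists_nat_repr_of_mem_closure {V : Type*} [AddCommGroup V] [Module ℂ V] {r : ℕ}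
    (b : Module.Basis (Fin r) ℂ V) {v : V} (hv : v ∈ AddSubmonoid.closure (Set.range b)) :
    ∃ f : Fin r → ℕ, ∀ k, b.repr v k = f k := by
  refine AddSubmonoid.closure_induction ?_ ⟨0, by simp⟩ ?_ hv
  · rintro - ⟨j, rfl⟩
    refine ⟨Pi.single j 1, fun k => ?_⟩
    simp [Finsupp.single_apply, Pi.single_apply, eq_comm]
  · rintro _ _ - - ⟨f, hf⟩ ⟨h, hh⟩
    exact ⟨f + h, by simp [hf, hh]⟩

theorem exists_coeffs (D : NumberedBase g r) : ∃ c : Fin D.numPos → Fin r → ℕ, ∃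
    e : Fin D.numPos ≃ D.positiveRoots, ∀ i k, D.corootBasis.repr (D.coroot (e i)) k = c i k := by
  have h : ∀ α : D.positiveRoots, ∃ f : Fin r → ℕ,
      ∀ k, D.corootBasis.repr (D.coroot α) k = f k := fun α =>
    exists_nat_repr_of_mem_closure _ (D.mem_positiveRoots.1 α.2)
  choose f hf using h
  let e := D.positiveRoots.equivFin.symm
  exact ⟨fun i => f (e i), e, fun i k => hf _ _⟩

/-- A numbering of the positive roots. -/
noncomputable def NumberedBase.posEquiv : Fin D.numPos ≃ D.positiveRoots :=
  (exists_coeffs D).choose_spec.choose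

/-- The coefficients of the positive coroots with respect to the simple coroots. -/
noncomputable def NumberedBase.coeffs : Fin D.numPos → Fin r → ℕ := (exists_coeffs D).choose

theorem NumberedBase.repr_coroot (i : Fin D.numPos) (k : Fin r) :
    D.corootBasis.repr (D.coroot (D.posEquiv i)) k = D.coeffs i k :=
  (exists_coeffs D).choose_spec.choose_spec i k

/-- The simple coroots are positive and have unit coordinate vectors, so they supply the coordinate
forms. No form vanishes because no coroot does. -/
theorem NumberedBase.isFormFamily : IsFormFamily D.coeffs where
  simple k := by
    have hk : (D.numbering k : D.cartan.root) ∈ D.positiveRoots := by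
      rw [D.mem_positiveRoots, ← D.corootBasis_apply]
      exact AddSubmonoid.subset_closure ⟨k, rfl⟩
    refine ⟨D.posEquiv.symm ⟨_, hk⟩, ?_⟩
    funext j
    have h := D.repr_coroot (D.posEquiv.symm ⟨_, hk⟩) j
    rw [Equiv.apply_symm_apply, ← D.corootBasis_apply, Module.Basis.repr_self] at h
    have : ((D.coeffs (D.posEquiv.symm ⟨_, hk⟩) j : ℕ) : ℂ) = ((Pi.single k 1 : Fin r → ℕ) j : ℕ) := by
      rw [← h]
      simp [Finsupp.single_apply, Pi.single_apply, eq_comm]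
    exact_mod_cast this
  ne_zero i h0 := by
    have h : D.coroot (D.posEquiv i) = 0 := by
      apply D.corootBasis.repr.injective
      ext k
      rw [D.repr_coroot, h0]
      simp
    exact (LieAlgebra.IsKilling.rootSystem D.cartan).flip.ne_zero _ h

theorem NumberedBase.weightForm_eq (x : Fin r → ℂ) (i : Fin D.numPos) :
    D.weightForm x (D.posEquiv i) = linForm (D.coeffs i) x := by
  simp only [NumberedBase.weightForm, linForm, LinearMap.sum_apply, LinearMap.smul_apply,
    D.fundamentalWeight_eq, smul_eq_mul]
  exact Finset.sum_congr rfl fun k _ => by rw [D.repr_coroot, mul_comm]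

theorem NumberedBase.prod_positiveRoots {R : Type*} [CommMonoid R] (f : D.cartan.root → R) :
    ∏ α ∈ D.positiveRoots, f α = ∏ i, f (D.posEquiv i) := by
  rw [← Finset.prod_coe_sort]
  exact (D.posEquiv.prod_comp fun α => f α).symm

theorem NumberedBase.term_eq (s : ℂ) (x : Fin r → ℂ) : D.term s x = formTerm D.coeffs s x := by
  rw [NumberedBase.term, D.prod_positiveRoots, formTerm]
  exact Finset.prod_congr rfl fun i _ => by rw [D.weightForm_eq]

theorem NumberedBase.zetaSeries_eq (s : ℂ) (x : Fin r → ℂ) :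
    D.zetaSeries s x = formSum D.coeffs s x := by
  simp only [NumberedBase.zetaSeries, formSum, D.term_eq]

theorem NumberedBase.zetaIntegral_eq (s : ℂ) (x : Fin r → ℂ) :
    D.zetaIntegral s x = formInt D.coeffs s x := by
  simp only [NumberedBase.zetaIntegral, formInt, D.term_eq]

theorem NumberedBase.weylPower_eq (ℓ : ℕ) : D.weylPower ℓ = formPoly ℂ D.coeffs ^ ℓ := by
  have h := D.prod_positiveRoots (fun α => ∑ k, MvPolynomial.X k * MvPolynomial.C
    (D.fundamentalWeight k (D.coroot α)))
  refine congrArg (· ^ ℓ) (h.trans ?_)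
  refine Finset.prod_congr rfl fun i _ => Finset.sum_congr rfl fun k _ => ?_
  rw [D.fundamentalWeight_eq, D.repr_coroot]

end Coroots

end LieZeta

namespace LieZeta

set_option autoImplicit false

/-! ### The special values of the Lie algebra as polynomials. -/

section SpecialValues

open MvPolynomial

theorem meromorphicContinuation_eq {σ : ℝ} {f F : ℂ → ℂ} (h : IsMeromorphicContinuation σ f F) :
    meromorphicContinuation σ f = F := by
  have h' : ∃ F, IsMeromorphicContinuation σ f F := ⟨F, h⟩
  rw [meromorphicContinuation, dif_pos h']
  exact h'.choose_spec.unique h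

theorem polynomialOf_eq {r : ℕ} {f : (Fin r → ℝ) → ℂ} {p : MvPolynomial (Fin r) ℚ}
    (h : Represents p f) : polynomialOf f = p := by
  have h' : ∃ p, Represents p f := ⟨p, h⟩
  rw [polynomialOf, dif_pos h']
  exact h'.choose_spec.unique h

variable {g : Type*} [LieRing g] [LieAlgebra ℂ g] [FiniteDimensional ℂ g]
  [LieAlgebra.IsSemisimple ℂ g] {r : ℕ} (D : NumberedBase g r)

theorem NumberedBase.exists_continuation : ∃ a : ℕ → (Fin r → ℕ) → ℚ, ∀ x ∈ orthant r,
    (IsMeromorphicContinuation r (fun s => D.zetaSeries s (fun k => (x k : ℂ))) (D.zeta x) ∧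
      ∀ ℓ : ℕ, AnalyticAt ℂ (D.zeta x) (-ℓ) ∧
        D.zeta x (-ℓ) = aeval (fun k => (x k : ℂ)) (bernoulliSum (D.numPos * ℓ + r) (a ℓ))) ∧
    (IsMeromorphicContinuation r (fun s => D.zetaIntegral s (fun k => (x k : ℂ))) (D.intZeta x) ∧
      ∀ ℓ : ℕ, AnalyticAt ℂ (D.intZeta x) (-ℓ) ∧
        D.intZeta x (-ℓ) = aeval (fun k => (x k : ℂ)) (powerSum (D.numPos * ℓ + r) (a ℓ))) := by
  obtain ⟨a, ha⟩ := exists_form_continuation D.isFormFamily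
  refine ⟨a, fun x hx => ?_⟩
  obtain ⟨⟨F, hF, hF'⟩, G, hG, hG'⟩ := ha x hx
  simp only [← D.zetaSeries_eq] at hF
  simp only [← D.zetaIntegral_eq] at hG
  have e1 : D.zeta x = F := meromorphicContinuation_eq hF
  have e2 : D.intZeta x = G := meromorphicContinuation_eq hG
  rw [e1, e2]
  exact ⟨⟨hF, hF'⟩, hG, hG'⟩

theorem NumberedBase.exists_coefficients (ℓ : ℕ) : ∃ a : (Fin r → ℕ) → ℚ,
    D.P ℓ = bernoulliSum (D.numPos * ℓ + r) a ∧ D.Q ℓ = powerSum (D.numPos * ℓ + r) a := by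
  obtain ⟨a, ha⟩ := D.exists_continuation
  exact ⟨a ℓ, polynomialOf_eq fun x hx => ((ha x hx).1.2 ℓ).2,
    polynomialOf_eq fun x hx => ((ha x hx).2.2 ℓ).2⟩

theorem NumberedBase.isMeromorphicContinuation_zeta {x : Fin r → ℝ} (hx : x ∈ orthant r) :
    IsMeromorphicContinuation r (fun s => D.zetaSeries s (fun k => (x k : ℂ))) (D.zeta x) :=
  (D.exists_continuation.choose_spec x hx).1.1

theorem NumberedBase.isMeromorphicContinuation_intZeta {x : Fin r → ℝ} (hx : x ∈ orthant r) :
    IsMeromorphicContinuation r (fun s => D.zetaIntegral s (fun k => (x k : ℂ))) (D.intZeta x) :=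
  (D.exists_continuation.choose_spec x hx).2.1

theorem NumberedBase.analyticAt_zeta {x : Fin r → ℝ} (hx : x ∈ orthant r) (ℓ : ℕ) :
    AnalyticAt ℂ (D.zeta x) (-ℓ) :=
  ((D.exists_continuation.choose_spec x hx).1.2 ℓ).1

theorem NumberedBase.analyticAt_intZeta {x : Fin r → ℝ} (hx : x ∈ orthant r) (ℓ : ℕ) :
    AnalyticAt ℂ (D.intZeta x) (-ℓ) :=
  ((D.exists_continuation.choose_spec x hx).2.2 ℓ).1

theorem NumberedBase.represents_P (ℓ : ℕ) : Represents (D.P ℓ) (fun x => D.zeta x (-ℓ)) := by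
  have h : Represents _ (fun x => D.zeta x (-ℓ)) := fun x hx =>
    ((D.exists_continuation.choose_spec x hx).1.2 ℓ).2
  rw [NumberedBase.P, polynomialOf_eq h]
  exact h

theorem NumberedBase.represents_Q (ℓ : ℕ) : Represents (D.Q ℓ) (fun x => D.intZeta x (-ℓ)) := by
  have h : Represents _ (fun x => D.intZeta x (-ℓ)) := fun x hx =>
    ((D.exists_continuation.choose_spec x hx).2.2 ℓ).2
  rw [NumberedBase.Q, polynomialOf_eq h]
  exact h

theorem NumberedBase.diffAll_P_eq_pderivAll_Q (ℓ : ℕ) : diffAll (D.P ℓ) = pderivAll (D.Q ℓ) := by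
  obtain ⟨a, h1, h2⟩ := D.exists_coefficients ℓ
  rw [h1, h2, diffAll_bernoulliSum]

theorem NumberedBase.diffAll_P (ℓ : ℕ) :
    diffAll (D.P ℓ) = (-1) ^ r * formPoly ℚ D.coeffs ^ ℓ := by
  refine diffAll_eq (F := D.zeta) D.isFormFamily fun x hx => ?_
  have h := D.isMeromorphicContinuation_zeta hx
  simp only [D.zetaSeries_eq] at h
  exact ⟨h, D.analyticAt_zeta hx ℓ, D.represents_P ℓ x hx⟩

theorem pderivAll_zero (r : ℕ) : pderivAll (0 : MvPolynomial (Fin r) ℚ) = 0 := by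
  have : ∀ l : List (Fin r), l.foldr (fun k q => pderiv k q) (0 : MvPolynomial (Fin r) ℚ) = 0 := by
    intro l
    induction l with
    | nil => rfl
    | cons k l ih => rw [List.foldr_cons, ih, map_zero]
  exact this _

/-- Its full mixed derivative is, up to sign, a power of a product of nonzero linear forms. With
this the degree bounds become equalities. -/
theorem NumberedBase.Q_ne_zero (ℓ : ℕ) : D.Q ℓ ≠ 0 := by
  intro h
  have h1 := D.diffAll_P ℓ
  rw [D.diffAll_P_eq_pderivAll_Q, h, pderivAll_zero] at h1
  exact mul_ne_zero (pow_ne_zero _ (by simp)) (pow_ne_zero _ (formPoly_ne_zero D.isFormFamily)) h1.symm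

theorem NumberedBase.totalDegree_P (ℓ : ℕ) : (D.P ℓ).totalDegree = D.numPos * ℓ + r := by
  obtain ⟨a, h1, h2⟩ := D.exists_coefficients ℓ
  rw [h1]
  exact totalDegree_bernoulliSum (h2 ▸ D.Q_ne_zero ℓ)

theorem NumberedBase.totalDegree_Q (ℓ : ℕ) : (D.Q ℓ).totalDegree = D.numPos * ℓ + r := by
  obtain ⟨a, h1, h2⟩ := D.exists_coefficients ℓ
  rw [h2]
  exact totalDegree_powerSum (h2 ▸ D.Q_ne_zero ℓ)

theorem NumberedBase.map_diffAll_P (ℓ : ℕ) :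
    map (algebraMap ℚ ℂ) (diffAll (D.P ℓ)) = (-1) ^ r * D.weylPower ℓ := by
  rw [D.diffAll_P, D.weylPower_eq, map_mul, map_pow, map_pow, map_formPoly]
  simp

theorem NumberedBase.weylPower_eq_map (ℓ : ℕ) :
    D.weylPower ℓ = map (Int.castRingHom ℂ) (formPoly ℤ D.coeffs ^ ℓ) := by
  rw [map_pow, map_formPoly, D.weylPower_eq]

/-- The special values in the case of a single positive root. -/
theorem NumberedBase.special_values_of_rank_one {D : NumberedBase g r} (hr : r = 1)
    (hn : D.numPos = 1) (ℓ : ℕ) (k : Fin r) :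
    D.P ℓ = C (-1 / ((ℓ : ℚ) + 1)) * Polynomial.aeval (X k) (Polynomial.bernoulli (ℓ + 1)) ∧
      D.Q ℓ = C (-1 / ((ℓ : ℚ) + 1)) * X k ^ (ℓ + 1) := by
  subst hr
  obtain rfl : k = 0 := Subsingleton.elim _ _
  obtain ⟨a, h1, h2⟩ := D.exists_coefficients ℓ
  -- In one variable the homogeneous combination has a single coefficient, which the derivative
  -- formula, evaluated at `1`, determines.
  have hL : multiIndices 1 (D.numPos * ℓ + 1) = {fun _ => ℓ + 1} := by
    ext L
    rw [mem_multiIndices, Finset.mem_singleton, hn]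
    constructor
    · intro h
      funext i
      obtain rfl : i = 0 := Subsingleton.elim _ _
      simpa using h
    · rintro rfl
      simp
  have h1' : D.P ℓ
      = C (a fun _ => ℓ + 1) * Polynomial.aeval (X 0) (Polynomial.bernoulli (ℓ + 1)) := by
    rw [h1, bernoulliSum, hL, Finset.sum_singleton]
    simp [sepProd]
  have h2' : D.Q ℓ = C (a fun _ => ℓ + 1) * X 0 ^ (ℓ + 1) := by
    rw [h2, powerSum, hL, Finset.sum_singleton]
    simp [sepProd]
  have hc : formPoly ℚ D.coeffs = X 0 := by
    obtain ⟨i, hi⟩ := D.isFormFamily.simple 0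
    have hu : ∀ j : Fin D.numPos, j = i := by
      intro j
      have := j.2
      have := i.2
      ext
      omega
    rw [formPoly, Fintype.prod_eq_single i fun j hj => absurd (hu j) hj, hi]
    simp
  have h3 := D.diffAll_P_eq_pderivAll_Q ℓ
  rw [D.diffAll_P, hc, h2'] at h3
  have h4 : pderivAll (C (a fun _ => ℓ + 1) * X 0 ^ (ℓ + 1) : MvPolynomial (Fin 1) ℚ)
      = C ((a fun _ => ℓ + 1) * (ℓ + 1)) * X 0 ^ ℓ := by
    simp only [pderivAll, List.finRange_succ, List.finRange_zero, List.map_nil, List.foldr_cons,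
      List.foldr_nil, Derivation.leibniz, Derivation.leibniz_pow, pderiv_X_self, pderiv_C]
    simp
    ring
  have h5 := congrArg (eval fun _ => (1 : ℚ)) (h3.trans h4)
  simp at h5
  have ha : (a fun _ => ℓ + 1) = -1 / ((ℓ : ℚ) + 1) := by
    rw [eq_div_iff (by positivity)]
    exact h5.symm
  rw [h1', h2', ha]
  exact ⟨rfl, rfl⟩

end SpecialValues

end LieZeta

namespace LieZeta

set_option autoImplicit false

/-! ### Conjugacy of simple systems under reflections. -/

section SimpleSystems

open Module

variable {V : Type*} [AddCommGroup V] [Module ℂ V]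

/-- The properties of a reduced root system in `V` that are used to compare its bases. -/
structure IsReducedRootSet (C : Set V) : Prop where
  finite : C.Finite
  zero_notMem : (0 : V) ∉ C
  reduced : ∀ c ∈ C, ∀ t : ℂ, t • c ∈ C → t = 1 ∨ t = -1
  reflection : ∀ c ∈ C, ∃ s : V ≃ₗ[ℂ] V, (∀ v ∈ C, s v ∈ C) ∧ s c = -c ∧
    ∀ v, ∃ t : ℂ, s v = v + t • c

/-- The coordinates of `v` with respect to `b` are natural numbers. -/
def IsNatComb {ι : Type*} (b : Basis ι ℂ V) (v : V) : Prop := ∀ i, ∃ n : ℕ, b.repr v i = n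

/-- `b` is a system of simple roots of `C`. -/
structure IsSimpleSystem {ι : Type*} (C : Set V) (b : Basis ι ℂ V) : Prop where
  mem : ∀ i, b i ∈ C
  comb : ∀ c ∈ C, IsNatComb b c ∨ IsNatComb b (-c)

theorem IsNatComb.eq_zero {ι : Type*} {b : Basis ι ℂ V} {v : V} (h : IsNatComb b v)
    (h' : IsNatComb b (-v)) : v = 0 := by
  apply b.repr.injective
  ext i
  obtain ⟨n, hn⟩ := h i
  obtain ⟨m, hm⟩ := h' i
  have : ((n + m : ℕ) : ℂ) = 0 := by
    push_cast
    rw [← hn, ← hm]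
    simp
  have hn0 : n = 0 := by
    have : n + m = 0 := by exact_mod_cast this
    omega
  simp [hn, hn0]

theorem IsNatComb.self {ι : Type*} (b : Basis ι ℂ V) (i : ι) : IsNatComb b (b i) := by
  classical
  intro j
  refine ⟨if i = j then 1 else 0, ?_⟩
  rw [Basis.repr_self, Finsupp.single_apply]
  split_ifs <;> simp

theorem IsNatComb.trans {ι ι' : Type*} [Fintype ι'] {b : Basis ι ℂ V} {b' : Basis ι' ℂ V}
    (h : ∀ j, IsNatComb b (b' j)) {v : V} (hv : IsNatComb b' v) : IsNatComb b v := by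
  intro i
  choose n hn using fun j => h j i
  choose m hm using hv
  refine ⟨∑ j, m j * n j, ?_⟩
  conv_lhs => rw [← b'.sum_repr v]
  simp [hm, hn]

/-- Reflection in a simple root permutes the other positive roots. -/
theorem IsSimpleSystem.reflection {ι : Type*} {C : Set V} (hC : IsReducedRootSet C)
    {b : Basis ι ℂ V} (hb : IsSimpleSystem C b) {i : ι} {s : V ≃ₗ[ℂ] V} (hs : ∀ v ∈ C, s v ∈ C)
    (hsv : ∀ v, ∃ t : ℂ, s v = v + t • b i) {v : V} (hv : v ∈ C) (hvp : IsNatComb b v)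
    (hvi : v ≠ b i) : IsNatComb b (s v) := by
  classical
  refine (hb.comb _ (hs v hv)).resolve_right fun hn => ?_
  obtain ⟨t, ht⟩ := hsv v
  -- The reflection changes only the `i`-th coordinate. If `s v` were negative, the other
  -- coordinates of `v` would have to vanish, and reducedness would force `v = b i`.
  have hz : ∀ j, j ≠ i → b.repr v j = 0 := by
    intro j hj
    obtain ⟨n, hn'⟩ := hvp j
    obtain ⟨m, hm⟩ := hn j
    rw [ht, map_neg, map_add, map_smul, Basis.repr_self] at hm
    simp only [Finsupp.coe_neg, Finsupp.coe_add, Finsupp.coe_smul, Pi.neg_apply, Pi.add_apply,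
      Pi.smul_apply, Finsupp.single_eq_of_ne hj, smul_zero, add_zero, hn'] at hm
    have : ((m + n : ℕ) : ℂ) = 0 := by
      push_cast
      rw [← hm]
      simp
    have hn0 : n = 0 := by
      have : m + n = 0 := by exact_mod_cast this
      omega
    rw [hn', hn0, Nat.cast_zero]
  have hve : v = b.repr v i • b i := by
    apply b.repr.injective
    ext j
    rw [map_smul, Basis.repr_self]
    by_cases hj : j = i
    · subst hj
      simp
    · simp [hz j hj, Finsupp.single_eq_of_ne hj]
  rcases hC.reduced _ (hb.mem i) _ (hve ▸ hv) with h1 | h1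
  · rw [h1, one_smul] at hve
    exact hvi hve
  · obtain ⟨n, hn'⟩ := hvp i
    rw [hn'] at h1
    have : ((n + 1 : ℕ) : ℂ) = 0 := by
      push_cast
      rw [h1]
      ring
    have h2 : n + 1 = 0 := by exact_mod_cast this
    omega

/-- The two matrices of change of basis have natural entries and are inverse to each other. Nothing
can cancel, so some `b' j` is a natural multiple of `b i`, and reducedness makes the factor `1`. -/
theorem exists_eq_of_isNatComb {ι ι' : Type*} [Fintype ι'] {C : Set V} (hC : IsReducedRootSet C)
    {b : Basis ι ℂ V} (hb : IsSimpleSystem C b) {b' : Basis ι' ℂ V} (hb' : IsSimpleSystem C b')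
    (h : ∀ j, IsNatComb b (b' j)) (h' : ∀ i, IsNatComb b' (b i)) (i : ι) : ∃ j, b' j = b i := by
  classical
  choose n hn using h
  choose m hm using h'
  obtain ⟨j, hj⟩ : ∃ j, m i j ≠ 0 := by
    by_contra! hcon
    apply hC.zero_notMem
    have : b i = 0 := by
      apply b'.repr.injective
      ext j
      simp [hm, hcon]
    exact this ▸ hb.mem i
  have hz : ∀ k, k ≠ i → n j k = 0 := by
    intro k hk
    have e : b.repr (b i) k = ((∑ j, m i j * n j k : ℕ) : ℂ) := by
      conv_lhs => rw [← b'.sum_repr (b i)]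
      simp [hm, hn]
    rw [Basis.repr_self, Finsupp.single_eq_of_ne hk] at e
    have e' : ∑ j, m i j * n j k = 0 := by exact_mod_cast e.symm
    have := (Finset.sum_eq_zero_iff.1 e') j (Finset.mem_univ j)
    exact (Nat.mul_eq_zero.1 this).resolve_left hj
  have he : b' j = (n j i : ℂ) • b i := by
    apply b.repr.injective
    ext k
    rw [map_smul, Basis.repr_self, hn]
    by_cases hk : k = i
    · subst hk
      simp
    · simp [hz k hk, Finsupp.single_eq_of_ne hk]
  refine ⟨j, ?_⟩
  rcases hC.reduced _ (hb.mem i) _ (he ▸ hb'.mem j) with h1 | h1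
  · rw [he, h1, one_smul]
  · have : ((n j i + 1 : ℕ) : ℂ) = 0 := by
      push_cast
      rw [h1]
      ring
    have h2 : n j i + 1 = 0 := by exact_mod_cast this
    omega

theorem exists_equiv_of_isNatComb {ι ι' : Type*} [Fintype ι] [Fintype ι'] {C : Set V}
    (hC : IsReducedRootSet C) {b : Basis ι ℂ V} (hb : IsSimpleSystem C b) {b' : Basis ι' ℂ V}
    (hb' : IsSimpleSystem C b') (h : ∀ j, IsNatComb b (b' j)) :
    ∃ ρ : ι ≃ ι', ∀ i, b i = b' (ρ i) := by
  have h' : ∀ i, IsNatComb b' (b i) := by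
    intro i
    refine (hb'.comb _ (hb.mem i)).resolve_right fun hn => hC.zero_notMem ?_
    exact (IsNatComb.self b i).eq_zero (IsNatComb.trans h hn) ▸ hb.mem i
  choose f hf using exists_eq_of_isNatComb hC hb hb' h h'
  choose k hk using exists_eq_of_isNatComb hC hb' hb h' h
  refine ⟨⟨f, k, fun i => b.injective ?_, fun j => b'.injective ?_⟩, fun i => (hf i).symm⟩
  · rw [hk, hf]
  · rw [hf, hk]

theorem IsReducedRootSet.symm_mem {C : Set V} (hC : IsReducedRootSet C) {s : V ≃ₗ[ℂ] V}
    (hs : ∀ v ∈ C, s v ∈ C) {v : V} (hv : v ∈ C) : s.symm v ∈ C := by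
  have : Set.SurjOn s C C :=
    ((hC.finite.injOn_iff_bijOn_of_mapsTo hs).1 s.injective.injOn).surjOn
  obtain ⟨u, hu, rfl⟩ := this hv
  simpa using hu

/-- Any two systems of simple roots are conjugate under the Weyl group. -/
theorem exists_linearEquiv_map_simple {ι ι' : Type*} [Fintype ι] [Fintype ι'] {C : Set V}
    (hC : IsReducedRootSet C) {b : Basis ι ℂ V} (hb : IsSimpleSystem C b) {b' : Basis ι' ℂ V}
    (hb' : IsSimpleSystem C b') :
    ∃ (w : V ≃ₗ[ℂ] V) (ρ : ι ≃ ι'), (∀ v ∈ C, w v ∈ C) ∧ ∀ i, w (b i) = b' (ρ i) := by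
  -- Induction on the number of elements that are positive for `b'` but not for `b`. Reflecting `b'`
  -- in one of its members that is not positive for `b` removes that member from this set and adds
  -- nothing.
  generalize hN : {c ∈ C | IsNatComb b' c ∧ ¬ IsNatComb b c}.ncard = N
  induction N using Nat.strong_induction_on generalizing b' with
  | _ N ih =>
    by_cases hall : ∀ j, IsNatComb b (b' j)
    · obtain ⟨ρ, hρ⟩ := exists_equiv_of_isNatComb hC hb hb' hall
      exact ⟨LinearEquiv.refl ℂ V, ρ, fun v hv => hv, hρ⟩
    push Not at hall
    obtain ⟨j, hj⟩ := hall
    obtain ⟨s, hs, hsj, hsv⟩ := hC.reflection _ (hb'.mem j)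
    have hneg : IsNatComb b (-b' j) := (hb.comb _ (hb'.mem j)).resolve_left hj
    have hmap : ∀ v, IsNatComb (b'.map s) v ↔ IsNatComb b' (s.symm v) := fun v => Iff.rfl
    have hb'' : IsSimpleSystem C (b'.map s) := by
      refine ⟨fun i => by simpa using hs _ (hb'.mem i), fun c hc => ?_⟩
      rw [hmap, hmap, map_neg]
      exact hb'.comb _ (hC.symm_mem hs hc)
    have hlt : {c ∈ C | IsNatComb (b'.map s) c ∧ ¬ IsNatComb b c}.ncard < N := by
      rw [← hN]
      refine Set.ncard_lt_ncard ?_ (hC.finite.subset fun c hc => hc.1)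
      rw [Set.ssubset_iff_of_subset]
      · refine ⟨b' j, ⟨hb'.mem j, IsNatComb.self b' j, hj⟩, fun hcon => ?_⟩
        have h1 := hcon.2.1
        rw [hmap, show s.symm (b' j) = -b' j by rw [LinearEquiv.symm_apply_eq, map_neg, hsj,
          neg_neg]] at h1
        exact hC.zero_notMem ((IsNatComb.self b' j).eq_zero h1 ▸ hb'.mem j)
      · rintro c ⟨hc, hc1, hc2⟩
        rw [hmap] at hc1
        refine ⟨hc, ?_, hc2⟩
        have hu : s.symm c ≠ b' j := by
          intro hu
          rw [LinearEquiv.symm_apply_eq, hsj] at hu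
          exact hc2 (hu ▸ hneg)
        simpa using hb'.reflection hC hs hsv (hC.symm_mem hs hc) hc1 hu
    obtain ⟨w, ρ, hw, hwb⟩ := ih _ hlt hb'' rfl
    refine ⟨w.trans s.symm, ρ, fun v hv => hC.symm_mem hs (hw v hv), fun i => ?_⟩
    simp [hwb]

end SimpleSystems

end LieZeta

namespace LieZeta

set_option autoImplicit false

/-! ### Exponentials of derivations and a local covering argument. -/

section Exponential

open Filter Topology

variable {V : Type*} [NormedAddCommGroup V] [NormedSpace ℂ V] [FiniteDimensional ℂ V]

theorem exp_mul_exp_neg (A : V →L[ℂ] V) : NormedSpace.exp A * NormedSpace.exp (-A) = 1 := by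
  have : CompleteSpace V := FiniteDimensional.complete ℂ V
  let : NormedAlgebra ℚ (V →L[ℂ] V) := NormedAlgebra.restrictScalars ℚ ℂ _
  rw [← NormedSpace.exp_add_of_commute ((Commute.refl A).neg_right)]
  simp

/-- The exponential of a derivation of a bilinear product is multiplicative. -/
theorem exp_derivation_apply (B : V →L[ℂ] V →L[ℂ] V) (A : V →L[ℂ] V)
    (hA : ∀ a b, A (B a b) = B (A a) b + B a (A b)) (a b : V) :
    NormedSpace.exp A (B a b) = B (NormedSpace.exp A a) (NormedSpace.exp A b) := by
  have : CompleteSpace V := FiniteDimensional.complete ℂ V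
  have hE : ∀ (C : V →L[ℂ] V) (t : ℂ),
      HasDerivAt (fun t : ℂ => NormedSpace.exp (t • C)) (NormedSpace.exp (t • C) * C) t := fun C t =>
    hasDerivAt_exp_smul_const C t
  have hcomm : ∀ t : ℂ, NormedSpace.exp (t • A) * A = A * NormedSpace.exp (t • A) := fun t =>
    (((Commute.refl A).smul_left t).exp_left).eq
  have hEv : ∀ (v : V) (t : ℂ), HasDerivAt (fun t : ℂ => NormedSpace.exp (t • A) v)
      (A (NormedSpace.exp (t • A) v)) t := by
    intro v t
    have h := (hE A t).clm_apply (hasDerivAt_const t v)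
    rw [hcomm] at h
    simpa using h
  set ψ : ℂ → V := fun t => B (NormedSpace.exp (t • A) a) (NormedSpace.exp (t • A) b) with hψ
  have hψd : ∀ t, HasDerivAt ψ (A (ψ t)) t := by
    intro t
    have h1 : HasDerivAt (fun t : ℂ => B (NormedSpace.exp (t • A) a))
        (B (A (NormedSpace.exp (t • A) a))) t := B.hasFDerivAt.comp_hasDerivAt t (hEv a t)
    have h := h1.clm_apply (hEv b t)
    rw [hψ]
    simp only [hA]
    exact h
  set χ : ℂ → V := fun t => NormedSpace.exp (t • (-A)) (ψ t) with hχ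
  have hχd : ∀ t, HasDerivAt χ 0 t := by
    intro t
    have h := (hE (-A) t).clm_apply (hψd t)
    have e : (NormedSpace.exp (t • -A) * -A) (ψ t) + NormedSpace.exp (t • -A) (A (ψ t)) = 0 := by
      simp
    rwa [e] at h
  have hconst : χ 1 = χ 0 :=
    is_const_of_deriv_eq_zero (fun t => (hχd t).differentiableAt) (fun t => (hχd t).deriv) 1 0
  have h0 : χ 0 = B a b := by simp [hχ, hψ]
  have h1 : χ 1 = NormedSpace.exp (-A) (B (NormedSpace.exp A a) (NormedSpace.exp A b)) := by
    simp [hχ, hψ]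
  rw [← h0, ← hconst, h1]
  exact DFunLike.congr_fun (exp_mul_exp_neg A) _

/-- Near `h₀` every vector is the image under some `exp (B x)` of an element of `W`, if
`B h₀ V + W = V`. -/
theorem eventually_exists_exp_apply (B : V →L[ℂ] V →L[ℂ] V) (hB : ∀ a b, B a b = -B b a)
    (W : Submodule ℂ V) {h₀ : V} (hh₀ : h₀ ∈ W) (hW : ∀ v, ∃ a, ∃ w ∈ W, v = B h₀ a + w) :
    ∀ᶠ y in 𝓝 h₀, ∃ x, ∃ h ∈ W, NormedSpace.exp (B x) h = y := by
  have : CompleteSpace V := FiniteDimensional.complete ℂ V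
  have : CompleteSpace W := FiniteDimensional.complete ℂ W
  let f : V × W → V := fun p => NormedSpace.exp (B p.1) (p.2 : V)
  have hc : HasStrictFDerivAt (fun p : V × W => NormedSpace.exp (B p.1))
      (B.comp (ContinuousLinearMap.fst ℂ V W)) ((0 : V), (⟨h₀, hh₀⟩ : W)) := by
    have h1 : HasStrictFDerivAt (fun p : V × W => B p.1) (B.comp (ContinuousLinearMap.fst ℂ V W))
        ((0 : V), (⟨h₀, hh₀⟩ : W)) :=
      (B.comp (ContinuousLinearMap.fst ℂ V W)).hasStrictFDerivAt
    have h2 : HasStrictFDerivAt (NormedSpace.exp : (V →L[ℂ] V) → (V →L[ℂ] V))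
        (1 : (V →L[ℂ] V) →L[ℂ] (V →L[ℂ] V)) (B ((0 : V), (⟨h₀, hh₀⟩ : W)).1) := by
      simpa using hasStrictFDerivAt_exp_zero (𝕂 := ℂ) (𝔸 := V →L[ℂ] V)
    exact HasStrictFDerivAt.comp (f := fun p : V × W => B p.1) _ h2 h1
  have hu : HasStrictFDerivAt (fun p : V × W => (p.2 : V))
      (W.subtypeL.comp (ContinuousLinearMap.snd ℂ V W)) ((0 : V), (⟨h₀, hh₀⟩ : W)) :=
    (W.subtypeL.comp (ContinuousLinearMap.snd ℂ V W)).hasStrictFDerivAt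
  have hf := hc.clm_apply hu
  -- The derivative at `(0, h₀)` sends `(a, w)` to `B a h₀ + w`. It is surjective by `hW`, so the
  -- map is open at this point.
  have hsurj := hf.map_nhds_eq_of_surj (by
    rw [LinearMap.range_eq_top]
    intro v
    obtain ⟨a, w, hw, rfl⟩ := hW v
    refine ⟨(-a, ⟨w, hw⟩), ?_⟩
    simp [hB h₀ a, add_comm])
  have hv : NormedSpace.exp (B ((0 : V), (⟨h₀, hh₀⟩ : W)).1) h₀ = h₀ := by simp
  have hy : ∀ᶠ y in 𝓝 h₀, y ∈ Set.range f := by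
    rw [← hv]
    change ∀ᶠ y in 𝓝 (f ((0 : V), (⟨h₀, hh₀⟩ : W))), y ∈ Set.range f
    rw [← hsurj]
    exact Filter.eventually_map.2 (Filter.Eventually.of_forall fun p => ⟨p, rfl⟩)
  filter_upwards [hy]
  rintro y ⟨p, rfl⟩
  exact ⟨p.1, p.2, p.2.2, rfl⟩

end Exponential

/-! ### The covering argument inside a Lie algebra. -/

section LieExponential

open Filter Topology

variable {g : Type*} [LieRing g] [LieAlgebra ℂ g] [FiniteDimensional ℂ g]

/-- If `⁅h₀, g⁆ + W = g` for some `h₀ ∈ W`, then the elements of a complex line through `h₀` which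
are close to `h₀` are conjugate to elements of `W`. -/
theorem eventually_exists_lieEquiv_apply (W : Submodule ℂ g) {h₀ : g} (hh₀ : h₀ ∈ W)
    (hW : LinearMap.range (LieAlgebra.ad ℂ g h₀) ⊔ W = ⊤) (u : g) :
    ∀ᶠ z in 𝓝 (0 : ℂ), ∃ θ : g ≃ₗ⁅ℂ⁆ g, ∃ h ∈ W, θ h = h₀ + z • u := by
  -- Coordinates supply the norm that the exponential series requires.
  let e : g ≃ₗ[ℂ] (Fin (Module.finrank ℂ g) → ℂ) := (Module.finBasis ℂ g).equivFun
  let V := Fin (Module.finrank ℂ g) → ℂ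
  let B₀ : V →ₗ[ℂ] V →ₗ[ℂ] V := LinearMap.mk₂ ℂ (fun a b => e ⁅e.symm a, e.symm b⁆)
    (by simp) (by simp) (by simp) (by simp)
  let B : V →L[ℂ] V →L[ℂ] V := LinearMap.toContinuousLinearMap
    ((LinearMap.toContinuousLinearMap : (V →ₗ[ℂ] V) ≃ₗ[ℂ] (V →L[ℂ] V)).toLinearMap.comp B₀)
  have hBe : ∀ a b, B a b = e ⁅e.symm a, e.symm b⁆ := fun a b => rfl
  have hanti : ∀ a b, B a b = -B b a := fun a b => by
    rw [hBe, hBe, ← lie_skew, map_neg]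
  have hder : ∀ x a b, B x (B a b) = B (B x a) b + B a (B x b) := fun x a b => by
    simp only [hBe, LinearEquiv.symm_apply_apply]
    rw [leibniz_lie, map_add]
  have hev := eventually_exists_exp_apply B hanti (W.map e.toLinearMap) (h₀ := e h₀)
    (Submodule.mem_map_of_mem hh₀) (by
      intro v
      have hv : e.symm v ∈ LinearMap.range (LieAlgebra.ad ℂ g h₀) ⊔ W := hW ▸ Submodule.mem_top
      obtain ⟨_, ⟨a, rfl⟩, w, hw, hvw⟩ := Submodule.mem_sup.1 hv
      refine ⟨e a, e w, Submodule.mem_map_of_mem hw, ?_⟩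
      rw [hBe, LinearEquiv.symm_apply_apply, LinearEquiv.symm_apply_apply, ← map_add]
      rw [LieAlgebra.ad_apply] at hvw
      rw [hvw, LinearEquiv.apply_symm_apply])
  have hline : Tendsto (fun z : ℂ => e h₀ + z • e u) (𝓝 0) (𝓝 (e h₀)) := by
    have : Continuous fun z : ℂ => e h₀ + z • e u := by fun_prop
    simpa using this.tendsto 0
  filter_upwards [hline.eventually hev]
  rintro z ⟨x, _, ⟨h, hh, rfl⟩, hz⟩
  have hinv : ∀ A : V →L[ℂ] V, ∀ v, NormedSpace.exp A (NormedSpace.exp (-A) v) = v := fun A v =>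
    DFunLike.congr_fun (exp_mul_exp_neg A) v
  let T : g →ₗ⁅ℂ⁆ g :=
    { toLinearMap := e.symm.toLinearMap.comp
        ((NormedSpace.exp (B x)).toLinearMap.comp e.toLinearMap)
      map_lie' := by
        intro a b
        have h := exp_derivation_apply B (B x) (hder x) (e a) (e b)
        simp only [hBe, LinearEquiv.symm_apply_apply] at h
        simp [h] }
  have hT : ∀ a, T a = e.symm (NormedSpace.exp (B x) (e a)) := fun a => rfl
  let θ : g ≃ₗ⁅ℂ⁆ g :=
    { T with
      invFun := fun a => e.symm (NormedSpace.exp (-B x) (e a))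
      left_inv := fun a => by
        change e.symm (NormedSpace.exp (-B x) (e (T a))) = a
        rw [hT, LinearEquiv.apply_symm_apply]
        conv_lhs => rw [show B x = -(-B x) by rw [neg_neg]]
        rw [neg_neg (-B x), hinv, LinearEquiv.symm_apply_apply]
      right_inv := fun a => by
        change T (e.symm (NormedSpace.exp (-B x) (e a))) = a
        rw [hT, LinearEquiv.apply_symm_apply, hinv, LinearEquiv.symm_apply_apply] }
  refine ⟨θ, h, hh, ?_⟩
  change T h = _
  rw [hT]
  have hz' : NormedSpace.exp (B x) (e h) = e h₀ + z • e u := hz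
  rw [hz', ← map_smul, ← map_add, LinearEquiv.symm_apply_apply]

end LieExponential

end LieZeta

namespace LieZeta

set_option autoImplicit false

/-! ### Conjugacy of Cartan subalgebras. -/

section Conjugacy

open Filter Topology LieAlgebra

theorem mem_engel_map_iff {g : Type*} [LieRing g] [LieAlgebra ℂ g] (θ : g ≃ₗ⁅ℂ⁆ g) (x y : g) :
    θ y ∈ LieSubalgebra.engel ℂ (θ x) ↔ y ∈ LieSubalgebra.engel ℂ x := by
  have h : ∀ n : ℕ, ((ad ℂ g (θ x)) ^ n) (θ y) = θ (((ad ℂ g x) ^ n) y) := by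
    intro n
    induction n with
    | zero => simp
    | succ n ih => rw [pow_succ', pow_succ', Module.End.mul_apply, ih, Module.End.mul_apply,
        LieAlgebra.ad_apply, LieAlgebra.ad_apply, LieEquiv.map_lie]
  rw [LieSubalgebra.mem_engel_iff, LieSubalgebra.mem_engel_iff]
  refine exists_congr fun n => ?_
  rw [h]
  exact map_eq_zero_iff θ θ.injective

variable {g : Type*} [LieRing g] [LieAlgebra ℂ g] [FiniteDimensional ℂ g]

/-- Regularity is the nonvanishing of one coefficient of the characteristic polynomial of `ad`.
Along the line this is a polynomial in `z`, not identically zero because of `z₁`. -/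
theorem finite_not_isRegular_line (x u : g) {z₁ : ℂ} (h : IsRegular ℂ (x + z₁ • u)) :
    {z : ℂ | ¬ IsRegular ℂ (x + z • u)}.Finite := by
  classical
  let b := Module.finBasis ℂ g
  let p := (LinearMap.polyCharpoly (ad ℂ g : g →ₗ[ℂ] Module.End ℂ g) b).coeff (rank ℂ g)
  let q : Polynomial ℂ := MvPolynomial.aeval
    (fun i => Polynomial.C (b.repr x i) + Polynomial.X * Polynomial.C (b.repr u i)) p
  have hq : ∀ z, q.eval z = MvPolynomial.eval (b.repr (x + z • u)) p := by
    intro z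
    change Polynomial.evalRingHom z (MvPolynomial.aeval _ p) = _
    rw [MvPolynomial.aeval_def, MvPolynomial.hom_eval₂, MvPolynomial.eval,
      MvPolynomial.coe_eval₂Hom]
    congr 1
    · ext c
      simp
    · funext i
      simp
      ring
  have hreg : ∀ z, IsRegular ℂ (x + z • u) ↔ q.eval z ≠ 0 := fun z => by
    rw [hq, isRegular_iff_coeff_polyCharpoly_rank_ne_zero ℂ b]
  have hq0 : q ≠ 0 := by
    intro h0
    exact (hreg z₁).1 h (by simp [h0])
  refine q.roots.toFinset.finite_toSet.subset fun z hz => ?_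
  have hz' : q.eval z = 0 := by
    by_contra hne
    exact hz ((hreg z).2 hne)
  simpa [hq0] using hz'

/-- The Engel subalgebra of a regular element has the least possible dimension, hence is minimal
among Engel subalgebras. Minimality puts it inside the Engel subalgebra of each of its elements,
which makes it nilpotent. -/
theorem isCartanSubalgebra_engel {x : g} (hx : IsRegular ℂ x) :
    (LieSubalgebra.engel ℂ x).IsCartanSubalgebra := by
  refine ⟨?_, LieSubalgebra.normalizer_engel _ _⟩
  apply LieSubalgebra.isNilpotent_of_forall_le_engel
  intro y hy
  set Ex : {LieSubalgebra.engel ℂ z | z ∈ LieSubalgebra.engel ℂ x} :=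
    ⟨LieSubalgebra.engel ℂ x, x, LieSubalgebra.self_mem_engel _ _, rfl⟩
  suffices IsBot Ex from @this ⟨LieSubalgebra.engel ℂ y, y, hy, rfl⟩
  apply engel_isBot_of_isMin (Cardinal.natCast_le_aleph0.trans 
      (Cardinal.infinite_iff.1 inferInstance))
    (LieSubalgebra.engel ℂ x) Ex le_rfl
  rintro ⟨_, y, hy, rfl⟩ hyx
  have hle : Module.finrank ℂ (LieSubalgebra.engel ℂ x)
      ≤ Module.finrank ℂ (LieSubalgebra.engel ℂ y) := by
    rw [(isRegular_iff_finrank_engel_eq_rank ℂ x).mp hx]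
    exact rank_le_finrank_engel ℂ y
  have heq : LieSubalgebra.engel ℂ y = LieSubalgebra.engel ℂ x :=
    LieSubalgebra.toSubmodule_injective (Submodule.eq_of_le_of_finrank_le hyx hle)
  exact heq.ge

theorem isRegular_map_iff (θ : g ≃ₗ⁅ℂ⁆ g) (x : g) :
    IsRegular ℂ (θ x) ↔ IsRegular ℂ x := by
  rw [isRegular_def, isRegular_def, ← LieAlgebra.conj_ad_apply, LinearEquiv.charpoly_conj]

/-- Fitting's decomposition of `ad x`: the nilpotent part is the Engel subalgebra and the other part
lies in the range. -/
theorem range_ad_sup_engel (x : g) :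
    LinearMap.range (ad ℂ g x) ⊔ (LieSubalgebra.engel ℂ x).toSubmodule = ⊤ := by
  have h := (LinearMap.isCompl_iSup_ker_pow_iInf_range_pow (ad ℂ g x)).sup_eq_top
  rw [eq_top_iff, ← h]
  refine sup_le ?_ ?_
  · refine le_sup_of_le_right (iSup_le fun n y hy => ?_)
    exact (LieSubalgebra.mem_engel_iff ℂ x y).2 ⟨n, hy⟩
  · refine le_sup_of_le_left ((iInf_le _ 1).trans ?_)
    rw [pow_one]

variable [LieAlgebra.IsSemisimple ℂ g]

/-- Cartan subalgebras of a semisimple algebra are abelian. So `H` lies in the Engel subalgebra of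
`h`, which is itself Cartan and abelian, hence normalizes `H`; but `H` is its own normalizer. -/
theorem engel_eq_of_isRegular {H : LieSubalgebra ℂ g} [H.IsCartanSubalgebra] {h : g} (hH : h ∈ H)
    (hh : IsRegular ℂ h) : LieSubalgebra.engel ℂ h = H := by
  have hle : H ≤ LieSubalgebra.engel ℂ h := by
    intro y hy
    refine (LieSubalgebra.mem_engel_iff ℂ h y).2 ⟨1, ?_⟩
    have h0 : ⁅(⟨h, hH⟩ : H), (⟨y, hy⟩ : H)⁆ = 0 := trivial_lie_zero H H _ _
    simpa using congrArg (Subtype.val) h0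
  have := isCartanSubalgebra_engel hh
  refine le_antisymm (fun y hy => ?_) hle
  rw [← LieSubalgebra.IsCartanSubalgebra.self_normalizing (H := H),
    LieSubalgebra.mem_normalizer_iff']
  intro z hz
  have h0 : ⁅(⟨z, hle hz⟩ : LieSubalgebra.engel ℂ h), (⟨y, hy⟩ : LieSubalgebra.engel ℂ h)⁆ = 0 :=
    trivial_lie_zero _ _ _ _
  have h1 : ⁅z, y⁆ = 0 := congrArg Subtype.val h0
  rw [h1]
  exact H.zero_mem

/-- Choose `h` on which no root vanishes. Then `ad h` is invertible on every root space, and the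
zero weight space is `H`. -/
theorem exists_range_ad_sup_eq_top (H : LieSubalgebra ℂ g) [H.IsCartanSubalgebra] :
    ∃ h ∈ H, LinearMap.range (ad ℂ g h) ⊔ H.toSubmodule = ⊤ := by
  obtain ⟨h, -, hh⟩ := Module.Dual.exists_forall_mem_ne_zero_of_forall_exists
    (⊤ : Submodule ℂ H) (fun α : H.root => (α : LieModule.Weight ℂ H g).toLinear) (by
      intro α
      by_contra! hcon
      have hα := LieSubalgebra.isNonZero_coe_root α
      exact hα (by ext x; simpa using hcon x trivial))
  refine ⟨h, h.2, ?_⟩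
  have htop := congrArg (fun N : LieSubmodule ℂ H g => N.toSubmodule)
    (LieModule.iSup_genWeightSpace_eq_top' ℂ H g)
  simp only [LieSubmodule.iSup_toSubmodule, LieSubmodule.top_toSubmodule] at htop
  rw [eq_top_iff, ← htop]
  refine iSup_le fun χ => ?_
  by_cases hχ : χ.IsZero
  · refine le_sup_of_le_right fun y hy => ?_
    have e : LieModule.genWeightSpace g (χ : H → ℂ) = rootSpace H (0 : H → ℂ) := by
      rw [hχ]
    rw [e, rootSpace_zero_eq] at hy
    exact hy
  · refine le_sup_of_le_left fun y hy => ?_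
    have hmem : χ ∈ H.root := by simpa using hχ
    have hne : χ h ≠ 0 := hh ⟨χ, hmem⟩
    refine ⟨(χ h)⁻¹ • y, ?_⟩
    have hy' := IsKilling.lie_eq_smul_of_mem_rootSpace (H := H) hy h
    have hy2 : ⁅(h : g), y⁆ = χ h • y := hy'
    rw [LieAlgebra.ad_apply, lie_smul, hy2, smul_smul, inv_mul_cancel₀ hne, one_smul]

/-- On the line from `h₀` to a regular element, all points near `h₀` are conjugate into `H` and only
finitely many points are not regular. A regular point near `h₀` is thus conjugate to an element of
`H`, and automorphisms preserve regularity. -/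
theorem exists_isRegular_mem (H : LieSubalgebra ℂ g) [H.IsCartanSubalgebra] :
    ∃ h ∈ H, IsRegular ℂ h := by
  obtain ⟨h₀, hh₀, hsup⟩ := exists_range_ad_sup_eq_top H
  obtain ⟨x₀, hx₀⟩ := LieAlgebra.exists_isRegular ℂ g
  have hev := eventually_exists_lieEquiv_apply H.toSubmodule hh₀ hsup (x₀ - h₀)
  have hfin := finite_not_isRegular_line h₀ (x₀ - h₀) (z₁ := 1) (by simpa using hx₀)
  obtain ⟨z, hz, hzreg⟩ := ((infinite_of_mem_nhds (0 : ℂ) hev).sdiff hfin).nonempty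
  obtain ⟨θ, h, hh, he⟩ := hz
  refine ⟨h, hh, (isRegular_map_iff θ h).1 ?_⟩
  rw [he]
  simpa using hzreg

/-- Any two Cartan subalgebras of a semisimple complex Lie algebra are conjugate. -/
theorem exists_lieEquiv_map_cartan (H H' : LieSubalgebra ℂ g) [H.IsCartanSubalgebra]
    [H'.IsCartanSubalgebra] : ∃ θ : g ≃ₗ⁅ℂ⁆ g, ∀ y, θ y ∈ H' ↔ y ∈ H := by
  obtain ⟨h, hh, hreg⟩ := exists_isRegular_mem H
  obtain ⟨h', hh', hreg'⟩ := exists_isRegular_mem H'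
  let p : ℂ → g := fun z => h + z • (h' - h)
  let S : Set ℂ := {z | ¬ IsRegular ℂ (p z)}ᶜ
  have hS : ∀ {z}, z ∈ S → IsRegular ℂ (p z) := fun {z} hz => by simpa [S] using hz
  have hfin : {z | ¬ IsRegular ℂ (p z)}.Finite :=
    finite_not_isRegular_line h (h' - h) (z₁ := 0) (by simpa using hreg)
  -- A complex line without finitely many points is connected, so it is enough that the conjugacy
  -- class of the Engel subalgebra is locally constant along it.
  have hconn : IsPreconnected S :=
    (hfin.countable.isConnected_compl_of_one_lt_rank (by
      rw [Complex.rank_real_complex]; norm_num)).isPreconnected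
  have key : ∃ θ : g ≃ₗ⁅ℂ⁆ g, ∀ y, θ y ∈ LieSubalgebra.engel ℂ (p 1)
      ↔ y ∈ LieSubalgebra.engel ℂ (p 0) := by
    refine hconn.induction₂ (fun z w => ∃ θ : g ≃ₗ⁅ℂ⁆ g, ∀ y,
      θ y ∈ LieSubalgebra.engel ℂ (p w) ↔ y ∈ LieSubalgebra.engel ℂ (p z)) ?_ ?_ ?_ ?_ ?_
    · intro z hz
      have hev := eventually_exists_lieEquiv_apply (LieSubalgebra.engel ℂ (p z)).toSubmodule
        (LieSubalgebra.self_mem_engel ℂ (p z)) (range_ad_sup_engel (p z)) (h' - h)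
      have ht : Tendsto (fun w : ℂ => w - z) (𝓝 z) (𝓝 0) := by
        have : Continuous fun w : ℂ => w - z := by fun_prop
        simpa using this.tendsto z
      filter_upwards [nhdsWithin_le_nhds (ht.eventually hev), self_mem_nhdsWithin] with w hw hwS
      obtain ⟨θ, k, hk, he⟩ := hw
      have hpw : p w = θ k := by
        rw [he]
        simp only [p]
        module
      have hkreg : IsRegular ℂ k := (isRegular_map_iff θ k).1 (hpw ▸ hS hwS)
      have := isCartanSubalgebra_engel (hS hz)
      have hek := engel_eq_of_isRegular (H := LieSubalgebra.engel ℂ (p z)) hk hkreg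
      refine ⟨θ, fun y => ?_⟩
      rw [hpw, mem_engel_map_iff, hek]
    · rintro x y z - - - ⟨θ, hθ⟩ ⟨η, hη⟩
      exact ⟨θ.trans η, fun v => by rw [LieEquiv.trans_apply, hη, hθ]⟩
    · rintro x y - - ⟨θ, hθ⟩
      exact ⟨θ.symm, fun v => by rw [← hθ, LieEquiv.apply_symm_apply]⟩
    · simpa [S, p] using hreg
    · simpa [S, p] using hreg'
  have e0 : LieSubalgebra.engel ℂ (p 0) = H := by
    simpa [p] using engel_eq_of_isRegular hh hreg
  have e1 : LieSubalgebra.engel ℂ (p 1) = H' := by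
    simpa [p] using engel_eq_of_isRegular hh' hreg'
  rwa [e0, e1] at key

end Conjugacy

end LieZeta

namespace LieZeta

set_option autoImplicit false

/-! ### Intrinsic description of coroots and invariance of the coefficients. -/

section CorootSets

open Module LieAlgebra

/-- A description of the coroots in terms of `sl₂`-triples, which does not mention roots. -/
def IsCorootOf {g : Type*} [LieRing g] [LieAlgebra ℂ g] (H : LieSubalgebra ℂ g) (h : g) : Prop :=
  h ∈ H ∧ ∃ e f : g, IsSl2Triple h e f ∧
    ∀ y ∈ H, ∃ t : ℂ, ⁅y, e⁆ = t • e ∧ ⁅y, f⁆ = -(t • f)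

theorem IsCorootOf.map {g g' : Type*} [LieRing g] [LieAlgebra ℂ g] [LieRing g'] [LieAlgebra ℂ g']
    (θ : g ≃ₗ⁅ℂ⁆ g') {H : LieSubalgebra ℂ g} {H' : LieSubalgebra ℂ g'}
    (hθ : ∀ y, θ y ∈ H' ↔ y ∈ H) {h : g} (hh : IsCorootOf H h) : IsCorootOf H' (θ h) := by
  obtain ⟨hH, e, f, ht, hw⟩ := hh
  refine ⟨(hθ h).2 hH, θ e, θ f, ⟨?_, ?_, ?_, ?_⟩, fun y hy => ?_⟩
  · exact fun h0 => ht.h_ne_zero ((map_eq_zero_iff θ θ.injective).1 h0)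
  · rw [← LieEquiv.map_lie, ht.lie_e_f]
  · rw [← LieEquiv.map_lie, ht.lie_h_e_nsmul, map_nsmul]
  · rw [← LieEquiv.map_lie, ht.lie_h_f_nsmul, map_neg, map_nsmul]
  · have hy' : θ.symm y ∈ H := by rwa [← hθ, LieEquiv.apply_symm_apply]
    obtain ⟨t, h1, h2⟩ := hw _ hy'
    refine ⟨t, ?_, ?_⟩
    · have := congrArg θ h1
      rwa [LieEquiv.map_lie, LieEquiv.apply_symm_apply, map_smul] at this
    · have := congrArg θ h2
      rwa [LieEquiv.map_lie, LieEquiv.apply_symm_apply, map_neg, map_smul] at this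

theorem isCorootOf_map_iff {g g' : Type*} [LieRing g] [LieAlgebra ℂ g] [LieRing g']
    [LieAlgebra ℂ g'] (θ : g ≃ₗ⁅ℂ⁆ g') {H : LieSubalgebra ℂ g} {H' : LieSubalgebra ℂ g'}
    (hθ : ∀ y, θ y ∈ H' ↔ y ∈ H) (h : g) : IsCorootOf H' (θ h) ↔ IsCorootOf H h := by
  refine ⟨fun hh => ?_, fun hh => hh.map θ hθ⟩
  have := hh.map θ.symm (H' := H) fun y => by rw [← hθ, LieEquiv.apply_symm_apply]
  rwa [LieEquiv.symm_apply_apply] at this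

/-- The subalgebra `H₁ × H₂` of `g₁ × g₂`. -/
def prodSubalgebra {g₁ g₂ : Type*} [LieRing g₁] [LieAlgebra ℂ g₁] [LieRing g₂] [LieAlgebra ℂ g₂]
    (H₁ : LieSubalgebra ℂ g₁) (H₂ : LieSubalgebra ℂ g₂) : LieSubalgebra ℂ (g₁ × g₂) :=
  { H₁.toSubmodule.prod H₂.toSubmodule with
    lie_mem' := fun hx hy => ⟨H₁.lie_mem hx.1 hy.1, H₂.lie_mem hx.2 hy.2⟩ }

/-- If both components of `e` were nonzero, the element `(0, z.2)` would have to act on `e` by a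
single scalar, equal to `0` on the first component and to `2` on the second. -/
theorem isCorootOf_prod_iff {g₁ g₂ : Type*} [LieRing g₁] [LieAlgebra ℂ g₁] [LieRing g₂]
    [LieAlgebra ℂ g₂] {H₁ : LieSubalgebra ℂ g₁} {H₂ : LieSubalgebra ℂ g₂} {z : g₁ × g₂} :
    IsCorootOf (prodSubalgebra H₁ H₂) z ↔
      (IsCorootOf H₁ z.1 ∧ z.2 = 0) ∨ (z.1 = 0 ∧ IsCorootOf H₂ z.2) := by
  constructor
  · rintro ⟨⟨hz1, hz2⟩, ⟨e₁, e₂⟩, ⟨f₁, f₂⟩, ht, hw⟩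
    have hef1 : ⁅e₁, f₁⁆ = z.1 := congrArg Prod.fst ht.lie_e_f
    have hef2 : ⁅e₂, f₂⁆ = z.2 := congrArg Prod.snd ht.lie_e_f
    have he1 : ⁅z.1, e₁⁆ = 2 • e₁ := congrArg Prod.fst ht.lie_h_e_nsmul
    have he2 : ⁅z.2, e₂⁆ = 2 • e₂ := congrArg Prod.snd ht.lie_h_e_nsmul
    have hf1 : ⁅z.1, f₁⁆ = -(2 • f₁) := congrArg Prod.fst ht.lie_h_f_nsmul
    have hf2 : ⁅z.2, f₂⁆ = -(2 • f₂) := congrArg Prod.snd ht.lie_h_f_nsmul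
    have hz0 : ¬ (z.1 = 0 ∧ z.2 = 0) := fun h => ht.h_ne_zero (Prod.ext h.1 h.2)
    by_cases h1 : e₁ = 0
    · have hz : z.1 = 0 := by rw [← hef1, h1, zero_lie]
      refine Or.inr ⟨hz, hz2, e₂, f₂, ⟨fun h => hz0 ⟨hz, h⟩, hef2, he2, hf2⟩, fun y hy => ?_⟩
      obtain ⟨t, a, b⟩ := hw (0, y) ⟨H₁.zero_mem, hy⟩
      exact ⟨t, congrArg Prod.snd a, congrArg Prod.snd b⟩
    · have h2 : e₂ = 0 := by
        obtain ⟨t, a, -⟩ := hw (0, z.2) ⟨H₁.zero_mem, hz2⟩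
        have a1 : ⁅(0 : g₁), e₁⁆ = t • e₁ := congrArg Prod.fst a
        have a2 : ⁅z.2, e₂⁆ = t • e₂ := congrArg Prod.snd a
        rw [zero_lie] at a1
        have ht0 : t = 0 := (smul_eq_zero.1 a1.symm).resolve_right h1
        rw [ht0, zero_smul, he2, ← Nat.cast_smul_eq_nsmul ℂ] at a2
        exact (smul_eq_zero.1 a2).resolve_left (by norm_num)
      have hz : z.2 = 0 := by rw [← hef2, h2, zero_lie]
      refine Or.inl ⟨⟨hz1, e₁, f₁, ⟨fun h => hz0 ⟨h, hz⟩, hef1, he1, hf1⟩, fun y hy => ?_⟩, hz⟩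
      obtain ⟨t, a, b⟩ := hw (y, 0) ⟨hy, H₂.zero_mem⟩
      exact ⟨t, congrArg Prod.fst a, congrArg Prod.fst b⟩
  · rintro (⟨⟨hz1, e, f, ht, hw⟩, hz⟩ | ⟨hz, hz2, e, f, ht, hw⟩)
    · refine ⟨⟨hz1, hz ▸ H₂.zero_mem⟩, (e, 0), (f, 0), ⟨?_, ?_, ?_, ?_⟩, ?_⟩
      · exact fun h => ht.h_ne_zero (congrArg Prod.fst h)
      · exact Prod.ext ht.lie_e_f (by simp [hz])
      · exact Prod.ext ht.lie_h_e_nsmul (by simp)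
      · exact Prod.ext ht.lie_h_f_nsmul (by simp)
      · rintro ⟨y₁, y₂⟩ hy
        obtain ⟨t, a, b⟩ := hw y₁ hy.1
        exact ⟨t, Prod.ext a (by simp), Prod.ext b (by simp)⟩
    · refine ⟨⟨hz ▸ H₁.zero_mem, hz2⟩, (0, e), (0, f), ⟨?_, ?_, ?_, ?_⟩, ?_⟩
      · exact fun h => ht.h_ne_zero (congrArg Prod.snd h)
      · exact Prod.ext (by simp [hz]) ht.lie_e_f
      · exact Prod.ext (by simp) ht.lie_h_e_nsmul
      · exact Prod.ext (by simp) ht.lie_h_f_nsmul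
      · rintro ⟨y₁, y₂⟩ hy
        obtain ⟨t, a, b⟩ := hw y₂ hy.2
        exact ⟨t, Prod.ext (by simp) a, Prod.ext (by simp) b⟩

theorem isCartanSubalgebra_of_abelian {g : Type*} [LieRing g] [LieAlgebra ℂ g]
    (K : LieSubalgebra ℂ g) (hab : ∀ x ∈ K, ∀ y ∈ K, ⁅x, y⁆ = 0)
    (hn : ∀ x, (∀ y ∈ K, ⁅x, y⁆ ∈ K) → x ∈ K) : K.IsCartanSubalgebra := by
  have : IsLieAbelian K := ⟨fun x y => Subtype.ext (hab x x.2 y y.2)⟩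
  refine ⟨inferInstance, le_antisymm (fun x hx => ?_) K.le_normalizer⟩
  exact hn x ((LieSubalgebra.mem_normalizer_iff K x).1 hx)

variable {g : Type*} [LieRing g] [LieAlgebra ℂ g] [FiniteDimensional ℂ g]
  [LieAlgebra.IsSemisimple ℂ g]

theorem lie_eq_zero_of_mem_cartan {H : LieSubalgebra ℂ g} [H.IsCartanSubalgebra] {x y : g}
    (hx : x ∈ H) (hy : y ∈ H) : ⁅x, y⁆ = 0 := by
  have h0 : ⁅(⟨x, hx⟩ : H), (⟨y, hy⟩ : H)⁆ = 0 := trivial_lie_zero H H _ _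
  exact congrArg Subtype.val h0

theorem mem_cartan_of_forall_lie_mem {g : Type*} [LieRing g] [LieAlgebra ℂ g] {H : LieSubalgebra ℂ g} [H.IsCartanSubalgebra] {x : g}
    (hx : ∀ y ∈ H, ⁅x, y⁆ ∈ H) : x ∈ H := by
  rw [← LieSubalgebra.IsCartanSubalgebra.self_normalizing (H := H),
    LieSubalgebra.mem_normalizer_iff]
  exact hx

/-- In a triple as in `IsCorootOf` the vector `e` is a weight vector, and its weight takes the value
`2` at `h`. It is therefore a root, whose coroot is `h`. -/
theorem mem_range_coroot_iff (H : LieSubalgebra ℂ g) [H.IsCartanSubalgebra] (h : H) :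
    h ∈ Set.range (IsKilling.rootSystem H).coroot ↔ IsCorootOf H (h : g) := by
  constructor
  · rintro ⟨α, rfl⟩
    have hα := LieSubalgebra.isNonZero_coe_root α
    obtain ⟨h, e, f, ht, he, hf⟩ := IsKilling.exists_isSl2Triple_of_weight_isNonZero hα
    refine ⟨Subtype.property _, e, f, ?_, fun y hy => ⟨α.1 ⟨y, hy⟩, ?_, ?_⟩⟩
    · rw [ht.h_eq_coroot hα he hf] at ht
      exact ht
    · exact IsKilling.lie_eq_smul_of_mem_rootSpace he ⟨y, hy⟩
    · have := IsKilling.lie_eq_smul_of_mem_rootSpace hf ⟨y, hy⟩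
      rw [Pi.neg_apply, neg_smul] at this
      exact this
  · rintro ⟨-, e, f, ht, hw⟩
    choose χ hχ using fun y : H => hw y y.2
    have he0 : e ≠ 0 := fun h0 => ht.h_ne_zero (by rw [← ht.lie_e_f, h0, zero_lie])
    have he : e ∈ rootSpace H χ := LieModule.weightSpace_le_genWeightSpace g χ
      ((LieModule.mem_weightSpace χ e).2 fun y => (hχ y).1)
    have hf : f ∈ rootSpace H (-χ) := LieModule.weightSpace_le_genWeightSpace g (-χ)
      ((LieModule.mem_weightSpace (-χ) f).2 fun y => by
        rw [Pi.neg_apply, neg_smul]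
        exact (hχ y).2)
    let α : LieModule.Weight ℂ H g := ⟨χ, fun hbot => he0 (by
      have : e ∈ (⊥ : LieSubmodule ℂ H g) := hbot ▸ he
      simpa using this)⟩
    have hα : α.IsNonZero := by
      intro h0
      have h1 : χ h = 0 := congrFun h0 h
      have h2 := (hχ h).1
      rw [h1, zero_smul, ht.lie_h_e_nsmul, ← Nat.cast_smul_eq_nsmul ℂ] at h2
      exact he0 ((smul_eq_zero.1 h2).resolve_left (by norm_num))
    refine ⟨⟨α, by simpa using hα⟩, ?_⟩
    exact Subtype.ext (ht.h_eq_coroot hα he hf).symm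

theorem isReducedRootSet_range_coroot (H : LieSubalgebra ℂ g) [H.IsCartanSubalgebra] :
    IsReducedRootSet (Set.range (IsKilling.rootSystem H).coroot) where
  finite := Set.finite_range _
  zero_notMem := by
    rintro ⟨α, hα⟩
    exact (IsKilling.rootSystem H).flip.ne_zero α hα
  reduced := by
    rintro _ ⟨α, rfl⟩ t ⟨β, hβ⟩
    have hne : (IsKilling.rootSystem H).coroot α ≠ 0 := (IsKilling.rootSystem H).flip.ne_zero α
    have hdep : ¬ LinearIndependent ℂ ![(IsKilling.rootSystem H).flip.root β,
        (IsKilling.rootSystem H).flip.root α] := by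
      intro hli
      have h1 := LinearIndependent.pair_iff.1 hli 1 (-t) (by
        change (1 : ℂ) • (IsKilling.rootSystem H).coroot β
          + (-t) • (IsKilling.rootSystem H).coroot α = 0
        rw [hβ]
        module)
      exact one_ne_zero h1.1
    rcases RootPairing.IsReduced.eq_or_eq_neg β α hdep with h | h
    · left
      have h' : (IsKilling.rootSystem H).coroot β = (IsKilling.rootSystem H).coroot α := h
      rw [hβ] at h'
      have : (t - 1) • (IsKilling.rootSystem H).coroot α = 0 := by rw [sub_smul, h', one_smul, sub_self]
      exact sub_eq_zero.1 ((smul_eq_zero.1 this).resolve_right hne)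
    · right
      have h' : (IsKilling.rootSystem H).coroot β = -(IsKilling.rootSystem H).coroot α := h
      rw [hβ] at h'
      have : (t + 1) • (IsKilling.rootSystem H).coroot α = 0 := by rw [add_smul, h', one_smul, neg_add_cancel]
      exact eq_neg_of_add_eq_zero_left ((smul_eq_zero.1 this).resolve_right hne)
  reflection := by
    rintro _ ⟨α, rfl⟩
    refine ⟨(IsKilling.rootSystem H).coreflection α, ?_,
      RootPairing.coreflection_apply_self _ α, fun v =>
        ⟨-((IsKilling.rootSystem H).root' α v), ?_⟩⟩
    · rintro _ ⟨β, rfl⟩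
      exact ⟨_, RootPairing.coroot_reflectionPerm _ α β⟩
    · rw [RootPairing.coreflection_apply, neg_smul, sub_eq_add_neg]

theorem mem_closure_iff_isNatComb {V : Type*} [AddCommGroup V] [Module ℂ V] {r : ℕ}
    (b : Basis (Fin r) ℂ V) (v : V) :
    v ∈ AddSubmonoid.closure (Set.range b) ↔ IsNatComb b v := by
  constructor
  · intro h
    obtain ⟨f, hf⟩ := exists_nat_repr_of_mem_closure b h
    exact fun k => ⟨f k, hf k⟩
  · intro h
    choose f hf using h
    rw [← b.sum_repr v]
    refine sum_mem fun k _ => ?_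
    rw [hf, Nat.cast_smul_eq_nsmul]
    exact nsmul_mem (AddSubmonoid.subset_closure (Set.mem_range_self k)) _

variable {r : ℕ} (D : NumberedBase g r)

theorem NumberedBase.isSimpleSystem :
    IsSimpleSystem (Set.range (IsKilling.rootSystem D.cartan).coroot) D.corootBasis where
  mem k := ⟨_, (D.corootBasis_apply k).symm⟩
  comb := by
    rintro _ ⟨α, rfl⟩
    rw [← mem_closure_iff_isNatComb, ← mem_closure_iff_isNatComb, D.range_corootBasis]
    exact D.base.coroot_mem_or_neg_mem α

theorem NumberedBase.range_posEquiv :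
    Set.range (fun i => D.coroot (D.posEquiv i))
      = {c ∈ Set.range (IsKilling.rootSystem D.cartan).coroot | IsNatComb D.corootBasis c} := by
  ext v
  constructor
  · rintro ⟨i, rfl⟩
    refine ⟨⟨_, rfl⟩, ?_⟩
    rw [← mem_closure_iff_isNatComb]
    exact D.mem_positiveRoots.1 (D.posEquiv i).2
  · rintro ⟨⟨α, rfl⟩, hα⟩
    rw [← mem_closure_iff_isNatComb] at hα
    exact ⟨D.posEquiv.symm ⟨α, D.mem_positiveRoots.2 hα⟩, by simp⟩

theorem NumberedBase.injective_coroot_posEquiv :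
    Function.Injective (fun i => D.coroot (D.posEquiv i)) := fun _ _ h =>
  D.posEquiv.injective (Subtype.ext ((IsKilling.rootSystem D.cartan).coroot.injective h))

/-- The coefficients of the positive roots with respect to the simple roots are determined by the
root system, up to renumbering. -/
theorem exists_equiv_coeffs {V V' ι ι' κ κ' : Type*} [AddCommGroup V] [Module ℂ V]
    [AddCommGroup V'] [Module ℂ V'] [Fintype ι] [Fintype ι'] {C : Set V} {C' : Set V'}
    (hC : IsReducedRootSet C) {b : Basis ι ℂ V} (hb : IsSimpleSystem C b) {b' : Basis ι' ℂ V'}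
    (hb' : IsSimpleSystem C' b') (φ : V ≃ₗ[ℂ] V') (hφ : ∀ v, φ v ∈ C' ↔ v ∈ C)
    {p : κ → V} (hp : Function.Injective p) (hpr : Set.range p = {c ∈ C | IsNatComb b c})
    {p' : κ' → V'} (hp' : Function.Injective p')
    (hpr' : Set.range p' = {c ∈ C' | IsNatComb b' c}) {c : κ → ι → ℕ} {c' : κ' → ι' → ℕ}
    (hc : ∀ k i, b.repr (p k) i = c k i) (hc' : ∀ k i, b'.repr (p' k) i = c' k i) :
    ∃ (ρ : ι ≃ ι') (σ : κ ≃ κ'), ∀ k i, c' (σ k) (ρ i) = c k i := by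
  have hb'' : IsSimpleSystem C (b'.map φ.symm) := by
    refine ⟨fun i => by rw [← hφ]; simpa using hb'.mem i, fun v hv => ?_⟩
    have := hb'.comb _ ((hφ v).2 hv)
    rw [← map_neg] at this
    exact this
  -- Correcting `φ` by this element yields a map that matches both the root sets and the simple
  -- systems. Coordinates, positivity and coefficients then correspond.
  obtain ⟨w, ρ, hw, hwb⟩ := exists_linearEquiv_map_simple hC hb hb''
  let ψ : V ≃ₗ[ℂ] V' := w.trans φ
  have hψb : ∀ i, ψ (b i) = b' (ρ i) := fun i => by simp [ψ, hwb]
  have hψC : ∀ v, ψ v ∈ C' ↔ v ∈ C := by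
    intro v
    change φ (w v) ∈ C' ↔ _
    rw [hφ]
    exact ⟨fun h => by simpa using hC.symm_mem hw h, hw v⟩
  have hrepr : ∀ v i, b'.repr (ψ v) (ρ i) = b.repr v i := by
    intro v i
    have h : b'.repr.toLinearMap.comp ψ.toLinearMap
        = (Finsupp.domLCongr (R := ℂ) (M := ℂ) ρ).toLinearMap.comp b.repr.toLinearMap :=
      b.ext fun j => by simp [hψb]
    have h' : b'.repr (ψ v) = Finsupp.domLCongr (R := ℂ) ρ (b.repr v) := LinearMap.congr_fun h v
    rw [h']
    simp
  have hnat : ∀ v, IsNatComb b' (ψ v) ↔ IsNatComb b v := by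
    intro v
    constructor
    · intro h i
      obtain ⟨n, hn⟩ := h (ρ i)
      exact ⟨n, by rw [← hrepr, hn]⟩
    · intro h i
      obtain ⟨n, hn⟩ := h (ρ.symm i)
      refine ⟨n, ?_⟩
      rw [← hrepr, Equiv.apply_symm_apply] at hn
      exact hn
  have hex : ∀ k, ∃ k', p' k' = ψ (p k) := by
    intro k
    have h : p k ∈ {c ∈ C | IsNatComb b c} := hpr ▸ ⟨k, rfl⟩
    have h' : ψ (p k) ∈ Set.range p' := hpr' ▸ ⟨(hψC _).2 h.1, (hnat _).2 h.2⟩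
    exact h'
  have hex' : ∀ k', ∃ k, ψ (p k) = p' k' := by
    intro k'
    have h : p' k' ∈ {c ∈ C' | IsNatComb b' c} := hpr' ▸ ⟨k', rfl⟩
    have h' : ψ.symm (p' k') ∈ Set.range p := by
      rw [hpr]
      refine ⟨?_, ?_⟩
      · rw [← hψC, LinearEquiv.apply_symm_apply]
        exact h.1
      · rw [← hnat, LinearEquiv.apply_symm_apply]
        exact h.2
    obtain ⟨k, hk⟩ := h'
    exact ⟨k, by rw [hk, LinearEquiv.apply_symm_apply]⟩
  choose σ hσ using hex
  choose τ hτ using hex'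
  refine ⟨ρ, ⟨σ, τ, fun k => hp (ψ.injective (by rw [hτ, hσ])), fun k' => hp' (by rw [hσ, hτ])⟩,
    fun k i => ?_⟩
  have h := hc' (σ k) (ρ i)
  rw [hσ, hrepr, hc] at h
  exact_mod_cast h.symm

/-- The restriction of an isomorphism of Lie algebras to subalgebras which correspond. -/
def restrictEquiv {g g' : Type*} [LieRing g] [LieAlgebra ℂ g] [LieRing g'] [LieAlgebra ℂ g']
    (θ : g ≃ₗ⁅ℂ⁆ g') {H : LieSubalgebra ℂ g} {H' : LieSubalgebra ℂ g'}
    (hθ : ∀ y, θ y ∈ H' ↔ y ∈ H) : H ≃ₗ[ℂ] H' where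
  toFun v := ⟨θ v, (hθ v).2 v.2⟩
  map_add' _ _ := Subtype.ext (map_add θ _ _)
  map_smul' _ _ := Subtype.ext (map_smul θ _ _)
  invFun v := ⟨θ.symm v, by rw [← hθ, LieEquiv.apply_symm_apply]; exact v.2⟩
  left_inv v := Subtype.ext (θ.symm_apply_apply v)
  right_inv v := Subtype.ext (θ.apply_symm_apply v)

/-- Isomorphic Lie algebras have the same coefficients, up to renumbering. -/
theorem NumberedBase.exists_equiv_coeffs_of_lieEquiv {g' : Type*} [LieRing g'] [LieAlgebra ℂ g']
    [FiniteDimensional ℂ g'] [LieAlgebra.IsSemisimple ℂ g'] {r' : ℕ} (D' : NumberedBase g' r')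
    (e : g' ≃ₗ⁅ℂ⁆ g) : ∃ (ρ : Fin r ≃ Fin r') (σ : Fin D.numPos ≃ Fin D'.numPos),
      ∀ i k, D'.coeffs (σ i) (ρ k) = D.coeffs i k := by
  -- The Cartan subalgebra of `g'`, transported to `g`. An automorphism of `g` then aligns it with
  -- the chosen one.
  let K : LieSubalgebra ℂ g := D'.cartan.comap (e.symm : g →ₗ⁅ℂ⁆ g')
  have hK : ∀ y, y ∈ K ↔ e.symm y ∈ D'.cartan := fun y => Iff.rfl
  have hKc : K.IsCartanSubalgebra := by
    refine isCartanSubalgebra_of_abelian K (fun x hx y hy => ?_) fun x hx => ?_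
    · have h : e.symm ⁅x, y⁆ = 0 := by
        rw [LieEquiv.map_lie]
        exact lie_eq_zero_of_mem_cartan hx hy
      exact (map_eq_zero_iff e.symm e.symm.injective).1 h
    · rw [hK]
      refine mem_cartan_of_forall_lie_mem fun y hy => ?_
      have := hx (e y) (by rwa [hK, LieEquiv.symm_apply_apply])
      rwa [hK, LieEquiv.map_lie, LieEquiv.symm_apply_apply] at this
  obtain ⟨θ, hθ⟩ := exists_lieEquiv_map_cartan D.cartan K
  let η : g ≃ₗ⁅ℂ⁆ g' := θ.trans e.symm
  have hη : ∀ y, η y ∈ D'.cartan ↔ y ∈ D.cartan := fun y => by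
    rw [← hθ, hK]
    rfl
  refine exists_equiv_coeffs (isReducedRootSet_range_coroot D.cartan) D.isSimpleSystem
    D'.isSimpleSystem (restrictEquiv η hη) (fun v => ?_) D.injective_coroot_posEquiv
    D.range_posEquiv D'.injective_coroot_posEquiv D'.range_posEquiv D.repr_coroot D'.repr_coroot
  rw [mem_range_coroot_iff, mem_range_coroot_iff]
  exact isCorootOf_map_iff η hη v

end CorootSets

end LieZeta

namespace LieZeta

set_option autoImplicit false

/-! ### Effect of renumbering forms and variables. -/

section Renumbering

theorem linForm_comp_equiv {r r' : ℕ} (ρ : Fin r ≃ Fin r') (a : Fin r' → ℕ) (x : Fin r' → ℂ) :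
    linForm a x = linForm (a ∘ ρ) (x ∘ ρ) := by
  simp only [linForm, Function.comp_apply]
  exact (ρ.sum_comp fun k => (a k : ℂ) * x k).symm

theorem formTerm_comp_equiv {n n' r r' : ℕ} {c : Fin n → Fin r → ℕ} {c' : Fin n' → Fin r' → ℕ}
    (ρ : Fin r ≃ Fin r') (σ : Fin n ≃ Fin n') (h : ∀ i k, c' (σ i) (ρ k) = c i k) (s : ℂ)
    (x : Fin r' → ℂ) : formTerm c' s x = formTerm c s (x ∘ ρ) := by
  rw [formTerm, formTerm, ← σ.prod_comp]
  refine Finset.prod_congr rfl fun i _ => ?_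
  rw [linForm_comp_equiv ρ, show c' (σ i) ∘ ρ = c i from funext (h i)]

theorem formSum_comp_equiv {n n' r r' : ℕ} {c : Fin n → Fin r → ℕ} {c' : Fin n' → Fin r' → ℕ}
    (ρ : Fin r ≃ Fin r') (σ : Fin n ≃ Fin n') (h : ∀ i k, c' (σ i) (ρ k) = c i k) (s : ℂ)
    (x : Fin r' → ℂ) : formSum c' s x = formSum c s (x ∘ ρ) := by
  rw [formSum, formSum, ← (Equiv.arrowCongr ρ (Equiv.refl ℕ)).tsum_eq]
  refine tsum_congr fun m => ?_
  rw [formTerm_comp_equiv ρ σ h]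
  congr 1
  funext k
  simp

theorem measurePreserving_piCongrLeft_orthant {ι : Type*} [Fintype ι] {r : ℕ} (ρ : ι ≃ Fin r) :
    MeasurePreserving (fun (t : ι → ℝ) k => t (ρ.symm k)) := by
  have h := volume_measurePreserving_piCongrLeft (fun _ : Fin r => ℝ) ρ
  refine (congrArg (fun f => MeasurePreserving f volume volume) ?_).mp h
  funext t k
  have := MeasurableEquiv.piCongrLeft_apply_apply (β := fun _ => ℝ) ρ t (ρ.symm k)
  rwa [Equiv.apply_symm_apply] at this

theorem measurableEmbedding_piCongrLeft {ι : Type*} [Fintype ι] {r : ℕ} (ρ : ι ≃ Fin r) :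
    MeasurableEmbedding (fun (t : ι → ℝ) k => t (ρ.symm k)) := by
  have h := (MeasurableEquiv.piCongrLeft (fun _ : Fin r => ℝ) ρ).measurableEmbedding
  refine (congrArg (fun f => MeasurableEmbedding f) ?_).mp h
  funext t k
  have := MeasurableEquiv.piCongrLeft_apply_apply (β := fun _ => ℝ) ρ t (ρ.symm k)
  rwa [Equiv.apply_symm_apply] at this

theorem formInt_comp_equiv {n n' r r' : ℕ} {c : Fin n → Fin r → ℕ} {c' : Fin n' → Fin r' → ℕ}
    (ρ : Fin r ≃ Fin r') (σ : Fin n ≃ Fin n') (h : ∀ i k, c' (σ i) (ρ k) = c i k) (s : ℂ)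
    (x : Fin r' → ℂ) : formInt c' s x = formInt c s (x ∘ ρ) := by
  rw [formInt, formInt, ← (measurePreserving_piCongrLeft_orthant ρ).setIntegral_preimage_emb
    (measurableEmbedding_piCongrLeft ρ)]
  have hpre : (fun (t : Fin r → ℝ) k => t (ρ.symm k)) ⁻¹' orthant r' = orthant r := by
    ext t
    exact ⟨fun ht k => by simpa using ht (ρ k), fun ht k => ht _⟩
  rw [hpre]
  congr 1
  funext t
  rw [formTerm_comp_equiv ρ σ h]
  congr 1
  funext k
  simp

end Renumbering

/-! ### Zeta functions of direct sums of families. -/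

section Products

variable {n₁ n₂ n r₁ r₂ r : ℕ} {c₁ : Fin n₁ → Fin r₁ → ℕ} {c₂ : Fin n₂ → Fin r₂ → ℕ}
  {c : Fin n → Fin r → ℕ}

/-- The direct sum of two families of linear forms. -/
def sumCoeffs (c₁ : Fin n₁ → Fin r₁ → ℕ) (c₂ : Fin n₂ → Fin r₂ → ℕ) :
    Fin n₁ ⊕ Fin n₂ → Fin r₁ ⊕ Fin r₂ → ℕ :=
  Sum.elim (fun i => Sum.elim (c₁ i) 0) (fun i => Sum.elim 0 (c₂ i))

theorem formTerm_eq_mul (e : Fin r₁ ⊕ Fin r₂ ≃ Fin r) (σ : Fin n ≃ Fin n₁ ⊕ Fin n₂)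
    (h : ∀ i k, sumCoeffs c₁ c₂ (σ i) (e.symm k) = c i k) (s : ℂ) (x : Fin r → ℂ) :
    formTerm c s x = formTerm c₁ s (x ∘ e ∘ Sum.inl) * formTerm c₂ s (x ∘ e ∘ Sum.inr) := by
  have hl : ∀ i, linForm (c i) x = ∑ a, (sumCoeffs c₁ c₂ (σ i) a : ℂ) * x (e a) := by
    intro i
    rw [linForm, ← e.sum_comp]
    refine Finset.sum_congr rfl fun a _ => ?_
    rw [← h, Equiv.symm_apply_apply]
  simp only [formTerm, hl]
  rw [σ.prod_comp (fun j => (∑ a, (sumCoeffs c₁ c₂ j a : ℂ) * x (e a)) ^ (-s)),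
    Fintype.prod_sum_type]
  simp [sumCoeffs, linForm]

theorem formSum_eq_mul (h₁ : IsFormFamily c₁) (h₂ : IsFormFamily c₂)
    (e : Fin r₁ ⊕ Fin r₂ ≃ Fin r) (σ : Fin n ≃ Fin n₁ ⊕ Fin n₂)
    (h : ∀ i k, sumCoeffs c₁ c₂ (σ i) (e.symm k) = c i k) {s : ℂ} (hs₁ : (r₁ : ℝ) < s.re)
    (hs₂ : (r₂ : ℝ) < s.re) {x : Fin r → ℂ} (hx : ∀ k, 0 < (x k).re) :
    formSum c s x = formSum c₁ s (x ∘ e ∘ Sum.inl) * formSum c₂ s (x ∘ e ∘ Sum.inr) := by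
  have s₁ := summable_formTerm h₁ hs₁ (x := x ∘ e ∘ Sum.inl) fun k => hx _
  have s₂ := summable_formTerm h₂ hs₂ (x := x ∘ e ∘ Sum.inr) fun k => hx _
  rw [formSum, formSum, formSum, tsum_mul_tsum_of_summable_norm s₁.norm s₂.norm,
    ← ((Equiv.sumArrowEquivProdArrow _ _ _).symm.trans
      (Equiv.arrowCongr e (Equiv.refl ℕ))).tsum_eq]
  refine tsum_congr fun p => ?_
  rw [formTerm_eq_mul e σ h]
  congr 2 <;> funext k <;> simp [Equiv.sumArrowEquivProdArrow]

/-- No convergence is needed, unlike for the series: the integral of a product of functions of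
separate variables factors unconditionally. -/
theorem formInt_eq_mul (e : Fin r₁ ⊕ Fin r₂ ≃ Fin r) (σ : Fin n ≃ Fin n₁ ⊕ Fin n₂)
    (h : ∀ i k, sumCoeffs c₁ c₂ (σ i) (e.symm k) = c i k) (s : ℂ) (x : Fin r → ℂ) :
    formInt c s x = formInt c₁ s (x ∘ e ∘ Sum.inl) * formInt c₂ s (x ∘ e ∘ Sum.inr) := by
  have hm := (measurePreserving_piCongrLeft_orthant e).comp
    (volume_measurePreserving_sumPiEquivProdPi_symm fun _ : Fin r₁ ⊕ Fin r₂ => ℝ)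
  have he := (measurableEmbedding_piCongrLeft e).comp
    (MeasurableEquiv.sumPiEquivProdPi fun _ : Fin r₁ ⊕ Fin r₂ => ℝ).symm.measurableEmbedding
  rw [formInt, formInt, formInt, ← setIntegral_prod_mul, ← hm.setIntegral_preimage_emb he]
  have hcoe : ∀ (p : (Fin r₁ → ℝ) × (Fin r₂ → ℝ)) a,
      (MeasurableEquiv.sumPiEquivProdPi fun _ : Fin r₁ ⊕ Fin r₂ => ℝ).symm p a
        = Sum.elim p.1 p.2 a := by
    rintro p (k | k) <;> rfl
  have hpre : ((fun (t : Fin r₁ ⊕ Fin r₂ → ℝ) k => t (e.symm k)) ∘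
      (MeasurableEquiv.sumPiEquivProdPi fun _ : Fin r₁ ⊕ Fin r₂ => ℝ).symm) ⁻¹' orthant r
        = orthant r₁ ×ˢ orthant r₂ := by
    ext p
    simp only [Set.mem_preimage, Function.comp_apply, Set.mem_prod]
    constructor
    · intro hp
      refine ⟨fun k => ?_, fun k => ?_⟩
      · have := hp (e (Sum.inl k))
        simp only [hcoe] at this
        simpa using this
      · have := hp (e (Sum.inr k))
        simp only [hcoe] at this
        simpa using this
    · intro hp k
      simp only [hcoe]
      rcases e.symm k with j | j
      · exact hp.1 j
      · exact hp.2 j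
  rw [hpre]
  refine setIntegral_congr_fun ((measurableSet_orthant r₁).prod (measurableSet_orthant r₂))
    fun p _ => ?_
  refine (formTerm_eq_mul e σ h s _).trans ?_
  congr 2 <;> funext k <;> simp [hcoe]

end Products

/-! ### Invariance and multiplicativity of the special values. -/

section SpecialValuesOfProducts

open MvPolynomial Module LieAlgebra

variable {g : Type*} [LieRing g] [LieAlgebra ℂ g] [FiniteDimensional ℂ g]
  [LieAlgebra.IsSemisimple ℂ g] {r : ℕ} (D : NumberedBase g r)

theorem mem_orthant_comp {ι : Type*} {r r' : ℕ} {x : Fin r' → ℝ} (hx : x ∈ orthant r')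
    (f : ι → Fin r') (e : Fin r → ι) : x ∘ f ∘ e ∈ orthant r := fun _ => hx _

/-- The special values of isomorphic Lie algebras agree, up to renumbering the variables. -/
theorem NumberedBase.exists_rename_eq {g' : Type*} [LieRing g'] [LieAlgebra ℂ g']
    [FiniteDimensional ℂ g'] [LieAlgebra.IsSemisimple ℂ g'] {r' : ℕ} (D' : NumberedBase g' r')
    (e : g' ≃ₗ⁅ℂ⁆ g) (ℓ : ℕ) :
    ∃ ρ : Fin r ≃ Fin r', D'.P ℓ = rename ρ (D.P ℓ) ∧ D'.Q ℓ = rename ρ (D.Q ℓ) := by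
  obtain ⟨ρ, σ, h⟩ := D.exists_equiv_coeffs_of_lieEquiv D' e
  obtain rfl : r = r' := Fin.equiv_iff_eq.1 ⟨ρ⟩
  refine ⟨ρ, polynomialOf_eq fun x hx => ?_, polynomialOf_eq fun x hx => ?_⟩
  -- The two series agree for every `s`, so their continuations are the same function.
  · have hz : D'.zeta x = D.zeta (x ∘ ρ) := by
      rw [NumberedBase.zeta, NumberedBase.zeta]
      congr 1
      funext s
      rw [D'.zetaSeries_eq, D.zetaSeries_eq, formSum_comp_equiv ρ σ h]
      rfl
    rw [hz, aeval_rename]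
    exact D.represents_P ℓ (x ∘ ρ) fun k => hx _
  · have hz : D'.intZeta x = D.intZeta (x ∘ ρ) := by
      rw [NumberedBase.intZeta, NumberedBase.intZeta]
      congr 1
      funext s
      rw [D'.zetaIntegral_eq, D.zetaIntegral_eq, formInt_comp_equiv ρ σ h]
      rfl
    rw [hz, aeval_rename]
    exact D.represents_Q ℓ (x ∘ ρ) fun k => hx _

theorem isNatComb_prod_iff {V W : Type*} [AddCommGroup V] [Module ℂ V] [AddCommGroup W]
    [Module ℂ W] {ι κ : Type*} (b : Basis ι ℂ V) (b' : Basis κ ℂ W) (z : V × W) :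
    IsNatComb (b.prod b') z ↔ IsNatComb b z.1 ∧ IsNatComb b' z.2 := by
  refine ⟨fun h => ⟨fun i => ?_, fun i => ?_⟩, fun h => ?_⟩
  · simpa using h (Sum.inl i)
  · simpa using h (Sum.inr i)
  · rintro (i | i)
    · simpa using h.1 i
    · simpa using h.2 i

theorem IsNatComb.zero {V : Type*} [AddCommGroup V] [Module ℂ V] {ι : Type*} (b : Basis ι ℂ V) :
    IsNatComb b 0 := fun i => ⟨0, by simp⟩

theorem IsSimpleSystem.prod {V W : Type*} [AddCommGroup V] [Module ℂ V] [AddCommGroup W]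
    [Module ℂ W] {ι κ : Type*} {C : Set V} {C' : Set W} {b : Basis ι ℂ V} {b' : Basis κ ℂ W}
    (hb : IsSimpleSystem C b) (hb' : IsSimpleSystem C' b') :
    IsSimpleSystem {z : V × W | (z.1 ∈ C ∧ z.2 = 0) ∨ (z.1 = 0 ∧ z.2 ∈ C')} (b.prod b') where
  mem := by
    rintro (i | i)
    · exact Or.inl ⟨by simpa using hb.mem i, by simp⟩
    · exact Or.inr ⟨by simp, by simpa using hb'.mem i⟩
  comb := by
    rintro ⟨v, w⟩ (⟨hv, hw⟩ | ⟨hv, hw⟩)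
    · obtain rfl : w = 0 := hw
      rw [isNatComb_prod_iff, isNatComb_prod_iff]
      simpa [IsNatComb.zero] using hb.comb v hv
    · obtain rfl : v = 0 := hv
      rw [isNatComb_prod_iff, isNatComb_prod_iff]
      simpa [IsNatComb.zero] using hb'.comb w hw

variable {g₂ : Type*} [LieRing g₂] [LieAlgebra ℂ g₂] [FiniteDimensional ℂ g₂]
  [LieAlgebra.IsSemisimple ℂ g₂] {r₂ r₁₂ : ℕ} (D₂ : NumberedBase g₂ r₂)
  (D₁₂ : NumberedBase (g × g₂) r₁₂)

theorem isCartanSubalgebra_prod (H₁ : LieSubalgebra ℂ g) (H₂ : LieSubalgebra ℂ g₂)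
    [H₁.IsCartanSubalgebra] [H₂.IsCartanSubalgebra] :
    (prodSubalgebra H₁ H₂).IsCartanSubalgebra := by
  refine isCartanSubalgebra_of_abelian _ (fun x hx y hy => ?_) fun x hx => ⟨?_, ?_⟩
  · exact Prod.ext (lie_eq_zero_of_mem_cartan hx.1 hy.1) (lie_eq_zero_of_mem_cartan hx.2 hy.2)
  · exact mem_cartan_of_forall_lie_mem fun y hy => (hx (y, 0) ⟨hy, H₂.zero_mem⟩).1
  · exact mem_cartan_of_forall_lie_mem fun y hy => (hx (0, y) ⟨H₁.zero_mem, hy⟩).2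

/-- The positive coroots of a product are those of the factors, up to renumbering. -/
theorem NumberedBase.exists_equiv_coeffs_prod :
    ∃ (ρ : Fin r₁₂ ≃ Fin r ⊕ Fin r₂) (σ : Fin D₁₂.numPos ≃ Fin D.numPos ⊕ Fin D₂.numPos),
      ∀ i k, sumCoeffs D.coeffs D₂.coeffs (σ i) (ρ k) = D₁₂.coeffs i k := by
  have hK := isCartanSubalgebra_prod D.cartan D₂.cartan
  obtain ⟨θ, hθ⟩ := exists_lieEquiv_map_cartan D₁₂.cartan (prodSubalgebra D.cartan D₂.cartan)
  let π : prodSubalgebra D.cartan D₂.cartan ≃ₗ[ℂ] D.cartan × D₂.cartan :=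
    { toFun := fun z => (⟨z.1.1, z.2.1⟩, ⟨z.1.2, z.2.2⟩)
      map_add' := fun _ _ => rfl
      map_smul' := fun _ _ => rfl
      invFun := fun z => ⟨(z.1, z.2), z.1.2, z.2.2⟩
      left_inv := fun _ => rfl
      right_inv := fun _ => rfl }
  refine exists_equiv_coeffs (isReducedRootSet_range_coroot D₁₂.cartan) D₁₂.isSimpleSystem
    (D.isSimpleSystem.prod D₂.isSimpleSystem) ((restrictEquiv θ hθ).trans π) (fun v => ?_)
    D₁₂.injective_coroot_posEquiv D₁₂.range_posEquiv
    (p' := Sum.elim (fun i => (D.coroot (D.posEquiv i), 0)) fun i => (0, D₂.coroot (D₂.posEquiv i)))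
    ?_ ?_ D₁₂.repr_coroot ?_
  · rw [mem_range_coroot_iff, ← isCorootOf_map_iff θ hθ v, isCorootOf_prod_iff, Set.mem_ofPred_eq,
      mem_range_coroot_iff, mem_range_coroot_iff, Subtype.ext_iff, Subtype.ext_iff]
    rfl
  · have hne : ∀ i, D.coroot (D.posEquiv i) ≠ 0 := fun i =>
      (IsKilling.rootSystem D.cartan).flip.ne_zero _
    rintro (i | i) (j | j) h
    · exact congrArg Sum.inl (D.injective_coroot_posEquiv (congrArg Prod.fst h))
    · exact absurd (congrArg Prod.fst h) (hne i)
    · exact absurd (congrArg Prod.fst h).symm (hne j)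
    · exact congrArg Sum.inr (D₂.injective_coroot_posEquiv (congrArg Prod.snd h))
  · have h1 := D.range_posEquiv
    have h2 := D₂.range_posEquiv
    ext ⟨v, w⟩
    have h1' := Set.ext_iff.1 h1 v
    have h2' := Set.ext_iff.1 h2 w
    simp only [Set.mem_range, Set.mem_ofPred_eq] at h1' h2'
    simp only [Set.mem_range, Sum.exists, Sum.elim_inl, Sum.elim_inr, Prod.mk.injEq,
      Set.mem_ofPred_eq, isNatComb_prod_iff]
    rw [exists_and_right, exists_and_left, h1', h2']
    constructor
    · rintro (⟨⟨a, b⟩, rfl⟩ | ⟨rfl, a, b⟩)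
      · exact ⟨Or.inl ⟨a, rfl⟩, b, IsNatComb.zero _⟩
      · exact ⟨Or.inr ⟨rfl, a⟩, IsNatComb.zero _, b⟩
    · rintro ⟨⟨a, rfl⟩ | ⟨rfl, a⟩, b, b'⟩
      · exact Or.inl ⟨⟨a, b⟩, rfl⟩
      · exact Or.inr ⟨rfl, a, b'⟩
  · rintro (i | i) (k | k)
    · simpa [sumCoeffs] using D.repr_coroot i k
    · simp [sumCoeffs]
    · simp [sumCoeffs]
    · simpa [sumCoeffs] using D₂.repr_coroot i k

/-- The special values of a product are the products of the special values. -/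
theorem NumberedBase.exists_eq_mul (ℓ : ℕ) : ∃ e : Fin r ⊕ Fin r₂ ≃ Fin r₁₂,
    D₁₂.P ℓ = rename (e ∘ Sum.inl) (D.P ℓ) * rename (e ∘ Sum.inr) (D₂.P ℓ) ∧
    D₁₂.Q ℓ = rename (e ∘ Sum.inl) (D.Q ℓ) * rename (e ∘ Sum.inr) (D₂.Q ℓ) := by
  obtain ⟨ρ, σ, h⟩ := D.exists_equiv_coeffs_prod D₂ D₁₂
  have h' : ∀ i k, sumCoeffs D.coeffs D₂.coeffs (σ i) (ρ.symm.symm k) = D₁₂.coeffs i k := h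
  refine ⟨ρ.symm, polynomialOf_eq fun x hx => ?_, polynomialOf_eq fun x hx => ?_⟩
  · have hx₁ : x ∘ ρ.symm ∘ Sum.inl ∈ orthant r := mem_orthant_comp hx _ _
    have hx₂ : x ∘ ρ.symm ∘ Sum.inr ∈ orthant r₂ := mem_orthant_comp hx _ _
    have c₁₂ := D₁₂.isMeromorphicContinuation_zeta hx
    have c₁ := D.isMeromorphicContinuation_zeta hx₁
    have c₂ := D₂.isMeromorphicContinuation_zeta hx₂
    rw [map_mul, aeval_rename, aeval_rename]
    have e₁ := D.represents_P ℓ _ hx₁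
    have e₂ := D₂.represents_P ℓ _ hx₂
    refine Eq.trans ?_ (congrArg₂ (· * ·) e₁ e₂)
    -- The sum of the ranks is at least each of the three abscissae of definition, so all three
    -- series represent their continuations to the right of it.
    refine eq_of_eq_on_halfPlane (b := (r : ℝ) + r₂ + r₁₂)
      (f := D₁₂.zeta x) (g := fun s => D.zeta (x ∘ ρ.symm ∘ Sum.inl) s
        * D₂.zeta (x ∘ ρ.symm ∘ Sum.inr) s) (fun s => (c₁₂.1 trivial).meromorphicAt)
      (fun s => (c₁.1 trivial).meromorphicAt.mul (c₂.1 trivial).meromorphicAt) (fun s hs => ?_)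
      (D₁₂.analyticAt_zeta hx ℓ) ((D.analyticAt_zeta hx₁ ℓ).mul (D₂.analyticAt_zeta hx₂ ℓ))
    have p₁ : (0 : ℝ) ≤ r := Nat.cast_nonneg r
    have p₂ : (0 : ℝ) ≤ r₂ := Nat.cast_nonneg r₂
    have p₃ : (0 : ℝ) ≤ r₁₂ := Nat.cast_nonneg r₁₂
    rw [c₁₂.2 s (by linarith), c₁.2 s (by linarith), c₂.2 s (by linarith)]
    simp only [NumberedBase.zetaSeries_eq]
    exact formSum_eq_mul D.isFormFamily D₂.isFormFamily ρ.symm σ h' (by linarith) (by linarith)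
      fun k => by simpa using hx k
  · have hx₁ : x ∘ ρ.symm ∘ Sum.inl ∈ orthant r := mem_orthant_comp hx _ _
    have hx₂ : x ∘ ρ.symm ∘ Sum.inr ∈ orthant r₂ := mem_orthant_comp hx _ _
    have c₁₂ := D₁₂.isMeromorphicContinuation_intZeta hx
    have c₁ := D.isMeromorphicContinuation_intZeta hx₁
    have c₂ := D₂.isMeromorphicContinuation_intZeta hx₂
    rw [map_mul, aeval_rename, aeval_rename]
    have e₁ := D.represents_Q ℓ _ hx₁
    have e₂ := D₂.represents_Q ℓ _ hx₂
    refine Eq.trans ?_ (congrArg₂ (· * ·) e₁ e₂)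
    refine eq_of_eq_on_halfPlane (b := (r : ℝ) + r₂ + r₁₂)
      (f := D₁₂.intZeta x) (g := fun s => D.intZeta (x ∘ ρ.symm ∘ Sum.inl) s
        * D₂.intZeta (x ∘ ρ.symm ∘ Sum.inr) s) (fun s => (c₁₂.1 trivial).meromorphicAt)
      (fun s => (c₁.1 trivial).meromorphicAt.mul (c₂.1 trivial).meromorphicAt) (fun s hs => ?_)
      (D₁₂.analyticAt_intZeta hx ℓ)
      ((D.analyticAt_intZeta hx₁ ℓ).mul (D₂.analyticAt_intZeta hx₂ ℓ))
    have p₁ : (0 : ℝ) ≤ r := Nat.cast_nonneg r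
    have p₂ : (0 : ℝ) ≤ r₂ := Nat.cast_nonneg r₂
    have p₃ : (0 : ℝ) ≤ r₁₂ := Nat.cast_nonneg r₁₂
    rw [c₁₂.2 s (by linarith), c₁.2 s (by linarith), c₂.2 s (by linarith)]
    simp only [NumberedBase.zetaIntegral_eq]
    exact formInt_eq_mul ρ.symm σ h' s _

end SpecialValuesOfProducts

end LieZeta

namespace LieZeta

set_option autoImplicit false

/-! ### Algebras of dimension three have rank one. -/

section RankOne

open Module LieAlgebra

theorem finrank_sl_two : finrank ℂ (SpecialLinear.sl (Fin 2) ℂ) = 3 := by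
  have h := (Matrix.traceLinearMap (Fin 2) ℂ ℂ).finrank_range_add_finrank_ker
  have hs : LinearMap.range (Matrix.traceLinearMap (Fin 2) ℂ ℂ) = ⊤ := by
    rw [LinearMap.range_eq_top]
    intro z
    exact ⟨Matrix.diagonal ![z, 0], by simp [Matrix.trace, Fin.sum_univ_two]⟩
  rw [hs, finrank_top, finrank_self, finrank_matrix] at h
  simp only [Fintype.card_fin, finrank_self] at h
  have e : finrank ℂ (SpecialLinear.sl (Fin 2) ℂ)
      = finrank ℂ (LinearMap.ker (Matrix.traceLinearMap (Fin 2) ℂ ℂ)) := rfl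
  omega

variable {g : Type*} [LieRing g] [LieAlgebra ℂ g] [FiniteDimensional ℂ g]
  [LieAlgebra.IsSemisimple ℂ g] {r : ℕ}

/-- The simple roots and their negatives are `2r` distinct weights with independent nonzero weight
spaces. They are told apart by their coroots, of which the simple ones form a basis. -/
theorem NumberedBase.two_mul_rank_le_finrank (D : NumberedBase g r) : 2 * r ≤ finrank ℂ g := by
  classical
  have hind := LieSubmodule.iSupIndep_toSubmodule.2
    (LieModule.iSupIndep_genWeightSpace' ℂ D.cartan g)
  have := hind.fintypeNeBotOfFiniteDimensional
  have hcard := hind.subtype_ne_bot_le_finrank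
  have hne : ∀ χ : LieModule.Weight ℂ D.cartan g,
      (LieModule.genWeightSpace g (χ : D.cartan → ℂ)).toSubmodule ≠ ⊥ := fun χ => by
    simpa using χ.genWeightSpace_ne_bot
  let f : Fin r ⊕ Fin r → LieModule.Weight ℂ D.cartan g :=
    Sum.elim (fun k => ((D.numbering k : D.cartan.root) : LieModule.Weight ℂ D.cartan g))
      (fun k => -((D.numbering k : D.cartan.root) : LieModule.Weight ℂ D.cartan g))
  have hf : Function.Injective f := by
    have hl : ∀ k, IsKilling.coroot (f (Sum.inl k)) = D.corootBasis k := fun k => by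
      rw [D.corootBasis_apply]
      rfl
    have hr : ∀ k, IsKilling.coroot (f (Sum.inr k)) = -D.corootBasis k := fun k => by
      rw [D.corootBasis_apply]
      exact IsKilling.coroot_neg _
    have hcon : ∀ j k, D.corootBasis j ≠ -D.corootBasis k := by
      intro j k h
      have h1 := congrArg (fun v => D.corootBasis.repr v j) h
      simp only [map_neg, Basis.repr_self, Finsupp.coe_neg, Pi.neg_apply,
        Finsupp.single_eq_same] at h1
      obtain ⟨m, hm⟩ := IsNatComb.self D.corootBasis k j
      rw [Basis.repr_self] at hm
      rw [hm] at h1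
      have h2 : ((m + 1 : ℕ) : ℂ) = 0 := by
        push_cast
        rw [h1]
        ring
      have h3 : m + 1 = 0 := by exact_mod_cast h2
      omega
    rintro (j | j) (k | k) h
    · have h' := congrArg IsKilling.coroot h
      rw [hl, hl] at h'
      exact congrArg Sum.inl (D.corootBasis.injective h')
    · have h' := congrArg IsKilling.coroot h
      rw [hl, hr] at h'
      exact absurd h' (hcon j k)
    · have h' := congrArg IsKilling.coroot h.symm
      rw [hl, hr] at h'
      exact absurd h' (hcon k j)
    · have h' := congrArg IsKilling.coroot h
      rw [hr, hr] at h'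
      exact congrArg Sum.inr (D.corootBasis.injective (neg_injective h'))
  have hle := Fintype.card_le_of_injective (fun a => (⟨f a, hne (f a)⟩ :
    {χ : LieModule.Weight ℂ D.cartan g //
      (LieModule.genWeightSpace g (χ : D.cartan → ℂ)).toSubmodule ≠ ⊥}))
    fun a b hab => hf (congrArg Subtype.val hab)
  rw [Fintype.card_sum, Fintype.card_fin] at hle
  omega

/-- The algebra is spanned by the Cartan subalgebra and the range of `ad h` for one of its elements
`h`; both are zero if the Cartan subalgebra is. -/
theorem NumberedBase.finrank_eq_zero_of_rank_zero (D : NumberedBase g r) (hr : r = 0) : finrank ℂ g = 0 := by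
  have hH : D.cartan.toSubmodule = ⊥ := Submodule.finrank_eq_zero.1 (D.finrank_cartan.trans hr)
  obtain ⟨h, hh, htop⟩ := exists_range_ad_sup_eq_top D.cartan
  have h0 : h = 0 := by
    have : h ∈ D.cartan.toSubmodule := hh
    rw [hH] at this
    simpa using this
  rw [hH, h0, map_zero, LinearMap.range_zero, sup_bot_eq] at htop
  rw [← finrank_top ℂ g, ← htop, finrank_bot]

/-- In rank one every positive coroot is a natural multiple of the simple one, hence equal to it by
reducedness. -/
theorem NumberedBase.numPos_eq_one (D : NumberedBase g r) (hr : r = 1) : D.numPos = 1 := by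
  subst hr
  have hsub : Subsingleton (Fin D.numPos) := by
    have key : ∀ i, D.coroot (D.posEquiv i) = D.corootBasis 0 := by
      intro i
      have e : D.coroot (D.posEquiv i) = (D.coeffs i 0 : ℂ) • D.corootBasis 0 := by
        conv_lhs => rw [← D.corootBasis.sum_repr (D.coroot (D.posEquiv i))]
        rw [Fin.sum_univ_one, D.repr_coroot]
      have hC := isReducedRootSet_range_coroot D.cartan
      rcases hC.reduced _ (D.isSimpleSystem.mem 0) (D.coeffs i 0 : ℂ) (e ▸ ⟨_, rfl⟩) with h | h
      · rw [e, h, one_smul]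
      · have h2 : ((D.coeffs i 0 + 1 : ℕ) : ℂ) = 0 := by
          push_cast
          rw [h]
          ring
        have h3 : D.coeffs i 0 + 1 = 0 := by exact_mod_cast h2
        omega
    exact ⟨fun i j => D.injective_coroot_posEquiv ((key i).trans (key j).symm)⟩
  obtain ⟨i, -⟩ := D.isFormFamily.simple 0
  have := Fin.subsingleton_iff_le_one.1 hsub
  have := i.2
  omega

theorem NumberedBase.rank_eq_one_of_finrank_eq_three (D : NumberedBase g r) (h : finrank ℂ g = 3) : r = 1 := by
  have h1 := D.two_mul_rank_le_finrank
  have h2 := D.finrank_eq_zero_of_rank_zero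
  omega

end RankOne

end LieZeta

/-! ### The theorem, assembled from the properties of the common coefficients. -/

open LieZeta MvPolynomial MeasureTheory in
theorem theorem1 {g : Type*} [LieRing g] [LieAlgebra ℂ g] [FiniteDimensional ℂ g]
    [LieAlgebra.IsSemisimple ℂ g] {r : ℕ} (D : NumberedBase g r) (ℓ : ℕ) :
    -- `r` is the rank
    Module.finrank ℂ D.cartan = r ∧
    -- convergence of the series and of the integral
    (∀ (s : ℂ) (x : Fin r → ℂ), (r : ℝ) < s.re → (∀ k, 0 < (x k).re) →
      Summable (fun m : Fin r → ℕ => D.term s (fun k => (m k : ℂ) + x k)) ∧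
      IntegrableOn (fun t : Fin r → ℝ => D.term s (fun k => (t k : ℂ) + x k)) (orthant r)) ∧
    -- analyticity in `(s, x)`
    AnalyticOnNhd ℂ (fun z : ℂ × (Fin r → ℂ) => D.zetaSeries z.1 z.2)
      {z | (r : ℝ) < z.1.re ∧ ∀ k, 0 < (z.2 k).re} ∧
    AnalyticOnNhd ℂ (fun z : ℂ × (Fin r → ℂ) => D.zetaIntegral z.1 z.2)
      {z | (r : ℝ) < z.1.re ∧ ∀ k, 0 < (z.2 k).re} ∧
    -- meromorphic continuation, regular at `-ℓ`
    (∀ x ∈ orthant r,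
      IsMeromorphicContinuation r (fun s => D.zetaSeries s (fun k => (x k : ℂ))) (D.zeta x) ∧
      AnalyticAt ℂ (D.zeta x) (-ℓ) ∧
      IsMeromorphicContinuation r (fun s => D.zetaIntegral s (fun k => (x k : ℂ))) (D.intZeta x) ∧
      AnalyticAt ℂ (D.intZeta x) (-ℓ)) ∧
    -- the special values are rational polynomials of degree `n ℓ + r`, the second one homogeneous
    Represents (D.P ℓ) (fun x => D.zeta x (-ℓ)) ∧
    Represents (D.Q ℓ) (fun x => D.intZeta x (-ℓ)) ∧
    (D.P ℓ).totalDegree = D.numPos * ℓ + r ∧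
    (D.Q ℓ).totalDegree = D.numPos * ℓ + r ∧
    (D.Q ℓ).IsHomogeneous (D.numPos * ℓ + r) ∧
    -- (0)
    (Nonempty (g ≃ₗ⁅ℂ⁆ LieAlgebra.SpecialLinear.sl (Fin 2) ℂ) →
      r = 1 ∧ ∀ k : Fin r,
        D.P ℓ = C (-1 / ((ℓ : ℚ) + 1)) * Polynomial.aeval (X k) (Polynomial.bernoulli (ℓ + 1)) ∧
        D.Q ℓ = C (-1 / ((ℓ : ℚ) + 1)) * X k ^ (ℓ + 1)) ∧
    -- (i)
    (∀ {g' : Type*} [LieRing g'] [LieAlgebra ℂ g'] [FiniteDimensional ℂ g']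
      [LieAlgebra.IsSemisimple ℂ g'] {r' : ℕ} (D' : NumberedBase g' r'),
      Nonempty (g' ≃ₗ⁅ℂ⁆ g) →
      ∃ ρ : Fin r ≃ Fin r', D'.P ℓ = rename ρ (D.P ℓ) ∧ D'.Q ℓ = rename ρ (D.Q ℓ)) ∧
    -- (ii)
    (∀ {g₂ : Type*} [LieRing g₂] [LieAlgebra ℂ g₂] [FiniteDimensional ℂ g₂]
      [LieAlgebra.IsSemisimple ℂ g₂] {r₂ r₁₂ : ℕ} (D₂ : NumberedBase g₂ r₂)
      (D₁₂ : NumberedBase (g × g₂) r₁₂),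
      ∃ e : Fin r ⊕ Fin r₂ ≃ Fin r₁₂,
        D₁₂.P ℓ = rename (e ∘ Sum.inl) (D.P ℓ) * rename (e ∘ Sum.inr) (D₂.P ℓ) ∧
        D₁₂.Q ℓ = rename (e ∘ Sum.inl) (D.Q ℓ) * rename (e ∘ Sum.inr) (D₂.Q ℓ)) ∧
    -- (iii)
    (diffAll (D.P ℓ) = pderivAll (D.Q ℓ) ∧
      map (algebraMap ℚ ℂ) (diffAll (D.P ℓ)) = (-1) ^ r * D.weylPower ℓ ∧
      ∃ q : MvPolynomial (Fin r) ℤ, D.weylPower ℓ = map (Int.castRingHom ℂ) q) ∧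
    -- (iv)
    reflect (D.P ℓ) = (-1) ^ (D.numPos * ℓ + r) * D.P ℓ ∧
    -- (v)
    (∃ a : (Fin r → ℕ) → ℚ,
      D.Q ℓ = ∑ L ∈ multiIndices r (D.numPos * ℓ + r), C (a L) * ∏ i, X i ^ L i ∧
      D.P ℓ = ∑ L ∈ multiIndices r (D.numPos * ℓ + r),
        C (a L) * ∏ i, Polynomial.aeval (X i) (Polynomial.bernoulli (L i))) ∧
    -- (vi)
    (∀ x : Fin r → ℝ,
      aeval x (D.Q ℓ) = ∫ t in Set.Icc (0 : Fin r → ℝ) 1, aeval (x + t) (D.P ℓ)) := by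
  obtain ⟨a, haP, haQ⟩ := D.exists_coefficients ℓ
  refine ⟨D.finrank_cartan, fun s x hs hx => ?_, ?_, ?_, fun x hx => ?_, D.represents_P ℓ,
    D.represents_Q ℓ, D.totalDegree_P ℓ, D.totalDegree_Q ℓ, ?_, ?_, ?_, ?_,
    ⟨D.diffAll_P_eq_pderivAll_Q ℓ, D.map_diffAll_P ℓ, _, D.weylPower_eq_map ℓ⟩, ?_, ⟨a, ?_, ?_⟩, ?_⟩
  · simp only [D.term_eq]
    exact ⟨summable_formTerm D.isFormFamily hs hx, integrableOn_formTerm D.isFormFamily hs hx⟩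
  · simp only [D.zetaSeries_eq]
    exact analyticOnNhd_formSum D.isFormFamily
  · simp only [D.zetaIntegral_eq]
    exact analyticOnNhd_formInt D.isFormFamily
  · exact ⟨D.isMeromorphicContinuation_zeta hx, D.analyticAt_zeta hx ℓ,
      D.isMeromorphicContinuation_intZeta hx, D.analyticAt_intZeta hx ℓ⟩
  · rw [haQ]
    exact isHomogeneous_powerSum _ _
  · rintro ⟨e⟩
    have hr := D.rank_eq_one_of_finrank_eq_three (e.toLinearEquiv.finrank_eq.trans finrank_sl_two)
    exact ⟨hr, fun k => NumberedBase.special_values_of_rank_one hr (D.numPos_eq_one hr) ℓ k⟩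
  · rintro g' _ _ _ _ r' D' ⟨e⟩
    exact D.exists_rename_eq D' e ℓ
  · intro g₂ _ _ _ _ r₂ r₁₂ D₂ D₁₂
    exact D.exists_eq_mul D₂ D₁₂ ℓ
  · rw [haP, reflect_bernoulliSum]
  · rw [haQ, powerSum]
    simp [sepProd]
  · rw [haP, bernoulliSum]
    rfl
  · rw [haP, haQ]
    exact integral_bernoulliSum _ _
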